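/- **Setting.** Functions on $\mathbb T^2=(\mathbb R/2\pi\mathbb Z)^2$ are written in Fourier series over $k\in\mathbb Z^2$; $\Lambda^s$ has symbol $|k|^s$ ($0$ at $k=0$), $\mathcal R=\nabla\Lambda^{-1}$, $\nabla^\perp=(-\partial_2,\partial_1)$, and $*_t$ is convolution in time. Fix an even $\psi\in C_c^\infty(\mathbb R^2;\mathbb R)$ with $\psi(k)=0$ for $|k|\ge1$, $\psi(k)=1$ for $|k|\le 1/2$, and let $P_{\le\lambda}$ be the multiplier with symbol $\psi(k/\lambda)$. Fix a one-sided mollifier $\psi_0\in C_c^\infty(\mathbb R;[0,\infty))$, $\psi_0=0$ on $(-\infty,0)$, $\int\psi_0=1$, and put $\psi_\epsilon(t)=\epsilon^{-1}\psi_0(t/\epsilon)$. Let $\mathcal R_1^o,\mathcal R_2^o$ be the multipliers with symbols $\frac{25(k_2^2-k_1^2)}{12|k|^2}$ and $\frac{7(k_2^2-k_1^2)}{12|k|^2}+\frac{4k_1k_2}{|k|^2}$ ($0$ at $k=0$), and let $l_1=(\frac35,\frac45)$, $l_2=(1,0)$. Put $\|q\|_X=\|q\|_{L^\infty}+\sum_{j=1}^2\|\mathcal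 R_j^oq\|_{L^\infty}$. For a normed space $E$ of functions on $\mathbb T^2$, a random path $u$ and $p\in[1,\infty)$, $$\|u\|_{L^p_\omega C_{\rm loc}E}^p=\sup_{t\in\mathbb R}\mathbb E\Big[\sup_{s\in[t,t+1]}\|u(s)\|_E^p\Big],\qquad [u]_{L^p_\omega C^\alpha_{\rm loc}E}^p=\sup_{t\in\mathbb R}\mathbb E\Big[\sup_{s\ne s'\in[t,t+1]}\frac{\|u(s)-u(s')\|_E^p}{|s-s'|^{\alpha p}}\Big].$$ Here $C^s_x$ denotes, for real $s\ge0$, the usual Hölder space on $\mathbb T^2$. Let $m\ge1$, $\alpha\in(0,1)$, $\kappa>\frac12$, $0<\varepsilon\le\kappa$, $\gamma<\frac32$, $\nu\in\mathbb R$, $C_0\ge2$. Let $z$ be a random field on a probability space with $z\in L^{2m}_\omega(C_{\rm loc}C^{1+\kappa}_x\cap C^\alpha_{\rm loc}C^{1+\varepsilon}_x)$, and set $$C_z=\|z\|_{L^{2m}_\omega C_{\rm loc}C_x^{1+\kappa}}+[z]_{L^{2m}_\omega C^\alpha_{\rm loc}C_x^{1+\varepsilon}}.$$ Let $(\lambda_n,\mu_n,\ell_n,r_n)\in(0,\infty)^4$,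 $n\ge0$, be control parameters and $z_n=P_{\le\lambda_n}z$. Define $g_{\le0}=0$ and, for $n\ge1$, $g_{\le n}=g_{\le n-1}*_t\psi_{\ell_n}+g_n$, where $$g_n(t,x)=\sum_{j=1}^2a_{j,n}(t,x)\cos(5\lambda_n l_j\cdot x),\qquad a_{j,n}=2\sqrt{\frac{\chi_{\ell_n}}{5\lambda_n}}\,P_{\le\mu_n}\sqrt{C_0+\mathcal R_j^o\frac{q_{\ell_n}}{\chi_{\ell_n}}},$$ $q_{\ell_n}=q_{n-1}*_t\psi_{\ell_n}$ and $\chi_{\ell_n}=\|q_{n-1}\|_X*_t\psi_{\ell_n}+r_{n-1}$. For $n\ge0$ the residual $q_n$ is the spatially mean-free solution of $$\nabla q_n=-\partial_t\mathcal Rg_{\le n}+\nabla^\perp(g_{\le n}+z_n)\,\Lambda(g_{\le n}+z_n)-\nu\Lambda^{\gamma-1}\nabla g_{\le n}$$ modulo spatial constants and fields $\nabla^\perp p$ with $p$ smooth; that is, $q_n=\Delta^{-1}\nabla\cdot$ of the right-hand side. **Proposition.** There is a constant $C_{\rm it}\ge1$, depending only on $\psi,\psi_0,C_0,\alpha,\kappa,\varepsilon,\gamma$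 (in particular not on $N$, the control parameters, $m$, $\nu$ or $z$), such that the following holds for every $N\ge0$. Assume 1. (R1) $\mu_n\le\lambda_n$ and (R2) $\ell_n\le1$ for $1\le n\le N+1$; (R3) $\lambda_n\in\mathbb N$ for $0\le n\le N+1$, $10\le\mu_n$ for $1\le n\le N+1$, and $12\lambda_n\le4\mu_{n+1}$, $48\lambda_n\le\lambda_{n+1}$ for $0\le n\le N$; 2. $\|q_n\|_{L^m_\omega C_{\rm loc}X}\le r_n$ for $0\le n\le N$. Then $$\|q_{N+1}\|_{L^m_\omega C_{\rm loc}X}\le C_{\rm it}\big(\mathfrak E^{\rm miss}_{N+1}+\mathfrak E^{\rm com}_{N+1}+\mathfrak E^{\rm time}_{N+1}+\mathfrak E^{\rm dis}_{N+1}+\mathfrak E^{\rm trans}_{N+1}+\mathfrak E^{\rm sto}_{N+1}\big),$$ where, with $\mathfrak S_{N,\beta}=\sum_{n=1}^N4^{N-n}\ell_n^{-\beta}r_{n-1}^{1/2}$, $$\begin{aligned} \mathfrak E^{\rm miss}_{N+1}&=\Big\{\log\mu_{N+1}\Big(\frac{\lambda_N}{\mu_{N+1}}+\frac{\mu_{N+1}}{\lambda_{N+1}}\Big)^2+\frac{\lambda_N}{\lambda_{N+1}}\Big\}r_N,\\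 \mathfrak E^{\rm com}_{N+1}&=\log(\lambda_{N+1})\lambda_N\ell_{N+1}^\alpha\mathfrak S_{N,\alpha}\mathfrak S_{N,0}+\log(\lambda_{N+1})\lambda_N^{1/2}\big(\ell_{N+1}^\alpha\mathfrak S_{N,\alpha}+\lambda_N^{-\kappa}\mathfrak S_{N,0}\big)C_z+\log(\lambda_{N+1})\big(\ell_{N+1}^\alpha+\lambda_N^{-\kappa}\big)C_z^2,\\ \mathfrak E^{\rm time}_{N+1}&=\log(\lambda_{N+1})\lambda_{N+1}^{-3/2}r_N^{1/2}\ell_{N+1}^{-1},\\ \mathfrak E^{\rm dis}_{N+1}&=\log(\lambda_{N+1})|\nu|\lambda_{N+1}^{\gamma-3/2}r_N^{1/2},\\ \mathfrak E^{\rm trans}_{N+1}&=\log(\lambda_{N+1})\lambda_N^{1/2}\lambda_{N+1}^{-1/2}r_N^{1/2}\mathfrak S_{N,0},\\ \mathfrak E^{\rm sto}_{N+1}&=\log(\lambda_{N+1})\lambda_{N+1}^{-1/2}r_N^{1/2}C_z. \end{aligned}$$ -/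

import Mathlib

open MeasureTheory Filter Topology
open scoped ENNReal

noncomputable section

namespace SQG

/-! ### Functions on the torus

A function on `𝕋² = (ℝ / 2πℤ)²` is a function on `ℝ × ℝ` that is `2π`-periodic in both variables. -/

/-- Real functions of the space variable. -/
abbrev Field : Type := ℝ × ℝ → ℝ

/-- Time-dependent real functions of the space variable, `(t, x) ↦ u t x`. -/
abbrev Path : Type := ℝ → Field

/-- `2π`-periodicity in both variables. -/
def IsPeriodic (f : Field) : Prop :=
  ∀ x : ℝ × ℝ, f (x.1 + 2 * Real.pi, x.2) = f x ∧ f (x.1, x.2 + 2 * Real.pi) = f x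

/-- The Euclidean length of a vector (the norm of `ℝ × ℝ` in Mathlib is the maximum norm). -/
def eucl (x : ℝ × ℝ) : ℝ := Real.sqrt (x.1 ^ 2 + x.2 ^ 2)

/-- The Euclidean length of a frequency. -/
def freqAbs (k : ℤ × ℤ) : ℝ := eucl ((k.1 : ℝ), (k.2 : ℝ))

/-- The character `x ↦ exp (i k · x)`. -/
def character (k : ℤ × ℤ) (x : ℝ × ℝ) : ℂ :=
  Complex.exp (Complex.I * ((k.1 : ℂ) * (x.1 : ℂ) + (k.2 : ℂ) * (x.2 : ℂ)))

/-- The Fourier coefficient `(2π)⁻² ∫_{𝕋²} f(x) exp (-i k · x) dx`. -/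
def fourierCoeff (f : Field) (k : ℤ × ℤ) : ℂ :=
  (1 / (2 * Real.pi) ^ 2 : ℝ) *
    ∫ a in (0 : ℝ)..(2 * Real.pi), ∫ b in (0 : ℝ)..(2 * Real.pi), (f (a, b) : ℂ) * character (-k) (a, b)

/-- The Fourier multiplier with a real symbol `σ`: the operator multiplying the `k`-th Fourier
coefficient by `σ k`.  All symbols below are even, so the sum is real for real `f`.  It is used only
where the sum is finite: `f` is a trigonometric polynomial or `σ` has finite support. -/
def fourierMul (σ : ℤ × ℤ → ℝ) (f : Field) : Field := fun x =>
  (∑' k : ℤ × ℤ, (σ k : ℂ) * fourierCoeff f k * character k x).re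

/-- The mean value over the torus. -/
def mean (f : Field) : ℝ :=
  1 / (2 * Real.pi) ^ 2 * ∫ a in (0 : ℝ)..(2 * Real.pi), ∫ b in (0 : ℝ)..(2 * Real.pi), f (a, b)

/-- The partial derivative in the first variable. -/
def dx₁ (f : Field) : Field := fun x => deriv (fun s => f (s, x.2)) x.1

/-- The partial derivative in the second variable. -/
def dx₂ (f : Field) : Field := fun x => deriv (fun s => f (x.1, s)) x.2

/-- `Λ ^ s` with `Λ = (-Δ) ^ (1/2)`, on the mean-free part: symbol `|k| ^ s`, and `0` at `k = 0`. -/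
def lambdaPow (s : ℝ) : Field → Field :=
  fourierMul fun k => if k = 0 then 0 else freqAbs k ^ s

/-- The inverse Laplacian on the mean-free part: symbol `-|k|⁻²`, and `0` at `k = 0`. -/
def invLaplacian : Field → Field :=
  fourierMul fun k => if k = 0 then 0 else -(freqAbs k ^ 2)⁻¹

/-- The frequency truncation `P_{≤ lam}` with symbol `k ↦ ψ (k / lam)`. -/
def freqTrunc (ψ : ℝ × ℝ → ℝ) (lam : ℝ) : Field → Field :=
  fourierMul fun k => ψ ((k.1 : ℝ) / lam, (k.2 : ℝ) / lam)

/-- The symbols of the Riesz-type transforms `R₁ᵒ` (index `0`) and `R₂ᵒ` (index `1`). -/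
def rieszOSymbol (j : Fin 2) (k : ℤ × ℤ) : ℝ :=
  if k = 0 then 0
  else if j = 0 then 25 * ((k.2 : ℝ) ^ 2 - (k.1 : ℝ) ^ 2) / (12 * freqAbs k ^ 2)
  else 7 * ((k.2 : ℝ) ^ 2 - (k.1 : ℝ) ^ 2) / (12 * freqAbs k ^ 2)
    + 4 * ((k.1 : ℝ) * (k.2 : ℝ)) / freqAbs k ^ 2

/-- The Riesz-type transforms `R_jᵒ`. -/
def rieszO (j : Fin 2) : Field → Field := fourierMul (rieszOSymbol j)

/-- The unit vectors `l₁ = (3/5, 4/5)` and `l₂ = (1, 0)`. -/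
def direction (j : Fin 2) : ℝ × ℝ := if j = 0 then (3 / 5, 4 / 5) else (1, 0)

/-! ### Cut-off and mollifier -/

/-- The profile of the frequency truncation: smooth, `0` for `|k| ≥ 1`, `1` for `|k| ≤ 1/2`, and
even, so that the truncation maps real functions to real functions. -/
structure IsFreqCutoff (ψ : ℝ × ℝ → ℝ) : Prop where
  smooth : ContDiff ℝ (⊤ : ℕ∞) ψ
  eq_zero : ∀ k, 1 ≤ eucl k → ψ k = 0
  eq_one : ∀ k, eucl k ≤ 1 / 2 → ψ k = 1
  even : ∀ k, ψ (-k) = ψ k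

/-- The profile of a one-sided time mollifier (convolution with it looks into the past only). -/
structure IsOneSidedMollifier (ψ₀ : ℝ → ℝ) : Prop where
  smooth : ContDiff ℝ (⊤ : ℕ∞) ψ₀
  compact : HasCompactSupport ψ₀
  nonneg : ∀ t, 0 ≤ ψ₀ t
  one_sided : ∀ t, t < 0 → ψ₀ t = 0
  integral_eq_one : ∫ t, ψ₀ t = 1

/-- The rescaled mollifier `ψ_ε (t) = ε⁻¹ ψ₀ (ε⁻¹ t)`. -/
def rescale (ψ₀ : ℝ → ℝ) (ε : ℝ) (t : ℝ) : ℝ := ε⁻¹ * ψ₀ (ε⁻¹ * t)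

/-- Convolution in time. -/
def timeConv (f ρ : ℝ → ℝ) (s : ℝ) : ℝ := ∫ t, f (s - t) * ρ t

/-- Convolution in time of a time-dependent field, pointwise in space. -/
def timeConvField (u : Path) (ρ : ℝ → ℝ) : Path := fun s x => timeConv (fun t => u t x) ρ s

/-! ### Norms -/

/-- The supremum norm, which is the `L^∞` norm on continuous functions. -/
def supNorm (f : Field) : ℝ≥0∞ := ⨆ x, ‖f x‖ₑ

/-- The norm `‖q‖_X = ‖q‖_{L^∞} + ∑_j ‖R_jᵒ q‖_{L^∞}`. -/
def xNorm (q : Field) : ℝ≥0∞ := supNorm q + ∑ j : Fin 2, supNorm (rieszO j q)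

/-- The mixed partial derivative `∂₁^{k₁} ∂₂^{k₂}`. -/
def multiDeriv (k : ℕ × ℕ) (f : Field) : Field := dx₁^[k.1] (dx₂^[k.2] f)

/-- The `θ`-Hölder seminorm in space. -/
def holderSeminorm (θ : ℝ) (f : Field) : ℝ≥0∞ :=
  ⨆ (x : ℝ × ℝ) (y : ℝ × ℝ) (_ : x ≠ y), ‖f x - f y‖ₑ / ENNReal.ofReal (eucl (x - y) ^ θ)

/-- The norm of `C^s_x`, for real `s ≥ 0`, with `s = n + θ`, `n` an integer and `θ ∈ [0, 1)`. -/
def holderNorm (s : ℝ) (f : Field) : ℝ≥0∞ :=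
  ∑ i ∈ Finset.range (⌊s⌋₊ + 1), ∑ k ∈ Finset.HasAntidiagonal.antidiagonal i, supNorm (multiDeriv k f)
    + ∑ k ∈ Finset.HasAntidiagonal.antidiagonal ⌊s⌋₊, holderSeminorm (s - ⌊s⌋₊) (multiDeriv k f)

/-- The space `C^s_x` of functions on the torus. -/
structure MemHolder (s : ℝ) (f : Field) : Prop where
  periodic : IsPeriodic f
  contDiff : ContDiff ℝ ⌊s⌋₊ f
  norm_lt_top : holderNorm s f < ∞

/-- `‖u‖_{C_t E} = sup_{s ∈ [t, t+1]} ‖u(s)‖_E`. -/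
def normCt (normE : Field → ℝ≥0∞) (t : ℝ) (u : Path) : ℝ≥0∞ :=
  ⨆ s ∈ Set.Icc t (t + 1), normE (u s)

/-- `[u]_{C_t^α E}`, the supremum of `‖u(s) - u(s')‖_E / |s - s'|^α` over `s ≠ s'` in
`[t, t+1]`. -/
def seminormCt (normE : Field → ℝ≥0∞) (α t : ℝ) (u : Path) : ℝ≥0∞ :=
  ⨆ (s ∈ Set.Icc t (t + 1)) (s' ∈ Set.Icc t (t + 1)) (_ : s ≠ s'),
    normE (u s - u s') / ENNReal.ofReal (|s - s'| ^ α)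

/-- `‖u‖_{L^p_ω C_loc E}`. -/
def normLpCloc {Ω : Type*} [MeasurableSpace Ω] (P : Measure Ω) (p : ℝ) (normE : Field → ℝ≥0∞)
    (u : Ω → Path) : ℝ≥0∞ :=
  (⨆ t : ℝ, ∫⁻ ω, normCt normE t (u ω) ^ p ∂P) ^ (1 / p)

/-- `[u]_{L^p_ω C^α_loc E}`. -/
def seminormLpCloc {Ω : Type*} [MeasurableSpace Ω] (P : Measure Ω) (p : ℝ)
    (normE : Field → ℝ≥0∞) (α : ℝ) (u : Ω → Path) : ℝ≥0∞ :=
  (⨆ t : ℝ, ∫⁻ ω, seminormCt normE α t (u ω) ^ p ∂P) ^ (1 / p)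

/-- The random field `z` belongs to
`L^{2m}_ω (C_loc C^{1+κ}_x ∩ C^α_loc C^{1+ε}_x)`, where `ε ≤ κ`.  The paths are
continuous with values in `C^{1+κ}_x`. -/
structure NoiseRegular {Ω : Type*} [MeasurableSpace Ω] (P : Measure Ω) (m α κ ε : ℝ)
    (z : Ω → Path) : Prop where
  measurable : ∀ t x, AEMeasurable (fun ω => z ω t x) P
  mem_kappa : ∀ᵐ ω ∂P, ∀ t, MemHolder (1 + κ) (z ω t)
  continuous_kappa : ∀ᵐ ω ∂P, ∀ t,
    Tendsto (fun s => holderNorm (1 + κ) (z ω s - z ω t)) (𝓝 t) (𝓝 0)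
  norm_lt_top : normLpCloc P (2 * m) (holderNorm (1 + κ)) z < ∞
  seminorm_lt_top : seminormLpCloc P (2 * m) (holderNorm (1 + ε)) α z < ∞

/-- The constant `C_z = ‖z‖_{L^{2m}_ω C_loc C^{1+κ}_x} + [z]_{L^{2m}_ω C^α_loc C^{1+ε}_x}`. -/
def noiseConst {Ω : Type*} [MeasurableSpace Ω] (P : Measure Ω) (m α κ ε : ℝ)
    (z : Ω → Path) : ℝ :=
  (normLpCloc P (2 * m) (holderNorm (1 + κ)) z
    + seminormLpCloc P (2 * m) (holderNorm (1 + ε)) α z).toReal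

/-! ### The residual of an approximate solution -/

/-- `v ≈ w`: the vector fields differ by `∇^⊥ p` for a smooth scalar function `p` on the torus. -/
def PerpEquiv (v w : Field × Field) : Prop :=
  ∃ p : Field, IsPeriodic p ∧ ContDiff ℝ (⊤ : ℕ∞) p ∧
    (∀ x, v.1 x = w.1 x - dx₂ p x) ∧ ∀ x, v.2 x = w.2 x + dx₁ p x

/-- `q` is the mean-free function with `∇ q ≈ F - mean F`. -/
structure IsPotential (q : Field) (F : Field × Field) : Prop where
  periodic : IsPeriodic q
  smooth : ContDiff ℝ (⊤ : ℕ∞) q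
  mean_free : mean q = 0
  grad : PerpEquiv (dx₁ q, dx₂ q) (fun x => F.1 x - mean F.1, fun x => F.2 x - mean F.2)

/-- The inverse gradient `Δ⁻¹ ∇ ·`.  On a trigonometric vector field it is a potential in the sense
of `IsPotential`; see `isPotential_invGrad`. -/
def invGrad (F : Field × Field) : Field := invLaplacian fun x => dx₁ F.1 x + dx₂ F.2 x

/-- Trigonometric polynomials. -/
def IsTrigPoly (f : Field) : Prop :=
  ∃ (S : Finset (ℤ × ℤ)) (a : ℤ × ℤ → ℂ), (∀ k, k ∉ S → a k = 0) ∧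
    ∀ x, (f x : ℂ) = ∑ k ∈ S, a k * character k x

theorem character_mul (k l : ℤ × ℤ) (x : ℝ × ℝ) :
    character k x * character l x = character (k + l) x := by
  simp only [character, ← Complex.exp_add]
  congr 1
  push_cast [Prod.fst_add, Prod.snd_add]
  ring

theorem integral_exp_int (n : ℤ) :
    ∫ a in (0 : ℝ)..(2 * Real.pi), Complex.exp (Complex.I * ((n : ℂ) * (a : ℂ)))
      = if n = 0 then (2 * Real.pi : ℂ) else 0 := by
  split_ifs with h
  · subst h; simp
  · have hc : (Complex.I * (n : ℂ)) ≠ 0 := mul_ne_zero Complex.I_ne_zero (by exact_mod_cast h)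
    have := integral_exp_mul_complex (a := 0) (b := 2 * Real.pi) hc
    simp only [← mul_assoc]
    rw [this]
    have h2 : Complex.exp (Complex.I * n * ((2 * Real.pi : ℝ) : ℂ)) = 1 := by
      rw [← Complex.exp_int_mul_two_pi_mul_I n]
      congr 1
      push_cast
      ring
    rw [h2]
    simp

theorem integral_character (k : ℤ × ℤ) :
    ∫ a in (0 : ℝ)..(2 * Real.pi), ∫ b in (0 : ℝ)..(2 * Real.pi), character k (a, b)
      = if k = 0 then ((2 * Real.pi) ^ 2 : ℂ) else 0 := by
  have h : ∀ a b : ℝ, character k (a, b)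
      = Complex.exp (Complex.I * ((k.1 : ℂ) * (a : ℂ)))
        * Complex.exp (Complex.I * ((k.2 : ℂ) * (b : ℂ))) := by
    intro a b
    simp only [character, ← Complex.exp_add]
    congr 1
    ring
  simp only [h, intervalIntegral.integral_const_mul, intervalIntegral.integral_mul_const,
    integral_exp_int]
  rcases k with ⟨k₁, k₂⟩
  by_cases h1 : k₁ = 0 <;> by_cases h2 : k₂ = 0 <;> simp [h1, h2, pow_two]

theorem continuous_character (k : ℤ × ℤ) : Continuous (character k) := by
  unfold character
  fun_prop

theorem fourierCoeff_of_sum {f : Field} {S : Finset (ℤ × ℤ)} {a : ℤ × ℤ → ℂ}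
    (hS : ∀ k, k ∉ S → a k = 0) (hf : ∀ x, (f x : ℂ) = ∑ k ∈ S, a k * character k x)
    (l : ℤ × ℤ) : fourierCoeff f l = a l := by
  have hpi : (Real.pi : ℂ) ≠ 0 := by exact_mod_cast Real.pi_ne_zero
  have hc : ∀ k : ℤ × ℤ, Continuous fun p : ℝ × ℝ => a k * character (k + -l) p := fun k =>
    continuous_const.mul (continuous_character _)
  have h1 : ∀ s t : ℝ, (f (s, t) : ℂ) * character (-l) (s, t)
      = ∑ k ∈ S, a k * character (k + -l) (s, t) := by
    intro s t
    rw [hf, Finset.sum_mul]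
    refine Finset.sum_congr rfl fun k _ => ?_
    rw [mul_assoc, character_mul]
  have h2 : ∀ s : ℝ, (∫ t in (0 : ℝ)..(2 * Real.pi), ∑ k ∈ S, a k * character (k + -l) (s, t))
      = ∑ k ∈ S, a k * ∫ t in (0 : ℝ)..(2 * Real.pi), character (k + -l) (s, t) := by
    intro s
    rw [intervalIntegral.integral_finsetSum]
    · simp only [intervalIntegral.integral_const_mul]
    · intro k _
      exact ((hc k).comp (by fun_prop : Continuous fun t : ℝ => (s, t))).intervalIntegrable _ _
  unfold fourierCoeff
  simp only [h1, h2]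
  rw [intervalIntegral.integral_finsetSum]
  · simp only [intervalIntegral.integral_const_mul, integral_character]
    by_cases hl : l ∈ S
    · rw [Finset.sum_eq_single l]
      · simp
        field_simp
      · intro k _ hk
        have : k + -l ≠ 0 := by
          intro h
          exact hk (by rwa [← sub_eq_add_neg, sub_eq_zero] at h)
        simp [this]
      · exact fun h => absurd hl h
    · rw [hS l hl, Finset.sum_eq_zero]
      · simp
      · intro k hk
        have : k + -l ≠ 0 := by
          intro h
          rw [← sub_eq_add_neg, sub_eq_zero] at h
          exact hl (h ▸ hk)
        simp [this]
  · intro k _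
    refine Continuous.intervalIntegrable ?_ _ _
    refine continuous_const.mul ?_
    exact intervalIntegral.continuous_parametric_intervalIntegral_of_continuous'
      (by exact (continuous_character _)) _ _

theorem fourierMul_of_sum {f : Field} {S : Finset (ℤ × ℤ)} {a : ℤ × ℤ → ℂ}
    (hS : ∀ k, k ∉ S → a k = 0) (hf : ∀ x, (f x : ℂ) = ∑ k ∈ S, a k * character k x)
    (σ : ℤ × ℤ → ℝ) (x : ℝ × ℝ) :
    fourierMul σ f x = (∑ k ∈ S, (σ k : ℂ) * a k * character k x).re := by
  unfold fourierMul
  simp only [fourierCoeff_of_sum hS hf]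
  rw [tsum_eq_sum]
  intro k hk
  simp [hS k hk]

theorem hasDerivAt_character_fst (k : ℤ × ℤ) (x : ℝ × ℝ) :
    HasDerivAt (fun s : ℝ => character k (s, x.2)) (Complex.I * k.1 * character k x) x.1 := by
  have h : HasDerivAt (fun s : ℝ => Complex.I * ((k.1 : ℂ) * (s : ℂ) + (k.2 : ℂ) * (x.2 : ℂ)))
      (Complex.I * ((k.1 : ℂ) * 1)) x.1 :=
    (((Complex.ofRealCLM.hasDerivAt (x := x.1)).const_mul (k.1 : ℂ)).add_const _).const_mul _
  refine h.cexp.congr_deriv ?_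
  change _ = _ * Complex.exp _
  ring

theorem hasDerivAt_character_snd (k : ℤ × ℤ) (x : ℝ × ℝ) :
    HasDerivAt (fun s : ℝ => character k (x.1, s)) (Complex.I * k.2 * character k x) x.2 := by
  have h : HasDerivAt (fun s : ℝ => Complex.I * ((k.1 : ℂ) * (x.1 : ℂ) + (k.2 : ℂ) * (s : ℂ)))
      (Complex.I * ((k.2 : ℂ) * 1)) x.2 :=
    (((Complex.ofRealCLM.hasDerivAt (x := x.2)).const_mul (k.2 : ℂ)).const_add _).const_mul _
  refine h.cexp.congr_deriv ?_
  change _ = _ * Complex.exp _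
  ring

theorem hasDerivAt_sum_fst (S : Finset (ℤ × ℤ)) (a : ℤ × ℤ → ℂ) (x : ℝ × ℝ) :
    HasDerivAt (fun s : ℝ => ∑ k ∈ S, a k * character k (s, x.2))
      (∑ k ∈ S, Complex.I * k.1 * a k * character k x) x.1 := by
  have := HasDerivAt.fun_sum (u := S) fun k _ => (hasDerivAt_character_fst k x).const_mul (a k)
  exact this.congr_deriv (Finset.sum_congr rfl fun k _ => by ring)

theorem hasDerivAt_sum_snd (S : Finset (ℤ × ℤ)) (a : ℤ × ℤ → ℂ) (x : ℝ × ℝ) :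
    HasDerivAt (fun s : ℝ => ∑ k ∈ S, a k * character k (x.1, s))
      (∑ k ∈ S, Complex.I * k.2 * a k * character k x) x.2 := by
  have := HasDerivAt.fun_sum (u := S) fun k _ => (hasDerivAt_character_snd k x).const_mul (a k)
  exact this.congr_deriv (Finset.sum_congr rfl fun k _ => by ring)

theorem hasDerivAt_re {u : ℝ → ℂ} {u' : ℂ} {t : ℝ} (h : HasDerivAt u u' t) :
    HasDerivAt (fun s => (u s).re) u'.re t :=
  (Complex.reCLM.hasFDerivAt.comp_hasDerivAt t h)

theorem dx₁_re_sum (S : Finset (ℤ × ℤ)) (a : ℤ × ℤ → ℂ) (x : ℝ × ℝ) :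
    dx₁ (fun y => (∑ k ∈ S, a k * character k y).re) x
      = (∑ k ∈ S, Complex.I * k.1 * a k * character k x).re :=
  (hasDerivAt_re (hasDerivAt_sum_fst S a x)).deriv

theorem dx₂_re_sum (S : Finset (ℤ × ℤ)) (a : ℤ × ℤ → ℂ) (x : ℝ × ℝ) :
    dx₂ (fun y => (∑ k ∈ S, a k * character k y).re) x
      = (∑ k ∈ S, Complex.I * k.2 * a k * character k x).re :=
  (hasDerivAt_re (hasDerivAt_sum_snd S a x)).deriv

theorem dx₁_of_sum {f : Field} {S : Finset (ℤ × ℤ)} {a : ℤ × ℤ → ℂ}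
    (hf : ∀ x, (f x : ℂ) = ∑ k ∈ S, a k * character k x) (x : ℝ × ℝ) :
    (dx₁ f x : ℂ) = ∑ k ∈ S, Complex.I * k.1 * a k * character k x := by
  have h := hasDerivAt_sum_fst S a x
  simp only [← hf] at h
  have h' := hasDerivAt_re h
  simp only [Complex.ofReal_re] at h'
  have e : dx₁ f x = (∑ k ∈ S, Complex.I * k.1 * a k * character k x).re := h'.deriv
  rw [e]
  exact (h'.ofReal_comp).unique h

theorem dx₂_of_sum {f : Field} {S : Finset (ℤ × ℤ)} {a : ℤ × ℤ → ℂ}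
    (hf : ∀ x, (f x : ℂ) = ∑ k ∈ S, a k * character k x) (x : ℝ × ℝ) :
    (dx₂ f x : ℂ) = ∑ k ∈ S, Complex.I * k.2 * a k * character k x := by
  have h := hasDerivAt_sum_snd S a x
  simp only [← hf] at h
  have h' := hasDerivAt_re h
  simp only [Complex.ofReal_re] at h'
  have e : dx₂ f x = (∑ k ∈ S, Complex.I * k.2 * a k * character k x).re := h'.deriv
  rw [e]
  exact (h'.ofReal_comp).unique h

theorem mean_eq_fourierCoeff (f : Field) : (mean f : ℂ) = fourierCoeff f 0 := by
  have h : ∀ a b : ℝ, character (-0) (a, b) = 1 := by intro a b; simp [character]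
  simp only [mean, fourierCoeff, h, mul_one, intervalIntegral.integral_ofReal]
  push_cast
  rfl

theorem mean_re_sum (S : Finset (ℤ × ℤ)) (a : ℤ × ℤ → ℂ) (h0 : a 0 = 0) :
    mean (fun y => (∑ k ∈ S, a k * character k y).re) = 0 := by
  have hc : Continuous fun p : ℝ × ℝ => ∑ k ∈ S, a k * character k p :=
    continuous_finsetSum _ fun k _ => continuous_const.mul (continuous_character k)
  have e1 : ∀ s : ℝ, (∫ t in (0 : ℝ)..(2 * Real.pi), (∑ k ∈ S, a k * character k (s, t)).re)
      = (∫ t in (0 : ℝ)..(2 * Real.pi), ∑ k ∈ S, a k * character k (s, t)).re := by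
    intro s
    exact Complex.reCLM.intervalIntegral_comp_comm
      ((hc.comp (by fun_prop : Continuous fun t : ℝ => (s, t))).intervalIntegrable _ _)
  have hc2 : Continuous fun s : ℝ =>
      ∫ t in (0 : ℝ)..(2 * Real.pi), ∑ k ∈ S, a k * character k (s, t) :=
    intervalIntegral.continuous_parametric_intervalIntegral_of_continuous' (by exact hc) _ _
  have e2 := Complex.reCLM.intervalIntegral_comp_comm (hc2.intervalIntegrable 0 (2 * Real.pi)
    (μ := volume))
  simp only [Complex.reCLM_apply] at e2
  unfold mean
  simp only [e1]
  rw [e2]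
  have e3 : ∀ s : ℝ, (∫ t in (0 : ℝ)..(2 * Real.pi), ∑ k ∈ S, a k * character k (s, t))
      = ∑ k ∈ S, a k * ∫ t in (0 : ℝ)..(2 * Real.pi), character k (s, t) := by
    intro s
    rw [intervalIntegral.integral_finsetSum]
    · simp only [intervalIntegral.integral_const_mul]
    · intro k _
      exact ((continuous_const.mul (continuous_character k)).comp
        (by fun_prop : Continuous fun t : ℝ => (s, t))).intervalIntegrable _ _
  simp only [e3]
  rw [intervalIntegral.integral_finsetSum]
  · simp only [intervalIntegral.integral_const_mul, integral_character]
    rw [Finset.sum_eq_zero]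
    · simp
    · intro k _
      by_cases hk : k = 0
      · simp [hk, h0]
      · simp [hk]
  · intro k _
    refine Continuous.intervalIntegrable ?_ _ _
    refine continuous_const.mul ?_
    exact intervalIntegral.continuous_parametric_intervalIntegral_of_continuous'
      (by exact (continuous_character _)) _ _

theorem contDiff_re_sum (S : Finset (ℤ × ℤ)) (a : ℤ × ℤ → ℂ) :
    ContDiff ℝ (⊤ : ℕ∞) fun y : ℝ × ℝ => (∑ k ∈ S, a k * character k y).re := by
  refine Complex.reCLM.contDiff.comp (ContDiff.sum fun k _ => contDiff_const.mul ?_)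
  unfold character
  refine ContDiff.cexp (contDiff_const.mul ?_)
  exact (contDiff_const.mul (Complex.ofRealCLM.contDiff.comp contDiff_fst)).add
    (contDiff_const.mul (Complex.ofRealCLM.contDiff.comp contDiff_snd))

theorem isPeriodic_re_sum (S : Finset (ℤ × ℤ)) (a : ℤ × ℤ → ℂ) :
    IsPeriodic fun y : ℝ × ℝ => (∑ k ∈ S, a k * character k y).re := by
  have h1 : ∀ (k : ℤ × ℤ) (x : ℝ × ℝ), character k (x.1 + 2 * Real.pi, x.2) = character k x := by
    intro k x
    unfold character
    rw [← mul_one (Complex.exp (Complex.I * (k.1 * (x.1 : ℂ) + k.2 * (x.2 : ℂ)))),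
      ← Complex.exp_int_mul_two_pi_mul_I k.1, ← Complex.exp_add]
    congr 1
    push_cast
    ring
  have h2 : ∀ (k : ℤ × ℤ) (x : ℝ × ℝ), character k (x.1, x.2 + 2 * Real.pi) = character k x := by
    intro k x
    unfold character
    rw [← mul_one (Complex.exp (Complex.I * (k.1 * (x.1 : ℂ) + k.2 * (x.2 : ℂ)))),
      ← Complex.exp_int_mul_two_pi_mul_I k.2, ← Complex.exp_add]
    congr 1
    push_cast
    ring
  intro x
  simp only [h1, h2, and_self]

/-- On trigonometric vector fields `Δ⁻¹ ∇ ·` inverts the gradient up to `∇^⊥ p`. -/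
theorem isPotential_invGrad {F : Field × Field} (h₁ : IsTrigPoly F.1) (h₂ : IsTrigPoly F.2) :
    IsPotential (invGrad F) F := by
  classical
  obtain ⟨S₁, a₁, hS₁, hf₁⟩ := h₁
  obtain ⟨S₂, a₂, hS₂, hf₂⟩ := h₂
  set S := S₁ ∪ S₂ with hS
  have k₁ : ∀ k, k ∉ S → a₁ k = 0 := fun k hk => hS₁ k fun h => hk (Finset.mem_union_left _ h)
  have k₂ : ∀ k, k ∉ S → a₂ k = 0 := fun k hk => hS₂ k fun h => hk (Finset.mem_union_right _ h)
  have f₁ : ∀ x, (F.1 x : ℂ) = ∑ k ∈ S, a₁ k * character k x := by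
    intro x
    rw [hf₁]
    exact Finset.sum_subset Finset.subset_union_left fun k _ hk => by simp [hS₁ k hk]
  have f₂ : ∀ x, (F.2 x : ℂ) = ∑ k ∈ S, a₂ k * character k x := by
    intro x
    rw [hf₂]
    exact Finset.sum_subset Finset.subset_union_right fun k _ hk => by simp [hS₂ k hk]
  let σ : ℤ × ℤ → ℝ := fun k => if k = 0 then 0 else -(freqAbs k ^ 2)⁻¹
  let d : ℤ × ℤ → ℂ := fun k => Complex.I * k.1 * a₁ k + Complex.I * k.2 * a₂ k
  let e : ℤ × ℤ → ℂ := fun k => Complex.I * k.2 * a₁ k - Complex.I * k.1 * a₂ k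
  have hd : ∀ x, ((dx₁ F.1 x + dx₂ F.2 x : ℝ) : ℂ) = ∑ k ∈ S, d k * character k x := by
    intro x
    push_cast
    rw [dx₁_of_sum f₁, dx₂_of_sum f₂, ← Finset.sum_add_distrib]
    exact Finset.sum_congr rfl fun k _ => by simp only [d]; ring
  have he : ∀ x, ((dx₂ F.1 x - dx₁ F.2 x : ℝ) : ℂ) = ∑ k ∈ S, e k * character k x := by
    intro x
    push_cast
    rw [dx₂_of_sum f₁, dx₁_of_sum f₂, ← Finset.sum_sub_distrib]
    exact Finset.sum_congr rfl fun k _ => by simp only [e]; ring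
  have hq : invGrad F = fun x => (∑ k ∈ S, ((σ k : ℂ) * d k) * character k x).re := by
    funext x
    exact fourierMul_of_sum (fun k hk => by simp [d, k₁ k hk, k₂ k hk]) hd σ x
  have hσ : ∀ k : ℤ × ℤ, k ≠ 0 → (σ k : ℂ) * ((k.1 : ℂ) ^ 2 + (k.2 : ℂ) ^ 2) = -1 := by
    intro k hk
    have hpos : (k.1 : ℝ) ^ 2 + (k.2 : ℝ) ^ 2 ≠ 0 := by
      intro h
      apply hk
      have h1 : (k.1 : ℝ) = 0 := by nlinarith [sq_nonneg (k.1 : ℝ), sq_nonneg (k.2 : ℝ)]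
      have h2 : (k.2 : ℝ) = 0 := by nlinarith [sq_nonneg (k.1 : ℝ), sq_nonneg (k.2 : ℝ)]
      exact Prod.ext (by exact_mod_cast h1) (by exact_mod_cast h2)
    have hr : σ k * ((k.1 : ℝ) ^ 2 + (k.2 : ℝ) ^ 2) = -1 := by
      simp only [σ, if_neg hk, freqAbs, eucl]
      rw [Real.sq_sqrt (by positivity)]
      field_simp
    exact_mod_cast hr
  have hm₁ : (mean F.1 : ℂ) = a₁ 0 := by
    rw [mean_eq_fourierCoeff, fourierCoeff_of_sum k₁ f₁]
  have hm₂ : (mean F.2 : ℂ) = a₂ 0 := by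
    rw [mean_eq_fourierCoeff, fourierCoeff_of_sum k₂ f₂]
  have split : ∀ (a : ℤ × ℤ → ℂ), (∀ k, k ∉ S → a k = 0) → ∀ x,
      a 0 = ∑ k ∈ S, (if k = 0 then a 0 else 0) * character k x := by
    intro a ha x
    by_cases h0 : (0 : ℤ × ℤ) ∈ S
    · rw [Finset.sum_eq_single 0]
      · simp [character]
      · intro k _ hk; simp [hk]
      · exact fun h => absurd h0 h
    · rw [Finset.sum_eq_zero, ha 0 h0]
      intro k hk
      have hk0 : k ≠ 0 := by
        rintro rfl
        exact h0 hk
      simp [hk0]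
  refine ⟨?_, ?_, ?_, ?_⟩
  · rw [hq]; exact isPeriodic_re_sum S _
  · rw [hq]; exact contDiff_re_sum S _
  · rw [hq]; exact mean_re_sum S _ (by simp [σ])
  · refine ⟨fun x => (∑ k ∈ S, ((σ k : ℂ) * e k) * character k x).re, isPeriodic_re_sum S _,
      contDiff_re_sum S _, fun x => ?_, fun x => ?_⟩
    · have key : ∑ k ∈ S, Complex.I * k.1 * ((σ k : ℂ) * d k) * character k x
          = ((F.1 x - mean F.1 : ℝ) : ℂ)
            - ∑ k ∈ S, Complex.I * k.2 * ((σ k : ℂ) * e k) * character k x := by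
        push_cast
        rw [f₁, hm₁, split a₁ k₁ x, ← Finset.sum_sub_distrib, ← Finset.sum_sub_distrib]
        refine Finset.sum_congr rfl fun k _ => ?_
        by_cases hk : k = 0
        · subst hk; simp [σ]
        · have := hσ k hk
          simp only [d, e, if_neg hk]
          linear_combination (Complex.I ^ 2 * a₁ k * character k x) * this
            + (-a₁ k * character k x) * Complex.I_sq
      simp only [hq, dx₁_re_sum, dx₂_re_sum]
      rw [key, Complex.sub_re, Complex.ofReal_re]
    · have key : ∑ k ∈ S, Complex.I * k.2 * ((σ k : ℂ) * d k) * character k x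
          = ((F.2 x - mean F.2 : ℝ) : ℂ)
            + ∑ k ∈ S, Complex.I * k.1 * ((σ k : ℂ) * e k) * character k x := by
        push_cast
        rw [f₂, hm₂, split a₂ k₂ x, ← Finset.sum_sub_distrib, ← Finset.sum_add_distrib]
        refine Finset.sum_congr rfl fun k _ => ?_
        by_cases hk : k = 0
        · subst hk; simp [σ]
        · have := hσ k hk
          simp only [d, e, if_neg hk]
          linear_combination (Complex.I ^ 2 * a₂ k * character k x) * this
            + (-a₂ k * character k x) * Complex.I_sq
      simp only [hq, dx₁_re_sum, dx₂_re_sum]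
      rw [key, Complex.add_re, Complex.ofReal_re]

/-- The time derivative. -/
def timeDeriv (u : Path) : Path := fun t x => deriv (fun s => u s x) t

/-- The vector field
`-∂_t R g + ∇^⊥ (g + z) Λ (g + z) - ν Λ^{γ-1} ∇ g` at time `t`, with `R = ∇ Λ⁻¹`. -/
def residualField (ν γ : ℝ) (g z : Path) (t : ℝ) : Field × Field :=
  (fun x => - timeDeriv (fun s => dx₁ (lambdaPow (-1) (g s))) t x
      + (- dx₂ (g t + z t) x) * lambdaPow 1 (g t + z t) x
      - ν * lambdaPow (γ - 1) (dx₁ (g t)) x,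
   fun x => - timeDeriv (fun s => dx₂ (lambdaPow (-1) (g s))) t x
      + dx₁ (g t + z t) x * lambdaPow 1 (g t + z t) x
      - ν * lambdaPow (γ - 1) (dx₂ (g t)) x)

/-- The residual `q` of `g` with noise `z`: `∇ q ≈ -∂_t R g + ∇^⊥ (g + z) Λ (g + z) - ν Λ^{γ-1} ∇ g`
(up to the mean value), with `q` mean-free. -/
def residual (ν γ : ℝ) (g z : Path) : Path := fun t => invGrad (residualField ν γ g z t)

/-! ### The iteration -/

/-- The control parameters `(λ_n, μ_n, ℓ_n, r_n)`. -/
structure Controls where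
  lam : ℕ → ℝ
  mu : ℕ → ℝ
  ell : ℕ → ℝ
  r : ℕ → ℝ

/-- All control parameters are positive. -/
structure Controls.Positive (c : Controls) : Prop where
  lam : ∀ n, 0 < c.lam n
  mu : ∀ n, 0 < c.mu n
  ell : ∀ n, 0 < c.ell n
  r : ∀ n, 0 < c.r n

/-- The conditions on the control parameters that are needed for the passage from step `N` to
step `N + 1`.  The parameters `μ_n`, `ℓ_n` enter the construction for `n ≥ 1` only. -/
structure Controls.Admissible (c : Controls) (N : ℕ) : Prop where
  mu_le_lam : ∀ n, 1 ≤ n → n ≤ N + 1 → c.mu n ≤ c.lam n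
  ell_le_one : ∀ n, 1 ≤ n → n ≤ N + 1 → c.ell n ≤ 1
  lam_nat : ∀ n, n ≤ N + 1 → ∃ k : ℕ, c.lam n = k
  lam_le_mu : ∀ n, n ≤ N → 12 * c.lam n ≤ 4 * c.mu (n + 1)
  ten_le_mu : ∀ n, 1 ≤ n → n ≤ N + 1 → 10 ≤ c.mu n
  lam_growth : ∀ n, n ≤ N → 48 * c.lam n ≤ c.lam (n + 1)

/-- `χ = ‖q‖_X *_t ρ + r`. -/
def chi (q : Path) (ρ : ℝ → ℝ) (r : ℝ) : ℝ → ℝ := fun t =>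
  timeConv (fun s => (xNorm (q s)).toReal) ρ t + r

/-- The amplitude `a_j = 2 √(χ / (5 λ)) P_{≤ μ} √(C₀ + R_jᵒ (q / χ))` at a fixed time. -/
def amplitude (ψ : ℝ × ℝ → ℝ) (C₀ lam mu χ : ℝ) (q : Field) (j : Fin 2) : Field := fun x =>
  2 * Real.sqrt (χ / (5 * lam)) *
    freqTrunc ψ mu (fun y => Real.sqrt (C₀ + rieszO j (fun w => q w / χ) y)) x

/-- The building block `∑_j a_j(t, x) cos (5 λ l_j · x)` made from the previous residual `q` with
the mollifier `ρ`. -/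
def block (ψ : ℝ × ℝ → ℝ) (C₀ lam mu r : ℝ) (ρ : ℝ → ℝ) (q : Path) : Path := fun t x =>
  ∑ j : Fin 2, amplitude ψ C₀ lam mu (chi q ρ r t) (timeConvField q ρ t) j x
    * Real.cos (5 * lam * ((direction j).1 * x.1 + (direction j).2 * x.2))

/-- The pairs `(g_{≤ n}, q_n)` of the iteration, for a realization `z` of the noise:
`g_{≤ 0} = 0`, `g_{≤ n+1} = g_{≤ n} *_t ψ_{ℓ_{n+1}} + g_{n+1}`, and `q_n` is the residual of
`g_{≤ n}` with noise `z_n = P_{≤ λ_n} z`. -/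
def iteration (ψ : ℝ × ℝ → ℝ) (ψ₀ : ℝ → ℝ) (C₀ ν γ : ℝ) (c : Controls) (z : Path) :
    ℕ → Path × Path
  | 0 => (0, residual ν γ 0 (fun t => freqTrunc ψ (c.lam 0) (z t)))
  | n + 1 =>
    let prev := iteration ψ ψ₀ C₀ ν γ c z n
    let ρ := rescale ψ₀ (c.ell (n + 1))
    let g : Path := timeConvField prev.1 ρ
      + block ψ C₀ (c.lam (n + 1)) (c.mu (n + 1)) (c.r n) ρ prev.2
    (g, residual ν γ g (fun t => freqTrunc ψ (c.lam (n + 1)) (z t)))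

/-- The `n`-th residual `q_n` as a random field. -/
def residualSeq (ψ : ℝ × ℝ → ℝ) (ψ₀ : ℝ → ℝ) (C₀ ν γ : ℝ) (c : Controls) {Ω : Type*}
    (z : Ω → Path) (n : ℕ) : Ω → Path :=
  fun ω => (iteration ψ ψ₀ C₀ ν γ c (z ω) n).2

/-! ### The error terms -/

/-- `S_{N,α} = ∑_{n=1}^N 4^{N-n} ℓ_n^{-α} r_{n-1}^{1/2}`. -/
def sumDec (c : Controls) (N : ℕ) (α : ℝ) : ℝ :=
  ∑ n ∈ Finset.Icc 1 N, 4 ^ (N - n) * c.ell n ^ (-α) * c.r (n - 1) ^ (1 / 2 : ℝ)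

/-- The mismatch error. -/
def errMiss (c : Controls) (N : ℕ) : ℝ :=
  (Real.log (c.mu (N + 1)) * (c.lam N / c.mu (N + 1) + c.mu (N + 1) / c.lam (N + 1)) ^ 2
    + c.lam N / c.lam (N + 1)) * c.r N

/-- The commutator error. -/
def errCom (c : Controls) (α κ Cz : ℝ) (N : ℕ) : ℝ :=
  Real.log (c.lam (N + 1)) * c.lam N * c.ell (N + 1) ^ α * sumDec c N α * sumDec c N 0
    + Real.log (c.lam (N + 1)) * c.lam N ^ (1 / 2 : ℝ)
      * (c.ell (N + 1) ^ α * sumDec c N α + c.lam N ^ (-κ) * sumDec c N 0) * Cz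
    + Real.log (c.lam (N + 1)) * (c.ell (N + 1) ^ α + c.lam N ^ (-κ)) * Cz ^ 2

/-- The time error. -/
def errTime (c : Controls) (N : ℕ) : ℝ :=
  Real.log (c.lam (N + 1)) * c.lam (N + 1) ^ (-(3 / 2) : ℝ) * c.r N ^ (1 / 2 : ℝ)
    * (c.ell (N + 1))⁻¹

/-- The dissipation error. -/
def errDis (c : Controls) (ν γ : ℝ) (N : ℕ) : ℝ :=
  Real.log (c.lam (N + 1)) * |ν| * c.lam (N + 1) ^ (γ - 3 / 2) * c.r N ^ (1 / 2 : ℝ)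

/-- The transport error. -/
def errTrans (c : Controls) (N : ℕ) : ℝ :=
  Real.log (c.lam (N + 1)) * c.lam N ^ (1 / 2 : ℝ) * c.lam (N + 1) ^ (-(1 / 2) : ℝ)
    * c.r N ^ (1 / 2 : ℝ) * sumDec c N 0

/-- The stochastic error. -/
def errSto (c : Controls) (Cz : ℝ) (N : ℕ) : ℝ :=
  Real.log (c.lam (N + 1)) * c.lam (N + 1) ^ (-(1 / 2) : ℝ) * c.r N ^ (1 / 2 : ℝ) * Cz

end SQG

end

noncomputable section

namespace SQG

open scoped Real
open Finset (sum_congr mul_sum sum_mul sum_nonneg sum_le_sum single_le_sum mem_product mem_range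
  sum_sub_distrib mem_image_of_mem measurable_fun_sum sum_product sum_comm range univ sum_add_distrib
  sum_subset mem_univ)
open Real (log rpow_pos_of_pos sqrt_pos sqrt_mul sq_sqrt norm_eq_abs)
open ENNReal (ofReal ofReal_mul ofReal_add toReal_nonneg ofReal_ne_top ofReal_toReal
  ofReal_le_ofReal toReal_add toReal_ofReal ofReal_lt_top toReal_mul)
open Complex (I norm_real continuous_ofReal)
open Set (Icc)
open Finset.HasAntidiagonal (antidiagonal)
open Filter.Eventually (of_forall)

local notation "ℝ²" => ℝ × ℝ
local notation "ℤ²" => ℤ × ℤ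

variable {ψ : ℝ² → ℝ} {ψ₀ : ℝ → ℝ} {f : Field} {K : ℝ} {ι : Type*} {T : Finset ι} {c : ι → ℂ}
  {κ : ι → ℤ²}

/-! ### Trigonometric sums with an arbitrary finite index -/

/-- The trigonometric sum `∑ c_p exp(i κ_p · x)`. -/
def trig {ι : Type*} (T : Finset ι) (c : ι → ℂ) (κ : ι → ℤ²) (x : ℝ²) : ℂ :=
  ∑ p ∈ T, c p * character (κ p) x

/-- The real function `f` is the trigonometric sum with data `T, c, κ`. -/
def Rep {ι : Type*} (f : Field) (T : Finset ι) (c : ι → ℂ) (κ : ι → ℤ²) : Prop :=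
  ∀ x, (f x : ℂ) = trig T c κ x

/-- A frequency as a vector of the plane. -/
def toVec (k : ℤ²) : ℝ² := ((k.1 : ℝ), (k.2 : ℝ))

theorem toVec_add (k l : ℤ²) : toVec (k + l) = toVec k + toVec l := by
  simp [toVec]

theorem freqAbs_eq (k : ℤ²) : freqAbs k = eucl (toVec k) := rfl

theorem eucl_nonneg (x : ℝ²) : 0 ≤ eucl x := Real.sqrt_nonneg _

theorem freqAbs_nonneg (k : ℤ²) : 0 ≤ freqAbs k := eucl_nonneg _

theorem eucl_sq (x : ℝ²) : eucl x ^ 2 = x.1 ^ 2 + x.2 ^ 2 := sq_sqrt (by positivity)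

theorem freqAbs_sq (k : ℤ²) : freqAbs k ^ 2 = (k.1 : ℝ) ^ 2 + (k.2 : ℝ) ^ 2 := eucl_sq _

theorem eucl_eq_norm (x : ℝ²) : eucl x = ‖(⟨x.1, x.2⟩ : ℂ)‖ := by
  rw [Complex.norm_def, Complex.normSq_mk, eucl]
  congr 1
  ring

theorem eucl_add_le (x y : ℝ²) : eucl (x + y) ≤ eucl x + eucl y := by
  simp only [eucl_eq_norm]
  exact norm_add_le (⟨x.1, x.2⟩ : ℂ) ⟨y.1, y.2⟩

theorem eucl_neg (x : ℝ²) : eucl (-x) = eucl x := by simp [eucl]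

theorem eucl_smul (a : ℝ) (x : ℝ²) : eucl (a • x) = |a| * eucl x := by
  rw [eucl, eucl, ← Real.sqrt_sq_eq_abs, ← sqrt_mul (sq_nonneg _)]
  congr 1
  simp only [Prod.smul_fst, Prod.smul_snd, smul_eq_mul]
  ring

theorem abs_fst_le_eucl (x : ℝ²) : |x.1| ≤ eucl x := by
  rw [eucl]
  exact Real.abs_le_sqrt (by nlinarith [sq_nonneg x.2])

theorem abs_snd_le_eucl (x : ℝ²) : |x.2| ≤ eucl x := by
  rw [eucl]
  exact Real.abs_le_sqrt (by nlinarith [sq_nonneg x.1])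

theorem eucl_pos {x : ℝ²} (h : x ≠ 0) : 0 < eucl x := by
  rw [eucl_eq_norm, norm_pos_iff]
  intro h0
  apply h
  have h1 := congrArg Complex.re h0
  have h2 := congrArg Complex.im h0
  exact Prod.ext h1 h2

theorem continuous_eucl : Continuous eucl := by
  unfold eucl
  fun_prop

theorem freqAbs_add_le (k l : ℤ²) : freqAbs (k + l) ≤ freqAbs k + freqAbs l := by
  simp only [freqAbs_eq, toVec_add]
  exact eucl_add_le _ _

theorem freqAbs_neg (k : ℤ²) : freqAbs (-k) = freqAbs k := by
  simp [freqAbs, eucl]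

theorem freqAbs_zero : freqAbs 0 = 0 := by simp [freqAbs, eucl]

theorem one_le_freqAbs {k : ℤ²} (h : k ≠ 0) : 1 ≤ freqAbs k := by
  have h1 : (1 : ℤ) ≤ k.1 ^ 2 + k.2 ^ 2 := by
    by_contra hlt
    have h1 : k.1 = 0 := by nlinarith [sq_nonneg k.1, sq_nonneg k.2]
    have h2 : k.2 = 0 := by nlinarith [sq_nonneg k.1, sq_nonneg k.2]
    exact h (Prod.ext h1 h2)
  have h2 : (1 : ℝ) ≤ (k.1 : ℝ) ^ 2 + (k.2 : ℝ) ^ 2 := by exact_mod_cast h1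
  unfold freqAbs eucl
  exact Real.one_le_sqrt.mpr h2

theorem freqAbs_pos {k : ℤ²} (h : k ≠ 0) : 0 < freqAbs k :=
  lt_of_lt_of_le one_pos (one_le_freqAbs h)

/-- The frequencies of length at most `K`. -/
def disc (K : ℝ) : Finset ℤ² :=
  (Finset.Icc (-⌈K⌉) ⌈K⌉ ×ˢ Finset.Icc (-⌈K⌉) ⌈K⌉).filter fun k => freqAbs k ≤ K

theorem mem_disc {k : ℤ²} : k ∈ disc K ↔ freqAbs k ≤ K := by
  unfold disc
  rw [Finset.mem_filter, and_iff_right_iff_imp]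
  intro h
  have h1 := (abs_fst_le_eucl (toVec k)).trans h
  have h2 := (abs_snd_le_eucl (toVec k)).trans h
  simp only [toVec, abs_le] at h1 h2
  have hK := Int.le_ceil K
  rw [mem_product, Finset.mem_Icc, Finset.mem_Icc]
  refine ⟨⟨?_, ?_⟩, ?_, ?_⟩ <;> (rw [← Int.cast_le (R := ℝ)]; push_cast; linarith)

theorem character_zero (x : ℝ²) : character 0 x = 1 := by simp [character]

theorem norm_character (k : ℤ²) (x : ℝ²) : ‖character k x‖ = 1 := by
  have : I * ((k.1 : ℂ) * (x.1 : ℂ) + (k.2 : ℂ) * (x.2 : ℂ))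
      = ((k.1 * x.1 + k.2 * x.2 : ℝ) : ℂ) * I := by push_cast; ring
  rw [character, this, Complex.norm_exp_ofReal_mul_I]

theorem conj_character (k : ℤ²) (x : ℝ²) : (starRingEnd ℂ) (character k x) = character (-k) x := by
  rw [character, character, ← Complex.exp_conj]
  congr 1
  simp
  ring

theorem continuous_trig (T : Finset ι) (c : ι → ℂ) (κ : ι → ℤ²) : Continuous (trig T c κ) :=
  continuous_finsetSum _ fun p _ => continuous_const.mul (continuous_character (κ p))

theorem Rep.continuous (h : Rep f T c κ) : Continuous f := by
  have : f = fun x => (trig T c κ x).re := by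
    funext x
    rw [← h x, Complex.ofReal_re]
  rw [this]
  exact Complex.continuous_re.comp (continuous_trig T c κ)

theorem trig_eq_image (T : Finset ι) (c : ι → ℂ) (κ : ι → ℤ²) (x : ℝ²)
    (S : Finset ℤ²) (hS : ∀ p ∈ T, κ p ∈ S) :
    trig T c κ x = ∑ k ∈ S, (∑ p ∈ T, if κ p = k then c p else 0) * character k x := by
  simp only [sum_mul, trig]
  rw [sum_comm]
  refine sum_congr rfl fun p hp => ?_
  rw [Finset.sum_eq_single (κ p)]
  · simp
  · intro k _ hk
    simp [hk.symm]
  · exact fun h => absurd (hS p hp) h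

theorem Rep.fourierCoeff (h : Rep f T c κ) (k : ℤ²) :
    fourierCoeff f k = ∑ p ∈ T, if κ p = k then c p else 0 := by
  classical
  refine fourierCoeff_of_sum (S := T.image κ) (a := fun k => ∑ p ∈ T, if κ p = k then c p else 0)
    ?_ ?_ k
  · intro k hk
    refine Finset.sum_eq_zero fun p hp => ?_
    rw [if_neg]
    rintro rfl
    exact hk (mem_image_of_mem _ hp)
  · intro x
    rw [h x, trig_eq_image T c κ x (T.image κ) fun p hp => mem_image_of_mem _ hp]

theorem fourierCoeff_neg (f : Field) (k : ℤ²) :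
    fourierCoeff f (-k) = (starRingEnd ℂ) (fourierCoeff f k) := by
  have hconj : ∀ (F : ℝ → ℂ) (a b : ℝ), (starRingEnd ℂ) (∫ s in a..b, F s)
      = ∫ s in a..b, (starRingEnd ℂ) (F s) := by
    intro F a b
    simp only [intervalIntegral, map_sub, integral_conj]
  simp only [fourierCoeff, map_mul, hconj, Complex.conj_ofReal, conj_character]

theorem fourierMul_coe {σ : ℤ² → ℝ} (hσ : ∀ k, σ (-k) = σ k) (f : Field) (x : ℝ²) :
    ((fourierMul σ f x : ℝ) : ℂ) = ∑' k : ℤ², (σ k : ℂ) * fourierCoeff f k * character k x := by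
  unfold fourierMul
  rw [← Complex.conj_eq_iff_re, Complex.conj_tsum]
  rw [← (Equiv.neg ℤ²).tsum_eq]
  refine tsum_congr fun k => ?_
  simp only [Equiv.neg_apply, map_mul, Complex.conj_ofReal, conj_character, neg_neg, hσ,
    fourierCoeff_neg, Complex.conj_conj]

theorem Rep.fourierMul (h : Rep f T c κ) {σ : ℤ² → ℝ} (hσ : ∀ k, σ (-k) = σ k) :
    Rep (fourierMul σ f) T (fun p => (σ (κ p) : ℂ) * c p) κ := by
  classical
  intro x
  rw [fourierMul_coe hσ, tsum_eq_sum (s := T.image κ)]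
  · rw [trig_eq_image T _ κ x (T.image κ) fun p hp => mem_image_of_mem _ hp]
    refine sum_congr rfl fun k _ => ?_
    rw [h.fourierCoeff, mul_sum]
    congr 1
    refine sum_congr rfl fun p _ => ?_
    split_ifs with hk
    · rw [hk]
    · simp
  · intro k hk
    rw [h.fourierCoeff, Finset.sum_eq_zero]
    · simp
    · intro p hp
      rw [if_neg]
      rintro rfl
      exact hk (mem_image_of_mem _ hp)

theorem Rep.dx₁ (h : Rep f T c κ) : Rep (dx₁ f) T (fun p => I * (κ p).1 * c p) κ := by
  intro x
  have h1 := HasDerivAt.fun_sum (u := T)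
    fun p _ => (hasDerivAt_character_fst (κ p) x).const_mul (c p)
  have h2 := hasDerivAt_re h1
  have e : (fun s : ℝ => f (s, x.2)) = fun s => (∑ p ∈ T, c p * character (κ p) (s, x.2)).re := by
    funext s
    have := h (s, x.2)
    rw [trig] at this
    rw [← this, Complex.ofReal_re]
  rw [← e] at h2
  have h3 : HasDerivAt (fun s : ℝ => (f (s, x.2) : ℂ))
      (∑ p ∈ T, c p * (I * (κ p).1 * character (κ p) x)) x.1 := by
    refine h1.congr_of_eventuallyEq (of_forall fun s => ?_)
    exact h (s, x.2)
  have h4 := h2.ofReal_comp.unique h3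
  have h5 : SQG.dx₁ f x = _ := h2.deriv
  rw [h5, h4]
  exact sum_congr rfl fun p _ => by ring

theorem Rep.dx₂ (h : Rep f T c κ) : Rep (dx₂ f) T (fun p => I * (κ p).2 * c p) κ := by
  intro x
  have h1 := HasDerivAt.fun_sum (u := T)
    fun p _ => (hasDerivAt_character_snd (κ p) x).const_mul (c p)
  have h2 := hasDerivAt_re h1
  have e : (fun s : ℝ => f (x.1, s)) = fun s => (∑ p ∈ T, c p * character (κ p) (x.1, s)).re := by
    funext s
    have := h (x.1, s)
    rw [trig] at this
    rw [← this, Complex.ofReal_re]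
  rw [← e] at h2
  have h3 : HasDerivAt (fun s : ℝ => (f (x.1, s) : ℂ))
      (∑ p ∈ T, c p * (I * (κ p).2 * character (κ p) x)) x.2 := by
    refine h1.congr_of_eventuallyEq (of_forall fun s => ?_)
    exact h (x.1, s)
  have h4 := h2.ofReal_comp.unique h3
  have h5 : SQG.dx₂ f x = _ := h2.deriv
  rw [h5, h4]
  exact sum_congr rfl fun p _ => by ring

theorem trig_mul {ι ι' : Type*} (T : Finset ι) (c : ι → ℂ) (κ : ι → ℤ²)
    (T' : Finset ι') (c' : ι' → ℂ) (κ' : ι' → ℤ²) (x : ℝ²) : trig T c κ x * trig T' c' κ' x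
      = trig (T ×ˢ T') (fun p => c p.1 * c' p.2) (fun p => κ p.1 + κ' p.2) x := by
  simp only [trig, Finset.sum_mul_sum, sum_product, ← character_mul]
  exact sum_congr rfl fun p _ => sum_congr rfl fun p' _ => by ring

theorem Rep.mul {ι ι' : Type*} {f g : Field} {T : Finset ι} {c : ι → ℂ} {κ : ι → ℤ²}
    {T' : Finset ι'} {c' : ι' → ℂ} {κ' : ι' → ℤ²} (h : Rep f T c κ) (h' : Rep g T' c' κ') :
    Rep (fun x => f x * g x) (T ×ˢ T') (fun p => c p.1 * c' p.2) (fun p => κ p.1 + κ' p.2) := by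
  intro x
  push_cast
  rw [h x, h' x, trig_mul]

theorem trig_add {ι ι' : Type*} (T : Finset ι) (c : ι → ℂ) (κ : ι → ℤ²)
    (T' : Finset ι') (c' : ι' → ℂ) (κ' : ι' → ℤ²) (x : ℝ²) : trig T c κ x + trig T' c' κ' x
      = trig (T.disjSum T') (Sum.elim c c') (Sum.elim κ κ') x := by
  simp [trig, Finset.sum_disjSum]

theorem Rep.add {ι ι' : Type*} {f g : Field} {T : Finset ι} {c : ι → ℂ} {κ : ι → ℤ²}
    {T' : Finset ι'} {c' : ι' → ℂ} {κ' : ι' → ℤ²} (h : Rep f T c κ) (h' : Rep g T' c' κ') :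
    Rep (fun x => f x + g x) (T.disjSum T') (Sum.elim c c') (Sum.elim κ κ') := by
  intro x
  push_cast
  rw [h x, h' x, trig_add]

theorem Rep.const_mul (h : Rep f T c κ) (a : ℝ) : Rep (fun x => a * f x) T (fun p => a * c p) κ := by
  intro x
  push_cast
  rw [h x, trig, trig, mul_sum]
  exact sum_congr rfl fun p _ => by ring

/-! ### Trigonometric polynomials of bounded frequency -/

/-- `f` is a trigonometric polynomial with frequencies of length at most `K`. -/
def IsTP (K : ℝ) (f : Field) : Prop := Rep f (disc K) (fourierCoeff f) id

theorem Rep.isTP (h : Rep f T c κ) (hK : ∀ p ∈ T, freqAbs (κ p) ≤ K) : IsTP K f := by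
  intro x
  rw [h x, trig_eq_image T c κ x (disc K) fun p hp => mem_disc.2 (hK p hp)]
  simp only [trig, h.fourierCoeff, id]

theorem IsTP.mono {K K' : ℝ} (h : IsTP K f) (hK : K ≤ K') : IsTP K' f :=
  Rep.isTP h fun _ hp => (mem_disc.1 hp).trans hK

theorem IsTP.continuous (h : IsTP K f) : Continuous f := Rep.continuous h

theorem IsTP.fourierCoeff_eq_zero (h : IsTP K f) {k : ℤ²}
    (hk : K < freqAbs k) : fourierCoeff f k = 0 := by
  rw [Rep.fourierCoeff h]
  refine Finset.sum_eq_zero fun p hp => ?_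
  rw [if_neg]
  rintro rfl
  exact absurd (mem_disc.1 hp) (not_le.2 hk)

theorem IsTP.ext {K K' : ℝ} {f g : Field} (hf : IsTP K f) (hg : IsTP K' g)
    (h : ∀ k, fourierCoeff f k = fourierCoeff g k) : f = g := by
  funext x
  have h1 := hf.mono (le_max_left K K') x
  have h2 := hg.mono (le_max_right K K') x
  have : (f x : ℂ) = g x := by
    rw [h1, h2]
    exact sum_congr rfl fun k _ => by rw [h k]
  exact_mod_cast this

theorem isTP_zero (K : ℝ) : IsTP K 0 :=
  Rep.isTP (T := (∅ : Finset ℤ²)) (c := fun _ => 0) (κ := id)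
    (fun x => by simp [trig]) (by simp)

theorem IsTP.add {f g : Field} (hf : IsTP K f) (hg : IsTP K g) : IsTP K (fun x => f x + g x) := by
  refine Rep.isTP (Rep.add hf hg) ?_
  intro p hp
  rcases p with p | p
  · simp only [Finset.inl_mem_disjSum] at hp
    exact mem_disc.1 hp
  · simp only [Finset.inr_mem_disjSum] at hp
    exact mem_disc.1 hp

theorem IsTP.const_mul (hf : IsTP K f) (a : ℝ) : IsTP K (fun x => a * f x) :=
  Rep.isTP (Rep.const_mul hf a) fun _ hp => mem_disc.1 hp

theorem IsTP.neg (hf : IsTP K f) : IsTP K (fun x => -f x) := by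
  simpa using hf.const_mul (-1)

theorem IsTP.sub {f g : Field} (hf : IsTP K f) (hg : IsTP K g) : IsTP K (fun x => f x - g x) := by
  simpa [sub_eq_add_neg] using hf.add hg.neg

theorem IsTP.mul {K K' : ℝ} {f g : Field} (hf : IsTP K f) (hg : IsTP K' g) :
    IsTP (K + K') (fun x => f x * g x) := by
  refine Rep.isTP (Rep.mul hf hg) ?_
  intro p hp
  rw [mem_product] at hp
  exact (freqAbs_add_le _ _).trans (add_le_add (mem_disc.1 hp.1) (mem_disc.1 hp.2))

theorem IsTP.fourierMul (hf : IsTP K f) {σ : ℤ² → ℝ}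
    (hσ : ∀ k, σ (-k) = σ k) : IsTP K (fourierMul σ f) :=
  Rep.isTP (Rep.fourierMul hf hσ) fun _ hp => mem_disc.1 hp

theorem IsTP.dx₁ (hf : IsTP K f) : IsTP K (dx₁ f) :=
  Rep.isTP (Rep.dx₁ hf) fun _ hp => mem_disc.1 hp

theorem IsTP.dx₂ (hf : IsTP K f) : IsTP K (dx₂ f) :=
  Rep.isTP (Rep.dx₂ hf) fun _ hp => mem_disc.1 hp

theorem continuous_inner_integral {F : ℝ² → ℂ} (hF : Continuous F) :
    Continuous fun s : ℝ => ∫ t in (0 : ℝ)..(2 * π), F (s, t) :=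
  intervalIntegral.continuous_parametric_intervalIntegral_of_continuous' (by exact hF) _ _

theorem fourierCoeff_add {f g : Field} (hf : Continuous f) (hg : Continuous g) (k : ℤ²) :
    fourierCoeff (fun x => f x + g x) k = fourierCoeff f k + fourierCoeff g k := by
  have hf' : Continuous fun p : ℝ² => (f p : ℂ) * character (-k) p :=
    (continuous_ofReal.comp hf).mul (continuous_character _)
  have hg' : Continuous fun p : ℝ² => (g p : ℂ) * character (-k) p :=
    (continuous_ofReal.comp hg).mul (continuous_character _)
  unfold fourierCoeff
  rw [← mul_add, ← intervalIntegral.integral_add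
    ((continuous_inner_integral hf').intervalIntegrable _ _)
    ((continuous_inner_integral hg').intervalIntegrable _ _)]
  congr 1
  refine intervalIntegral.integral_congr fun s _ => ?_
  simp only
  have hs : Continuous fun t : ℝ => (s, t) := by fun_prop
  have h1 : Continuous fun t : ℝ => (f (s, t) : ℂ) * character (-k) (s, t) := hf'.comp hs
  have h2 : Continuous fun t : ℝ => (g (s, t) : ℂ) * character (-k) (s, t) := hg'.comp hs
  rw [← intervalIntegral.integral_add (h1.intervalIntegrable _ _) (h2.intervalIntegrable _ _)]
  refine intervalIntegral.integral_congr fun t _ => ?_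
  push_cast
  ring

theorem fourierCoeff_const_mul (f : Field) (a : ℝ) (k : ℤ²) :
    fourierCoeff (fun x => a * f x) k = a * fourierCoeff f k := by
  unfold fourierCoeff
  simp only [Complex.ofReal_mul, mul_assoc, intervalIntegral.integral_const_mul]
  ring

theorem fourierCoeff_neg_fun (f : Field) (k : ℤ²) :
    fourierCoeff (fun x => -f x) k = -fourierCoeff f k := by
  simpa using fourierCoeff_const_mul f (-1) k

theorem fourierCoeff_sub {f g : Field} (hf : Continuous f) (hg : Continuous g) (k : ℤ²) :
    fourierCoeff (fun x => f x - g x) k = fourierCoeff f k - fourierCoeff g k := by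
  have := fourierCoeff_add hf (g := fun x => -g x) hg.neg k
  rw [fourierCoeff_neg_fun] at this
  simpa [sub_eq_add_neg] using this

theorem norm_fourierCoeff_le {A : ℝ} (hA : ∀ x, |f x| ≤ A) (k : ℤ²) : ‖fourierCoeff f k‖ ≤ A := by
  have hpi := Real.pi_pos
  have h1 : ∀ s : ℝ, ‖∫ t in (0 : ℝ)..(2 * π), (f (s, t) : ℂ) * character (-k) (s, t)‖
      ≤ A * |2 * π - 0| := fun s =>
    intervalIntegral.norm_integral_le_of_norm_le_const fun t _ => by
      rw [norm_mul, norm_character, mul_one, norm_real]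
      exact hA _
  have h2 := intervalIntegral.norm_integral_le_of_norm_le_const (a := 0) (b := 2 * π)
    (f := fun s : ℝ => ∫ t in (0 : ℝ)..(2 * π), (f (s, t) : ℂ) * character (-k) (s, t))
    fun s _ => h1 s
  unfold fourierCoeff
  rw [norm_mul, norm_real, Real.norm_of_nonneg (by positivity)]
  rw [sub_zero, abs_of_pos (by positivity)] at h2
  calc _ ≤ 1 / (2 * π) ^ 2 * (A * (2 * π) * (2 * π)) := by gcongr
    _ = A := by field_simp

theorem IsTP.fourierCoeff_fourierMul (hf : IsTP K f) {σ : ℤ² → ℝ}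
    (hσ : ∀ k, σ (-k) = σ k) (k : ℤ²) :
    fourierCoeff (SQG.fourierMul σ f) k = σ k * fourierCoeff f k := by
  rw [Rep.fourierCoeff (Rep.fourierMul hf hσ), Rep.fourierCoeff hf, mul_sum]
  refine sum_congr rfl fun p _ => ?_
  split_ifs with h
  · rw [← h]
  · simp

theorem IsTP.fourierCoeff_dx₁ (hf : IsTP K f) (k : ℤ²) :
    fourierCoeff (SQG.dx₁ f) k = I * k.1 * fourierCoeff f k := by
  rw [Rep.fourierCoeff (Rep.dx₁ hf), Rep.fourierCoeff hf, mul_sum]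
  refine sum_congr rfl fun p _ => ?_
  split_ifs with h
  · rw [← h]
  · simp

theorem IsTP.fourierCoeff_dx₂ (hf : IsTP K f) (k : ℤ²) :
    fourierCoeff (SQG.dx₂ f) k = I * k.2 * fourierCoeff f k := by
  rw [Rep.fourierCoeff (Rep.dx₂ hf), Rep.fourierCoeff hf, mul_sum]
  refine sum_congr rfl fun p _ => ?_
  split_ifs with h
  · rw [← h]
  · simp

/-! ### Symbols -/

theorem lambdaPow_even (s : ℝ) (k : ℤ²) :
    (if -k = 0 then 0 else freqAbs (-k) ^ s) = if k = 0 then 0 else freqAbs k ^ s := by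
  simp [freqAbs_neg]

theorem invLaplacian_even (k : ℤ²) :
    (if -k = 0 then 0 else -(freqAbs (-k) ^ 2)⁻¹) = if k = 0 then 0 else -(freqAbs k ^ 2)⁻¹ := by
  simp [freqAbs_neg]

theorem rieszOSymbol_even (j : Fin 2) (k : ℤ²) : rieszOSymbol j (-k) = rieszOSymbol j k := by
  simp [rieszOSymbol, freqAbs_neg]

theorem freqTrunc_even (hψ : IsFreqCutoff ψ) (lam : ℝ) (k : ℤ²) :
    ψ (((-k).1 : ℝ) / lam, ((-k).2 : ℝ) / lam) = ψ ((k.1 : ℝ) / lam, (k.2 : ℝ) / lam) := by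
  rw [← hψ.even]
  congr 1
  simp [neg_div]

/-- The bilinear form `Δ⁻¹ ∇ · (∇^⊥ v Λ w)`. -/
def bilin (v w : Field) : Field :=
  invGrad (fun x => (-dx₂ v x) * lambdaPow 1 w x, fun x => dx₁ v x * lambdaPow 1 w x)

/-- The symbol of `bilin`. -/
def bilinSymbol (k l : ℤ²) : ℝ :=
  if k + l = 0 then 0
  else freqAbs l * ((k.1 : ℝ) * l.2 - (k.2 : ℝ) * l.1) * (freqAbs (k + l) ^ 2)⁻¹

theorem Rep.bilin {ι ι' : Type*} {f g : Field} {T : Finset ι} {c : ι → ℂ} {κ : ι → ℤ²}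
    {T' : Finset ι'} {c' : ι' → ℂ} {κ' : ι' → ℤ²} (h : Rep f T c κ) (h' : Rep g T' c' κ') :
    Rep (bilin f g) (T ×ˢ T') (fun p => (bilinSymbol (κ p.1) (κ' p.2) : ℂ) * (c p.1 * c' p.2))
      (fun p => κ p.1 + κ' p.2) := by
  have hL : Rep (lambdaPow 1 g) T' _ κ' := h'.fourierMul (lambdaPow_even 1)
  have h1 := ((h.dx₂.const_mul (-1)).mul hL).dx₁
  have h2 := (h.dx₁.mul hL).dx₂
  have h3 := (h1.add h2).fourierMul (σ := fun k => if k = 0 then 0 else -(freqAbs k ^ 2)⁻¹)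
    invLaplacian_even
  intro x
  have h4 := h3 x
  have e : SQG.bilin f g x = SQG.fourierMul (fun k => if k = 0 then 0 else -(freqAbs k ^ 2)⁻¹)
      (fun x => SQG.dx₁ (fun x => -1 * SQG.dx₂ f x * lambdaPow 1 g x) x
        + SQG.dx₂ (fun x => SQG.dx₁ f x * lambdaPow 1 g x) x) x := by
    simp only [SQG.bilin, invGrad, invLaplacian, neg_one_mul]
  rw [e, h4]
  simp only [trig, Finset.sum_disjSum, Sum.elim_inl, Sum.elim_inr]
  rw [← sum_add_distrib]
  refine sum_congr rfl fun p _ => ?_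
  rw [← add_mul]
  congr 1
  unfold bilinSymbol
  by_cases h0 : κ p.1 + κ' p.2 = 0
  · simp [h0]
  · simp only [h0, ↓reduceIte]
    have hl : (if κ' p.2 = 0 then (0 : ℝ) else freqAbs (κ' p.2) ^ (1 : ℝ)) = freqAbs (κ' p.2) := by
      split_ifs with hk
      · rw [hk, freqAbs_zero]
      · rw [Real.rpow_one]
    rw [hl]
    simp only [Prod.fst_add, Prod.snd_add]
    push_cast
    linear_combination (-(freqAbs (κ p.1 + κ' p.2) : ℂ)⁻¹ ^ 2 * freqAbs (κ' p.2) * c p.1 * c' p.2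
      * ((κ p.1).1 * (κ' p.2).2 - (κ p.1).2 * (κ' p.2).1)) * Complex.I_sq

theorem isTP_bilin {K K' : ℝ} {f g : Field} (hf : IsTP K f) (hg : IsTP K' g) :
    IsTP (K + K') (bilin f g) := by
  refine Rep.isTP (Rep.bilin hf hg) ?_
  intro p hp
  rw [mem_product] at hp
  exact (freqAbs_add_le _ _).trans (add_le_add (mem_disc.1 hp.1) (mem_disc.1 hp.2))

/-! ### Smooth compactly supported symbols as Fourier transforms of integrable densities -/

theorem exists_fourier_density {V : Type*} [NormedAddCommGroup V] [InnerProductSpace ℝ V]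
    [FiniteDimensional ℝ V] [MeasurableSpace V] [BorelSpace V] {m : V → ℂ}
    (hm : ContDiff ℝ (⊤ : ℕ∞) m) (hc : HasCompactSupport m) :
    ∃ M : V → ℂ, Continuous M ∧ (∀ n : ℕ, Integrable fun ξ => ‖ξ‖ ^ n * ‖M ξ‖) ∧
      ∀ y, m y = ∫ ξ, Complex.exp (((2 * π * inner ℝ ξ y : ℝ) : ℂ) * I) * M ξ := by
  let f : SchwartzMap V ℂ := hc.toSchwartzMap hm
  refine ⟨FourierTransform.fourier f, (FourierTransform.fourier f).continuous, fun n =>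
    (FourierTransform.fourier f).integrable_pow_mul volume n, fun y => ?_⟩
  have h1 : FourierTransformInv.fourierInv (FourierTransform.fourier f) = f :=
    FourierTransform.fourierInv_fourier_eq f
  have h2 := congrArg (fun g : SchwartzMap V ℂ => g y) h1
  have h3 : f y = m y := rfl
  rw [← h3]
  change f y = _
  rw [← h2]
  change (FourierTransformInv.fourierInv (FourierTransform.fourier f)) y = _
  rw [SchwartzMap.fourierInv_coe, Real.fourierInv_eq']
  rfl

/-- The parameter space of the densities of symbols in one variable. -/
abbrev E2 : Type := EuclideanSpace ℝ (Fin 2)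

/-- The parameter space of the densities of symbols in two variables. -/
abbrev E4 : Type := EuclideanSpace ℝ (Fin 4)

/-- The translation that belongs to a parameter. -/
def shift (ξ : E2) : ℝ² := (2 * π * ξ 0, 2 * π * ξ 1)

/-- The translation of the first factor that belongs to a parameter. -/
def shift₁ (ξ : E4) : ℝ² := (2 * π * ξ 0, 2 * π * ξ 1)

/-- The translation of the second factor that belongs to a parameter. -/
def shift₂ (ξ : E4) : ℝ² := (2 * π * ξ 2, 2 * π * ξ 3)

/-- The character `exp (i h · y)` of the plane. -/
def planeWave (h y : ℝ²) : ℂ := Complex.exp (I * ((h.1 * y.1 + h.2 * y.2 : ℝ) : ℂ))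

theorem continuous_shift : Continuous shift := by
  unfold shift
  fun_prop

theorem continuous_shift₁ : Continuous shift₁ := by
  unfold shift₁
  fun_prop

theorem continuous_shift₂ : Continuous shift₂ := by
  unfold shift₂
  fun_prop

theorem continuous_translate {E : Type*} [TopologicalSpace E] {s : E → ℝ²} (hs : Continuous s)
    (x : ℝ²) (R : ℝ) : Continuous fun ξ => x + R⁻¹ • s ξ :=
  continuous_const.add ((continuous_const_smul R⁻¹).comp hs)

/-- The symbol `m` is the Fourier transform of the density `M`. -/
structure IsWiener (m : ℝ² → ℂ) (M : E2 → ℂ) : Prop where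
  cont : Continuous M
  integ : Integrable fun ξ => (1 + eucl (shift ξ) ^ 2) * ‖M ξ‖
  eq : ∀ y, m y = ∫ ξ, M ξ * planeWave (shift ξ) y

/-- The symbol `m` in two variables is the Fourier transform of the density `M`. -/
structure IsWiener₂ (m : ℝ² × ℝ² → ℂ) (M : E4 → ℂ) : Prop where
  cont : Continuous M
  integ : Integrable fun ξ => (1 + eucl (shift₁ ξ) ^ 2 + eucl (shift₂ ξ) ^ 2) * ‖M ξ‖
  eq : ∀ y, m y = ∫ ξ, M ξ * (planeWave (shift₁ ξ) y.1 * planeWave (shift₂ ξ) y.2)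

/-- The weighted mass of a density. -/
def mass (M : E2 → ℂ) : ℝ := ∫ ξ, (1 + eucl (shift ξ) ^ 2) * ‖M ξ‖

/-- The weighted mass of a density. -/
def mass₂ (M : E4 → ℂ) : ℝ := ∫ ξ, (1 + eucl (shift₁ ξ) ^ 2 + eucl (shift₂ ξ) ^ 2) * ‖M ξ‖

theorem mass_nonneg (M : E2 → ℂ) : 0 ≤ mass M := integral_nonneg fun ξ => by positivity

theorem mass₂_nonneg (M : E4 → ℂ) : 0 ≤ mass₂ M := integral_nonneg fun ξ => by positivity

theorem exists_isWiener {m : ℝ² → ℂ} (hm : ContDiff ℝ (⊤ : ℕ∞) m) (hc : HasCompactSupport m) :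
    ∃ M, IsWiener m M := by
  let e : E2 ≃L[ℝ] (Fin 2 → ℝ) := EuclideanSpace.equiv (Fin 2) ℝ
  let e' : (Fin 2 → ℝ) ≃L[ℝ] ℝ² := ContinuousLinearEquiv.finTwoArrow ℝ ℝ
  let m' : E2 → ℂ := m ∘ (e.trans e')
  have hm' : ContDiff ℝ (⊤ : ℕ∞) m' := hm.comp (e.trans e').contDiff
  have hc' : HasCompactSupport m' := hc.comp_homeomorph (e.trans e').toHomeomorph
  obtain ⟨M, hM, hI, hE⟩ := exists_fourier_density hm' hc'
  refine ⟨M, hM, ?_, fun y => ?_⟩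
  · have h1 := (hI 0).add ((hI 2).const_mul ((2 * π) ^ 2))
    refine h1.congr (of_forall fun ξ => ?_)
    simp only [Pi.add_apply, eucl_sq, shift, EuclideanSpace.norm_sq_eq, Fin.sum_univ_two,
      norm_eq_abs, sq_abs]
    ring
  · have h1 := hE ((e.trans e').symm y)
    simp only [m', Function.comp_apply, ContinuousLinearEquiv.apply_symm_apply] at h1
    rw [h1]
    refine integral_congr_ae (of_forall fun ξ => ?_)
    simp only
    rw [mul_comm, planeWave]
    congr 2
    rw [mul_comm]
    congr 2
    have h2 : ∀ i, ((e.trans e').symm y) i = ![y.1, y.2] i := fun i => rfl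
    simp only [PiLp.inner_apply, Fin.sum_univ_two, shift, h2]
    simp
    ring

theorem exists_isWiener₂ {m : ℝ² × ℝ² → ℂ} (hm : ContDiff ℝ (⊤ : ℕ∞) m)
    (hc : HasCompactSupport m) : ∃ M, IsWiener₂ m M := by
  let e : E4 →ₗ[ℝ] ℝ² × ℝ² :=
    { toFun := fun v => ((v 0, v 1), (v 2, v 3))
      map_add' := fun v w => rfl
      map_smul' := fun a v => rfl }
  let e₁ : E4 ≃ₗ[ℝ] ℝ² × ℝ² :=
    LinearEquiv.ofBijective e ⟨fun v w h => by
      have h : ((v 0, v 1), (v 2, v 3)) = ((w 0, w 1), (w 2, w 3)) := h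
      simp only [Prod.mk.injEq] at h
      ext i
      fin_cases i
      exacts [h.1.1, h.1.2, h.2.1, h.2.2], fun y =>
      ⟨WithLp.toLp 2 ![y.1.1, y.1.2, y.2.1, y.2.2], rfl⟩⟩
  let E := e₁.toContinuousLinearEquiv
  let m' : E4 → ℂ := m ∘ E
  have hm' : ContDiff ℝ (⊤ : ℕ∞) m' := hm.comp E.contDiff
  have hc' : HasCompactSupport m' := hc.comp_homeomorph E.toHomeomorph
  obtain ⟨M, hM, hI, hE⟩ := exists_fourier_density hm' hc'
  refine ⟨M, hM, ?_, fun y => ?_⟩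
  · have h1 := (hI 0).add ((hI 2).const_mul ((2 * π) ^ 2))
    refine h1.congr (of_forall fun ξ => ?_)
    simp only [Pi.add_apply, eucl_sq, shift₁, shift₂, EuclideanSpace.norm_sq_eq,
      Fin.sum_univ_four, norm_eq_abs, sq_abs]
    ring
  · have h1 := hE (WithLp.toLp 2 ![y.1.1, y.1.2, y.2.1, y.2.2])
    have h2 : m' (WithLp.toLp 2 ![y.1.1, y.1.2, y.2.1, y.2.2]) = m y := rfl
    rw [← h2, h1]
    refine integral_congr_ae (of_forall fun ξ => ?_)
    simp only
    rw [mul_comm, planeWave, planeWave, ← Complex.exp_add, ← mul_add, ← Complex.ofReal_add]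
    congr 2
    rw [mul_comm]
    congr 2
    simp only [PiLp.inner_apply, Fin.sum_univ_four, shift₁, shift₂]
    simp
    ring

theorem IsWiener.integrable {m : ℝ² → ℂ} {M : E2 → ℂ} (h : IsWiener m M) : Integrable M := by
  refine h.integ.mono' h.cont.aestronglyMeasurable (of_forall fun ξ => ?_)
  have := norm_nonneg (M ξ)
  nlinarith [mul_nonneg (sq_nonneg (eucl (shift ξ))) this]

theorem IsWiener₂.integrable {m : ℝ² × ℝ² → ℂ} {M : E4 → ℂ} (h : IsWiener₂ m M) : Integrable M := by
  refine h.integ.mono' h.cont.aestronglyMeasurable (of_forall fun ξ => ?_)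
  have := norm_nonneg (M ξ)
  nlinarith [mul_nonneg (sq_nonneg (eucl (shift₁ ξ))) this,
    mul_nonneg (sq_nonneg (eucl (shift₂ ξ))) this]

theorem character_shift (k : ℤ²) (x h : ℝ²) (R : ℝ) :
    character k (x + R⁻¹ • h) = character k x * planeWave h (R⁻¹ • toVec k) := by
  rw [character, character, planeWave, ← Complex.exp_add]
  congr 1
  simp only [Prod.fst_add, Prod.snd_add, Prod.smul_fst, Prod.smul_snd, smul_eq_mul, toVec]
  push_cast
  ring

theorem integrable_mul_of_bounded {E : Type*} [TopologicalSpace E] [MeasurableSpace E]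
    [OpensMeasurableSpace E] [SecondCountableTopology E] {ν : Measure E} {M F : E → ℂ}
    (hM : Integrable M ν) (hF : Continuous F) {A : ℝ} (hA : ∀ ξ, ‖F ξ‖ ≤ A) :
    Integrable (fun ξ => M ξ * F ξ) ν :=
  hM.mul_bdd (c := A) hF.aestronglyMeasurable (of_forall hA)

/-- A multiplier with symbol `m (k / R)` is an average of translations. -/
theorem IsWiener.trig_eq {m : ℝ² → ℂ} {M : E2 → ℂ} (h : IsWiener m M)
    (T : Finset ι) (c : ι → ℂ) (κ : ι → ℤ²) (R : ℝ) (x : ℝ²) :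
    trig T (fun p => m (R⁻¹ • toVec (κ p)) * c p) κ x
      = ∫ ξ, M ξ * trig T c κ (x + R⁻¹ • shift ξ) := by
  simp only [trig, mul_sum]
  rw [integral_finsetSum]
  · refine sum_congr rfl fun p _ => ?_
    rw [h.eq, ← integral_mul_const, ← integral_mul_const]
    refine integral_congr_ae (of_forall fun ξ => ?_)
    simp only
    rw [character_shift]
    ring
  · intro p _
    refine integrable_mul_of_bounded h.integrable ?_ (A := ‖c p‖) fun ξ => ?_
    · exact continuous_const.mul ((continuous_character _).comp
        (continuous_translate continuous_shift x R))
    · rw [norm_mul, norm_character, mul_one]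

theorem IsWiener.norm_integral_le {m : ℝ² → ℂ} {M : E2 → ℂ} (h : IsWiener m M)
    {F : E2 → ℂ} {A : ℝ} (hA : ∀ ξ, ‖F ξ‖ ≤ A * (1 + eucl (shift ξ) ^ 2)) :
    ‖∫ ξ, M ξ * F ξ‖ ≤ mass M * A := by
  rw [mass, ← integral_mul_const]
  refine norm_integral_le_of_norm_le (h.integ.mul_const A) (of_forall fun ξ => ?_)
  rw [norm_mul]
  calc ‖M ξ‖ * ‖F ξ‖ ≤ ‖M ξ‖ * (A * (1 + eucl (shift ξ) ^ 2)) := by gcongr; exact hA ξ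
    _ = _ := by ring

theorem IsWiener.norm_integral_le_of_bounded {m : ℝ² → ℂ} {M : E2 → ℂ} (h : IsWiener m M)
    {F : E2 → ℂ} {A : ℝ} (hA : ∀ ξ, ‖F ξ‖ ≤ A) : ‖∫ ξ, M ξ * F ξ‖ ≤ mass M * A := by
  refine h.norm_integral_le fun ξ => (hA ξ).trans ?_
  have h0 : 0 ≤ A := (norm_nonneg _).trans (hA ξ)
  nlinarith [mul_nonneg h0 (sq_nonneg (eucl (shift ξ)))]

theorem IsWiener.norm_trig_le {m : ℝ² → ℂ} {M : E2 → ℂ} (h : IsWiener m M)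
    {A : ℝ} (hA : ∀ x, ‖trig T c κ x‖ ≤ A) (R : ℝ) (x : ℝ²) :
    ‖trig T (fun p => m (R⁻¹ • toVec (κ p)) * c p) κ x‖ ≤ mass M * A := by
  rw [h.trig_eq]
  exact h.norm_integral_le_of_bounded fun ξ => hA _

/-- A bilinear multiplier with symbol `m (k / R, l / R)` is an average of products of
translations. -/
theorem IsWiener₂.trig_eq {m : ℝ² × ℝ² → ℂ} {M : E4 → ℂ} (h : IsWiener₂ m M)
    {ι ι' : Type*} (T : Finset ι) (c : ι → ℂ) (κ : ι → ℤ²) (T' : Finset ι') (c' : ι' → ℂ)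
    (κ' : ι' → ℤ²) (R : ℝ) (x : ℝ²) :
    trig (T ×ˢ T') (fun p => m (R⁻¹ • toVec (κ p.1), R⁻¹ • toVec (κ' p.2)) * (c p.1 * c' p.2))
        (fun p => κ p.1 + κ' p.2) x
      = ∫ ξ, M ξ * (trig T c κ (x + R⁻¹ • shift₁ ξ) * trig T' c' κ' (x + R⁻¹ • shift₂ ξ)) := by
  have e : ∀ ξ, M ξ * (trig T c κ (x + R⁻¹ • shift₁ ξ) * trig T' c' κ' (x + R⁻¹ • shift₂ ξ))
      = ∑ p ∈ T ×ˢ T', M ξ * ((c p.1 * character (κ p.1) (x + R⁻¹ • shift₁ ξ))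
        * (c' p.2 * character (κ' p.2) (x + R⁻¹ • shift₂ ξ))) := by
    intro ξ
    rw [trig, trig, Finset.sum_mul_sum, ← Finset.sum_product', mul_sum]
  simp only [e]
  rw [integral_finsetSum]
  · simp only [trig]
    refine sum_congr rfl fun p _ => ?_
    rw [h.eq, ← integral_mul_const, ← integral_mul_const]
    refine integral_congr_ae (of_forall fun ξ => ?_)
    simp only
    rw [character_shift, character_shift, ← character_mul]
    ring
  · intro p _
    refine integrable_mul_of_bounded h.integrable ?_ (A := ‖c p.1‖ * ‖c' p.2‖) fun ξ => ?_
    · exact (continuous_const.mul ((continuous_character _).comp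
        (continuous_translate continuous_shift₁ x R))).mul
        (continuous_const.mul ((continuous_character _).comp
        (continuous_translate continuous_shift₂ x R)))
    · rw [norm_mul, norm_mul, norm_mul, norm_character, norm_character, mul_one, mul_one]

theorem IsWiener₂.norm_integral_le {m : ℝ² × ℝ² → ℂ} {M : E4 → ℂ} (h : IsWiener₂ m M)
    {F : E4 → ℂ} {A : ℝ} (hA : ∀ ξ, ‖F ξ‖ ≤ A * (1 + eucl (shift₁ ξ) ^ 2 + eucl (shift₂ ξ) ^ 2)) :
    ‖∫ ξ, M ξ * F ξ‖ ≤ mass₂ M * A := by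
  rw [mass₂, ← integral_mul_const]
  refine norm_integral_le_of_norm_le (h.integ.mul_const A) (of_forall fun ξ => ?_)
  rw [norm_mul]
  calc ‖M ξ‖ * ‖F ξ‖ ≤ ‖M ξ‖ * (A * (1 + eucl (shift₁ ξ) ^ 2 + eucl (shift₂ ξ) ^ 2)) := by
        gcongr; exact hA ξ
    _ = _ := by ring

theorem planeWave_zero (h : ℝ²) : planeWave h 0 = 1 := by simp [planeWave]

theorem eucl_inv_smul {R : ℝ} (hR : 0 < R) (h : ℝ²) : eucl (R⁻¹ • h) = R⁻¹ * eucl h := by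
  rw [eucl_smul, abs_of_pos (inv_pos.2 hR)]

/-- A bilinear multiplier whose symbol vanishes at the origin gains one derivative. -/
theorem IsWiener₂.norm_trig_le_first {m : ℝ² × ℝ² → ℂ} {M : E4 → ℂ}
    (h : IsWiener₂ m M) (h0 : m 0 = 0) {ι ι' : Type*} {T : Finset ι} {c : ι → ℂ}
    {κ : ι → ℤ²} {T' : Finset ι'} {c' : ι' → ℂ} {κ' : ι' → ℤ²} {R A D A' D' : ℝ} (hR : 0 < R)
    (hA : ∀ x, ‖trig T c κ x‖ ≤ A) (hA' : ∀ x, ‖trig T' c' κ' x‖ ≤ A')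
    (hD : ∀ x y, ‖trig T c κ (x + y) - trig T c κ x‖ ≤ D * eucl y)
    (hD' : ∀ x y, ‖trig T' c' κ' (x + y) - trig T' c' κ' x‖ ≤ D' * eucl y)
    (hD0 : 0 ≤ D) (hD0' : 0 ≤ D') (x : ℝ²) :
    ‖trig (T ×ˢ T') (fun p => m (R⁻¹ • toVec (κ p.1), R⁻¹ • toVec (κ' p.2)) * (c p.1 * c' p.2))
        (fun p => κ p.1 + κ' p.2) x‖ ≤ mass₂ M * (R⁻¹ * (D * A' + A * D')) := by
  have hA0 : 0 ≤ A := (norm_nonneg _).trans (hA 0)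
  have hA0' : 0 ≤ A' := (norm_nonneg _).trans (hA' 0)
  have hM0 : ∫ ξ, M ξ = 0 := by
    have := h.eq 0
    rw [h0] at this
    simp only [Prod.fst_zero, Prod.snd_zero, planeWave_zero, mul_one] at this
    exact this.symm
  have e1 : ∫ ξ, M ξ * (trig T c κ x * trig T' c' κ' x) = 0 := by
    rw [integral_mul_const, hM0, zero_mul]
  have c1 : Continuous fun ξ : E4 =>
      trig T c κ (x + R⁻¹ • shift₁ ξ) * trig T' c' κ' (x + R⁻¹ • shift₂ ξ) :=
    ((continuous_trig T c κ).comp (continuous_translate continuous_shift₁ x R)).mul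
      ((continuous_trig T' c' κ').comp (continuous_translate continuous_shift₂ x R))
  rw [h.trig_eq, ← sub_zero (∫ ξ, _), ← e1, ← integral_sub]
  · simp only [← mul_sub]
    refine h.norm_integral_le fun ξ => ?_
    set a := trig T c κ (x + R⁻¹ • shift₁ ξ)
    set b := trig T' c' κ' (x + R⁻¹ • shift₂ ξ)
    have e2 : a * b - trig T c κ x * trig T' c' κ' x
        = (a - trig T c κ x) * b + trig T c κ x * (b - trig T' c' κ' x) := by ring
    rw [e2]
    have b1 := hD x (R⁻¹ • shift₁ ξ)
    have b2 := hD' x (R⁻¹ • shift₂ ξ)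
    rw [eucl_inv_smul hR] at b1 b2
    have hRi : 0 < R⁻¹ := inv_pos.2 hR
    set s := eucl (shift₁ ξ)
    set t := eucl (shift₂ ξ)
    have hs : 0 ≤ s := eucl_nonneg _
    have ht : 0 ≤ t := eucl_nonneg _
    have hs1 : s ≤ 1 + s ^ 2 + t ^ 2 := by nlinarith [sq_nonneg (s - 1), sq_nonneg t]
    have ht1 : t ≤ 1 + s ^ 2 + t ^ 2 := by nlinarith [sq_nonneg (t - 1), sq_nonneg s]
    calc ‖(a - trig T c κ x) * b + trig T c κ x * (b - trig T' c' κ' x)‖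
        ≤ ‖a - trig T c κ x‖ * ‖b‖ + ‖trig T c κ x‖ * ‖b - trig T' c' κ' x‖ := by
          refine (norm_add_le _ _).trans ?_
          rw [norm_mul, norm_mul]
      _ ≤ (D * (R⁻¹ * s)) * A' + A * (D' * (R⁻¹ * t)) := by
          gcongr
          · exact hA' _
          · exact hA _
      _ ≤ (D * (R⁻¹ * (1 + s ^ 2 + t ^ 2))) * A' + A * (D' * (R⁻¹ * (1 + s ^ 2 + t ^ 2))) := by
          gcongr
      _ = _ := by ring
  · exact integrable_mul_of_bounded h.integrable c1 (A := A * A') fun ξ => by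
      rw [norm_mul]
      exact mul_le_mul (hA _) (hA' _) (norm_nonneg _) hA0
  · exact h.integrable.mul_const _

/-- A symmetric bilinear multiplier agrees with the product up to second order. -/
theorem IsWiener₂.norm_trig_sub_le_second {m : ℝ² × ℝ² → ℂ} {M : E4 → ℂ}
    (h : IsWiener₂ m M) (hsym : ∀ y₁ y₂, m (-y₂, -y₁) = m (y₁, y₂)) {R A D D₂ : ℝ} (hR : 0 < R)
    (hA : ∀ x, ‖trig T c κ x‖ ≤ A) (hD : ∀ x y, ‖trig T c κ (x + y) - trig T c κ x‖ ≤ D * eucl y)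
    (hD₂ : ∀ x y, ‖trig T c κ (x + y) + trig T c κ (x - y) - 2 * trig T c κ x‖ ≤ D₂ * eucl y ^ 2)
    (hD0 : 0 ≤ D) (hD0' : 0 ≤ D₂) (x : ℝ²) :
    ‖trig (T ×ˢ T) (fun p => m (R⁻¹ • toVec (κ p.1), R⁻¹ • toVec (κ p.2)) * (c p.1 * c p.2))
        (fun p => κ p.1 + κ p.2) x - m 0 * trig T c κ x ^ 2‖
      ≤ mass₂ M * (R⁻¹ ^ 2 * (A * D₂ + D ^ 2)) := by
  have hA0 : 0 ≤ A := (norm_nonneg _).trans (hA 0)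
  have hM0 : ∫ ξ, M ξ = m 0 := by
    have := h.eq 0
    simp only [Prod.fst_zero, Prod.snd_zero, planeWave_zero, mul_one] at this
    exact this.symm
  set F := trig T c κ with hF
  have cF : Continuous F := continuous_trig T c κ
  have hplus : ∀ (u v : E4 → ℝ²), Continuous u → Continuous v →
      Integrable fun ξ : E4 => M ξ * (F (u ξ) * F (v ξ)) := by
    intro u v hu hv
    exact integrable_mul_of_bounded h.integrable ((cF.comp hu).mul (cF.comp hv)) (A := A * A)
      fun ξ => by
        rw [norm_mul]
        exact mul_le_mul (hA _) (hA _) (norm_nonneg _) hA0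
  have s₁ : Continuous fun ξ : E4 => R⁻¹ • shift₁ ξ := (continuous_const_smul R⁻¹).comp continuous_shift₁
  have s₂ : Continuous fun ξ : E4 => R⁻¹ • shift₂ ξ := (continuous_const_smul R⁻¹).comp continuous_shift₂
  have I₁ := hplus (fun ξ => x + R⁻¹ • shift₁ ξ) (fun ξ => x + R⁻¹ • shift₂ ξ)
    (continuous_const.add s₁) (continuous_const.add s₂)
  have I₂ := hplus (fun ξ => x - R⁻¹ • shift₁ ξ) (fun ξ => x - R⁻¹ • shift₂ ξ)
    (continuous_const.sub s₁) (continuous_const.sub s₂)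
  set S := trig (T ×ˢ T) (fun p => m (R⁻¹ • toVec (κ p.1), R⁻¹ • toVec (κ p.2)) * (c p.1 * c p.2))
        (fun p => κ p.1 + κ p.2) x with hS
  have e₁ : S = ∫ ξ, M ξ * (F (x + R⁻¹ • shift₁ ξ) * F (x + R⁻¹ • shift₂ ξ)) := h.trig_eq ..
  have e₂ : S = ∫ ξ, M ξ * (F (x - R⁻¹ • shift₁ ξ) * F (x - R⁻¹ • shift₂ ξ)) := by
    have h3 := h.trig_eq T c κ T c κ (-R) x
    simp only [inv_neg, neg_smul, ← sub_eq_add_neg] at h3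
    rw [← hF] at h3
    rw [← h3, hS]
    simp only [trig]
    rw [sum_product, Finset.sum_product_right]
    refine sum_congr rfl fun p _ => sum_congr rfl fun p' _ => ?_
    simp only
    rw [hsym, mul_comm (c p') (c p), add_comm (κ p') (κ p)]
  have e₃ : S - m 0 * F x ^ 2 = ∫ ξ, M ξ * (2⁻¹ * (F (x + R⁻¹ • shift₁ ξ) * F (x + R⁻¹ • shift₂ ξ)
      + F (x - R⁻¹ • shift₁ ξ) * F (x - R⁻¹ • shift₂ ξ) - 2 * F x ^ 2)) := by
    have : S = 2⁻¹ * (S + S) := by ring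
    rw [this]
    nth_rewrite 1 [e₁]
    rw [e₂, ← integral_add I₁ I₂, ← hM0, ← integral_mul_const, ← integral_const_mul]
    refine (integral_sub ((I₁.add I₂).const_mul _) (h.integrable.mul_const _)).symm.trans ?_
    refine integral_congr_ae (of_forall fun ξ => ?_)
    simp only [Pi.add_apply]
    ring
  rw [e₃]
  refine h.norm_integral_le fun ξ => ?_
  have a₁ := hD x (R⁻¹ • shift₁ ξ)
  have a₂ := hD x (R⁻¹ • shift₂ ξ)
  have a₃ := hD x (-(R⁻¹ • shift₁ ξ))
  have a₄ := hD x (-(R⁻¹ • shift₂ ξ))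
  have a₅ := hD₂ x (R⁻¹ • shift₁ ξ)
  have a₆ := hD₂ x (R⁻¹ • shift₂ ξ)
  rw [← sub_eq_add_neg, eucl_neg] at a₃ a₄
  rw [eucl_inv_smul hR] at a₁ a₂ a₃ a₄ a₅ a₆
  set s := eucl (shift₁ ξ)
  set t := eucl (shift₂ ξ)
  have hs : 0 ≤ s := eucl_nonneg _
  have ht : 0 ≤ t := eucl_nonneg _
  set b₁ := F (x + R⁻¹ • shift₁ ξ)
  set b₂ := F (x + R⁻¹ • shift₂ ξ)
  set b₃ := F (x - R⁻¹ • shift₁ ξ)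
  set b₄ := F (x - R⁻¹ • shift₂ ξ)
  have e₄ : 2⁻¹ * (b₁ * b₂ + b₃ * b₄ - 2 * F x ^ 2)
      = 2⁻¹ * (F x * (b₁ + b₃ - 2 * F x) + F x * (b₂ + b₄ - 2 * F x)
        + (b₁ - F x) * (b₂ - F x) + (b₃ - F x) * (b₄ - F x)) := by ring
  have hRi : 0 < R⁻¹ := inv_pos.2 hR
  rw [e₄, norm_mul]
  have h2 : ‖(2⁻¹ : ℂ)‖ = 2⁻¹ := by simp
  rw [h2]
  have hx := hA x
  calc 2⁻¹ * ‖F x * (b₁ + b₃ - 2 * F x) + F x * (b₂ + b₄ - 2 * F x)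
        + (b₁ - F x) * (b₂ - F x) + (b₃ - F x) * (b₄ - F x)‖
      ≤ 2⁻¹ * (‖F x‖ * ‖b₁ + b₃ - 2 * F x‖ + ‖F x‖ * ‖b₂ + b₄ - 2 * F x‖
        + ‖b₁ - F x‖ * ‖b₂ - F x‖ + ‖b₃ - F x‖ * ‖b₄ - F x‖) := by
        gcongr
        simp only [← norm_mul]
        exact norm_add₄_le
    _ ≤ 2⁻¹ * (A * (D₂ * (R⁻¹ * s) ^ 2) + A * (D₂ * (R⁻¹ * t) ^ 2)
        + (D * (R⁻¹ * s)) * (D * (R⁻¹ * t)) + (D * (R⁻¹ * s)) * (D * (R⁻¹ * t))) := by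
        gcongr
    _ = R⁻¹ ^ 2 * (A * D₂ * ((s ^ 2 + t ^ 2) / 2) + D ^ 2 * (s * t)) := by ring
    _ ≤ R⁻¹ ^ 2 * (A * D₂ * (1 + s ^ 2 + t ^ 2) + D ^ 2 * (1 + s ^ 2 + t ^ 2)) := by
        gcongr
        · nlinarith
        · nlinarith [sq_nonneg (s - t)]
    _ = _ := by ring

/-! ### Homogeneous symbols -/

/-- A symbol that is smooth away from the origin and homogeneous of degree `d`. -/
structure HomSymbol (d : ℝ) (h : ℝ² → ℂ) : Prop where
  smooth : ∀ y, y ≠ 0 → ContDiffAt ℝ (⊤ : ℕ∞) h y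
  hom : ∀ t : ℝ, 0 < t → ∀ y, y ≠ 0 → h (t • y) = ((t ^ d : ℝ) : ℂ) * h y
  zero : h 0 = 0

theorem HomSymbol.mul {d d' : ℝ} {h h' : ℝ² → ℂ} (H : HomSymbol d h) (H' : HomSymbol d' h') :
    HomSymbol (d + d') (fun y => h y * h' y) where
  smooth y hy := (H.smooth y hy).mul (H'.smooth y hy)
  hom t ht y hy := by
    rw [H.hom t ht y hy, H'.hom t ht y hy, Real.rpow_add ht]
    push_cast
    ring
  zero := by rw [H.zero, zero_mul]

theorem HomSymbol.add {d : ℝ} {h h' : ℝ² → ℂ} (H : HomSymbol d h) (H' : HomSymbol d h') :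
    HomSymbol d (fun y => h y + h' y) where
  smooth y hy := (H.smooth y hy).add (H'.smooth y hy)
  hom t ht y hy := by
    rw [H.hom t ht y hy, H'.hom t ht y hy]
    ring
  zero := by rw [H.zero, H'.zero, zero_add]

theorem HomSymbol.const_mul {d : ℝ} {h : ℝ² → ℂ} (H : HomSymbol d h) (a : ℂ) :
    HomSymbol d (fun y => a * h y) where
  smooth y hy := contDiffAt_const.mul (H.smooth y hy)
  hom t ht y hy := by
    rw [H.hom t ht y hy]
    ring
  zero := by rw [H.zero, mul_zero]

theorem homSymbol_fst : HomSymbol 1 (fun y => (y.1 : ℂ)) where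
  smooth y _ := (Complex.ofRealCLM.contDiff.comp contDiff_fst).contDiffAt
  hom t _ y _ := by simp
  zero := by simp

theorem homSymbol_snd : HomSymbol 1 (fun y => (y.2 : ℂ)) where
  smooth y _ := (Complex.ofRealCLM.contDiff.comp contDiff_snd).contDiffAt
  hom t _ y _ := by simp
  zero := by simp

/-- The symbol `|y| ^ s`, and `0` at the origin. -/
def absPow (s : ℝ) (y : ℝ²) : ℝ := if y = 0 then 0 else eucl y ^ s

theorem contDiffAt_eucl {y : ℝ²} (hy : y ≠ 0) : ContDiffAt ℝ (⊤ : ℕ∞) eucl y := by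
  unfold eucl
  refine ContDiffAt.sqrt (by fun_prop) ?_
  have := eucl_pos hy
  rw [eucl, sqrt_pos] at this
  exact this.ne'

theorem homSymbol_absPow (s : ℝ) : HomSymbol s (fun y => (absPow s y : ℂ)) where
  smooth y hy := by
    have h1 : ContDiffAt ℝ (⊤ : ℕ∞) (fun y => eucl y ^ s) y :=
      (contDiffAt_eucl hy).rpow_const_of_ne (eucl_pos hy).ne'
    have h2 : (fun y => absPow s y) =ᶠ[𝓝 y] fun y => eucl y ^ s := by
      filter_upwards [isOpen_ne.mem_nhds hy] with w hw
      rw [absPow, if_neg hw]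
    exact Complex.ofRealCLM.contDiff.contDiffAt.comp y (h1.congr_of_eventuallyEq h2)
  hom t ht y hy := by
    have : t • y ≠ 0 := smul_ne_zero ht.ne' hy
    rw [absPow, if_neg this, absPow, if_neg hy, eucl_smul, abs_of_pos ht,
      Real.mul_rpow ht.le (eucl_nonneg y)]
    push_cast
    ring
  zero := by simp [absPow]

theorem toVec_eq_zero {k : ℤ²} : toVec k = 0 ↔ k = 0 := by
  constructor
  · intro h
    have h1 := congrArg Prod.fst h
    have h2 := congrArg Prod.snd h
    simp only [toVec, Prod.fst_zero, Prod.snd_zero, Int.cast_eq_zero] at h1 h2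
    exact Prod.ext h1 h2
  · rintro rfl
    simp [toVec]

theorem absPow_toVec (s : ℝ) (k : ℤ²) : absPow s (toVec k) = if k = 0 then 0 else freqAbs k ^ s := by
  simp only [absPow, toVec_eq_zero, freqAbs_eq]

/-- The symbol of `R_jᵒ` as a function on the plane. -/
def rieszSym (j : Fin 2) (y : ℝ²) : ℂ :=
  (if j = 0 then (25 / 12 : ℂ) else 7 / 12)
      * (((y.2 : ℂ) * y.2 + (-1) * ((y.1 : ℂ) * y.1)) * (absPow (-2) y : ℂ))
    + (if j = 0 then (0 : ℂ) else 4) * (((y.1 : ℂ) * y.2) * (absPow (-2) y : ℂ))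

theorem HomSymbol.cast {d d' : ℝ} {h : ℝ² → ℂ} (H : HomSymbol d h) (e : d = d') :
    HomSymbol d' h := e ▸ H

theorem homSymbol_rieszSym (j : Fin 2) : HomSymbol 0 (rieszSym j) :=
  (((((homSymbol_snd.mul homSymbol_snd).add ((homSymbol_fst.mul homSymbol_fst).const_mul (-1))).mul
    (homSymbol_absPow (-2))).const_mul _).add
    (((homSymbol_fst.mul homSymbol_snd).mul (homSymbol_absPow (-2))).const_mul _)).cast (by norm_num)

theorem rieszSym_toVec (j : Fin 2) (k : ℤ²) : rieszSym j (toVec k) = (rieszOSymbol j k : ℂ) := by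
  unfold rieszSym rieszOSymbol
  rw [absPow_toVec]
  by_cases hk : k = 0
  · simp [hk]
  · simp only [hk, ↓reduceIte, toVec]
    have h2 : freqAbs k ^ (-2 : ℝ) = (freqAbs k ^ 2)⁻¹ := by
      rw [Real.rpow_neg (freqAbs_nonneg k)]
      norm_num
    rw [h2]
    split_ifs <;> push_cast <;> ring

/-! ### Cut-offs -/

/-- The difference of two rescaled cut-offs, which vanishes near the origin. -/
def annulusCut (ψ : ℝ² → ℝ) (a b : ℝ) (y : ℝ²) : ℝ := ψ (a⁻¹ • y) - ψ (b⁻¹ • y)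

theorem IsFreqCutoff.eq_one_scaled (hψ : IsFreqCutoff ψ) {a : ℝ} (ha : 0 < a)
    {y : ℝ²} (hy : eucl y ≤ a / 2) : ψ (a⁻¹ • y) = 1 := by
  refine hψ.eq_one _ ?_
  rw [eucl_inv_smul ha, inv_mul_le_iff₀ ha]
  linarith

theorem IsFreqCutoff.eq_zero_scaled (hψ : IsFreqCutoff ψ) {a : ℝ} (ha : 0 < a)
    {y : ℝ²} (hy : a ≤ eucl y) : ψ (a⁻¹ • y) = 0 := by
  refine hψ.eq_zero _ ?_
  rw [eucl_inv_smul ha, le_inv_mul_iff₀ ha]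
  linarith

theorem IsFreqCutoff.contDiff_scaled (hψ : IsFreqCutoff ψ) (a : ℝ) :
    ContDiff ℝ (⊤ : ℕ∞) fun y => ψ (a⁻¹ • y) :=
  hψ.smooth.comp (contDiff_const_smul a⁻¹)

theorem norm_le_eucl (y : ℝ²) : ‖y‖ ≤ eucl y :=
  max_le (abs_fst_le_eucl y) (abs_snd_le_eucl y)

theorem hasCompactSupport_of_eucl {E : Type*} [Zero E] {f : ℝ² → E} (r : ℝ)
    (h : ∀ y, r ≤ eucl y → f y = 0) : HasCompactSupport f := by
  refine HasCompactSupport.intro (isCompact_closedBall (0 : ℝ²) r) fun y hy => h y ?_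
  rw [mem_closedBall_zero_iff, not_le] at hy
  exact hy.le.trans (norm_le_eucl y)

theorem contDiff_mul_of_local {E : Type*} [NormedAddCommGroup E] [NormedSpace ℝ E] {φ h : E → ℂ}
    (hφ : ContDiff ℝ (⊤ : ℕ∞) φ) (H : ∀ x, ContDiffAt ℝ (⊤ : ℕ∞) h x ∨ φ =ᶠ[𝓝 x] fun _ => 0) :
    ContDiff ℝ (⊤ : ℕ∞) fun x => φ x * h x := by
  rw [contDiff_iff_contDiffAt]
  intro x
  rcases H x with hx | hx
  · exact hφ.contDiffAt.mul hx
  · refine (contDiffAt_const (c := (0 : ℂ))).congr_of_eventuallyEq ?_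
    filter_upwards [hx] with y hy
    rw [hy, zero_mul]

theorem annulusCut_contDiff (hψ : IsFreqCutoff ψ) (a b : ℝ) :
    ContDiff ℝ (⊤ : ℕ∞) (annulusCut ψ a b) :=
  (hψ.contDiff_scaled a).sub (hψ.contDiff_scaled b)

theorem annulusCut_eq_zero_of_le (hψ : IsFreqCutoff ψ) {a b : ℝ} (ha : 0 < a)
    (hb : 0 < b) {y : ℝ²} (hy : eucl y ≤ min a b / 2) : annulusCut ψ a b y = 0 := by
  rw [annulusCut, hψ.eq_one_scaled ha (hy.trans (by have := min_le_left a b; linarith)),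
    hψ.eq_one_scaled hb (hy.trans (by have := min_le_right a b; linarith)), sub_self]

theorem annulusCut_eq_zero_of_ge (hψ : IsFreqCutoff ψ) {a b : ℝ} (ha : 0 < a)
    (hb : 0 < b) {y : ℝ²} (hy : max a b ≤ eucl y) : annulusCut ψ a b y = 0 := by
  rw [annulusCut, hψ.eq_zero_scaled ha ((le_max_left a b).trans hy),
    hψ.eq_zero_scaled hb ((le_max_right a b).trans hy), sub_self]

theorem annulusCut_eq_one (hψ : IsFreqCutoff ψ) {c₁ c₂ : ℝ} (h1 : 0 < c₁)
    (h2 : 0 < c₂) {y : ℝ²} (hy : c₁ ≤ eucl y) (hy' : eucl y ≤ c₂) :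
    annulusCut ψ (2 * c₂) c₁ y = 1 := by
  rw [annulusCut, hψ.eq_one_scaled (by linarith) (by linarith), hψ.eq_zero_scaled h1 hy, sub_zero]

theorem annulusCut_eventually_zero (hψ : IsFreqCutoff ψ) {a b : ℝ} (ha : 0 < a)
    (hb : 0 < b) : annulusCut ψ a b =ᶠ[𝓝 0] fun _ => 0 := by
  have h0 : eucl 0 < min a b / 2 := by
    have : eucl 0 = 0 := by simp [eucl]
    rw [this]
    have := lt_min ha hb
    linarith
  filter_upwards [continuous_eucl.continuousAt.eventually_lt continuousAt_const h0] with y hy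
  exact annulusCut_eq_zero_of_le hψ ha hb hy.le

theorem contDiff_annulusCut_mul (hψ : IsFreqCutoff ψ) {h : ℝ² → ℂ}
    (hh : ∀ y, y ≠ 0 → ContDiffAt ℝ (⊤ : ℕ∞) h y) {a b : ℝ} (ha : 0 < a) (hb : 0 < b) :
    ContDiff ℝ (⊤ : ℕ∞) fun y => (annulusCut ψ a b y : ℂ) * h y := by
  refine contDiff_mul_of_local (Complex.ofRealCLM.contDiff.comp (annulusCut_contDiff hψ a b)) ?_
  intro y
  by_cases hy : y = 0
  · right
    rw [hy]
    filter_upwards [annulusCut_eventually_zero hψ ha hb] with w hw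
    simp [hw]
  · exact Or.inl (hh y hy)

theorem exists_isWiener_annulus (hψ : IsFreqCutoff ψ) {h : ℝ² → ℂ}
    (hh : ∀ y, y ≠ 0 → ContDiffAt ℝ (⊤ : ℕ∞) h y) {a b : ℝ} (ha : 0 < a) (hb : 0 < b) :
    ∃ M, IsWiener (fun y => (annulusCut ψ a b y : ℂ) * h y) M :=
  exists_isWiener (contDiff_annulusCut_mul hψ hh ha hb)
    (hasCompactSupport_of_eucl (max a b) fun y hy => by
      rw [annulusCut_eq_zero_of_ge hψ ha hb hy]
      simp)

theorem exists_isWiener_cutoff (hψ : IsFreqCutoff ψ) : ∃ M, IsWiener (fun y => (ψ y : ℂ)) M :=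
  exists_isWiener (Complex.ofRealCLM.contDiff.comp hψ.smooth)
    (hasCompactSupport_of_eucl 1 fun y hy => by rw [hψ.eq_zero y hy]; simp)

theorem HomSymbol.eq_rescale {d : ℝ} {h : ℝ² → ℂ} (H : HomSymbol d h) {R : ℝ} (hR : 0 < R)
    (y : ℝ²) : h y = ((R ^ d : ℝ) : ℂ) * h (R⁻¹ • y) := by
  by_cases hy : y = 0
  · simp [hy, H.zero]
  · rw [← H.hom R hR _ (smul_ne_zero (inv_ne_zero hR.ne') hy), smul_inv_smul₀ hR.ne']

theorem trig_const_mul (T : Finset ι) (c : ι → ℂ) (κ : ι → ℤ²) (a : ℂ)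
    (x : ℝ²) : trig T (fun p => a * c p) κ x = a * trig T c κ x := by
  simp only [trig, mul_sum]
  exact sum_congr rfl fun p _ => by ring

theorem trig_congr {c c' : ι → ℂ}
    (h : ∀ p ∈ T, c p = c' p) (x : ℝ²) : trig T c κ x = trig T c' κ x :=
  sum_congr rfl fun p hp => by rw [h p hp]

/-- Frequency-localized pieces of a homogeneous multiplier. -/
theorem HomSymbol.piece_bound (hψ : IsFreqCutoff ψ) {d : ℝ} {h : ℝ² → ℂ}
    (H : HomSymbol d h) {a b : ℝ} (ha : 0 < a) (hb : 0 < b) :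
    ∃ C, 0 ≤ C ∧ ∀ R : ℝ, 0 < R → ∀ (ι : Type) (T : Finset ι) (c : ι → ℂ) (κ : ι → ℤ²) (A : ℝ),
      (∀ x, ‖trig T c κ x‖ ≤ A) → ∀ x, ‖trig T (fun p => (annulusCut ψ a b (R⁻¹ • toVec (κ p)) : ℂ)
        * h (toVec (κ p)) * c p) κ x‖ ≤ C * R ^ d * A := by
  obtain ⟨M, hM⟩ := exists_isWiener_annulus hψ H.smooth ha hb
  refine ⟨mass M, mass_nonneg M, fun R hR ι T c κ A hA x => ?_⟩
  have e : ∀ p ∈ T, (annulusCut ψ a b (R⁻¹ • toVec (κ p)) : ℂ) * h (toVec (κ p)) * c p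
      = ((R ^ d : ℝ) : ℂ) * ((annulusCut ψ a b (R⁻¹ • toVec (κ p)) : ℂ)
        * h (R⁻¹ • toVec (κ p)) * c p) := by
    intro p _
    rw [H.eq_rescale hR (toVec (κ p))]
    ring
  rw [trig_congr e, trig_const_mul, norm_mul, norm_real,
    Real.norm_of_nonneg (Real.rpow_nonneg hR.le d)]
  calc _ ≤ R ^ d * (mass M * A) := by
        gcongr
        exact hM.norm_trig_le hA R x
    _ = _ := by ring

theorem HomSymbol.annulus_bound (hψ : IsFreqCutoff ψ) {d : ℝ} {h : ℝ² → ℂ}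
    (H : HomSymbol d h) {c₁ c₂ : ℝ} (h1 : 0 < c₁) (h2 : 0 < c₂) :
    ∃ C, 0 ≤ C ∧ ∀ R : ℝ, 0 < R → ∀ (ι : Type) (T : Finset ι) (c : ι → ℂ) (κ : ι → ℤ²) (A : ℝ),
      (∀ p ∈ T, c₁ * R ≤ freqAbs (κ p) ∧ freqAbs (κ p) ≤ c₂ * R) →
      (∀ x, ‖trig T c κ x‖ ≤ A) → ∀ x, ‖trig T (fun p => h (toVec (κ p)) * c p) κ x‖
        ≤ C * R ^ d * A := by
  obtain ⟨C, hC, hb⟩ := H.piece_bound hψ (a := 2 * c₂) (b := c₁) (by linarith) h1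
  refine ⟨C, hC, fun R hR ι T c κ A hκ hA x => ?_⟩
  have e : ∀ p ∈ T, h (toVec (κ p)) * c p
      = (annulusCut ψ (2 * c₂) c₁ (R⁻¹ • toVec (κ p)) : ℂ) * h (toVec (κ p)) * c p := by
    intro p hp
    obtain ⟨k1, k2⟩ := hκ p hp
    rw [annulusCut_eq_one hψ h1 h2, Complex.ofReal_one, one_mul]
    · rw [eucl_inv_smul hR, le_inv_mul_iff₀ hR, mul_comm]
      exact k1
    · rw [eucl_inv_smul hR, inv_mul_le_iff₀ hR, mul_comm]
      exact k2
  rw [trig_congr e]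
  exact hb R hR ι T c κ A hA x

theorem sum_annulusCut (ψ : ℝ² → ℝ) (n : ℕ) (y : ℝ²) :
    ∑ i ∈ range (n + 1), annulusCut ψ 1 (1 / 2) (((2 : ℝ) ^ i)⁻¹ • y)
      = ψ (((2 : ℝ) ^ n)⁻¹ • y) - ψ ((2 : ℝ) • y) := by
  induction n with
  | zero => simp [annulusCut]
  | succ n ih =>
    rw [Finset.sum_range_succ, ih, annulusCut]
    have e : ((1 / 2 : ℝ)⁻¹ • ((2 : ℝ) ^ (n + 1))⁻¹ • y) = ((2 : ℝ) ^ n)⁻¹ • y := by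
      rw [smul_smul]
      congr 1
      rw [pow_succ]
      field_simp
    rw [e]
    simp

theorem sum_annulusCut_eq_one (hψ : IsFreqCutoff ψ) {n : ℕ} {k : ℤ²}
    (hk : k ≠ 0) (hn : freqAbs k ≤ 2 ^ n) :
    ∑ i ∈ range (n + 2), annulusCut ψ 1 (1 / 2) (((2 : ℝ) ^ i)⁻¹ • toVec k) = 1 := by
  rw [sum_annulusCut, hψ.eq_one_scaled (by positivity), hψ.eq_zero, sub_zero]
  · rw [eucl_smul, abs_two]
    have := one_le_freqAbs hk
    rw [freqAbs_eq] at this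
    linarith
  · rw [← freqAbs_eq, pow_succ]
    linarith

theorem trig_sum {n : ℕ} (T : Finset ι) (c : ℕ → ι → ℂ) (κ : ι → ℤ²) (x : ℝ²) :
    trig T (fun p => ∑ i ∈ range n, c i p) κ x = ∑ i ∈ range n, trig T (c i) κ x := by
  simp only [trig, sum_mul]
  exact sum_comm

/-- Dyadic bound for a homogeneous multiplier on frequencies up to `2 ^ n`. -/
theorem HomSymbol.dyadic_bound (hψ : IsFreqCutoff ψ) {d : ℝ} {h : ℝ² → ℂ} (H : HomSymbol d h) :
    ∃ C, 0 ≤ C ∧ ∀ (n : ℕ) (ι : Type) (T : Finset ι) (c : ι → ℂ) (κ : ι → ℤ²) (A : ℝ),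
      (∀ p ∈ T, freqAbs (κ p) ≤ 2 ^ n) →
      (∀ x, ‖trig T c κ x‖ ≤ A) → ∀ x, ‖trig T (fun p => h (toVec (κ p)) * c p) κ x‖
        ≤ C * (∑ i ∈ range (n + 2), ((2 : ℝ) ^ i) ^ d) * A := by
  obtain ⟨C, hC, hb⟩ := H.piece_bound hψ (a := 1) (b := 1 / 2) one_pos (by norm_num)
  refine ⟨C, hC, fun n ι T c κ A hκ hA x => ?_⟩
  have e : ∀ p ∈ T, h (toVec (κ p)) * c p = ∑ i ∈ range (n + 2),
      (annulusCut ψ 1 (1 / 2) (((2 : ℝ) ^ i)⁻¹ • toVec (κ p)) : ℂ) * h (toVec (κ p)) * c p := by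
    intro p hp
    rw [← sum_mul, ← sum_mul, ← Complex.ofReal_sum]
    by_cases h0 : κ p = 0
    · rw [h0, toVec_eq_zero.2 rfl, H.zero]
      simp
    · rw [sum_annulusCut_eq_one hψ h0 (hκ p hp)]
      simp
  rw [trig_congr e, trig_sum, mul_sum, sum_mul]
  refine (norm_sum_le _ _).trans (sum_le_sum fun i _ => ?_)
  exact hb (2 ^ i) (by positivity) ι T c κ A hA x

theorem HomSymbol.neg_bound (hψ : IsFreqCutoff ψ) {d : ℝ} (hd : d < 0)
    {h : ℝ² → ℂ} (H : HomSymbol d h) :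
    ∃ C, 0 ≤ C ∧ ∀ (ι : Type) (T : Finset ι) (c : ι → ℂ) (κ : ι → ℤ²) (A : ℝ),
      (∀ x, ‖trig T c κ x‖ ≤ A) → ∀ x, ‖trig T (fun p => h (toVec (κ p)) * c p) κ x‖ ≤ C * A := by
  obtain ⟨C, hC, hb⟩ := H.dyadic_bound hψ
  have hlt : (2 : ℝ) ^ d < 1 := Real.rpow_lt_one_of_one_lt_of_neg one_lt_two hd
  have hpos : (0 : ℝ) < 2 ^ d := rpow_pos_of_pos two_pos d
  refine ⟨C * (1 - 2 ^ d)⁻¹, mul_nonneg hC (inv_nonneg.2 (by linarith)),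
    fun ι T c κ A hA x => ?_⟩
  have hA0 : 0 ≤ A := (norm_nonneg _).trans (hA 0)
  obtain ⟨n, hn⟩ : ∃ n : ℕ, ∀ p ∈ T, freqAbs (κ p) ≤ 2 ^ n := by
    obtain ⟨n, hn⟩ := pow_unbounded_of_one_lt (∑ p ∈ T, freqAbs (κ p)) (one_lt_two (α := ℝ))
    refine ⟨n, fun p hp => le_trans ?_ hn.le⟩
    exact single_le_sum (f := fun p => freqAbs (κ p)) (fun p _ => freqAbs_nonneg _) hp
  refine (hb n ι T c κ A hn hA x).trans ?_
  have e : ∀ i : ℕ, ((2 : ℝ) ^ i) ^ d = (2 ^ d) ^ i := fun i => by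
    rw [← Real.rpow_natCast, ← Real.rpow_mul two_pos.le, mul_comm, Real.rpow_mul two_pos.le,
      Real.rpow_natCast]
  simp only [e]
  gcongr
  calc ∑ i ∈ range (n + 2), ((2 : ℝ) ^ d) ^ i ≤ ∑' i : ℕ, ((2 : ℝ) ^ d) ^ i :=
        (summable_geometric_of_lt_one hpos.le hlt).sum_le_tsum _ fun i _ => by positivity
    _ = _ := tsum_geometric_of_lt_one hpos.le hlt

theorem HomSymbol.log_bound (hψ : IsFreqCutoff ψ) {h : ℝ² → ℂ} (H : HomSymbol 0 h) :
    ∃ C, 0 ≤ C ∧ ∀ (K : ℝ), 2 ≤ K → ∀ (ι : Type) (T : Finset ι) (c : ι → ℂ) (κ : ι → ℤ²) (A : ℝ),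
      (∀ p ∈ T, freqAbs (κ p) ≤ K) →
      (∀ x, ‖trig T c κ x‖ ≤ A) → ∀ x, ‖trig T (fun p => h (toVec (κ p)) * c p) κ x‖
        ≤ C * log K * A := by
  obtain ⟨C, hC, hb⟩ := H.dyadic_bound hψ
  have hl2 : 0 < log 2 := Real.log_pos one_lt_two
  refine ⟨C * (4 / log 2), by positivity, fun K hK ι T c κ A hκ hA x => ?_⟩
  have hA0 : 0 ≤ A := (norm_nonneg _).trans (hA 0)
  have hlog : log 2 ≤ log K := Real.log_le_log two_pos hK
  set n := ⌈log K / log 2⌉₊ with hn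
  have h1 : log K / log 2 ≤ n := Nat.le_ceil _
  have h2 : (n : ℝ) < log K / log 2 + 1 := Nat.ceil_lt_add_one (div_nonneg (hl2.le.trans hlog) hl2.le)
  have h3 : K ≤ 2 ^ n := by
    rw [← Real.log_le_log_iff (by linarith) (by positivity), Real.log_pow]
    rwa [div_le_iff₀ hl2] at h1
  refine (hb n ι T c κ A (fun p hp => (hκ p hp).trans h3) hA x).trans ?_
  simp only [Real.rpow_zero, Finset.sum_const, Finset.card_range, nsmul_eq_mul, mul_one]
  refine mul_le_mul_of_nonneg_right ?_ hA0
  rw [mul_assoc]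
  refine mul_le_mul_of_nonneg_left ?_ hC
  push_cast
  have h4 : 1 ≤ log K / log 2 := by rwa [le_div_iff₀ hl2, one_mul]
  calc (n : ℝ) + 2 ≤ 4 * (log K / log 2) := by linarith
    _ = _ := by ring

/-! ### Bounds in `X` -/

/-- `A` bounds `q` and its transforms `R_jᵒ q`. -/
def XBound (q : Field) (A : ℝ) : Prop := (∀ x, |q x| ≤ A) ∧ ∀ j x, |rieszO j q x| ≤ A

theorem supNorm_le {A : ℝ} (h : ∀ x, |f x| ≤ A) : supNorm f ≤ ofReal A := by
  refine iSup_le fun x => ?_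
  rw [Real.enorm_eq_ofReal_abs]
  exact ofReal_le_ofReal (h x)

theorem XBound.nonneg {q : Field} {A : ℝ} (h : XBound q A) : 0 ≤ A := (abs_nonneg _).trans (h.1 0)

theorem XBound.mono {q : Field} {A B : ℝ} (h : XBound q A) (hAB : A ≤ B) : XBound q B :=
  ⟨fun x => (h.1 x).trans hAB, fun j x => (h.2 j x).trans hAB⟩

theorem XBound.xNorm_le {q : Field} {A : ℝ} (h : XBound q A) : xNorm q ≤ ofReal (3 * A) := by
  have hA := h.nonneg
  unfold xNorm
  rw [Fin.sum_univ_two]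
  have e : 3 * A = A + (A + A) := by ring
  rw [e, ofReal_add hA (by linarith), ofReal_add hA hA]
  exact add_le_add (supNorm_le h.1) (add_le_add (supNorm_le (h.2 0)) (supNorm_le (h.2 1)))

theorem abs_le_of_supNorm {A : ℝ} (hA : 0 ≤ A) (h : supNorm f ≤ ofReal A) (x : ℝ²) : |f x| ≤ A := by
  have h1 := (le_iSup (fun x => ‖f x‖ₑ) x).trans h
  rw [Real.enorm_eq_ofReal_abs] at h1
  exact (ENNReal.ofReal_le_ofReal_iff hA).1 h1

theorem xBound_of_xNorm {q : Field} {A : ℝ} (hA : 0 ≤ A) (h : xNorm q ≤ ofReal A) : XBound q A := by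
  unfold xNorm at h
  rw [Fin.sum_univ_two] at h
  refine ⟨abs_le_of_supNorm hA (le_self_add.trans h), fun j => abs_le_of_supNorm hA ?_⟩
  have h' := le_add_self.trans h
  fin_cases j
  · exact le_self_add.trans h'
  · exact le_add_self.trans h'

theorem abs_le_of_rep
    (h : Rep f T c κ) {A : ℝ} (hA : ∀ x, ‖trig T c κ x‖ ≤ A) (x : ℝ²) : |f x| ≤ A := by
  have := hA x
  rwa [← h x, norm_real] at this

theorem norm_trig_of_rep
    (h : Rep f T c κ) {A : ℝ} (hA : ∀ x, |f x| ≤ A) (x : ℝ²) : ‖trig T c κ x‖ ≤ A := by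
  rw [← h x, norm_real]
  exact hA x

theorem Rep.rieszO (h : Rep f T c κ) (j : Fin 2) :
    Rep (rieszO j f) T (fun p => rieszSym j (toVec (κ p)) * c p) κ := by
  intro x
  have h1 := h.fourierMul (rieszOSymbol_even j) x
  simp only [rieszSym_toVec]
  exact h1

theorem IsTP.rieszO (hf : IsTP K f) (j : Fin 2) : IsTP K (rieszO j f) :=
  hf.fourierMul (rieszOSymbol_even j)

theorem IsTP.fourierMul_add {f g : Field} (hf : IsTP K f) (hg : IsTP K g)
    {σ : ℤ² → ℝ} (hσ : ∀ k, σ (-k) = σ k) : SQG.fourierMul σ (fun x => f x + g x)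
      = fun x => SQG.fourierMul σ f x + SQG.fourierMul σ g x := by
  refine ((hf.add hg).fourierMul hσ).ext ((hf.fourierMul hσ).add (hg.fourierMul hσ)) fun k => ?_
  rw [(hf.add hg).fourierCoeff_fourierMul hσ, fourierCoeff_add hf.continuous hg.continuous,
    fourierCoeff_add (hf.fourierMul hσ).continuous (hg.fourierMul hσ).continuous,
    hf.fourierCoeff_fourierMul hσ, hg.fourierCoeff_fourierMul hσ]
  ring

theorem IsTP.fourierMul_const_mul (hf : IsTP K f) (a : ℝ) {σ : ℤ² → ℝ} (hσ : ∀ k, σ (-k) = σ k) :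
    SQG.fourierMul σ (fun x => a * f x) = fun x => a * SQG.fourierMul σ f x := by
  refine ((hf.const_mul a).fourierMul hσ).ext ((hf.fourierMul hσ).const_mul a) fun k => ?_
  rw [(hf.const_mul a).fourierCoeff_fourierMul hσ, fourierCoeff_const_mul, fourierCoeff_const_mul,
    hf.fourierCoeff_fourierMul hσ]
  ring

theorem XBound.add {K A B : ℝ} {f g : Field} (hf : IsTP K f) (hg : IsTP K g) (h : XBound f A)
    (h' : XBound g B) : XBound (fun x => f x + g x) (A + B) := by
  refine ⟨fun x => (abs_add_le _ _).trans (add_le_add (h.1 x) (h'.1 x)), fun j x => ?_⟩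
  have e : SQG.rieszO j (fun x => f x + g x) = _ := hf.fourierMul_add hg (rieszOSymbol_even j)
  rw [e]
  exact (abs_add_le _ _).trans (add_le_add (h.2 j x) (h'.2 j x))

theorem XBound.const_mul {K A : ℝ} (hf : IsTP K f) (h : XBound f A) (a : ℝ) :
    XBound (fun x => a * f x) (|a| * A) := by
  have e : ∀ j, SQG.rieszO j (fun x => a * f x) = _ :=
    fun j => hf.fourierMul_const_mul a (rieszOSymbol_even j)
  refine ⟨fun x => ?_, fun j x => ?_⟩
  · rw [abs_mul]
    exact mul_le_mul_of_nonneg_left (h.1 x) (abs_nonneg a)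
  · rw [e j]
    simp only [abs_mul]
    exact mul_le_mul_of_nonneg_left (h.2 j x) (abs_nonneg a)

theorem HomSymbol.xBound_annulus (hψ : IsFreqCutoff ψ) {d : ℝ} {h : ℝ² → ℂ}
    (H : HomSymbol d h) {c₁ c₂ : ℝ} (h1 : 0 < c₁) (h2 : 0 < c₂) :
    ∃ C, 0 ≤ C ∧ ∀ R : ℝ, 0 < R → ∀ (ι : Type) (T : Finset ι) (c : ι → ℂ) (κ : ι → ℤ²) (A : ℝ)
      (F : Field), (∀ p ∈ T, c₁ * R ≤ freqAbs (κ p) ∧ freqAbs (κ p) ≤ c₂ * R) →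
      (∀ x, ‖trig T c κ x‖ ≤ A) → Rep F T (fun p => h (toVec (κ p)) * c p) κ →
        XBound F (C * R ^ d * A) := by
  obtain ⟨C, hC, hb⟩ := H.annulus_bound hψ h1 h2
  have Hj : ∀ j, HomSymbol d fun y => rieszSym j y * h y := fun j =>
    ((homSymbol_rieszSym j).mul H).cast (zero_add d)
  obtain ⟨C₀, hC₀, hb₀⟩ := (Hj 0).annulus_bound hψ h1 h2
  obtain ⟨C₁, hC₁, hb₁⟩ := (Hj 1).annulus_bound hψ h1 h2
  refine ⟨C + C₀ + C₁, by positivity, fun R hR ι T c κ A F hκ hA hF => ?_⟩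
  have hA0 : 0 ≤ A := (norm_nonneg _).trans (hA 0)
  have hRd : 0 ≤ R ^ d := Real.rpow_nonneg hR.le d
  have m0 : 0 ≤ C * R ^ d * A := by positivity
  have m1 : 0 ≤ C₀ * R ^ d * A := by positivity
  have m2 : 0 ≤ C₁ * R ^ d * A := by positivity
  refine ⟨fun x => (abs_le_of_rep hF (hb R hR ι T c κ A hκ hA) x).trans (by nlinarith),
    fun j x => ?_⟩
  have hj := hF.rieszO j
  simp only [← mul_assoc] at hj
  fin_cases j
  · exact (abs_le_of_rep hj (hb₀ R hR ι T c κ A hκ hA) x).trans (by nlinarith)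
  · exact (abs_le_of_rep hj (hb₁ R hR ι T c κ A hκ hA) x).trans (by nlinarith)

theorem HomSymbol.xBound_neg (hψ : IsFreqCutoff ψ) {d : ℝ} (hd : d < 0)
    {h : ℝ² → ℂ} (H : HomSymbol d h) :
    ∃ C, 0 ≤ C ∧ ∀ (ι : Type) (T : Finset ι) (c : ι → ℂ) (κ : ι → ℤ²) (A : ℝ) (F : Field),
      (∀ x, ‖trig T c κ x‖ ≤ A) → Rep F T (fun p => h (toVec (κ p)) * c p) κ → XBound F (C * A) := by
  obtain ⟨C, hC, hb⟩ := H.neg_bound hψ hd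
  have Hj : ∀ j, HomSymbol d fun y => rieszSym j y * h y := fun j =>
    ((homSymbol_rieszSym j).mul H).cast (zero_add d)
  obtain ⟨C₀, hC₀, hb₀⟩ := (Hj 0).neg_bound hψ hd
  obtain ⟨C₁, hC₁, hb₁⟩ := (Hj 1).neg_bound hψ hd
  refine ⟨C + C₀ + C₁, by positivity, fun ι T c κ A F hA hF => ?_⟩
  have hA0 : 0 ≤ A := (norm_nonneg _).trans (hA 0)
  have m0 : 0 ≤ C * A := by positivity
  have m1 : 0 ≤ C₀ * A := by positivity
  have m2 : 0 ≤ C₁ * A := by positivity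
  refine ⟨fun x => (abs_le_of_rep hF (hb ι T c κ A hA) x).trans (by nlinarith),
    fun j x => ?_⟩
  have hj := hF.rieszO j
  simp only [← mul_assoc] at hj
  fin_cases j
  · exact (abs_le_of_rep hj (hb₀ ι T c κ A hA) x).trans (by nlinarith)
  · exact (abs_le_of_rep hj (hb₁ ι T c κ A hA) x).trans (by nlinarith)

/-- The frequencies of `f` have length between `lo` and `hi`. -/
def FreqIn (lo hi : ℝ) (f : Field) : Prop :=
  ∃ T : Finset ℤ², (∀ k ∈ T, lo ≤ freqAbs k ∧ freqAbs k ≤ hi) ∧ Rep f T (fourierCoeff f) id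

theorem Rep.freqIn
    (h : Rep f T c κ) {lo hi : ℝ} (hK : ∀ p ∈ T, lo ≤ freqAbs (κ p) ∧ freqAbs (κ p) ≤ hi) :
    FreqIn lo hi f := by
  classical
  refine ⟨T.image κ, fun k hk => ?_, fun x => ?_⟩
  · obtain ⟨p, hp, rfl⟩ := Finset.mem_image.1 hk
    exact hK p hp
  · rw [h x, trig_eq_image T c κ x (T.image κ) fun p hp => mem_image_of_mem _ hp]
    simp only [trig, h.fourierCoeff, id]

theorem FreqIn.isTP {lo hi : ℝ} (h : FreqIn lo hi f) : IsTP hi f := by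
  obtain ⟨T, hT, hR⟩ := h
  exact hR.isTP fun p hp => (hT p hp).2

theorem FreqIn.mul {lo hi K : ℝ} {f g : Field} (hf : FreqIn lo hi f) (hg : IsTP K g) :
    FreqIn (lo - K) (hi + K) (fun x => f x * g x) := by
  obtain ⟨T, hT, hR⟩ := hf
  refine (Rep.mul hR hg).freqIn fun p hp => ?_
  rw [mem_product] at hp
  have h1 := hT p.1 hp.1
  have h2 := mem_disc.1 hp.2
  have h3 := freqAbs_add_le p.1 p.2
  have h4 := freqAbs_add_le (p.1 + p.2) (-p.2)
  rw [add_neg_cancel_right, freqAbs_neg] at h4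
  exact ⟨by simp only [id]; linarith, by simp only [id]; linarith⟩

theorem FreqIn.mul_left {lo hi K : ℝ} {f g : Field} (hf : FreqIn lo hi f) (hg : IsTP K g) :
    FreqIn (lo - K) (hi + K) (fun x => g x * f x) := by
  simpa only [mul_comm] using hf.mul hg

theorem FreqIn.fourierMul {lo hi : ℝ} (hf : FreqIn lo hi f) {σ : ℤ² → ℝ}
    (hσ : ∀ k, σ (-k) = σ k) : FreqIn lo hi (fourierMul σ f) := by
  obtain ⟨T, hT, hR⟩ := hf
  exact (hR.fourierMul hσ).freqIn hT

theorem FreqIn.dx₁ {lo hi : ℝ} (hf : FreqIn lo hi f) : FreqIn lo hi (dx₁ f) := by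
  obtain ⟨T, hT, hR⟩ := hf
  exact hR.dx₁.freqIn hT

theorem FreqIn.dx₂ {lo hi : ℝ} (hf : FreqIn lo hi f) : FreqIn lo hi (dx₂ f) := by
  obtain ⟨T, hT, hR⟩ := hf
  exact hR.dx₂.freqIn hT

theorem FreqIn.neg {lo hi : ℝ} (hf : FreqIn lo hi f) : FreqIn lo hi (fun x => -f x) := by
  obtain ⟨T, hT, hR⟩ := hf
  have := (hR.const_mul (-1)).freqIn hT
  simpa using this

theorem FreqIn.mono {lo hi lo' hi' : ℝ} (hf : FreqIn lo hi f) (h1 : lo' ≤ lo)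
    (h2 : hi ≤ hi') : FreqIn lo' hi' f := by
  obtain ⟨T, hT, hR⟩ := hf
  exact ⟨T, fun k hk => ⟨h1.trans (hT k hk).1, (hT k hk).2.trans h2⟩, hR⟩

/-! ### The inverse gradient -/

theorem IsTP.invGrad_eq {F : Field × Field} (h₁ : IsTP K F.1) (h₂ : IsTP K F.2) :
    invGrad F = fun x => invLaplacian (SQG.dx₁ F.1) x + invLaplacian (SQG.dx₂ F.2) x :=
  h₁.dx₁.fourierMul_add h₂.dx₂ invLaplacian_even

/-- The symbol of `Δ⁻¹ ∂_a`. -/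
def invGradSym (a : Bool) (y : ℝ²) : ℂ :=
  -I * ((if a then (y.1 : ℂ) else y.2) * (absPow (-2) y : ℂ))

theorem homSymbol_invGradSym (a : Bool) : HomSymbol (-1) (invGradSym a) := by
  unfold invGradSym
  cases a
  · exact ((homSymbol_snd.mul (homSymbol_absPow (-2))).const_mul _).cast (by norm_num)
  · exact ((homSymbol_fst.mul (homSymbol_absPow (-2))).const_mul _).cast (by norm_num)

theorem absPow_neg_two (k : ℤ²) :
    absPow (-2) (toVec k) = -(if k = 0 then 0 else -(freqAbs k ^ 2)⁻¹) := by
  rw [absPow_toVec]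
  split_ifs
  · simp
  · rw [Real.rpow_neg (freqAbs_nonneg k)]
    norm_num

theorem Rep.invLaplacian_dx₁ (h : Rep f T c κ) :
    Rep (invLaplacian (SQG.dx₁ f)) T (fun p => invGradSym true (toVec (κ p)) * c p) κ := by
  intro x
  have h1 := h.dx₁.fourierMul
    (σ := fun k => if k = 0 then 0 else -(freqAbs k ^ 2)⁻¹) invLaplacian_even x
  rw [invLaplacian, h1]
  refine trig_congr (fun p _ => ?_) x
  rw [invGradSym, absPow_neg_two]
  simp only [toVec, if_true]
  push_cast
  ring

theorem Rep.invLaplacian_dx₂ (h : Rep f T c κ) :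
    Rep (invLaplacian (SQG.dx₂ f)) T (fun p => invGradSym false (toVec (κ p)) * c p) κ := by
  intro x
  have h1 := h.dx₂.fourierMul
    (σ := fun k => if k = 0 then 0 else -(freqAbs k ^ 2)⁻¹) invLaplacian_even x
  rw [invLaplacian, h1]
  refine trig_congr (fun p _ => ?_) x
  rw [invGradSym, absPow_neg_two]
  simp only [toVec, if_false, Bool.false_eq_true]
  push_cast
  ring

theorem exists_invGrad_xBound (hψ : IsFreqCutoff ψ) :
    ∃ C, 0 ≤ C ∧ ∀ (K A : ℝ) (F : Field × Field), IsTP K F.1 → IsTP K F.2 →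
      (∀ x, |F.1 x| ≤ A) → (∀ x, |F.2 x| ≤ A) → XBound (invGrad F) (C * A) := by
  obtain ⟨C₁, hC₁, hb₁⟩ := (homSymbol_invGradSym true).xBound_neg hψ (by norm_num)
  obtain ⟨C₂, hC₂, hb₂⟩ := (homSymbol_invGradSym false).xBound_neg hψ (by norm_num)
  refine ⟨C₁ + C₂, by positivity, fun K A F h₁ h₂ hA₁ hA₂ => ?_⟩
  rw [h₁.invGrad_eq h₂, add_mul]
  have r₁ := Rep.invLaplacian_dx₁ h₁
  have r₂ := Rep.invLaplacian_dx₂ h₂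
  exact (hb₁ _ _ _ _ A _ (norm_trig_of_rep h₁ hA₁) r₁).add
    (r₁.isTP fun _ hp => mem_disc.1 hp) (r₂.isTP fun _ hp => mem_disc.1 hp)
    (hb₂ _ _ _ _ A _ (norm_trig_of_rep h₂ hA₂) r₂)

theorem exists_invGrad_xBound_annulus (hψ : IsFreqCutoff ψ) {c₁ c₂ : ℝ}
    (h1 : 0 < c₁) (h2 : 0 < c₂) :
    ∃ C, 0 ≤ C ∧ ∀ R : ℝ, 0 < R → ∀ (A : ℝ) (F : Field × Field), FreqIn (c₁ * R) (c₂ * R) F.1 →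
      FreqIn (c₁ * R) (c₂ * R) F.2 →
      (∀ x, |F.1 x| ≤ A) → (∀ x, |F.2 x| ≤ A) → XBound (invGrad F) (C * R⁻¹ * A) := by
  obtain ⟨C₁, hC₁, hb₁⟩ := (homSymbol_invGradSym true).xBound_annulus hψ h1 h2
  obtain ⟨C₂, hC₂, hb₂⟩ := (homSymbol_invGradSym false).xBound_annulus hψ h1 h2
  refine ⟨C₁ + C₂, by positivity, fun R hR A F h₁ h₂ hA₁ hA₂ => ?_⟩
  rw [h₁.isTP.invGrad_eq h₂.isTP, add_mul, add_mul]
  obtain ⟨T₁, hT₁, R₁⟩ := h₁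
  obtain ⟨T₂, hT₂, R₂⟩ := h₂
  have r₁ := Rep.invLaplacian_dx₁ R₁
  have r₂ := Rep.invLaplacian_dx₂ R₂
  have b₁ := hb₁ R hR _ _ _ _ A _ hT₁ (norm_trig_of_rep R₁ hA₁) r₁
  have b₂ := hb₂ R hR _ _ _ _ A _ hT₂ (norm_trig_of_rep R₂ hA₂) r₂
  rw [Real.rpow_neg_one] at b₁ b₂
  exact b₁.add (r₁.isTP fun _ hp => (hT₁ _ hp).2) (r₂.isTP fun _ hp => (hT₂ _ hp).2) b₂

/-! ### Continuous periodic functions -/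

theorem IsPeriodic.add_int (hf : IsPeriodic f) (m n : ℤ) (a b : ℝ) :
    f (a + m * (2 * π), b + n * (2 * π)) = f (a, b) := by
  have h1 : ∀ b, Function.Periodic (fun s => f (s, b)) (2 * π) := fun b s => (hf (s, b)).1
  have h2 : ∀ a, Function.Periodic (fun s => f (a, s)) (2 * π) := fun a s => (hf (a, s)).2
  exact ((h1 _).int_mul m a).trans ((h2 a).int_mul n b)

theorem exists_trig_near (hc : Continuous f) (hp : IsPeriodic f) {ε : ℝ} (hε : 0 < ε) :
    ∃ (T : Finset ((Fin 2 → ℤ) ⊕ (Fin 2 → ℤ))) (c : _ → ℂ) (κ : _ → ℤ²) (g : Field),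
      Rep g T c κ ∧ ∀ x, |g x - f x| ≤ ε := by
  let pr : (Fin 2 → ℝ) → UnitAddTorus (Fin 2) := Pi.map fun _ => (fun s : ℝ => (s : AddCircle (1 : ℝ)))
  have hπ : IsOpenQuotientMap pr :=
    IsOpenQuotientMap.piMap fun _ => QuotientAddGroup.isOpenQuotientMap_mk
  let f' : C(Fin 2 → ℝ, ℂ) := ⟨fun v => (f (2 * π * v 0, 2 * π * v 1) : ℂ),
    continuous_ofReal.comp (hc.comp
      (by fun_prop : Continuous fun v : Fin 2 → ℝ => (2 * π * v 0, 2 * π * v 1)))⟩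
  let πc : C(Fin 2 → ℝ, UnitAddTorus (Fin 2)) := ⟨pr, hπ.continuous⟩
  have hfib : Function.FactorsThrough f' πc := by
    intro v w hvw
    have h1 : ∀ i, ∃ n : ℤ, v i = w i + n := by
      intro i
      have h2 : ((v i - w i : ℝ) : AddCircle (1 : ℝ)) = 0 := by
        rw [AddCircle.coe_sub, sub_eq_zero]
        exact congrFun hvw i
      rw [AddCircle.coe_eq_zero_iff] at h2
      obtain ⟨n, hn⟩ := h2
      refine ⟨n, ?_⟩
      rw [zsmul_one] at hn
      linarith
    obtain ⟨m, hm⟩ := h1 0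
    obtain ⟨n, hn⟩ := h1 1
    change (f (2 * π * v 0, 2 * π * v 1) : ℂ) = f (2 * π * w 0, 2 * π * w 1)
    rw [← hp.add_int m n (2 * π * w 0), hm, hn]
    congr 3 <;> ring
  have hπq : IsQuotientMap πc := hπ.isQuotientMap
  let F : C(UnitAddTorus (Fin 2), ℂ) := hπq.lift f' hfib
  have hF : ∀ v, F (pr v) = f' v := fun v => by
    have := hπq.lift_comp f' hfib
    exact congrArg (fun G : C(Fin 2 → ℝ, ℂ) => G v) this
  have hcl : F ∈ (Submodule.span ℂ (Set.range (UnitAddTorus.mFourier (d := Fin 2)))).topologicalClosure := by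
    rw [UnitAddTorus.span_mFourier_closure_eq_top]
    trivial
  obtain ⟨P, hP, hd⟩ := Metric.mem_closure_iff.1 hcl ε hε
  obtain ⟨c, hc'⟩ := (Finsupp.mem_span_range_iff_exists_finsupp).1 hP
  let κ : (Fin 2 → ℤ) → ℤ² := fun n => (n 0, n 1)
  have hval : ∀ x : ℝ², P (pr ![x.1 / (2 * π), x.2 / (2 * π)])
      = trig c.support c κ x := by
    intro x
    rw [← hc', Finsupp.sum, ContinuousMap.sum_apply, trig]
    refine sum_congr rfl fun n _ => ?_
    rw [ContinuousMap.smul_apply, smul_eq_mul]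
    congr 1
    simp only [UnitAddTorus.mFourier, ContinuousMap.coe_mk, Fin.prod_univ_two, pr, Pi.map_apply,
      fourier_coe_apply, character, κ, ← Complex.exp_add]
    congr 1
    have hpi : (π : ℂ) ≠ 0 := by exact_mod_cast Real.pi_ne_zero
    simp
    field_simp
  have hnear : ∀ x : ℝ², ‖trig c.support c κ x - f x‖ ≤ ε := by
    intro x
    have hpi := Real.pi_ne_zero
    have e1 : f' ![x.1 / (2 * π), x.2 / (2 * π)] = (f x : ℂ) := by
      change (f (2 * π * (x.1 / (2 * π)), 2 * π * (x.2 / (2 * π))) : ℂ) = _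
      congr 2
      exact Prod.ext (by field_simp) (by field_simp)
    rw [← hval, ← e1, ← hF]
    have := (ContinuousMap.dist_apply_le_dist (f := F) (g := P)
      (pr ![x.1 / (2 * π), x.2 / (2 * π)])).trans hd.le
    rwa [dist_comm, dist_eq_norm] at this
  refine ⟨c.support.disjSum c.support, Sum.elim (fun n => 2⁻¹ * c n)
    (fun n => 2⁻¹ * (starRingEnd ℂ) (c n)), Sum.elim κ (fun n => -κ n),
    fun x => (trig c.support c κ x).re, fun x => ?_, fun x => ?_⟩
  · rw [← trig_add, trig_const_mul, trig_const_mul]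
    have : trig c.support (fun n => (starRingEnd ℂ) (c n)) (fun n => -κ n) x
        = (starRingEnd ℂ) (trig c.support c κ x) := by
      simp only [trig, map_sum, map_mul, conj_character]
    rw [this, ← mul_add, Complex.add_conj]
    push_cast
    ring
  · have h1 := (Complex.abs_re_le_norm (trig c.support c κ x - f x)).trans (hnear x)
    simpa using h1

theorem exists_bound_of_periodic (hc : Continuous f) (hp : IsPeriodic f) : ∃ A, ∀ x, |f x| ≤ A := by
  obtain ⟨T, c, κ, g, hg, hn⟩ := exists_trig_near hc hp one_pos
  refine ⟨∑ p ∈ T, ‖c p‖ + 1, fun x => ?_⟩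
  have h1 : |g x| ≤ ∑ p ∈ T, ‖c p‖ := abs_le_of_rep hg (fun x => by
    refine (norm_sum_le _ _).trans (sum_le_sum fun p _ => ?_)
    rw [norm_mul, norm_character, mul_one]) x
  have h2 := hn x
  rw [abs_le] at h1 h2 ⊢
  constructor <;> linarith

theorem trig_disc_eq {g : Field} {K L : ℝ} (hg : IsTP K g) (σ : ℤ² → ℂ)
    (hσ : ∀ k, L < freqAbs k → σ k = 0) (x : ℝ²) :
    trig (disc L) (fun k => σ k * fourierCoeff g k) id x
      = trig (disc K) (fun k => σ k * fourierCoeff g k) id x := by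
  have h1 : trig (disc L) (fun k => σ k * fourierCoeff g k) id x
      = trig (disc (max K L)) (fun k => σ k * fourierCoeff g k) id x := by
    refine sum_subset (fun k hk => mem_disc.2 ((mem_disc.1 hk).trans (le_max_right _ _)))
      fun k _ hk => ?_
    rw [mem_disc, not_le] at hk
    simp only [hσ k hk, zero_mul]
  have h2 : trig (disc K) (fun k => σ k * fourierCoeff g k) id x
      = trig (disc (max K L)) (fun k => σ k * fourierCoeff g k) id x := by
    refine sum_subset (fun k hk => mem_disc.2 ((mem_disc.1 hk).trans (le_max_left _ _)))
      fun k _ hk => ?_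
    rw [mem_disc, not_le] at hk
    simp only [hg.fourierCoeff_eq_zero hk, mul_zero, zero_mul]
  rw [h1, h2]

theorem IsWiener.integrable_mul {m : ℝ² → ℂ} {M : E2 → ℂ} (h : IsWiener m M)
    (hc : Continuous f) (hp : IsPeriodic f) (R : ℝ) (x : ℝ²) :
    Integrable fun ξ => M ξ * (f (x + R⁻¹ • shift ξ) : ℂ) := by
  obtain ⟨A, hA⟩ := exists_bound_of_periodic hc hp
  refine integrable_mul_of_bounded h.integrable (A := A)
    (continuous_ofReal.comp (hc.comp (continuous_translate continuous_shift x R)))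
    fun ξ => ?_
  rw [norm_real]
  exact hA _

/-- A multiplier with a compactly supported symbol `m (k / R)`, applied to a continuous periodic
function, is an average of translations. -/
theorem IsWiener.disc_sum_eq {m : ℝ² → ℂ} {M : E2 → ℂ} (h : IsWiener m M) {r : ℝ}
    (hr : ∀ y, r ≤ eucl y → m y = 0) {R : ℝ} (hR : 0 < R) (hc : Continuous f)
    (hp : IsPeriodic f) (x : ℝ²) :
    trig (disc (r * R)) (fun k => m (R⁻¹ • toVec k) * fourierCoeff f k) id x
      = ∫ ξ, M ξ * (f (x + R⁻¹ • shift ξ) : ℂ) := by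
  set B := ∑ k ∈ disc (r * R), ‖m (R⁻¹ • toVec k)‖ with hB
  have hB0 : 0 ≤ B := sum_nonneg fun k _ => norm_nonneg _
  have hM0 := mass_nonneg M
  refine eq_of_forall_dist_le fun ε hε => ?_
  have hδ : 0 < ε / (B + mass M + 1) := by positivity
  set δ := ε / (B + mass M + 1) with hδd
  obtain ⟨T, c, κ, g, hg, hn⟩ := exists_trig_near hc hp hδ
  have hgK : IsTP (∑ p ∈ T, freqAbs (κ p)) g := hg.isTP fun p hq =>
    single_le_sum (f := fun p => freqAbs (κ p)) (fun p _ => freqAbs_nonneg _) hq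
  have hgc := hg.continuous
  have e1 : trig (disc (r * R)) (fun k => m (R⁻¹ • toVec k) * fourierCoeff g k) id x
      = ∫ ξ, M ξ * (g (x + R⁻¹ • shift ξ) : ℂ) := by
    rw [trig_disc_eq hgK]
    · have := h.trig_eq (disc (∑ p ∈ T, freqAbs (κ p))) (fourierCoeff g) id R x
      rw [show (fun ξ => M ξ * (g (x + R⁻¹ • shift ξ) : ℂ)) = fun ξ => M ξ *
        trig (disc (∑ p ∈ T, freqAbs (κ p))) (fourierCoeff g) id (x + R⁻¹ • shift ξ) from
        funext fun ξ => by rw [hgK]]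
      exact this
    · intro k hk
      refine hr _ ?_
      rw [eucl_inv_smul hR, le_inv_mul_iff₀ hR, mul_comm]
      exact hk.le
  have e2 : ‖trig (disc (r * R)) (fun k => m (R⁻¹ • toVec k) * fourierCoeff f k) id x
      - trig (disc (r * R)) (fun k => m (R⁻¹ • toVec k) * fourierCoeff g k) id x‖ ≤ B * δ := by
    rw [trig, trig, ← sum_sub_distrib, hB, sum_mul]
    refine (norm_sum_le _ _).trans (sum_le_sum fun k _ => ?_)
    rw [← sub_mul, ← mul_sub, ← fourierCoeff_sub hc hgc, norm_mul, norm_mul, norm_character, mul_one]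
    refine mul_le_mul_of_nonneg_left (norm_fourierCoeff_le (fun y => ?_) k) (norm_nonneg _)
    rw [abs_sub_comm]
    exact hn y
  have hgint : Integrable fun ξ => M ξ * (g (x + R⁻¹ • shift ξ) : ℂ) := by
    obtain ⟨A, hA⟩ := exists_bound_of_periodic hc hp
    refine integrable_mul_of_bounded h.integrable (A := A + δ)
      (continuous_ofReal.comp (hgc.comp (continuous_translate continuous_shift x R)))
      fun ξ => ?_
    rw [norm_real]
    have h1 := hn (x + R⁻¹ • shift ξ)
    have h2 := hA (x + R⁻¹ • shift ξ)
    rw [norm_eq_abs]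
    rw [abs_le] at h1 h2 ⊢
    constructor <;> linarith
  have e3 : ‖(∫ ξ, M ξ * (g (x + R⁻¹ • shift ξ) : ℂ)) - ∫ ξ, M ξ * (f (x + R⁻¹ • shift ξ) : ℂ)‖
      ≤ mass M * δ := by
    rw [← integral_sub hgint (h.integrable_mul hc hp R x)]
    simp only [← mul_sub]
    refine h.norm_integral_le_of_bounded fun ξ => ?_
    rw [← Complex.ofReal_sub, norm_real]
    exact hn _
  rw [dist_eq_norm, ← sub_add_sub_cancel _
    (trig (disc (r * R)) (fun k => m (R⁻¹ • toVec k) * fourierCoeff g k) id x)]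
  refine (norm_add_le _ _).trans ?_
  rw [← e1] at e3
  calc _ ≤ B * δ + mass M * δ := add_le_add e2 e3
    _ ≤ (B + mass M + 1) * δ := by nlinarith
    _ = ε := by rw [hδd]; field_simp

/-! ### The frequency truncation -/

theorem freqTrunc_rep (hψ : IsFreqCutoff ψ) {lam : ℝ} (hl : 0 < lam) (f : Field) :
    Rep (freqTrunc ψ lam f) (disc lam) (fun k => (ψ (lam⁻¹ • toVec k) : ℂ) * fourierCoeff f k) id := by
  intro x
  have e : ∀ k : ℤ², ψ ((k.1 : ℝ) / lam, (k.2 : ℝ) / lam) = ψ (lam⁻¹ • toVec k) := by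
    intro k
    congr 1
    exact Prod.ext (by simp [toVec, div_eq_inv_mul]) (by simp [toVec, div_eq_inv_mul])
  rw [freqTrunc, fourierMul_coe (freqTrunc_even hψ lam), tsum_eq_sum (s := disc lam)]
  · simp only [e]
    rfl
  · intro k hk
    rw [mem_disc, not_le] at hk
    rw [e, hψ.eq_zero_scaled hl (y := toVec k) hk.le]
    simp

theorem isTP_freqTrunc (hψ : IsFreqCutoff ψ) {lam : ℝ} (hl : 0 < lam) (f : Field) :
    IsTP lam (freqTrunc ψ lam f) :=
  (freqTrunc_rep hψ hl f).isTP fun _ hp => mem_disc.1 hp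

theorem fourierCoeff_freqTrunc (hψ : IsFreqCutoff ψ) {lam : ℝ} (hl : 0 < lam) (f : Field) (k : ℤ²) :
    fourierCoeff (freqTrunc ψ lam f) k = (ψ (lam⁻¹ • toVec k) : ℂ) * fourierCoeff f k := by
  rw [(freqTrunc_rep hψ hl f).fourierCoeff]
  simp only [id, Finset.sum_ite_eq']
  split_ifs with hk
  · rfl
  · rw [mem_disc, not_le] at hk
    rw [hψ.eq_zero_scaled hl (y := toVec k) hk.le]
    simp

theorem freqTrunc_eq_integral (hψ : IsFreqCutoff ψ) {M : E2 → ℂ}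
    (hM : IsWiener (fun y => (ψ y : ℂ)) M) {lam : ℝ} (hl : 0 < lam) (hc : Continuous f)
    (hp : IsPeriodic f) (x : ℝ²) :
    ((freqTrunc ψ lam f x : ℝ) : ℂ) = ∫ ξ, M ξ * (f (x + lam⁻¹ • shift ξ) : ℂ) := by
  rw [freqTrunc_rep hψ hl f x]
  have := hM.disc_sum_eq (r := 1) (fun y hy => by rw [hψ.eq_zero y hy]; simp) hl hc hp x
  rw [one_mul] at this
  exact this

/-- Bounds on linear combinations of values are preserved by the frequency truncation. -/
theorem exists_freqTrunc_comb_le (hψ : IsFreqCutoff ψ) :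
    ∃ C, 0 ≤ C ∧ ∀ lam : ℝ, 0 < lam → ∀ f : Field, Continuous f → IsPeriodic f →
      ∀ (a₁ a₂ a₃ B : ℝ) (x₁ x₂ x₃ : ℝ²),
      (∀ h, |a₁ * f (x₁ + h) + a₂ * f (x₂ + h) + a₃ * f (x₃ + h)| ≤ B) →
      |a₁ * freqTrunc ψ lam f x₁ + a₂ * freqTrunc ψ lam f x₂ + a₃ * freqTrunc ψ lam f x₃|
        ≤ C * B := by
  obtain ⟨M, hM⟩ := exists_isWiener_cutoff hψ
  refine ⟨mass M, mass_nonneg M, fun lam hl f hc hp a₁ a₂ a₃ B x₁ x₂ x₃ hB => ?_⟩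
  rw [← norm_eq_abs, ← norm_real]
  push_cast
  simp only [freqTrunc_eq_integral hψ hM hl hc hp]
  have i := fun x => hM.integrable_mul hc hp lam x
  have e := integral_add (((i x₁).const_mul (a₁ : ℂ)).add ((i x₂).const_mul (a₂ : ℂ)))
    ((i x₃).const_mul (a₃ : ℂ))
  have e' := integral_add ((i x₁).const_mul (a₁ : ℂ)) ((i x₂).const_mul (a₂ : ℂ))
  simp only [Pi.add_apply] at e
  rw [← integral_const_mul, ← integral_const_mul, ← integral_const_mul, ← e', ← e]
  have e'' : ∀ ξ, (a₁ * (M ξ * (f (x₁ + lam⁻¹ • shift ξ) : ℂ))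
      + a₂ * (M ξ * (f (x₂ + lam⁻¹ • shift ξ) : ℂ)) + a₃ * (M ξ * (f (x₃ + lam⁻¹ • shift ξ) : ℂ)))
      = M ξ * ((a₁ * f (x₁ + lam⁻¹ • shift ξ) + a₂ * f (x₂ + lam⁻¹ • shift ξ)
        + a₃ * f (x₃ + lam⁻¹ • shift ξ) : ℝ) : ℂ) := by
    intro ξ
    push_cast
    ring
  simp only [e'']
  refine hM.norm_integral_le_of_bounded fun ξ => ?_
  rw [norm_real]
  exact hB _

theorem IsWiener.comp_neg {m : ℝ² → ℂ} {M : E2 → ℂ} (h : IsWiener m M)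
    (he : ∀ y, m (-y) = m y) : IsWiener m (fun ξ => M (-ξ)) where
  cont := h.cont.comp continuous_neg
  integ := by
    have := h.integ.comp_neg
    refine this.congr (of_forall fun ξ => ?_)
    simp [shift, eucl]
  eq y := by
    rw [← he, h.eq, ← integral_neg_eq_self]
    refine integral_congr_ae (of_forall fun ξ => ?_)
    simp [shift, planeWave]

/-- The truncation is accurate to second order. -/
theorem exists_freqTrunc_sub_le (hψ : IsFreqCutoff ψ) :
    ∃ C, 0 ≤ C ∧ ∀ lam : ℝ, 0 < lam → ∀ f : Field, Continuous f → IsPeriodic f → ∀ B : ℝ,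
      (∀ x y, |f (x + y) + f (x - y) - 2 * f x| ≤ B * eucl y ^ 2) →
      ∀ x, |freqTrunc ψ lam f x - f x| ≤ C * (lam⁻¹ ^ 2 * B) := by
  obtain ⟨M, hM⟩ := exists_isWiener_cutoff hψ
  refine ⟨mass M, mass_nonneg M, fun lam hl f hc hp B hB x => ?_⟩
  have hB0 : 0 ≤ B := by
    have := (abs_nonneg _).trans (hB 0 (1, 0))
    simpa [eucl] using this
  have hM' := hM.comp_neg fun y => by rw [hψ.even]
  have e1 := freqTrunc_eq_integral hψ hM hl hc hp x
  have e2 := freqTrunc_eq_integral hψ hM' hl hc hp x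
  rw [← integral_neg_eq_self] at e2
  have e3 : ∫ ξ, M ξ = 1 := by
    have := hM.eq 0
    simp only [planeWave_zero, mul_one] at this
    rw [← this, hψ.eq_one 0 (by simp [eucl])]
    simp
  have hs : ∀ ξ : E2, shift (-ξ) = -shift ξ := fun ξ => by simp [shift]
  simp only [neg_neg, hs, smul_neg, ← sub_eq_add_neg] at e2
  have i1 := hM.integrable_mul hc hp lam x
  have i2 : Integrable fun ξ => M ξ * (f (x - lam⁻¹ • shift ξ) : ℂ) := by
    have := (hM'.integrable_mul hc hp lam x).comp_neg
    refine this.congr (of_forall fun ξ => ?_)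
    simp only [neg_neg, hs, smul_neg, ← sub_eq_add_neg]
  have e4 : ((freqTrunc ψ lam f x - f x : ℝ) : ℂ)
      = ∫ ξ, M ξ * ((2⁻¹ * (f (x + lam⁻¹ • shift ξ) + f (x - lam⁻¹ • shift ξ) - 2 * f x) : ℝ) : ℂ) := by
    have h1 : ((freqTrunc ψ lam f x - f x : ℝ) : ℂ)
        = 2⁻¹ * ((freqTrunc ψ lam f x : ℂ) + (freqTrunc ψ lam f x : ℂ)) - 1 * (f x : ℂ) := by
      push_cast
      ring
    rw [h1]
    nth_rewrite 1 [e1]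
    rw [e2, ← e3, ← integral_add i1 i2, ← integral_const_mul, ← integral_mul_const]
    refine (integral_sub ((i1.add i2).const_mul _) (hM.integrable.mul_const _)).symm.trans ?_
    refine integral_congr_ae (of_forall fun ξ => ?_)
    simp only [Pi.add_apply]
    push_cast
    ring
  rw [← norm_eq_abs, ← norm_real, e4]
  refine hM.norm_integral_le fun ξ => ?_
  rw [norm_real, norm_mul]
  have h5 := hB x (lam⁻¹ • shift ξ)
  rw [eucl_inv_smul hl] at h5
  have h6 : ‖(2⁻¹ : ℝ)‖ = 2⁻¹ := by norm_num
  rw [h6, norm_eq_abs]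
  have h7 : 0 ≤ lam⁻¹ ^ 2 * B := by positivity
  calc _ ≤ 2⁻¹ * (B * (lam⁻¹ * eucl (shift ξ)) ^ 2) := by gcongr
    _ = lam⁻¹ ^ 2 * B * (2⁻¹ * eucl (shift ξ) ^ 2) := by ring
    _ ≤ _ := by
      refine mul_le_mul_of_nonneg_left ?_ h7
      nlinarith [sq_nonneg (eucl (shift ξ))]

/-! ### Differentiation of Fourier coefficients -/

theorem hasDerivAt_parametric_integral {F F' : ℝ → ℝ → ℂ}
    (hF : Continuous fun p : ℝ² => F p.1 p.2) (hF' : Continuous fun p : ℝ² => F' p.1 p.2)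
    (hd : ∀ a b, HasDerivAt (fun s => F s b) (F' a b) a) (c d a : ℝ) :
    HasDerivAt (fun s => ∫ b in c..d, F s b) (∫ b in c..d, F' a b) a := by
  obtain ⟨B, hB⟩ := ((isCompact_closedBall a 1).prod (isCompact_uIcc (a := c) (b := d))).exists_bound_of_continuousOn
    hF'.continuousOn
  refine (intervalIntegral.hasDerivAt_integral_of_dominated_loc_of_deriv_le (F := F) (F' := F')
    (bound := fun _ => B) (Metric.ball_mem_nhds a one_pos) ?_ ?_ ?_ ?_ ?_ ?_).2
  · exact of_forall fun s => (hF.comp (by fun_prop : Continuous fun b : ℝ => (s, b))).aestronglyMeasurable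
  · exact (hF.comp (by fun_prop : Continuous fun b : ℝ => (a, b))).intervalIntegrable _ _
  · exact (hF'.comp (by fun_prop : Continuous fun b : ℝ => (a, b))).aestronglyMeasurable
  · refine of_forall fun b hb s hs => hB (s, b) ⟨Metric.ball_subset_closedBall hs, ?_⟩
    exact Set.uIoc_subset_uIcc hb
  · exact intervalIntegrable_const
  · exact of_forall fun b _ s _ => hd s b

theorem dx₁_hasDerivAt (hf : Differentiable ℝ f) (x : ℝ²) :
    HasDerivAt (fun s => f (s, x.2)) (dx₁ f x) x.1 := by
  have h : DifferentiableAt ℝ (fun s => f (s, x.2)) x.1 :=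
    (hf _).comp x.1 (differentiableAt_id.prodMk (differentiableAt_const _))
  exact h.hasDerivAt

theorem dx₂_hasDerivAt (hf : Differentiable ℝ f) (x : ℝ²) :
    HasDerivAt (fun s => f (x.1, s)) (dx₂ f x) x.2 := by
  have h : DifferentiableAt ℝ (fun s => f (x.1, s)) x.2 :=
    (hf _).comp x.2 ((differentiableAt_const _).prodMk differentiableAt_id)
  exact h.hasDerivAt

theorem dx₁_eq_fderiv (hf : Differentiable ℝ f) (x : ℝ²) : dx₁ f x = fderiv ℝ f x (1, 0) := by
  have h := ((hf x).hasFDerivAt).comp_hasDerivAt x.1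
    ((hasDerivAt_id x.1).prodMk (hasDerivAt_const x.1 x.2))
  exact h.deriv

theorem dx₂_eq_fderiv (hf : Differentiable ℝ f) (x : ℝ²) : dx₂ f x = fderiv ℝ f x (0, 1) := by
  have h := ((hf x).hasFDerivAt).comp_hasDerivAt x.2
    ((hasDerivAt_const x.2 x.1).prodMk (hasDerivAt_id x.2))
  exact h.deriv

theorem contDiff_dx₁ {n : ℕ} (hf : ContDiff ℝ (n + 1 : ℕ) f) : ContDiff ℝ (n : ℕ) (dx₁ f) := by
  have hd : Differentiable ℝ f := hf.differentiable (by simp)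
  rw [funext (dx₁_eq_fderiv hd)]
  exact (hf.fderiv_right (by norm_cast)).clm_apply contDiff_const

theorem contDiff_dx₂ {n : ℕ} (hf : ContDiff ℝ (n + 1 : ℕ) f) : ContDiff ℝ (n : ℕ) (dx₂ f) := by
  have hd : Differentiable ℝ f := hf.differentiable (by simp)
  rw [funext (dx₂_eq_fderiv hd)]
  exact (hf.fderiv_right (by norm_cast)).clm_apply contDiff_const

theorem IsPeriodic.dx₁ (hp : IsPeriodic f) : IsPeriodic (dx₁ f) := by
  intro x
  constructor
  · change deriv (fun s => f (s, x.2)) (x.1 + 2 * π) = deriv (fun s => f (s, x.2)) x.1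
    rw [← deriv_comp_add_const]
    congr 1
    funext s
    exact (hp (s, x.2)).1
  · change deriv (fun s => f (s, x.2 + 2 * π)) x.1 = deriv (fun s => f (s, x.2)) x.1
    congr 1
    funext s
    exact (hp (s, x.2)).2

theorem IsPeriodic.dx₂ (hp : IsPeriodic f) : IsPeriodic (dx₂ f) := by
  intro x
  constructor
  · change deriv (fun s => f (x.1 + 2 * π, s)) x.2 = deriv (fun s => f (x.1, s)) x.2
    congr 1
    funext s
    exact (hp (x.1, s)).1
  · change deriv (fun s => f (x.1, s)) (x.2 + 2 * π) = deriv (fun s => f (x.1, s)) x.2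
    rw [← deriv_comp_add_const]
    congr 1
    funext s
    exact (hp (x.1, s)).2

theorem character_add_two_pi (k : ℤ²) (x : ℝ²) : character k (x.1 + 2 * π, x.2) = character k x ∧
      character k (x.1, x.2 + 2 * π) = character k x := by
  constructor
  · unfold character
    rw [← mul_one (Complex.exp (I * (k.1 * (x.1 : ℂ) + k.2 * (x.2 : ℂ)))),
      ← Complex.exp_int_mul_two_pi_mul_I k.1, ← Complex.exp_add]
    congr 1
    push_cast
    ring
  · unfold character
    rw [← mul_one (Complex.exp (I * (k.1 * (x.1 : ℂ) + k.2 * (x.2 : ℂ)))),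
      ← Complex.exp_int_mul_two_pi_mul_I k.2, ← Complex.exp_add]
    congr 1
    push_cast
    ring

theorem fourierCoeff_dx₁ (hf : ContDiff ℝ (1 : ℕ) f) (hp : IsPeriodic f) (k : ℤ²) :
    fourierCoeff (dx₁ f) k = I * k.1 * fourierCoeff f k := by
  have hd : Differentiable ℝ f := hf.differentiable (by simp)
  have hc' : Continuous (dx₁ f) := (contDiff_dx₁ (n := 0) hf).continuous
  let F : ℝ → ℝ → ℂ := fun a b => (f (a, b) : ℂ) * character (-k) (a, b)
  let G : ℝ → ℝ → ℂ := fun a b => (dx₁ f (a, b) : ℂ) * character (-k) (a, b)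
  let F' : ℝ → ℝ → ℂ := fun a b => G a b - I * k.1 * F a b
  have hF : Continuous fun p : ℝ² => F p.1 p.2 :=
    (continuous_ofReal.comp hf.continuous).mul (continuous_character _)
  have hG : Continuous fun p : ℝ² => G p.1 p.2 :=
    (continuous_ofReal.comp hc').mul (continuous_character _)
  have hF' : Continuous fun p : ℝ² => F' p.1 p.2 := hG.sub (continuous_const.mul hF)
  have hder : ∀ a b, HasDerivAt (fun s => F s b) (F' a b) a := by
    intro a b
    have h1 := (dx₁_hasDerivAt hd (a, b)).ofReal_comp
    have h2 := hasDerivAt_character_fst (-k) (a, b)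
    refine (h1.mul h2).congr_deriv ?_
    simp only [F', F, G, Prod.fst_neg]
    push_cast
    ring
  have hI := fun a => hasDerivAt_parametric_integral hF hF' hder 0 (2 * π) a
  have hcI : Continuous fun a => ∫ b in (0 : ℝ)..(2 * π), F' a b := continuous_inner_integral hF'
  have h3 := intervalIntegral.integral_eq_sub_of_hasDerivAt (a := 0) (b := 2 * π)
    (fun a _ => hI a) (hcI.intervalIntegrable _ _)
  have h4 : ∀ b, F (2 * π) b = F 0 b := by
    intro b
    have e1 := (hp (0, b)).1
    have e2 := (character_add_two_pi (-k) (0, b)).1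
    simp only [zero_add] at e1 e2
    simp only [F, e1, e2]
  simp only [h4, sub_self] at h3
  have h5 : ∀ a, ∫ b in (0 : ℝ)..(2 * π), F' a b
      = (∫ b in (0 : ℝ)..(2 * π), G a b)
        - I * k.1 * ∫ b in (0 : ℝ)..(2 * π), F a b := by
    intro a
    rw [← intervalIntegral.integral_const_mul]
    exact intervalIntegral.integral_sub
      ((hG.comp (by fun_prop : Continuous fun b : ℝ => (a, b))).intervalIntegrable _ _)
      ((continuous_const.mul (hF.comp (by fun_prop : Continuous fun b : ℝ => (a, b)))).intervalIntegrable _ _)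
  simp only [h5] at h3
  have cG : Continuous fun a => ∫ b in (0 : ℝ)..(2 * π), G a b := continuous_inner_integral hG
  have cF : Continuous fun a => I * k.1 * ∫ b in (0 : ℝ)..(2 * π), F a b :=
    continuous_const.mul (continuous_inner_integral hF)
  rw [intervalIntegral.integral_sub (cG.intervalIntegrable _ _) (cF.intervalIntegrable _ _),
    intervalIntegral.integral_const_mul, sub_eq_zero] at h3
  unfold fourierCoeff
  change _ * (∫ a in (0 : ℝ)..(2 * π), ∫ b in (0 : ℝ)..(2 * π), G a b) = _
  rw [h3]
  ring

theorem fourierCoeff_dx₂ (hf : ContDiff ℝ (1 : ℕ) f) (hp : IsPeriodic f) (k : ℤ²) :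
    fourierCoeff (dx₂ f) k = I * k.2 * fourierCoeff f k := by
  have hd : Differentiable ℝ f := hf.differentiable (by simp)
  have hc' : Continuous (dx₂ f) := (contDiff_dx₂ (n := 0) hf).continuous
  have key : ∀ a : ℝ, ∫ b in (0 : ℝ)..(2 * π), (dx₂ f (a, b) : ℂ) * character (-k) (a, b)
      = I * k.2 * ∫ b in (0 : ℝ)..(2 * π), (f (a, b) : ℂ) * character (-k) (a, b) := by
    intro a
    have hs : Continuous fun b : ℝ => (a, b) := by fun_prop
    have c1 : Continuous fun b : ℝ => (dx₂ f (a, b) : ℂ) * character (-k) (a, b) :=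
      ((continuous_ofReal.comp hc').mul (continuous_character _)).comp hs
    have c2 : Continuous fun b : ℝ => (f (a, b) : ℂ) * character (-k) (a, b) :=
      ((continuous_ofReal.comp hf.continuous).mul (continuous_character _)).comp hs
    have hder : ∀ b, HasDerivAt (fun s => (f (a, s) : ℂ) * character (-k) (a, s))
        ((dx₂ f (a, b) : ℂ) * character (-k) (a, b)
          - I * k.2 * ((f (a, b) : ℂ) * character (-k) (a, b))) b := by
      intro b
      have h1 := (dx₂_hasDerivAt hd (a, b)).ofReal_comp
      have h2 := hasDerivAt_character_snd (-k) (a, b)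
      refine (h1.mul h2).congr_deriv ?_
      simp only [Prod.snd_neg]
      push_cast
      ring
    have h3 := intervalIntegral.integral_eq_sub_of_hasDerivAt (a := 0) (b := 2 * π)
      (fun b _ => hder b) ((c1.sub (continuous_const.mul c2)).intervalIntegrable _ _)
    have e1 := (hp (a, 0)).2
    have e2 := (character_add_two_pi (-k) (a, 0)).2
    simp only [zero_add] at e1 e2
    have c3 : Continuous fun b : ℝ => I * k.2 * ((f (a, b) : ℂ) * character (-k) (a, b)) :=
      continuous_const.mul c2
    rw [e1, e2, sub_self, intervalIntegral.integral_sub (c1.intervalIntegrable _ _)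
      (c3.intervalIntegrable _ _), intervalIntegral.integral_const_mul,
      sub_eq_zero] at h3
    exact h3
  unfold fourierCoeff
  simp only [key, intervalIntegral.integral_const_mul]
  ring

theorem iterate_dx₁ {n : ℕ} (j : ℕ) (hf : ContDiff ℝ (n + j : ℕ) f) (hp : IsPeriodic f) :
    ContDiff ℝ (n : ℕ) (dx₁^[j] f) ∧ IsPeriodic (dx₁^[j] f) ∧
      ∀ k, fourierCoeff (dx₁^[j] f) k = (I * k.1) ^ j * fourierCoeff f k := by
  induction j generalizing n with
  | zero => exact ⟨hf, hp, fun k => by simp⟩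
  | succ j ih =>
    obtain ⟨h1, h2, h3⟩ := ih (n := n + 1) (by rwa [add_right_comm, ← add_assoc] at *)
    rw [Function.iterate_succ_apply']
    refine ⟨contDiff_dx₁ h1, h2.dx₁, fun k => ?_⟩
    rw [fourierCoeff_dx₁ (h1.of_le (by norm_cast; omega)) h2, h3]
    ring

theorem iterate_dx₂ {n : ℕ} (j : ℕ) (hf : ContDiff ℝ (n + j : ℕ) f) (hp : IsPeriodic f) :
    ContDiff ℝ (n : ℕ) (dx₂^[j] f) ∧ IsPeriodic (dx₂^[j] f) ∧
      ∀ k, fourierCoeff (dx₂^[j] f) k = (I * k.2) ^ j * fourierCoeff f k := by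
  induction j generalizing n with
  | zero => exact ⟨hf, hp, fun k => by simp⟩
  | succ j ih =>
    obtain ⟨h1, h2, h3⟩ := ih (n := n + 1) (by rwa [add_right_comm, ← add_assoc] at *)
    rw [Function.iterate_succ_apply']
    refine ⟨contDiff_dx₂ h1, h2.dx₂, fun k => ?_⟩
    rw [fourierCoeff_dx₂ (h1.of_le (by norm_cast; omega)) h2, h3]
    ring

theorem multiDeriv_prop (β : ℕ × ℕ) (hf : ContDiff ℝ (β.1 + β.2 : ℕ) f) (hp : IsPeriodic f) :
    Continuous (multiDeriv β f) ∧ IsPeriodic (multiDeriv β f) ∧ ∀ k, fourierCoeff (multiDeriv β f) k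
      = (I * k.1) ^ β.1 * (I * k.2) ^ β.2 * fourierCoeff f k := by
  obtain ⟨h1, h2, h3⟩ := iterate_dx₂ (n := β.1) β.2 hf hp
  obtain ⟨h4, h5, h6⟩ := iterate_dx₁ (n := 0) β.1 (by rwa [zero_add]) h2
  refine ⟨h4.continuous, h5, fun k => ?_⟩
  rw [multiDeriv, h6, h3]
  ring

/-! ### Hölder functions -/

theorem abs_sub_le_of_holder {θ B : ℝ} {F : Field} (hB : 0 ≤ B)
    (h : holderSeminorm θ F ≤ ofReal B) (x y : ℝ²) : |F x - F y| ≤ B * eucl (x - y) ^ θ := by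
  by_cases hxy : x = y
  · rw [hxy, sub_self, abs_zero]
    exact mul_nonneg hB (Real.rpow_nonneg (eucl_nonneg _) _)
  · have hpos : 0 < eucl (x - y) ^ θ := rpow_pos_of_pos (eucl_pos (sub_ne_zero.2 hxy)) θ
    have h1 : ‖F x - F y‖ₑ / ofReal (eucl (x - y) ^ θ) ≤ ofReal B := by
      refine le_trans ?_ h
      exact le_iSup_of_le x (le_iSup_of_le y (le_iSup_of_le hxy le_rfl))
    rw [Real.enorm_eq_ofReal_abs, ← ENNReal.ofReal_div_of_pos hpos,
      ENNReal.ofReal_le_ofReal_iff hB, div_le_iff₀ hpos] at h1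
    exact h1

theorem holderSeminorm_le_holderNorm {s : ℝ} {β : ℕ × ℕ} (hβ : β ∈ antidiagonal ⌊s⌋₊) :
    holderSeminorm (s - ⌊s⌋₊) (multiDeriv β f) ≤ holderNorm s f := by
  refine le_trans ?_ le_add_self
  exact single_le_sum (f := fun β => holderSeminorm (s - ⌊s⌋₊) (multiDeriv β f))
    (fun _ _ => zero_le) hβ

/-- Littlewood–Paley pieces of Hölder functions decay. -/
theorem HomSymbol.holder_piece (hψ : IsFreqCutoff ψ) {d s : ℝ} (hs : 0 ≤ s)
    {h : ℝ² → ℂ} (H : HomSymbol d h) :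
    ∃ C, 0 ≤ C ∧ ∀ R : ℝ, 0 < R → ∀ f : Field, IsPeriodic f → ContDiff ℝ ⌊s⌋₊ f → ∀ B : ℝ, 0 ≤ B →
      holderNorm s f ≤ ofReal B → ∀ x, ‖trig (disc R) (fun k =>
        (annulusCut ψ 1 (1 / 2) (R⁻¹ • toVec k) : ℂ) * h (toVec k) * fourierCoeff f k) id x‖
          ≤ C * R ^ (d - s) * B := by
  set n := ⌊s⌋₊ with hn
  set θ := s - n with hθ
  have hθ0 : 0 ≤ θ := sub_nonneg.2 (Nat.floor_le hs)
  have hθ1 : θ ≤ 1 := by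
    have := Nat.lt_floor_add_one s
    rw [hθ]
    linarith
  let hb : ℕ × ℕ → ℝ² → ℂ := fun β y => h y * ((n.choose β.1 : ℂ) * (-I) ^ n
    * ((y.1 : ℂ) ^ β.1 * (y.2 : ℂ) ^ β.2) * (absPow (-(2 * n : ℝ)) y : ℂ))
  have hbs : ∀ β y, y ≠ 0 → ContDiffAt ℝ (⊤ : ℕ∞) (hb β) y := by
    intro β y hy
    refine (H.smooth y hy).mul (ContDiffAt.mul (contDiffAt_const.mul ?_)
      ((homSymbol_absPow _).smooth y hy))
    exact ((homSymbol_fst.smooth y hy).pow _).mul ((homSymbol_snd.smooth y hy).pow _)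
  choose M hM using fun β => exists_isWiener_annulus hψ (hbs β) one_pos (by norm_num : (0 : ℝ) < 1 / 2)
  refine ⟨∑ β ∈ antidiagonal n, mass (M β),
    sum_nonneg fun β _ => mass_nonneg _, fun R hR f hp hf B hB hfB x => ?_⟩
  have hRn : 0 < R ^ (d - n) := rpow_pos_of_pos hR _
  have e1 : ∀ k ∈ disc R, (annulusCut ψ 1 (1 / 2) (R⁻¹ • toVec k) : ℂ) * h (toVec k)
      * fourierCoeff f k = ((R ^ (d - n) : ℝ) : ℂ) * ∑ β ∈ antidiagonal n,
        ((annulusCut ψ 1 (1 / 2) (R⁻¹ • toVec k) : ℂ) * hb β (R⁻¹ • toVec k))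
          * fourierCoeff (multiDeriv β f) k := by
    intro k _
    by_cases hk : k = 0
    · have : annulusCut ψ 1 (1 / 2) (R⁻¹ • toVec k) = 0 := by
        rw [hk, toVec_eq_zero.2 rfl, smul_zero]
        exact (annulusCut_eventually_zero hψ one_pos (by norm_num)).self_of_nhds
      rw [this]
      simp
    · set y := R⁻¹ • toVec k with hy
      have hy0 : y ≠ 0 := smul_ne_zero (inv_ne_zero hR.ne') (fun h => hk (toVec_eq_zero.1 h))
      have hpow : (absPow (-(2 * n : ℝ)) y) * (y.1 ^ 2 + y.2 ^ 2) ^ n = 1 := by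
        rw [absPow, if_neg hy0, ← eucl_sq, ← pow_mul, Real.rpow_neg (eucl_nonneg y)]
        have : eucl y ^ (2 * n : ℝ) = eucl y ^ (2 * n) := by
          rw [← Real.rpow_natCast]
          norm_num
        rw [this, inv_mul_cancel₀ (pow_ne_zero _ (eucl_pos hy0).ne')]
      have hpowC : ((absPow (-(2 * n : ℝ)) y : ℝ) : ℂ) * ((y.1 : ℂ) ^ 2 + (y.2 : ℂ) ^ 2) ^ n = 1 := by
        exact_mod_cast hpow
      rw [(Commute.all _ _).add_pow', mul_sum] at hpowC
      have hk1 : (k.1 : ℂ) = R * (y.1 : ℂ) := by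
        rw [hy]
        simp only [toVec, Prod.smul_fst, smul_eq_mul]
        push_cast
        rw [← mul_assoc, mul_inv_cancel₀ (by exact_mod_cast hR.ne'), one_mul]
      have hk2 : (k.2 : ℂ) = R * (y.2 : ℂ) := by
        rw [hy]
        simp only [toVec, Prod.smul_snd, smul_eq_mul]
        push_cast
        rw [← mul_assoc, mul_inv_cancel₀ (by exact_mod_cast hR.ne'), one_mul]
      have hterm : ∀ β ∈ antidiagonal n,
          ((annulusCut ψ 1 (1 / 2) y : ℂ) * hb β y) * fourierCoeff (multiDeriv β f) k
          = ((annulusCut ψ 1 (1 / 2) y : ℂ) * h y * ((R : ℂ) ^ n) * fourierCoeff f k)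
            * (((absPow (-(2 * n : ℝ)) y : ℝ) : ℂ)
              * (n.choose β.1 • (((y.1 : ℂ) ^ 2) ^ β.1 * ((y.2 : ℂ) ^ 2) ^ β.2))) := by
        intro β hβ
        rw [Finset.HasAntidiagonal.mem_antidiagonal] at hβ
        rw [(multiDeriv_prop β (by rw [hβ]; exact hf) hp).2.2, hk1, hk2]
        simp only [hb, nsmul_eq_mul]
        have hI : (-I) ^ n * (I ^ β.1 * I ^ β.2) = 1 := by
          rw [← pow_add, hβ, ← mul_pow]
          simp
        have hRp : (R : ℂ) ^ n = R ^ β.1 * R ^ β.2 := by rw [← pow_add, hβ]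
        rw [hRp]
        simp only [mul_pow]
        linear_combination ((annulusCut ψ 1 (1 / 2) y : ℂ) * h y * (n.choose β.1 : ℂ)
          * ((y.1 : ℂ) ^ β.1 * (y.2 : ℂ) ^ β.2) * (absPow (-(2 * n : ℝ)) y : ℂ)
          * (R ^ β.1 * (y.1 : ℂ) ^ β.1 * (R ^ β.2 * (y.2 : ℂ) ^ β.2)) * fourierCoeff f k) * hI
      rw [sum_congr rfl hterm, ← mul_sum, hpowC, mul_one,
        H.eq_rescale hR (toVec k), ← hy]
      have hRd : ((R ^ d : ℝ) : ℂ) = ((R ^ (d - n) : ℝ) : ℂ) * (R : ℂ) ^ n := by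
        rw [← Complex.ofReal_pow, ← Complex.ofReal_mul, ← Real.rpow_natCast, ← Real.rpow_add hR]
        congr 2
        ring
      rw [hRd]
      ring
  rw [trig_congr e1, trig_const_mul, norm_mul, norm_real, Real.norm_of_nonneg hRn.le]
  have e2 : trig (disc R) (fun k => ∑ β ∈ antidiagonal n,
        ((annulusCut ψ 1 (1 / 2) (R⁻¹ • toVec k) : ℂ) * hb β (R⁻¹ • toVec k))
          * fourierCoeff (multiDeriv β f) k) id x
      = ∑ β ∈ antidiagonal n, trig (disc R) (fun k =>
        ((annulusCut ψ 1 (1 / 2) (R⁻¹ • toVec k) : ℂ) * hb β (R⁻¹ • toVec k))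
          * fourierCoeff (multiDeriv β f) k) id x := by
    simp only [trig, sum_mul]
    exact sum_comm
  have e3 : ∀ β ∈ antidiagonal n, ‖trig (disc R) (fun k =>
        ((annulusCut ψ 1 (1 / 2) (R⁻¹ • toVec k) : ℂ) * hb β (R⁻¹ • toVec k))
          * fourierCoeff (multiDeriv β f) k) id x‖ ≤ mass (M β) * (R ^ (-θ) * B) := by
    intro β hβ
    have hβ' := Finset.HasAntidiagonal.mem_antidiagonal.1 hβ
    obtain ⟨c1, c2, -⟩ := multiDeriv_prop β (by rw [hβ']; exact hf) hp
    have h1 := (hM β).disc_sum_eq (r := 1) (fun y hy => by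
      rw [annulusCut_eq_zero_of_ge hψ one_pos (by norm_num) (by norm_num; exact hy)]
      simp) hR c1 c2 x
    rw [one_mul] at h1
    rw [h1]
    have hz : ∫ ξ, M β ξ = 0 := by
      have := (hM β).eq 0
      simp only [planeWave_zero, mul_one] at this
      rw [← this, (annulusCut_eventually_zero hψ one_pos (by norm_num)).self_of_nhds]
      simp
    have hz' : ∫ ξ, M β ξ * (multiDeriv β f x : ℂ) = 0 := by rw [integral_mul_const, hz, zero_mul]
    rw [← sub_zero (∫ ξ, _), ← hz', ← integral_sub ((hM β).integrable_mul c1 c2 R x)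
      ((hM β).integrable.mul_const _)]
    simp only [← mul_sub]
    refine (hM β).norm_integral_le fun ξ => ?_
    rw [← Complex.ofReal_sub, norm_real]
    have h2 := abs_sub_le_of_holder hB ((holderSeminorm_le_holderNorm hβ).trans hfB)
      (x + R⁻¹ • shift ξ) x
    rw [add_sub_cancel_left, eucl_inv_smul hR, Real.mul_rpow (inv_nonneg.2 hR.le) (eucl_nonneg _),
      Real.inv_rpow hR.le, ← Real.rpow_neg hR.le] at h2
    refine h2.trans ?_
    have h3 : eucl (shift ξ) ^ θ ≤ 1 + eucl (shift ξ) ^ 2 := by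
      rcases le_total (eucl (shift ξ)) 1 with hle | hle
      · exact (Real.rpow_le_one (eucl_nonneg _) hle hθ0).trans (by nlinarith [sq_nonneg (eucl (shift ξ))])
      · calc eucl (shift ξ) ^ θ ≤ eucl (shift ξ) ^ (1 : ℝ) := Real.rpow_le_rpow_of_exponent_le hle hθ1
          _ = eucl (shift ξ) := Real.rpow_one _
          _ ≤ _ := by nlinarith
    have h4 : 0 < R ^ (-θ) := rpow_pos_of_pos hR _
    calc B * (R ^ (-θ) * eucl (shift ξ) ^ θ) ≤ B * (R ^ (-θ) * (1 + eucl (shift ξ) ^ 2)) := by gcongr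
      _ = _ := by ring
  rw [e2]
  calc R ^ (d - n) * ‖∑ β ∈ antidiagonal n, _‖
      ≤ R ^ (d - n) * ∑ β ∈ antidiagonal n, mass (M β) * (R ^ (-θ) * B) := by
        gcongr
        exact (norm_sum_le _ _).trans (sum_le_sum e3)
    _ = (∑ β ∈ antidiagonal n, mass (M β)) * (R ^ (d - n) * R ^ (-θ)) * B := by
        rw [← sum_mul]
        ring
    _ = _ := by
        rw [← Real.rpow_add hR]
        congr 3
        rw [hθ]
        ring

/-! ### Truncations of Hölder functions -/

/-- `A` bounds the first-order quantities `∂₁ f`, `∂₂ f`, `Λ f`. -/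
def WBound (f : Field) (A : ℝ) : Prop :=
  (∀ x, |dx₁ f x| ≤ A) ∧ (∀ x, |dx₂ f x| ≤ A) ∧ ∀ x, |lambdaPow 1 f x| ≤ A

theorem WBound.nonneg {A : ℝ} (h : WBound f A) : 0 ≤ A := (abs_nonneg _).trans (h.1 0)

theorem WBound.mono {A B : ℝ} (h : WBound f A) (hAB : A ≤ B) : WBound f B :=
  ⟨fun x => (h.1 x).trans hAB, fun x => (h.2.1 x).trans hAB, fun x => (h.2.2 x).trans hAB⟩

/-- The symbols of `∂₁`, `∂₂`, `Λ`. -/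
def gradSym : Fin 3 → ℝ² → ℂ
  | 0 => fun y => I * (y.1 : ℂ)
  | 1 => fun y => I * (y.2 : ℂ)
  | 2 => fun y => (absPow 1 y : ℂ)

theorem homSymbol_gradSym (i : Fin 3) : HomSymbol 1 (gradSym i) := by
  fin_cases i
  · exact homSymbol_fst.const_mul _
  · exact homSymbol_snd.const_mul _
  · exact homSymbol_absPow 1

theorem Rep.gradSym (h : Rep f T c κ) :
    Rep (SQG.dx₁ f) T (fun p => gradSym 0 (toVec (κ p)) * c p) κ ∧
    Rep (SQG.dx₂ f) T (fun p => SQG.gradSym 1 (toVec (κ p)) * c p) κ ∧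
    Rep (lambdaPow 1 f) T (fun p => SQG.gradSym 2 (toVec (κ p)) * c p) κ := by
  refine ⟨fun x => ?_, fun x => ?_, fun x => ?_⟩
  · rw [h.dx₁ x]
    exact trig_congr (fun p _ => by simp [SQG.gradSym, toVec]) x
  · rw [h.dx₂ x]
    exact trig_congr (fun p _ => by simp [SQG.gradSym, toVec]) x
  · have h1 := h.fourierMul (σ := fun k => if k = 0 then 0 else freqAbs k ^ (1 : ℝ))
      (lambdaPow_even 1) x
    rw [lambdaPow, h1]
    exact trig_congr (fun p _ => by simp only [SQG.gradSym, absPow_toVec]) x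

theorem wBound_of_rep (h : Rep f T c κ) {A : ℝ}
    (hA : ∀ i x, ‖trig T (fun p => gradSym i (toVec (κ p)) * c p) κ x‖ ≤ A) : WBound f A :=
  ⟨abs_le_of_rep h.gradSym.1 (hA 0), abs_le_of_rep h.gradSym.2.1 (hA 1),
    abs_le_of_rep h.gradSym.2.2 (hA 2)⟩

theorem trig_disc_congr {K L : ℝ} {c : ℤ² → ℂ} (hK : ∀ k, K < freqAbs k → c k = 0)
    (hL : ∀ k, L < freqAbs k → c k = 0) (x : ℝ²) : trig (disc K) c id x = trig (disc L) c id x := by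
  have key : ∀ K : ℝ, (∀ k, K < freqAbs k → c k = 0) → ∀ K', K ≤ K' →
      trig (disc K) c id x = trig (disc K') c id x := fun K hK K' h =>
    sum_subset (fun k hk => mem_disc.2 ((mem_disc.1 hk).trans h)) fun k _ hk => by
      rw [mem_disc, not_le] at hk
      simp only [hK k hk, zero_mul]
  rw [key K hK _ (le_max_left K L), key L hL _ (le_max_right K L)]

theorem HomSymbol.trunc_bound (hψ : IsFreqCutoff ψ) {σ : ℝ} (hσ : 0 < σ)
    {h : ℝ² → ℂ} (H : HomSymbol 1 h) :
    ∃ C, 0 ≤ C ∧ ∀ lam₀ lam₁ lam₂ a : ℝ, 0 < lam₀ → 0 < lam₁ → 0 < lam₂ → |a| ≤ 1 →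
      (∀ k : ℤ², k ≠ 0 → (ψ (lam₁⁻¹ • toVec k) - a * ψ (lam₂⁻¹ • toVec k))
        * ψ ((2 : ℝ) • lam₀⁻¹ • toVec k) = 0) →
      ∀ f : Field, IsPeriodic f → ContDiff ℝ ⌊1 + σ⌋₊ f → ∀ B : ℝ, 0 ≤ B →
      holderNorm (1 + σ) f ≤ ofReal B → ∀ x, ‖trig (disc (max lam₁ lam₂)) (fun k =>
        h (toVec k) * (((ψ (lam₁⁻¹ • toVec k) - a * ψ (lam₂⁻¹ • toVec k) : ℝ) : ℂ)
          * fourierCoeff f k)) id x‖ ≤ C * lam₀ ^ (-σ) * B := by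
  obtain ⟨C, hC, hb⟩ := H.holder_piece hψ (s := 1 + σ) (by linarith)
  obtain ⟨M, hM⟩ := exists_isWiener_cutoff hψ
  have hlt : (2 : ℝ) ^ (-σ) < 1 := Real.rpow_lt_one_of_one_lt_of_neg one_lt_two (by linarith)
  have hpos : (0 : ℝ) < 2 ^ (-σ) := rpow_pos_of_pos two_pos _
  have hm := mass_nonneg M
  refine ⟨2 * mass M * C * (1 - 2 ^ (-σ))⁻¹,
    mul_nonneg (by positivity) (inv_nonneg.2 (by linarith)),
    fun lam₀ lam₁ lam₂ a h0 h1 h2 ha hD f hp hf B hB hfB x => ?_⟩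
  set D : ℤ² → ℝ := fun k => ψ (lam₁⁻¹ • toVec k) - a * ψ (lam₂⁻¹ • toVec k) with hDdef
  have hDK : ∀ k, max lam₁ lam₂ < freqAbs k → D k = 0 := by
    intro k hk
    rw [freqAbs_eq] at hk
    have k1 := hψ.eq_zero_scaled h1 ((le_max_left lam₁ lam₂).trans hk.le)
    have k2 := hψ.eq_zero_scaled h2 ((le_max_right lam₁ lam₂).trans hk.le)
    simp only [hDdef, k1, k2, mul_zero, sub_zero]
  obtain ⟨n, hn⟩ := pow_unbounded_of_one_lt (2 * max lam₁ lam₂ / lam₀) (one_lt_two (α := ℝ))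
  have hn' : max lam₁ lam₂ ≤ (lam₀ * 2 ^ n) / 2 := by
    rw [div_lt_iff₀ h0] at hn
    linarith
  let R : ℕ → ℝ := fun i => lam₀ * 2 ^ i
  have hR : ∀ i, 0 < R i := fun i => by positivity
  have hsum : ∀ k : ℤ², k ≠ 0 → D k
      * ∑ i ∈ range (n + 1), annulusCut ψ 1 (1 / 2) ((R i)⁻¹ • toVec k) = D k := by
    intro k hk
    have e : ∀ i, (R i)⁻¹ • toVec k = ((2 : ℝ) ^ i)⁻¹ • lam₀⁻¹ • toVec k := fun i => by
      rw [smul_smul, ← mul_inv, mul_comm]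
    simp only [e]
    rw [sum_annulusCut, mul_sub, hD k hk, sub_zero, ← e]
    by_cases hkK : max lam₁ lam₂ < freqAbs k
    · rw [hDK k hkK, zero_mul]
    · rw [hψ.eq_one_scaled (hR n) (y := toVec k) ((not_lt.1 hkK).trans hn'), mul_one]
  have e1 : ∀ k ∈ disc (max lam₁ lam₂), h (toVec k) * ((D k : ℂ) * fourierCoeff f k)
      = ∑ i ∈ range (n + 1), (D k : ℂ) * ((annulusCut ψ 1 (1 / 2) ((R i)⁻¹ • toVec k) : ℂ)
        * h (toVec k) * fourierCoeff f k) := by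
    intro k _
    by_cases hk : k = 0
    · rw [hk, toVec_eq_zero.2 rfl, H.zero]
      simp
    · have := hsum k hk
      have h3 : (D k : ℂ) * ∑ i ∈ range (n + 1),
          (annulusCut ψ 1 (1 / 2) ((R i)⁻¹ • toVec k) : ℂ) = D k := by exact_mod_cast this
      rw [← mul_sum, ← sum_mul, ← sum_mul]
      linear_combination (-(h (toVec k) * fourierCoeff f k)) * h3
  rw [trig_congr e1, trig_sum]
  refine (norm_sum_le _ _).trans ?_
  have e2 : ∀ i ∈ range (n + 1), ‖trig (disc (max lam₁ lam₂)) (fun k => (D k : ℂ)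
      * ((annulusCut ψ 1 (1 / 2) ((R i)⁻¹ • toVec k) : ℂ) * h (toVec k) * fourierCoeff f k)) id x‖
      ≤ 2 * mass M * C * (lam₀ ^ (-σ) * (2 ^ (-σ)) ^ i) * B := by
    intro i _
    have k1 : ∀ k, R i < freqAbs k → annulusCut ψ 1 (1 / 2) ((R i)⁻¹ • toVec k) = 0 := by
      intro k hk
      refine annulusCut_eq_zero_of_ge hψ one_pos (by norm_num) ?_
      rw [eucl_inv_smul (hR i), le_inv_mul_iff₀ (hR i)]
      norm_num
      exact hk.le
    rw [trig_disc_congr (K := max lam₁ lam₂) (L := R i) (fun k hk => by rw [hDK k hk]; simp)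
      (fun k hk => by rw [k1 k hk]; simp)]
    have k2 := hb (R i) (hR i) f hp hf B hB hfB
    set c : ℤ² → ℂ := fun k =>
      (annulusCut ψ 1 (1 / 2) ((R i)⁻¹ • toVec k) : ℂ) * h (toVec k) * fourierCoeff f k with hc
    have k3 := hM.norm_trig_le k2 lam₁ x
    have k4 := hM.norm_trig_le k2 lam₂ x
    simp only [id] at k3 k4
    have k5 : trig (disc (R i)) (fun k => (D k : ℂ) * c k) id x
        = trig (disc (R i)) (fun k => (ψ (lam₁⁻¹ • toVec k) : ℂ) * c k) id x
          - a * trig (disc (R i)) (fun k => (ψ (lam₂⁻¹ • toVec k) : ℂ) * c k) id x := by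
      rw [← trig_const_mul]
      simp only [trig]
      rw [← sum_sub_distrib]
      refine sum_congr rfl fun k _ => ?_
      simp only [hDdef]
      push_cast
      ring
    have k6 : R i ^ (1 - (1 + σ)) = lam₀ ^ (-σ) * (2 ^ (-σ)) ^ i := by
      rw [show 1 - (1 + σ) = -σ by ring, Real.mul_rpow h0.le (by positivity), ← Real.rpow_natCast,
        ← Real.rpow_natCast, ← Real.rpow_mul two_pos.le, ← Real.rpow_mul two_pos.le, mul_comm (i : ℝ)]
    rw [k6] at k3 k4
    set Y := C * (lam₀ ^ (-σ) * (2 ^ (-σ)) ^ i) * B with hY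
    have hY0 : 0 ≤ mass M * Y := (norm_nonneg _).trans k3
    rw [k5]
    calc _ ≤ mass M * Y + 1 * (mass M * Y) := by
          refine (norm_sub_le _ _).trans (add_le_add k3 ?_)
          rw [norm_mul, norm_real]
          exact mul_le_mul ha k4 (norm_nonneg _) zero_le_one
      _ = _ := by rw [hY]; ring
  refine (sum_le_sum e2).trans ?_
  rw [← sum_mul, ← mul_sum, ← mul_sum]
  have e3 : ∑ i ∈ range (n + 1), ((2 : ℝ) ^ (-σ)) ^ i ≤ (1 - 2 ^ (-σ))⁻¹ := by
    rw [← tsum_geometric_of_lt_one hpos.le hlt]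
    exact (summable_geometric_of_lt_one hpos.le hlt).sum_le_tsum _ fun i _ => by positivity
  have : 0 < lam₀ ^ (-σ) := rpow_pos_of_pos h0 _
  calc _ ≤ 2 * mass M * C * (lam₀ ^ (-σ) * (1 - 2 ^ (-σ))⁻¹) * B := by gcongr
    _ = _ := by ring

theorem exists_trunc_wBound (hψ : IsFreqCutoff ψ) {σ : ℝ} (hσ : 0 < σ) :
    ∃ C, 0 ≤ C ∧ ∀ lam₀ lam₁ lam₂ a : ℝ, 0 < lam₀ → 0 < lam₁ → 0 < lam₂ → |a| ≤ 1 →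
      (∀ k : ℤ², k ≠ 0 → (ψ (lam₁⁻¹ • toVec k) - a * ψ (lam₂⁻¹ • toVec k))
        * ψ ((2 : ℝ) • lam₀⁻¹ • toVec k) = 0) →
      ∀ f : Field, IsPeriodic f → ContDiff ℝ ⌊1 + σ⌋₊ f → ∀ B : ℝ, 0 ≤ B →
      holderNorm (1 + σ) f ≤ ofReal B →
      WBound (fun x => freqTrunc ψ lam₁ f x - a * freqTrunc ψ lam₂ f x) (C * lam₀ ^ (-σ) * B) := by
  choose C hC hb using fun i => (homSymbol_gradSym i).trunc_bound hψ hσ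
  refine ⟨∑ i, C i, sum_nonneg fun i _ => hC i,
    fun lam₀ lam₁ lam₂ a h0 h1 h2 ha hD f hp hf B hB hfB => ?_⟩
  have t1 := (isTP_freqTrunc hψ h1 f).mono (le_max_left lam₁ lam₂)
  have t2 := (isTP_freqTrunc hψ h2 f).mono (le_max_right lam₁ lam₂)
  have hF := t1.sub (t2.const_mul a)
  have hc : ∀ k, fourierCoeff (fun x => freqTrunc ψ lam₁ f x - a * freqTrunc ψ lam₂ f x) k
      = ((ψ (lam₁⁻¹ • toVec k) - a * ψ (lam₂⁻¹ • toVec k) : ℝ) : ℂ) * fourierCoeff f k := by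
    intro k
    rw [fourierCoeff_sub t1.continuous (t2.const_mul a).continuous, fourierCoeff_const_mul,
      fourierCoeff_freqTrunc hψ h1, fourierCoeff_freqTrunc hψ h2]
    push_cast
    ring
  refine wBound_of_rep hF fun i x => ?_
  simp only [id, hc]
  refine (hb i lam₀ lam₁ lam₂ a h0 h1 h2 ha hD f hp hf B hB hfB x).trans ?_
  have : 0 < lam₀ ^ (-σ) := rpow_pos_of_pos h0 _
  gcongr
  exact single_le_sum (f := C) (fun i _ => hC i) (mem_univ i)

theorem exists_freqTrunc_wBound (hψ : IsFreqCutoff ψ) {σ : ℝ} (hσ : 0 < σ) :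
    ∃ C, 0 ≤ C ∧ ∀ lam : ℝ, 0 < lam →
      ∀ f : Field, IsPeriodic f → ContDiff ℝ ⌊1 + σ⌋₊ f → ∀ B : ℝ, 0 ≤ B →
      holderNorm (1 + σ) f ≤ ofReal B → WBound (freqTrunc ψ lam f) (C * B) := by
  obtain ⟨C, hC, hb⟩ := exists_trunc_wBound hψ hσ
  refine ⟨C, hC, fun lam hl f hp hf B hB hfB => ?_⟩
  have := hb 1 lam lam 0 one_pos hl hl (by norm_num) (fun k hk => by
    rw [hψ.eq_zero ((2 : ℝ) • (1 : ℝ)⁻¹ • toVec k), mul_zero]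
    have := one_le_freqAbs hk
    rw [freqAbs_eq] at this
    rw [inv_one, one_smul, eucl_smul, abs_two]
    linarith) f hp hf B hB hfB
  simpa using this

theorem exists_freqTrunc_sub_wBound (hψ : IsFreqCutoff ψ) {σ : ℝ} (hσ : 0 < σ) :
    ∃ C, 0 ≤ C ∧ ∀ lam lam' : ℝ, 0 < lam → lam ≤ lam' →
      ∀ f : Field, IsPeriodic f → ContDiff ℝ ⌊1 + σ⌋₊ f → ∀ B : ℝ, 0 ≤ B →
      holderNorm (1 + σ) f ≤ ofReal B →
      WBound (fun x => freqTrunc ψ lam' f x - freqTrunc ψ lam f x) (C * lam ^ (-σ) * B) := by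
  obtain ⟨C, hC, hb⟩ := exists_trunc_wBound hψ hσ
  refine ⟨C, hC, fun lam lam' hl hl' f hp hf B hB hfB => ?_⟩
  have := hb lam lam' lam 1 hl (hl.trans_le hl') hl (by norm_num) (fun k hk => by
    by_cases h : freqAbs k ≤ lam / 2
    · rw [hψ.eq_one_scaled hl (y := toVec k) h, hψ.eq_one_scaled (hl.trans_le hl') (y := toVec k)
        (h.trans (by linarith))]
      ring
    · rw [hψ.eq_zero ((2 : ℝ) • lam⁻¹ • toVec k), mul_zero]
      rw [not_le, freqAbs_eq] at h
      rw [eucl_smul, abs_two, eucl_inv_smul hl, ← div_le_iff₀' two_pos, le_inv_mul_iff₀ hl]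
      linarith) f hp hf B hB hfB
  simpa using this

/-! ### The symmetrized symbol of the nonlinearity -/

/-- The symmetrized symbol `(k^⊥ · l) (|l| - |k|) / (2 |k + l|²)`. -/
def symmSym (a b : ℝ²) : ℝ :=
  2⁻¹ * (a.1 * b.2 - a.2 * b.1) * (eucl b - eucl a) * absPow (-2) (a + b)

theorem symmSym_smul {L : ℝ} (hL : 0 < L) (a b : ℝ²) :
    symmSym (L • a) (L • b) = L * symmSym a b := by
  have h : absPow (-2) (L • a + L • b) = (L ^ 2)⁻¹ * absPow (-2) (a + b) := by
    rw [← smul_add]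
    by_cases h0 : a + b = 0
    · simp [h0, absPow]
    · have := (homSymbol_absPow (-2)).hom L hL (a + b) h0
      rw [Real.rpow_neg hL.le, Real.rpow_two] at this
      exact_mod_cast this
  rw [symmSym, symmSym, h, eucl_smul, eucl_smul, abs_of_pos hL]
  simp only [Prod.smul_fst, Prod.smul_snd, smul_eq_mul]
  field_simp

theorem bilinSymbol_add (k l : ℤ²) :
    (bilinSymbol k l + bilinSymbol l k) / 2 = symmSym (toVec k) (toVec l) := by
  rw [symmSym, ← toVec_add, absPow_neg_two, bilinSymbol, bilinSymbol, add_comm l k]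
  by_cases h : k + l = 0
  · simp [h]
  · simp only [h, ↓reduceIte, neg_neg]
    simp only [toVec, freqAbs]
    ring

theorem Rep.bilin_self (h : Rep f T c κ) : Rep (SQG.bilin f f) (T ×ˢ T)
      (fun p => (symmSym (toVec (κ p.1)) (toVec (κ p.2)) : ℂ) * (c p.1 * c p.2))
      (fun p => κ p.1 + κ p.2) := by
  intro x
  have h1 := h.bilin h x
  have h2 : trig (T ×ˢ T) (fun p => (bilinSymbol (κ p.1) (κ p.2) : ℂ) * (c p.1 * c p.2))
        (fun p => κ p.1 + κ p.2) x
      = trig (T ×ˢ T) (fun p => (bilinSymbol (κ p.2) (κ p.1) : ℂ) * (c p.1 * c p.2))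
        (fun p => κ p.1 + κ p.2) x := by
    simp only [trig]
    rw [sum_product, Finset.sum_product_right]
    refine sum_congr rfl fun p _ => sum_congr rfl fun p' _ => ?_
    simp only [add_comm (κ p'), mul_comm (c p')]
  have h3 : (SQG.bilin f f x : ℂ) = 2⁻¹ * (SQG.bilin f f x + SQG.bilin f f x) := by ring
  rw [h3]
  nth_rewrite 2 [h1]
  rw [h1, h2]
  nth_rewrite 1 [← h2]
  simp only [trig]
  rw [← sum_add_distrib, mul_sum]
  refine sum_congr rfl fun p _ => ?_
  rw [← bilinSymbol_add]
  push_cast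
  ring

/-! ### Smooth amplitudes -/

/-- A trigonometric polynomial with bounds on its values and its first and second differences. -/
structure SmoothAmp (mu A D D₂ : ℝ) (b : Field) : Prop where
  isTP : IsTP mu b
  bound : ∀ x, |b x| ≤ A
  lip : ∀ x y, |b (x + y) - b x| ≤ D * eucl y
  second : ∀ x y, |b (x + y) + b (x - y) - 2 * b x| ≤ D₂ * eucl y ^ 2
  lip_nonneg : 0 ≤ D
  second_nonneg : 0 ≤ D₂

theorem SmoothAmp.norm_trig {mu A D D₂ : ℝ} {b : Field} (h : SmoothAmp mu A D D₂ b) (x : ℝ²) :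
    ‖trig (disc mu) (fourierCoeff b) id x‖ ≤ A := norm_trig_of_rep h.isTP h.bound x

theorem SmoothAmp.norm_trig_sub {mu A D D₂ : ℝ} {b : Field} (h : SmoothAmp mu A D D₂ b) (x y : ℝ²) :
    ‖trig (disc mu) (fourierCoeff b) id (x + y) - trig (disc mu) (fourierCoeff b) id x‖
      ≤ D * eucl y := by
  rw [← h.isTP, ← h.isTP, ← Complex.ofReal_sub, norm_real]
  exact h.lip x y

theorem SmoothAmp.norm_trig_second {mu A D D₂ : ℝ} {b : Field} (h : SmoothAmp mu A D D₂ b)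
    (x y : ℝ²) :
    ‖trig (disc mu) (fourierCoeff b) id (x + y) + trig (disc mu) (fourierCoeff b) id (x - y)
      - 2 * trig (disc mu) (fourierCoeff b) id x‖ ≤ D₂ * eucl y ^ 2 := by
  rw [← h.isTP, ← h.isTP, ← h.isTP]
  have := h.second x y
  rw [← norm_eq_abs, ← norm_real] at this
  push_cast at this
  exact this

/-- A cut-off for pairs of frequencies. -/
def pairCut (ψ : ℝ² → ℝ) (y : ℝ² × ℝ²) : ℝ :=
  ψ ((2 / 5 : ℝ)⁻¹ • y.1) * ψ ((2 / 5 : ℝ)⁻¹ • y.2)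

theorem pairCut_eq_one (hψ : IsFreqCutoff ψ) {y : ℝ² × ℝ²}
    (h1 : eucl y.1 ≤ 1 / 5) (h2 : eucl y.2 ≤ 1 / 5) : pairCut ψ y = 1 := by
  rw [pairCut, hψ.eq_one_scaled (by norm_num) (h1.trans (by norm_num)),
    hψ.eq_one_scaled (by norm_num) (h2.trans (by norm_num)), mul_one]

theorem pairCut_eq_zero (hψ : IsFreqCutoff ψ) {y : ℝ² × ℝ²}
    (h : 2 / 5 ≤ eucl y.1 ∨ 2 / 5 ≤ eucl y.2) : pairCut ψ y = 0 := by
  rcases h with h | h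
  · rw [pairCut, hψ.eq_zero_scaled (by norm_num) h, zero_mul]
  · rw [pairCut, hψ.eq_zero_scaled (by norm_num) h, mul_zero]

theorem exists_isWiener₂_pairCut (hψ : IsFreqCutoff ψ) {H : ℝ² × ℝ² → ℂ}
    (hH : ∀ y, eucl y.1 ≤ 2 / 5 → eucl y.2 ≤ 2 / 5 → ContDiffAt ℝ (⊤ : ℕ∞) H y) :
    ∃ M, IsWiener₂ (fun y => (pairCut ψ y : ℂ) * H y) M := by
  refine exists_isWiener₂ (contDiff_mul_of_local (Complex.ofRealCLM.contDiff.comp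
    (((hψ.contDiff_scaled _).comp contDiff_fst).mul ((hψ.contDiff_scaled _).comp contDiff_snd))) ?_) ?_
  · intro y
    by_cases h1 : eucl y.1 ≤ 2 / 5
    · by_cases h2 : eucl y.2 ≤ 2 / 5
      · exact Or.inl (hH y h1 h2)
      · right
        filter_upwards [(continuous_eucl.comp continuous_snd).continuousAt.eventually_const_lt
          (not_le.1 h2)] with w hw
        have := pairCut_eq_zero hψ (y := w) (Or.inr (le_of_lt hw))
        rw [pairCut] at this
        exact congrArg Complex.ofReal this
    · right
      filter_upwards [(continuous_eucl.comp continuous_fst).continuousAt.eventually_const_lt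
        (not_le.1 h1)] with w hw
      have := pairCut_eq_zero hψ (y := w) (Or.inl (le_of_lt hw))
      rw [pairCut] at this
      exact congrArg Complex.ofReal this
  · refine HasCompactSupport.intro (isCompact_closedBall (0 : ℝ² × ℝ²) (2 / 5))
      fun y hy => ?_
    rw [mem_closedBall_zero_iff, Prod.norm_def, max_le_iff, not_and_or, not_le, not_le] at hy
    rw [pairCut_eq_zero hψ (hy.imp (fun h => h.le.trans (norm_le_eucl _))
      fun h => h.le.trans (norm_le_eucl _))]
    simp

theorem add_ne_zero_of_eucl {w y : ℝ²} (h : eucl y < eucl w) : w + y ≠ 0 := by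
  intro h0
  have : w = -y := eq_neg_of_add_eq_zero_left h0
  rw [this, eucl_neg] at h
  exact lt_irrefl _ h

theorem eucl_scaled_le {L mu : ℝ} (hL : 0 < L) (hmu : mu ≤ L / 5) {k : ℤ²} (hk : k ∈ disc mu) :
    eucl (L⁻¹ • toVec k) ≤ 1 / 5 := by
  rw [eucl_inv_smul hL, inv_mul_le_iff₀ hL, ← freqAbs_eq]
  have := mem_disc.1 hk
  linarith

theorem contDiffAt_eucl_comp {E : Type*} [NormedAddCommGroup E] [NormedSpace ℝ E] {f : E → ℝ²}
    {x : E} (hf : ContDiffAt ℝ (⊤ : ℕ∞) f x) (h : f x ≠ 0) :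
    ContDiffAt ℝ (⊤ : ℕ∞) (fun y => eucl (f y)) x :=
  (contDiffAt_eucl h).comp x hf

theorem HomSymbol.high_pair_bound (hψ : IsFreqCutoff ψ) {h : ℝ² → ℂ}
    (H : HomSymbol 0 h) {w w' : ℝ²} (hw : eucl w = 1) (hw' : eucl w' = 1)
    (hww : 4 / 5 < eucl (w + w')) :
    ∃ C, 0 ≤ C ∧ ∀ (L mu A D D₂ A' D' D₂' : ℝ) (b b' : Field) (v v' : ℤ²), 0 < L → mu ≤ L / 5 →
      SmoothAmp mu A D D₂ b → SmoothAmp mu A' D' D₂' b' → toVec v = L • w → toVec v' = L • w' →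
      ∀ x, ‖trig (disc mu ×ˢ disc mu) (fun p => h (toVec (v + p.1 + (v' + p.2)))
        * ((symmSym (toVec (v + p.1)) (toVec (v' + p.2)) : ℂ)
          * (fourierCoeff b p.1 * fourierCoeff b' p.2))) (fun p => p.1 + p.2) x‖
        ≤ C * (D * A' + A * D') := by
  let Hh : ℝ² × ℝ² → ℂ := fun y =>
    h (w + w' + (y.1 + y.2)) * (symmSym (w + y.1) (w' + y.2) : ℂ)
  have hsm : ∀ y : ℝ² × ℝ², eucl y.1 ≤ 2 / 5 → eucl y.2 ≤ 2 / 5 →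
      ContDiffAt ℝ (⊤ : ℕ∞) Hh y := by
    intro y h1 h2
    have n1 : w + y.1 ≠ 0 := add_ne_zero_of_eucl (by rw [hw]; linarith)
    have n2 : w' + y.2 ≠ 0 := add_ne_zero_of_eucl (by rw [hw']; linarith)
    have n3 : w + w' + (y.1 + y.2) ≠ 0 := add_ne_zero_of_eucl (by
      have := eucl_add_le y.1 y.2
      linarith)
    have n3' : (w + y.1) + (w' + y.2) ≠ 0 := by
      rwa [add_add_add_comm] at n3
    have c1 : ContDiffAt ℝ (⊤ : ℕ∞) (fun y : ℝ² × ℝ² => w + y.1) y := by fun_prop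
    have c2 : ContDiffAt ℝ (⊤ : ℕ∞) (fun y : ℝ² × ℝ² => w' + y.2) y := by fun_prop
    have c3 : ContDiffAt ℝ (⊤ : ℕ∞) (fun y : ℝ² × ℝ² => w + w' + (y.1 + y.2)) y := by
      fun_prop
    have c4 : ContDiffAt ℝ (⊤ : ℕ∞) (fun y : ℝ² × ℝ² => (w + y.1) + (w' + y.2)) y := by
      fun_prop
    refine ((H.smooth _ n3).comp y c3).mul ?_
    have c5 := contDiffAt_eucl_comp c1 n1
    have c6 := contDiffAt_eucl_comp c2 n2
    have c7 := ((homSymbol_absPow (-2)).smooth _ n3').comp y c4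
    have c8 : ContDiffAt ℝ (⊤ : ℕ∞) (fun y : ℝ² × ℝ² =>
        2⁻¹ * ((w + y.1).1 * (w' + y.2).2 - (w + y.1).2 * (w' + y.2).1)
          * (eucl (w' + y.2) - eucl (w + y.1))) y := by
      refine ContDiffAt.mul ?_ (c6.sub c5)
      simp only [Prod.fst_add, Prod.snd_add]
      fun_prop
    have c9 := (Complex.ofRealCLM.contDiff.contDiffAt.comp y c8).mul c7
    refine c9.congr_of_eventuallyEq (of_forall fun z => ?_)
    simp only [symmSym, Function.comp, Complex.ofRealCLM_apply]
    push_cast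
    ring
  obtain ⟨M, hM⟩ := exists_isWiener₂_pairCut hψ hsm
  refine ⟨mass₂ M, mass₂_nonneg M,
    fun L mu A D D₂ A' D' D₂' b b' v v' hL hmu hb hb' hv hv' x => ?_⟩
  have h0 : (pairCut ψ 0 : ℂ) * Hh 0 = 0 := by
    simp [Hh, symmSym, hw, hw']
  have key := hM.norm_trig_le_first h0 hL hb.norm_trig hb'.norm_trig hb.norm_trig_sub
    hb'.norm_trig_sub hb.lip_nonneg hb'.lip_nonneg x
  have e : ∀ p ∈ disc mu ×ˢ disc mu, h (toVec (v + p.1 + (v' + p.2)))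
      * ((symmSym (toVec (v + p.1)) (toVec (v' + p.2)) : ℂ)
        * (fourierCoeff b p.1 * fourierCoeff b' p.2))
      = (L : ℂ) * ((pairCut ψ (L⁻¹ • toVec (id p.1), L⁻¹ • toVec (id p.2)) : ℂ)
        * Hh (L⁻¹ • toVec (id p.1), L⁻¹ • toVec (id p.2))
        * (fourierCoeff b p.1 * fourierCoeff b' p.2)) := by
    intro p hp
    rw [mem_product] at hp
    rw [pairCut_eq_one hψ (eucl_scaled_le hL hmu hp.1) (eucl_scaled_le hL hmu hp.2)]
    have s1 : toVec (v + p.1) = L • (w + L⁻¹ • toVec p.1) := by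
      rw [toVec_add, hv, smul_add, smul_inv_smul₀ hL.ne']
    have s2 : toVec (v' + p.2) = L • (w' + L⁻¹ • toVec p.2) := by
      rw [toVec_add, hv', smul_add, smul_inv_smul₀ hL.ne']
    have s3 : L⁻¹ • toVec (v + p.1 + (v' + p.2))
        = w + w' + (L⁻¹ • toVec p.1 + L⁻¹ • toVec p.2) := by
      rw [toVec_add, s1, s2, ← smul_add, inv_smul_smul₀ hL.ne', add_add_add_comm]
    rw [H.eq_rescale hL (toVec (v + p.1 + (v' + p.2))), s3, s1, s2, symmSym_smul hL]
    simp only [Hh, id, Real.rpow_zero]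
    push_cast
    ring
  rw [trig_congr e, trig_const_mul, norm_mul, norm_real, Real.norm_of_nonneg hL.le]
  calc _ ≤ L * (mass₂ M * (L⁻¹ * (D * A' + A * D'))) := mul_le_mul_of_nonneg_left key hL.le
    _ = _ := by field_simp

/-- A component of a vector. -/
def comp (a : Bool) (y : ℝ²) : ℝ := if a then y.1 else y.2

/-- A component of the rotated vector `y^⊥`. -/
def perpComp (a : Bool) (y : ℝ²) : ℝ := if a then -y.2 else y.1

/-- The symbol `y^⊥_a y_b / |y|²`. -/
def pairSym (a b : Bool) (y : ℝ²) : ℂ := ((perpComp a y * comp b y : ℝ) : ℂ) * (absPow (-2) y : ℂ)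

theorem homSymbol_comp (a : Bool) : HomSymbol 1 (fun y => (comp a y : ℂ)) := by
  cases a
  · exact homSymbol_snd
  · exact homSymbol_fst

theorem homSymbol_perpComp (a : Bool) : HomSymbol 1 (fun y => (perpComp a y : ℂ)) := by
  cases a
  · exact homSymbol_fst
  · simpa [perpComp] using homSymbol_snd.const_mul (-1)

theorem homSymbol_pairSym (a b : Bool) : HomSymbol 0 (pairSym a b) := by
  have := (((homSymbol_perpComp a).mul (homSymbol_comp b)).mul (homSymbol_absPow (-2))).cast
    (d' := 0) (by norm_num)
  have e : pairSym a b = fun y => (perpComp a y : ℂ) * (comp b y : ℂ) * (absPow (-2) y : ℂ) := by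
    funext y
    simp [pairSym]
  rw [e]
  exact this

/-- The symbol `(y^⊥ · w) (y · w) / |y|²`. -/
def dirSym (w y : ℝ²) : ℂ :=
  (((y.1 * w.2 - y.2 * w.1) * (y.1 * w.1 + y.2 * w.2) : ℝ) : ℂ) * (absPow (-2) y : ℂ)

theorem dirSym_eq (w y : ℝ²) :
    dirSym w y = ∑ a : Bool, ∑ b : Bool, pairSym a b y * ((comp a w * comp b w : ℝ) : ℂ) := by
  simp only [Fintype.sum_bool, dirSym, pairSym, comp, perpComp, if_true, Bool.false_eq_true, if_false]
  push_cast
  ring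

theorem homSymbol_dirSym (w : ℝ²) : HomSymbol 0 (dirSym w) := by
  have h : ∀ a b, HomSymbol 0 fun y => ((comp a w * comp b w : ℝ) : ℂ) * pairSym a b y :=
    fun a b => (homSymbol_pairSym a b).const_mul _
  have := ((h true true).add (h true false)).add ((h false true).add (h false false))
  have e : dirSym w = fun y => ((comp true w * comp true w : ℝ) : ℂ) * pairSym true true y
      + ((comp true w * comp false w : ℝ) : ℂ) * pairSym true false y
      + (((comp false w * comp true w : ℝ) : ℂ) * pairSym false true y
        + ((comp false w * comp false w : ℝ) : ℂ) * pairSym false false y) := by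
    funext y
    rw [dirSym_eq]
    simp only [Fintype.sum_bool]
    ring
  rw [e]
  exact this

/-- The smooth part of the symmetrized symbol for nearly opposite frequencies. -/
def lowSym (w : ℝ²) (a b : Bool) (y : ℝ² × ℝ²) : ℝ :=
  comp a ((2⁻¹ : ℝ) • (y.2 - y.1) - w) * comp b ((2⁻¹ : ℝ) • (y.2 - y.1) - w)
    * (eucl (w + y.1) + eucl (w - y.2))⁻¹

theorem symmSym_low {w : ℝ²} {y : ℝ² × ℝ²} (h1 : w + y.1 ≠ 0) : (symmSym (w + y.1) (-w + y.2) : ℂ)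
      = ∑ a : Bool, ∑ b : Bool, pairSym a b (y.1 + y.2) * (lowSym w a b y : ℂ) := by
  have hP := eucl_pos h1
  have hQ := eucl_nonneg (w - y.2)
  have e1 := eucl_sq (w + y.1)
  have e2 := eucl_sq (w - y.2)
  have e3 : eucl (-w + y.2) = eucl (w - y.2) := by rw [← eucl_neg]; congr 1; abel
  have e4 : w + y.1 + (-w + y.2) = y.1 + y.2 := by abel
  have hne : eucl (w + y.1) + eucl (w - y.2) ≠ 0 := by positivity
  have : symmSym (w + y.1) (-w + y.2) = ∑ a : Bool, ∑ b : Bool,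
      (perpComp a (y.1 + y.2) * comp b (y.1 + y.2)) * absPow (-2) (y.1 + y.2) * lowSym w a b y := by
    simp only [Fintype.sum_bool, symmSym, lowSym, comp, perpComp, if_true, Bool.false_eq_true,
      if_false, e3, e4]
    set P := eucl (w + y.1)
    set Q := eucl (w - y.2)
    set N := absPow (-2) (y.1 + y.2)
    simp only [Prod.fst_add, Prod.snd_add, Prod.fst_sub, Prod.snd_sub, Prod.fst_neg, Prod.snd_neg,
      Prod.smul_fst, Prod.smul_snd, smul_eq_mul] at e1 e2 ⊢
    have hd : Q - P = (Q ^ 2 - P ^ 2) * (P + Q)⁻¹ := by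
      field_simp
      ring
    rw [hd, e1, e2]
    ring
  rw [this]
  push_cast [pairSym]
  rfl

theorem HomSymbol.low_pair_bound (hψ : IsFreqCutoff ψ) {h : ℝ² → ℂ}
    (H : HomSymbol 0 h) {w : ℝ²} (hw : eucl w = 1) :
    ∃ C, 0 ≤ C ∧ ∀ (L mu A D D₂ : ℝ) (β : Field) (v : ℤ²), 0 < L → 1 ≤ mu → mu ≤ L / 5 →
      SmoothAmp mu A D D₂ β → toVec v = L • w →
      ∀ x, ‖trig (disc mu ×ˢ disc mu) (fun p => h (toVec (p.1 + p.2))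
          * ((symmSym (toVec (v + p.1)) (toVec (-v + p.2)) : ℂ)
            * (fourierCoeff β p.1 * fourierCoeff β p.2))) (fun p => p.1 + p.2) x
        - (L / 2 : ℝ) * trig (disc mu ×ˢ disc mu) (fun p => (h (toVec (p.1 + p.2))
          * dirSym w (toVec (p.1 + p.2))) * (fourierCoeff β p.1 * fourierCoeff β p.2))
            (fun p => p.1 + p.2) x‖ ≤ C * log (2 * mu) * (L⁻¹ * (A * D₂ + D ^ 2)) := by
  have hsm : ∀ (a b : Bool) (y : ℝ² × ℝ²), eucl y.1 ≤ 2 / 5 → eucl y.2 ≤ 2 / 5 →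
      ContDiffAt ℝ (⊤ : ℕ∞) (fun y => (lowSym w a b y : ℂ)) y := by
    intro a b y h1 h2
    have n1 : w + y.1 ≠ 0 := add_ne_zero_of_eucl (by rw [hw]; linarith)
    have n2 : w - y.2 ≠ 0 := by
      rw [sub_eq_add_neg]
      exact add_ne_zero_of_eucl (by rw [hw, eucl_neg]; linarith)
    have c1 := contDiffAt_eucl_comp
      (f := fun y : ℝ² × ℝ² => w + y.1) (x := y) (by fun_prop) n1
    have c2 := contDiffAt_eucl_comp
      (f := fun y : ℝ² × ℝ² => w - y.2) (x := y) (by fun_prop) n2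
    have c3 : ∀ a : Bool, ContDiffAt ℝ (⊤ : ℕ∞) (fun y : ℝ² × ℝ² =>
        comp a ((2⁻¹ : ℝ) • (y.2 - y.1) - w)) y := by
      intro a
      cases a <;> simp only [comp, if_true, Bool.false_eq_true, if_false] <;> fun_prop
    have := eucl_pos n1
    have := eucl_pos n2
    exact Complex.ofRealCLM.contDiff.contDiffAt.comp y
      (((c3 a).mul (c3 b)).mul ((c1.add c2).inv (by positivity)))
  choose M hM using fun a b => exists_isWiener₂_pairCut hψ (hsm a b)
  have Hab : ∀ a b, HomSymbol 0 fun y => h y * pairSym a b y := fun a b =>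
    (H.mul (homSymbol_pairSym a b)).cast (zero_add 0)
  choose C hC hlog using fun a b => (Hab a b).log_bound hψ
  refine ⟨∑ a, ∑ b, C a b * mass₂ (M a b), sum_nonneg fun a _ => sum_nonneg fun b _ =>
    mul_nonneg (hC a b) (mass₂_nonneg _), fun L mu A D D₂ β v hL h1 hmu hβ hv x => ?_⟩
  let m : Bool → Bool → ℝ² × ℝ² → ℂ := fun a b y => (pairCut ψ y : ℂ) * (lowSym w a b y : ℂ)
  have hcut0 : pairCut ψ 0 = 1 := pairCut_eq_one hψ (by simp [eucl]) (by simp [eucl])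
  have hm0 : ∀ a b, m a b 0 = ((comp a w * comp b w / 2 : ℝ) : ℂ) := by
    intro a b
    have : lowSym w a b 0 = comp a w * comp b w / 2 := by
      simp only [lowSym, Prod.fst_zero, Prod.snd_zero, sub_zero, add_zero, smul_zero, zero_sub, hw]
      cases a <;> cases b <;> simp [comp] <;> ring
    simp only [m, hcut0, this]
    simp
  have hsym : ∀ a b y₁ y₂, m a b (-y₂, -y₁) = m a b (y₁, y₂) := by
    intro a b y₁ y₂
    have e1 : pairCut ψ (-y₂, -y₁) = pairCut ψ (y₁, y₂) := by
      simp only [pairCut, smul_neg, hψ.even]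
      ring
    have e2 : lowSym w a b (-y₂, -y₁) = lowSym w a b (y₁, y₂) := by
      simp only [lowSym]
      rw [show -y₁ - -y₂ = y₂ - y₁ by abel, ← sub_eq_add_neg, sub_neg_eq_add,
        add_comm (eucl (w - y₂))]
    simp only [m, e1, e2]
  let d : Bool → Bool → ℤ² × ℤ² → ℂ := fun a b p =>
    (m a b (L⁻¹ • toVec (id p.1), L⁻¹ • toVec (id p.2)) - m a b 0)
      * (fourierCoeff β p.1 * fourierCoeff β p.2)
  have hd : ∀ a b x, ‖trig (disc mu ×ˢ disc mu) (d a b) (fun p => p.1 + p.2) x‖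
      ≤ mass₂ (M a b) * (L⁻¹ ^ 2 * (A * D₂ + D ^ 2)) := by
    intro a b x
    have k1 := (hM a b).norm_trig_sub_le_second (hsym a b) hL hβ.norm_trig hβ.norm_trig_sub
      hβ.norm_trig_second hβ.lip_nonneg hβ.second_nonneg x
    refine le_trans (le_of_eq ?_) k1
    congr 1
    rw [sq, trig_mul, ← trig_const_mul]
    simp only [trig]
    rw [← sum_sub_distrib]
    refine sum_congr rfl fun p _ => ?_
    simp only [d, m, id]
    ring
  have hfreq : ∀ p ∈ disc mu ×ˢ disc mu, freqAbs (p.1 + p.2) ≤ 2 * mu := by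
    intro p hp
    rw [mem_product] at hp
    have := freqAbs_add_le p.1 p.2
    have := mem_disc.1 hp.1
    have := mem_disc.1 hp.2
    linarith
  have e : trig (disc mu ×ˢ disc mu) (fun p => h (toVec (p.1 + p.2))
          * ((symmSym (toVec (v + p.1)) (toVec (-v + p.2)) : ℂ)
            * (fourierCoeff β p.1 * fourierCoeff β p.2))) (fun p => p.1 + p.2) x
        - (L / 2 : ℝ) * trig (disc mu ×ˢ disc mu) (fun p => (h (toVec (p.1 + p.2))
          * dirSym w (toVec (p.1 + p.2))) * (fourierCoeff β p.1 * fourierCoeff β p.2))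
            (fun p => p.1 + p.2) x
      = ∑ a, ∑ b, (L : ℂ) * trig (disc mu ×ˢ disc mu) (fun p =>
          (h (toVec (p.1 + p.2)) * pairSym a b (toVec (p.1 + p.2))) * d a b p) (fun p => p.1 + p.2) x := by
    simp only [← trig_const_mul]
    simp only [trig]
    rw [← sum_sub_distrib]
    simp only [Fintype.sum_bool, ← sum_add_distrib]
    refine sum_congr rfl fun p hp => ?_
    rw [mem_product] at hp
    have q1 := eucl_scaled_le hL hmu hp.1
    have q2 := eucl_scaled_le hL hmu hp.2
    have s1 : toVec (v + p.1) = L • (w + L⁻¹ • toVec p.1) := by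
      rw [toVec_add, hv, smul_add, smul_inv_smul₀ hL.ne']
    have s2 : toVec (-v + p.2) = L • (-w + L⁻¹ • toVec p.2) := by
      have : toVec (-v) = -toVec v := by simp [toVec]
      rw [toVec_add, this, hv, smul_add, smul_inv_smul₀ hL.ne', smul_neg]
    have s3 : L⁻¹ • toVec (p.1 + p.2) = L⁻¹ • toVec p.1 + L⁻¹ • toVec p.2 := by
      rw [toVec_add, smul_add]
    have s4 : ∀ a b, pairSym a b (L⁻¹ • toVec p.1 + L⁻¹ • toVec p.2) = pairSym a b (toVec (p.1 + p.2)) := by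
      intro a b
      rw [(homSymbol_pairSym a b).eq_rescale hL (toVec (p.1 + p.2)), s3]
      simp
    have n1 : w + L⁻¹ • toVec p.1 ≠ 0 := add_ne_zero_of_eucl (by rw [hw]; linarith)
    have s5 := symmSym_low (w := w) (y := (L⁻¹ • toVec p.1, L⁻¹ • toVec p.2)) n1
    simp only [s4] at s5
    rw [s1, s2, symmSym_smul hL, Complex.ofReal_mul, s5, dirSym_eq]
    simp only [d, hm0]
    have hcut : pairCut ψ (L⁻¹ • toVec p.1, L⁻¹ • toVec p.2) = 1 := pairCut_eq_one hψ q1 q2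
    simp only [m, id, hcut, Fintype.sum_bool]
    push_cast
    ring
  rw [e, sum_mul, sum_mul]
  refine (norm_sum_le _ _).trans (sum_le_sum fun a _ => ?_)
  rw [sum_mul, sum_mul]
  refine (norm_sum_le _ _).trans (sum_le_sum fun b _ => ?_)
  rw [norm_mul, norm_real, Real.norm_of_nonneg hL.le]
  have := hlog a b (2 * mu) (by linarith) _ _ _ _ _ hfreq (hd a b) x
  calc _ ≤ L * (C a b * log (2 * mu) * (mass₂ (M a b) * (L⁻¹ ^ 2 * (A * D₂ + D ^ 2)))) :=
        mul_le_mul_of_nonneg_left this hL.le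
    _ = _ := by field_simp

/-! ### Differences of trigonometric polynomials -/

theorem exists_bernstein (hψ : IsFreqCutoff ψ) :
    ∃ C, 0 ≤ C ∧ ∀ (K A : ℝ) (u : Field), 0 < K → IsTP K u → (∀ x, |u x| ≤ A) →
      (∀ x, |dx₁ u x| ≤ C * K * A) ∧ ∀ x, |dx₂ u x| ≤ C * K * A := by
  have hcs : ∀ g : ℝ² → ℂ, HasCompactSupport fun y => (ψ ((2 : ℝ)⁻¹ • y) : ℂ) * g y := fun g =>
    hasCompactSupport_of_eucl 2 fun y hy => by
      rw [hψ.eq_zero_scaled two_pos hy]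
      simp
  have hsm : ContDiff ℝ (⊤ : ℕ∞) fun y => (ψ ((2 : ℝ)⁻¹ • y) : ℂ) :=
    Complex.ofRealCLM.contDiff.comp (hψ.contDiff_scaled 2)
  have h1 : ContDiff ℝ (⊤ : ℕ∞) fun y : ℝ² => I * (y.1 : ℂ) :=
    contDiff_const.mul (Complex.ofRealCLM.contDiff.comp contDiff_fst)
  have h2 : ContDiff ℝ (⊤ : ℕ∞) fun y : ℝ² => I * (y.2 : ℂ) :=
    contDiff_const.mul (Complex.ofRealCLM.contDiff.comp contDiff_snd)
  obtain ⟨M₁, hM₁⟩ := exists_isWiener (hsm.mul h1) (hcs _)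
  obtain ⟨M₂, hM₂⟩ := exists_isWiener (hsm.mul h2) (hcs _)
  have m1 := mass_nonneg M₁
  have m2 := mass_nonneg M₂
  refine ⟨mass M₁ + mass M₂, by positivity, fun K A u hK hu hA => ?_⟩
  have hA0 : 0 ≤ A := (abs_nonneg _).trans (hA 0)
  have hcut : ∀ k ∈ disc K, ψ ((2 : ℝ)⁻¹ • K⁻¹ • toVec k) = 1 := by
    intro k hk
    refine hψ.eq_one_scaled two_pos ?_
    rw [eucl_inv_smul hK, inv_mul_le_iff₀ hK, ← freqAbs_eq]
    have := mem_disc.1 hk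
    linarith
  have hKc : (K : ℂ) ≠ 0 := by exact_mod_cast hK.ne'
  constructor
  · refine abs_le_of_rep (Rep.dx₁ hu) fun x => ?_
    have key := hM₁.norm_trig_le (norm_trig_of_rep hu hA) K x
    have e : ∀ k ∈ disc K, I * ((id k).1 : ℂ) * fourierCoeff u k
        = K * (((ψ ((2 : ℝ)⁻¹ • K⁻¹ • toVec (id k)) : ℂ)
          * (I * (((K⁻¹ • toVec (id k)).1 : ℝ) : ℂ))) * fourierCoeff u k) := by
      intro k hk
      simp only [id]
      rw [hcut k hk]
      simp only [toVec, Prod.smul_fst, smul_eq_mul]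
      push_cast
      field_simp
    rw [trig_congr e, trig_const_mul, norm_mul, norm_real, Real.norm_of_nonneg hK.le]
    calc _ ≤ K * (mass M₁ * A) := mul_le_mul_of_nonneg_left key hK.le
      _ ≤ _ := by nlinarith [mul_nonneg (mul_nonneg m2 hK.le) hA0]
  · refine abs_le_of_rep (Rep.dx₂ hu) fun x => ?_
    have key := hM₂.norm_trig_le (norm_trig_of_rep hu hA) K x
    have e : ∀ k ∈ disc K, I * ((id k).2 : ℂ) * fourierCoeff u k
        = K * (((ψ ((2 : ℝ)⁻¹ • K⁻¹ • toVec (id k)) : ℂ)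
          * (I * (((K⁻¹ • toVec (id k)).2 : ℝ) : ℂ))) * fourierCoeff u k) := by
      intro k hk
      simp only [id]
      rw [hcut k hk]
      simp only [toVec, Prod.smul_snd, smul_eq_mul]
      push_cast
      field_simp
    rw [trig_congr e, trig_const_mul, norm_mul, norm_real, Real.norm_of_nonneg hK.le]
    calc _ ≤ K * (mass M₂ * A) := mul_le_mul_of_nonneg_left key hK.le
      _ ≤ _ := by nlinarith [mul_nonneg (mul_nonneg m1 hK.le) hA0]

theorem IsTP.contDiff {u : Field} (hu : IsTP K u) : ContDiff ℝ (⊤ : ℕ∞) u := by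
  have e : u = fun y => (∑ k ∈ disc K, fourierCoeff u k * character k y).re := by
    funext y
    have := hu y
    simp only [trig, id] at this
    rw [← this, Complex.ofReal_re]
  rw [e]
  exact contDiff_re_sum _ _

theorem IsTP.periodic {u : Field} (hu : IsTP K u) : IsPeriodic u := by
  have e : u = fun y => (∑ k ∈ disc K, fourierCoeff u k * character k y).re := by
    funext y
    have := hu y
    simp only [trig, id] at this
    rw [← this, Complex.ofReal_re]
  rw [e]
  exact isPeriodic_re_sum _ _

theorem IsTP.hasDerivAt_line {u : Field} (hu : IsTP K u) (x y : ℝ²) (t : ℝ) :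
    HasDerivAt (fun s : ℝ => u (x + s • y))
      (y.1 * SQG.dx₁ u (x + t • y) + y.2 * SQG.dx₂ u (x + t • y)) t := by
  have hd : Differentiable ℝ u := hu.contDiff.differentiable (by simp)
  have h1 : HasDerivAt (fun s : ℝ => x + s • y) y t := by
    simpa using ((hasDerivAt_id t).smul_const y).const_add x
  have h2 := (hd (x + t • y)).hasFDerivAt.comp_hasDerivAt t h1
  refine h2.congr_deriv ?_
  rw [dx₁_eq_fderiv hd, dx₂_eq_fderiv hd]
  have : y = y.1 • ((1 : ℝ), (0 : ℝ)) + y.2 • ((0 : ℝ), (1 : ℝ)) := by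
    ext <;> simp
  conv_lhs => rw [this]
  rw [map_add, map_smul, map_smul]
  simp

theorem abs_sub_le_of_deriv {p p' : ℝ → ℝ} (hp : ∀ t, HasDerivAt p (p' t) t) {B : ℝ}
    (hB : ∀ t ∈ Icc (0 : ℝ) 1, |p' t| ≤ B) : |p 1 - p 0| ≤ B := by
  have := (convex_Icc (0 : ℝ) 1).norm_image_sub_le_of_norm_hasDerivWithin_le
    (f := p) (f' := p') (C := B) (fun t _ => (hp t).hasDerivWithinAt) hB
    (Set.left_mem_Icc.2 zero_le_one) (Set.right_mem_Icc.2 zero_le_one)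
  simpa using this

theorem IsTP.abs_sub_le {K B : ℝ} {u : Field} (hu : IsTP K u) (h1 : ∀ x, |SQG.dx₁ u x| ≤ B)
    (h2 : ∀ x, |SQG.dx₂ u x| ≤ B) (x y : ℝ²) : |u (x + y) - u x| ≤ 2 * B * eucl y := by
  have := abs_sub_le_of_deriv (fun t => hu.hasDerivAt_line x y t) (B := 2 * B * eucl y) fun t _ => by
    have hB : 0 ≤ B := (abs_nonneg _).trans (h1 0)
    refine (abs_add_le _ _).trans ?_
    rw [abs_mul, abs_mul]
    have e1 := mul_le_mul (abs_fst_le_eucl y) (h1 (x + t • y)) (abs_nonneg _) (eucl_nonneg y)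
    have e2 := mul_le_mul (abs_snd_le_eucl y) (h2 (x + t • y)) (abs_nonneg _) (eucl_nonneg y)
    linarith
  simpa using this

theorem exists_differences (hψ : IsFreqCutoff ψ) :
    ∃ C, 0 ≤ C ∧ ∀ (K A : ℝ) (u : Field), 0 < K → IsTP K u → (∀ x, |u x| ≤ A) →
      (∀ x y, |u (x + y) - u x| ≤ C * K * A * eucl y) ∧
      ∀ x y, |u (x + y) + u (x - y) - 2 * u x| ≤ C * K ^ 2 * A * eucl y ^ 2 := by
  obtain ⟨C, hC, hb⟩ := exists_bernstein hψ
  refine ⟨2 * C + 8 * C ^ 2, by positivity, fun K A u hK hu hA => ?_⟩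
  have hA0 : 0 ≤ A := (abs_nonneg _).trans (hA 0)
  obtain ⟨b1, b2⟩ := hb K A u hK hu hA
  obtain ⟨b11, b12⟩ := hb K _ _ hK hu.dx₁ b1
  obtain ⟨b21, b22⟩ := hb K _ _ hK hu.dx₂ b2
  constructor
  · intro x y
    have h0 := eucl_nonneg y
    refine (hu.abs_sub_le b1 b2 x y).trans ?_
    have : 0 ≤ 8 * C ^ 2 * K * A * eucl y := by positivity
    nlinarith
  · intro x y
    have h0 := eucl_nonneg y
    set B := C * K * (C * K * A) with hB
    have l1 := hu.dx₁.abs_sub_le b11 b12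
    have l2 := hu.dx₂.abs_sub_le b21 b22
    have hd : ∀ t, HasDerivAt (fun s : ℝ => u (x + s • y) + u (x + s • (-y)) - 2 * u x)
        (y.1 * dx₁ u (x + t • y) + y.2 * dx₂ u (x + t • y)
          + ((-y).1 * dx₁ u (x + t • (-y)) + (-y).2 * dx₂ u (x + t • (-y)))) t := fun t =>
      ((hu.hasDerivAt_line x y t).add (hu.hasDerivAt_line x (-y) t)).sub_const _
    have := abs_sub_le_of_deriv hd (B := 8 * B * eucl y ^ 2) fun t ht => by
      have e1 := l1 (x + t • (-y)) ((2 * t) • y)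
      have e2 := l2 (x + t • (-y)) ((2 * t) • y)
      have e3 : x + t • (-y) + (2 * t) • y = x + t • y := by
        rw [smul_neg, mul_smul, two_smul]
        abel
      have hB0 : 0 ≤ B := by positivity
      rw [e3, eucl_smul, abs_of_nonneg (by linarith [ht.1] : 0 ≤ 2 * t)] at e1 e2
      have e4 : 2 * B * (2 * t * eucl y) ≤ 4 * B * eucl y := by
        have := mul_le_mul_of_nonneg_left ht.2 (by positivity : 0 ≤ 4 * B * eucl y)
        linarith
      have e5 := mul_le_mul (abs_fst_le_eucl y) (e1.trans e4) (abs_nonneg _) h0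
      have e6 := mul_le_mul (abs_snd_le_eucl y) (e2.trans e4) (abs_nonneg _) h0
      rw [← abs_mul] at e5 e6
      have e7 : y.1 * dx₁ u (x + t • y) + y.2 * dx₂ u (x + t • y)
          + ((-y).1 * dx₁ u (x + t • (-y)) + (-y).2 * dx₂ u (x + t • (-y)))
          = y.1 * (dx₁ u (x + t • y) - dx₁ u (x + t • (-y)))
            + y.2 * (dx₂ u (x + t • y) - dx₂ u (x + t • (-y))) := by
        simp only [Prod.fst_neg, Prod.snd_neg]
        ring
      rw [e7]
      refine (abs_add_le _ _).trans ((add_le_add e5 e6).trans (le_of_eq ?_))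
      ring
    simp only [one_smul, zero_smul, add_zero] at this
    rw [show u x + u x - 2 * u x = 0 by ring, sub_zero, ← sub_eq_add_neg] at this
    refine this.trans ?_
    rw [hB]
    have : 0 ≤ 2 * C * K ^ 2 * A * eucl y ^ 2 := by positivity
    nlinarith

/-! ### Amplitudes -/

theorem abs_sqrt_sub_sqrt_le {a c : ℝ} (ha : 1 ≤ a) (hc : 1 ≤ c) : |√a - √c| ≤ |a - c| := by
  have h1 : 1 ≤ √a := Real.one_le_sqrt.2 ha
  have h2 : 1 ≤ √c := Real.one_le_sqrt.2 hc
  have e : a - c = (√a - √c) * (√a + √c) := by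
    have := sq_sqrt (by linarith : 0 ≤ a)
    have := sq_sqrt (by linarith : 0 ≤ c)
    nlinarith
  rw [e, abs_mul]
  have h3 : 1 ≤ |√a + √c| := by
    rw [abs_of_pos (by linarith)]
    linarith
  nlinarith [abs_nonneg (√a - √c)]

theorem abs_sqrt_second_le {a b c : ℝ} (ha : 1 ≤ a) (hb : 1 ≤ b) (hc : 1 ≤ c) :
    |√a + √b - 2 * √c| ≤ |a + b - 2 * c| + (a - c) ^ 2 + (b - c) ^ 2 := by
  have h1 := abs_sqrt_sub_sqrt_le ha hc
  have h2 := abs_sqrt_sub_sqrt_le hb hc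
  have h3 : 1 ≤ √c := Real.one_le_sqrt.2 hc
  have q1 := sq_sqrt (by linarith : 0 ≤ a)
  have q2 := sq_sqrt (by linarith : 0 ≤ b)
  have q3 := sq_sqrt (by linarith : 0 ≤ c)
  set p := √a
  set q := √b
  set r := √c
  have s1 : (p - r) ^ 2 ≤ (a - c) ^ 2 := by rw [← sq_abs, ← sq_abs (a - c)]; gcongr
  have s2 : (q - r) ^ 2 ≤ (b - c) ^ 2 := by rw [← sq_abs, ← sq_abs (b - c)]; gcongr
  have e : 2 * r * (p + q - 2 * r) = (a + b - 2 * c) - (p - r) ^ 2 - (q - r) ^ 2 := by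
    rw [← q1, ← q2, ← q3]
    ring
  have h4 : |2 * r * (p + q - 2 * r)| ≤ |a + b - 2 * c| + (a - c) ^ 2 + (b - c) ^ 2 := by
    rw [e]
    have t1 := abs_sub ((a + b - 2 * c) - (p - r) ^ 2) ((q - r) ^ 2)
    have t2 := abs_sub (a + b - 2 * c) ((p - r) ^ 2)
    rw [abs_of_nonneg (sq_nonneg (q - r))] at t1
    rw [abs_of_nonneg (sq_nonneg (p - r))] at t2
    linarith
  rw [abs_mul, abs_of_pos (by linarith : 0 < 2 * r)] at h4
  nlinarith [abs_nonneg (p + q - 2 * r)]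

theorem exists_amp_bounds (hψ : IsFreqCutoff ψ) {C₀ : ℝ} (hC₀ : 2 ≤ C₀) :
    ∃ C, 0 ≤ C ∧ ∀ (K mu : ℝ) (u : Field), 0 < K → 0 < mu → IsTP K u → (∀ x, |u x| ≤ 1) →
      SmoothAmp mu C (C * K) (C * K ^ 2) (freqTrunc ψ mu fun x => √(C₀ + u x)) ∧
      ∀ x, |freqTrunc ψ mu (fun x => √(C₀ + u x)) x ^ 2 - (C₀ + u x)| ≤ C * (K / mu) ^ 2 := by
  obtain ⟨C₁, hC₁, hdiff⟩ := exists_differences hψ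
  obtain ⟨C₂, hC₂, hcomb⟩ := exists_freqTrunc_comb_le hψ
  obtain ⟨C₃, hC₃, hsub⟩ := exists_freqTrunc_sub_le hψ
  set S := √(C₀ + 1) with hS
  have hS0 : 0 ≤ S := Real.sqrt_nonneg _
  set E := C₁ + 2 * C₁ ^ 2 with hE
  have hE0 : 0 ≤ E := by positivity
  refine ⟨C₂ * S + C₂ * E + C₃ * E * (C₂ * S + S), by positivity, fun K mu u hK hmu hu hu1 => ?_⟩
  obtain ⟨d1, d2⟩ := hdiff K 1 u hK hu hu1
  set f : Field := fun x => √(C₀ + u x) with hf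
  have hge : ∀ x, 1 ≤ C₀ + u x := fun x => by linarith [(abs_le.1 (hu1 x)).1]
  have hfc : Continuous f := Real.continuous_sqrt.comp (continuous_const.add hu.continuous)
  have hfp : IsPeriodic f := fun x => by simp only [hf, hu.periodic x, and_self]
  have hfb : ∀ x, |f x| ≤ S := fun x => by
    rw [abs_of_nonneg (Real.sqrt_nonneg _)]
    exact Real.sqrt_le_sqrt (by linarith [(abs_le.1 (hu1 x)).2])
  have hf1 : ∀ x y, |f (x + y) - f x| ≤ E * K * eucl y := by
    intro x y
    have h0 := eucl_nonneg y
    refine (abs_sqrt_sub_sqrt_le (hge _) (hge _)).trans ?_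
    rw [add_sub_add_left_eq_sub]
    refine (d1 x y).trans ?_
    rw [hE]
    have : 0 ≤ 2 * C₁ ^ 2 * K * eucl y := by positivity
    nlinarith
  have hf2 : ∀ x y, |f (x + y) + f (x - y) - 2 * f x| ≤ E * K ^ 2 * eucl y ^ 2 := by
    intro x y
    refine (abs_sqrt_second_le (hge _) (hge _) (hge _)).trans ?_
    have k1 := d2 x y
    have k2 := d1 x y
    have k3 := d1 x (-y)
    rw [← sub_eq_add_neg, eucl_neg] at k3
    have e1 : C₀ + u (x + y) + (C₀ + u (x - y)) - 2 * (C₀ + u x)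
        = u (x + y) + u (x - y) - 2 * u x := by ring
    rw [e1, add_sub_add_left_eq_sub, add_sub_add_left_eq_sub, ← sq_abs (u (x + y) - u x),
      ← sq_abs (u (x - y) - u x)]
    have k4 := pow_le_pow_left₀ (abs_nonneg _) k2 2
    have k5 := pow_le_pow_left₀ (abs_nonneg _) k3 2
    rw [hE]
    nlinarith
  have hbb : ∀ x, |freqTrunc ψ mu f x| ≤ C₂ * S := fun x => by
    have := hcomb mu hmu f hfc hfp 1 0 0 S x x x fun h => by simpa using hfb (x + h)
    simpa using this
  set C := C₂ * S + C₂ * E + C₃ * E * (C₂ * S + S) with hCdef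
  have n1 : 0 ≤ C₂ * S := by positivity
  have n2 : 0 ≤ C₂ * E := by positivity
  have n3 : 0 ≤ C₃ * E * (C₂ * S + S) := by positivity
  have hCE : C₂ * E ≤ C := by linarith
  refine ⟨⟨isTP_freqTrunc hψ hmu f, fun x => (hbb x).trans (by linarith), fun x y => ?_,
    fun x y => ?_, mul_nonneg (by linarith) hK.le, mul_nonneg (by linarith) (sq_nonneg K)⟩,
    fun x => ?_⟩
  · have := hcomb mu hmu f hfc hfp 1 (-1) 0 (E * K * eucl y) (x + y) x x fun h => by
      have := hf1 (x + h) y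
      rw [add_right_comm] at this
      simpa [sub_eq_add_neg] using this
    have e : 1 * freqTrunc ψ mu f (x + y) + -1 * freqTrunc ψ mu f x + 0 * freqTrunc ψ mu f x
        = freqTrunc ψ mu f (x + y) - freqTrunc ψ mu f x := by ring
    rw [e] at this
    refine this.trans ?_
    have := mul_le_mul_of_nonneg_right hCE (mul_nonneg hK.le (eucl_nonneg y))
    linarith
  · have := hcomb mu hmu f hfc hfp 1 1 (-2) (E * K ^ 2 * eucl y ^ 2) (x + y) (x - y) x fun h => by
      have := hf2 (x + h) y
      rw [add_right_comm, sub_eq_add_neg, sub_eq_add_neg, add_right_comm x h (-y),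
        ← sub_eq_add_neg x y] at this
      have e : 1 * f (x + y + h) + 1 * f (x - y + h) + -2 * f (x + h)
        = f (x + y + h) + f (x - y + h) + -(2 * f (x + h)) := by ring
      rwa [e]
    have e : 1 * freqTrunc ψ mu f (x + y) + 1 * freqTrunc ψ mu f (x - y) + -2 * freqTrunc ψ mu f x
        = freqTrunc ψ mu f (x + y) + freqTrunc ψ mu f (x - y) - 2 * freqTrunc ψ mu f x := by ring
    rw [e] at this
    refine this.trans ?_
    have := mul_le_mul_of_nonneg_right hCE (mul_nonneg (sq_nonneg K) (sq_nonneg (eucl y)))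
    linarith
  · have k1 := hsub mu hmu f hfc hfp (E * K ^ 2) hf2 x
    have k2 : C₀ + u x = f x ^ 2 := (sq_sqrt (by linarith [hge x])).symm
    rw [k2, sq_sub_sq, abs_mul]
    have k3 : |freqTrunc ψ mu f x + f x| ≤ C₂ * S + S :=
      (abs_add_le _ _).trans (add_le_add (hbb x) (hfb x))
    calc _ ≤ (C₂ * S + S) * (C₃ * (mu⁻¹ ^ 2 * (E * K ^ 2))) :=
          mul_le_mul k3 k1 (abs_nonneg _) (by positivity)
      _ = C₃ * E * (C₂ * S + S) * (K / mu) ^ 2 := by rw [div_eq_mul_inv]; ring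
      _ ≤ _ := mul_le_mul_of_nonneg_right (by linarith) (sq_nonneg _)

/-! ### The mismatch -/

theorem Rep.trig_mul_eq (h : Rep f T c κ) (hK : IsTP K f) (σ : ℤ² → ℂ) (x : ℝ²) :
    trig T (fun p => σ (κ p) * c p) κ x = trig (disc K) (fun k => σ k * SQG.fourierCoeff f k) id x := by
  classical
  set S := T.image κ ∪ disc K with hS
  rw [trig_eq_image T _ κ x S fun p hp => Finset.mem_union_left _ (mem_image_of_mem _ hp)]
  have h1 : trig (disc K) (fun k => σ k * SQG.fourierCoeff f k) id x
      = ∑ k ∈ S, σ k * SQG.fourierCoeff f k * character k x :=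
    sum_subset Finset.subset_union_right fun k _ hk => by
      rw [mem_disc, not_le] at hk
      simp only [hK.fourierCoeff_eq_zero hk, mul_zero, zero_mul]
  rw [h1]
  refine sum_congr rfl fun k _ => ?_
  rw [h.fourierCoeff, mul_sum]
  congr 1
  refine sum_congr rfl fun p _ => ?_
  split_ifs with hp
  · rw [hp]
  · simp

theorem fourierCoeff_const (a : ℝ) {k : ℤ²} (hk : k ≠ 0) : fourierCoeff (fun _ => a) k = 0 := by
  rw [fourierCoeff_of_sum (S := {0}) (a := fun k => if k = 0 then (a : ℂ) else 0)
    (fun k hk => if_neg (by simpa using hk))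
    (by intro x; simp [character_zero])]
  simp [hk]

theorem isTP_const (a : ℝ) (hK : 0 ≤ K) : IsTP K (fun _ => a) := by
  refine Rep.isTP (T := ({0} : Finset ℤ²)) (c := fun _ => (a : ℂ)) (κ := id)
    (fun x => by simp [trig, character_zero]) fun p hp => ?_
  rw [Finset.mem_singleton] at hp
  rw [hp]
  simpa [freqAbs_zero] using hK

/-- The direction vectors with signs. -/
def signedDir (i : Fin 2 × Bool) : ℝ² := if i.2 then direction i.1 else -direction i.1

/-- The frequency `± 5 n l_j`. -/
def signedFreq (n : ℕ) (i : Fin 2 × Bool) : ℤ² :=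
  let v : ℤ² := if i.1 = 0 then (3 * n, 4 * n) else (5 * n, 0)
  if i.2 then v else -v

/-- The opposite index. -/
def oppIndex (i : Fin 2 × Bool) : Fin 2 × Bool := (i.1, !i.2)

theorem toVec_signedFreq (n : ℕ) (i : Fin 2 × Bool) :
    toVec (signedFreq n i) = (5 * n : ℝ) • signedDir i := by
  obtain ⟨j, s⟩ := i
  fin_cases j <;> cases s <;> simp [signedFreq, signedDir, direction, toVec] <;> ring_nf <;> simp

theorem eucl_signedDir (i : Fin 2 × Bool) : eucl (signedDir i) = 1 := by
  obtain ⟨j, s⟩ := i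
  rw [eucl, Real.sqrt_eq_one]
  fin_cases j <;> cases s <;> norm_num [signedDir, direction]

theorem signedFreq_opp (n : ℕ) (i : Fin 2 × Bool) : signedFreq n (oppIndex i) = -signedFreq n i := by
  obtain ⟨j, s⟩ := i
  cases s <;> simp [signedFreq, oppIndex]

theorem eucl_signedDir_add {i i' : Fin 2 × Bool} (h : i' ≠ oppIndex i) :
    4 / 5 < eucl (signedDir i + signedDir i') := by
  obtain ⟨j, s⟩ := i
  obtain ⟨j', s'⟩ := i'
  rw [eucl, Real.lt_sqrt (by norm_num)]
  fin_cases j <;> fin_cases j' <;> cases s <;> cases s' <;>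
    first
    | (exfalso; exact h rfl)
    | norm_num [signedDir, direction]

theorem dirSym_neg (w y : ℝ²) : dirSym (-w) y = dirSym w y := by
  simp only [dirSym, Prod.fst_neg, Prod.snd_neg]
  push_cast
  ring

theorem dirSym_signedDir (i : Fin 2 × Bool) (y : ℝ²) :
    dirSym (signedDir i) y = dirSym (direction i.1) y := by
  obtain ⟨j, s⟩ := i
  cases s
  · simp only [signedDir, Bool.false_eq_true, if_false, dirSym_neg]
  · simp [signedDir]

theorem sum_dirSym_rieszSym {k : ℤ²} (hk : k ≠ 0) :
    ∑ j : Fin 2, dirSym (direction j) (toVec k) * (rieszOSymbol j k : ℂ) = -1 := by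
  have hk2 : (k.1 : ℝ) ^ 2 + (k.2 : ℝ) ^ 2 ≠ 0 := by
    rw [← freqAbs_sq]
    exact pow_ne_zero 2 (freqAbs_pos hk).ne'
  have h : ∑ j : Fin 2, ((((toVec k).1 * (direction j).2 - (toVec k).2 * (direction j).1)
      * ((toVec k).1 * (direction j).1 + (toVec k).2 * (direction j).2)) * absPow (-2) (toVec k))
      * rieszOSymbol j k = -1 := by
    rw [Fin.sum_univ_two, absPow_neg_two]
    simp only [rieszOSymbol, hk, direction, toVec, ↓reduceIte, freqAbs_sq, one_ne_zero, neg_neg]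
    field_simp
    ring
  have := congrArg Complex.ofReal h
  push_cast at this
  simp only [dirSym]
  push_cast
  exact this

theorem trig_pair_expand {n : ℕ} {mu a : ℝ} {β : Fin 2 → Field} (h : ℝ² → ℂ) (x : ℝ²) :
    trig (((univ : Finset (Fin 2 × Bool)) ×ˢ disc mu) ×ˢ
        ((univ : Finset (Fin 2 × Bool)) ×ˢ disc mu))
      (fun p => h (toVec (signedFreq n p.1.1 + p.1.2 + (signedFreq n p.2.1 + p.2.2)))
        * ((symmSym (toVec (signedFreq n p.1.1 + p.1.2)) (toVec (signedFreq n p.2.1 + p.2.2)) : ℂ)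
          * (((a : ℂ) * fourierCoeff (β p.1.1.1) p.1.2) * ((a : ℂ) * fourierCoeff (β p.2.1.1) p.2.2))))
      (fun p => signedFreq n p.1.1 + p.1.2 + (signedFreq n p.2.1 + p.2.2)) x
    = ∑ i : Fin 2 × Bool, ∑ i' : Fin 2 × Bool,
      (a : ℂ) ^ 2 * (character (signedFreq n i + signedFreq n i') x
        * trig (disc mu ×ˢ disc mu) (fun p => h (toVec (signedFreq n i + p.1 + (signedFreq n i' + p.2)))
          * ((symmSym (toVec (signedFreq n i + p.1)) (toVec (signedFreq n i' + p.2)) : ℂ)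
            * (fourierCoeff (β i.1) p.1 * fourierCoeff (β i'.1) p.2))) (fun p => p.1 + p.2) x) := by
  simp only [trig, sum_product, mul_sum]
  refine sum_congr rfl fun i _ => ?_
  rw [sum_comm]
  refine sum_congr rfl fun i' _ => sum_congr rfl fun k _ =>
    sum_congr rfl fun l _ => ?_
  rw [add_add_add_comm, ← character_mul (signedFreq n i + signedFreq n i')]
  ring

theorem rep_wave {n : ℕ} {mu a : ℝ} {β : Fin 2 → Field} (hβ : ∀ j, IsTP mu (β j)) :
    Rep (fun x => ∑ j : Fin 2, (2 * a * β j x)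
        * Real.cos (5 * n * ((direction j).1 * x.1 + (direction j).2 * x.2)))
      ((univ : Finset (Fin 2 × Bool)) ×ˢ disc mu)
      (fun p => (a : ℂ) * fourierCoeff (β p.1.1) p.2) (fun p => signedFreq n p.1 + p.2) := by
  intro x
  have h1 : trig ((univ : Finset (Fin 2 × Bool)) ×ˢ disc mu)
      (fun p => (a : ℂ) * fourierCoeff (β p.1.1) p.2) (fun p => signedFreq n p.1 + p.2) x
      = ∑ i : Fin 2 × Bool, (a : ℂ) * character (signedFreq n i) x * (β i.1 x : ℂ) := by
    simp only [trig, sum_product]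
    refine sum_congr rfl fun i _ => ?_
    rw [hβ i.1 x, trig, mul_sum]
    refine sum_congr rfl fun k _ => ?_
    rw [← character_mul]
    simp only [id]
    ring
  rw [h1, Fintype.sum_prod_type]
  push_cast
  refine sum_congr rfl fun j _ => ?_
  simp only [Fintype.sum_bool]
  have h2 : ∀ s : Bool, character (signedFreq n (j, s)) x
      = Complex.exp (((if s then (1 : ℝ) else -1)
        * (5 * n * ((direction j).1 * x.1 + (direction j).2 * x.2)) : ℝ) * I) := by
    intro s
    have := toVec_signedFreq n (j, s)
    have e1 := congrArg Prod.fst this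
    have e2 := congrArg Prod.snd this
    simp only [toVec] at e1 e2
    rw [character]
    congr 1
    have e1' : ((signedFreq n (j, s)).1 : ℂ) = (((signedFreq n (j, s)).1 : ℝ) : ℂ) := by push_cast; rfl
    have e2' : ((signedFreq n (j, s)).2 : ℂ) = (((signedFreq n (j, s)).2 : ℝ) : ℂ) := by push_cast; rfl
    rw [e1', e2', e1, e2]
    cases s
    · simp [signedDir]
      ring
    · simp [signedDir]
      ring
  rw [h2, h2, Complex.cos]
  simp only [if_true, Bool.false_eq_true, if_false]
  push_cast
  ring_nf

theorem HomSymbol.mismatch_bound (hψ : IsFreqCutoff ψ) {h : ℝ² → ℂ} (H : HomSymbol 0 h) :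
    ∃ C, 0 ≤ C ∧ ∀ (n : ℕ) (mu K χ A C₀ : ℝ) (q : Field) (u β : Fin 2 → Field), 0 < n → 10 ≤ mu →
      mu ≤ n → 0 < K → K ≤ 4 * mu → 0 < χ → IsTP K q → 0 ≤ A →
      (∀ j, u j = fun x => χ⁻¹ * rieszO j q x) → (∀ j, SmoothAmp mu A (A * K) (A * K ^ 2) (β j)) →
      (∀ j x, |β j x ^ 2 - (C₀ + u j x)| ≤ A * (K / mu) ^ 2) →
      ∀ x, ‖trig (((univ : Finset (Fin 2 × Bool)) ×ˢ disc mu) ×ˢ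
          ((univ : Finset (Fin 2 × Bool)) ×ˢ disc mu))
        (fun p => h (toVec (signedFreq n p.1.1 + p.1.2 + (signedFreq n p.2.1 + p.2.2)))
          * ((symmSym (toVec (signedFreq n p.1.1 + p.1.2)) (toVec (signedFreq n p.2.1 + p.2.2)) : ℂ)
          * ((((√(χ / (5 * n)) : ℝ) : ℂ) * fourierCoeff (β p.1.1.1) p.1.2)
            * (((√(χ / (5 * n)) : ℝ) : ℂ) * fourierCoeff (β p.2.1.1) p.2.2))))
        (fun p => signedFreq n p.1.1 + p.1.2 + (signedFreq n p.2.1 + p.2.2)) x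
        + trig (disc K) (fun k => h (toVec k) * fourierCoeff q k) id x‖
        ≤ C * (A + A ^ 2) * χ * (log mu * (K / mu) ^ 2 + K / n) := by
  have hpair : ∀ i i' : Fin 2 × Bool, ∃ C, 0 ≤ C ∧ ∀ (n : ℕ) (mu K A : ℝ) (β : Fin 2 → Field),
      0 < n → 10 ≤ mu → mu ≤ n → 0 < K → 0 ≤ A →
      (∀ j, SmoothAmp mu A (A * K) (A * K ^ 2) (β j)) → ∀ x,
      ‖character (signedFreq n i + signedFreq n i') x
        * trig (disc mu ×ˢ disc mu) (fun p => h (toVec (signedFreq n i + p.1 + (signedFreq n i' + p.2)))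
          * ((symmSym (toVec (signedFreq n i + p.1)) (toVec (signedFreq n i' + p.2)) : ℂ)
            * (fourierCoeff (β i.1) p.1 * fourierCoeff (β i'.1) p.2))) (fun p => p.1 + p.2) x
        - (if i' = oppIndex i then ((5 * n / 2 : ℝ) : ℂ) * trig (disc mu ×ˢ disc mu) (fun p =>
          (h (toVec (p.1 + p.2)) * dirSym (direction i.1) (toVec (p.1 + p.2)))
            * (fourierCoeff (β i.1) p.1 * fourierCoeff (β i.1) p.2)) (fun p => p.1 + p.2) x else 0)‖
      ≤ C * A ^ 2 * (n * (log mu * (K / mu) ^ 2 + K / n)) := by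
    intro i i'
    by_cases hi : i' = oppIndex i
    · obtain ⟨C, hC, hb⟩ := H.low_pair_bound hψ (eucl_signedDir i)
      refine ⟨4 * C, by positivity, fun n mu K A β hn h10 hmun hK hA hβ x => ?_⟩
      have hn' : (0 : ℝ) < n := by exact_mod_cast hn
      have := hb (5 * n) mu A (A * K) (A * K ^ 2) (β i.1) (signedFreq n i) (by positivity)
        (by linarith) (by linarith) (hβ i.1) (toVec_signedFreq n i) x
      rw [if_pos hi, hi, signedFreq_opp, add_neg_cancel, character_zero, one_mul]
      have e : ∀ p : ℤ² × ℤ², signedFreq n i + p.1 + (-signedFreq n i + p.2) = p.1 + p.2 :=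
        fun p => by abel
      simp only [e, oppIndex]
      simp only [dirSym_signedDir] at this
      refine this.trans ?_
      have hlog : log (2 * mu) ≤ 2 * log mu := by
        rw [← Nat.cast_two, ← Real.log_pow]
        refine Real.log_le_log (by push_cast; linarith) ?_
        push_cast
        nlinarith
      have hlog0 : 0 ≤ log mu := Real.log_nonneg (by linarith)
      have e1 : (5 * (n : ℝ))⁻¹ * (A * (A * K ^ 2) + (A * K) ^ 2) ≤ 2 * A ^ 2 * (n * (K / mu) ^ 2) := by
        have : (n : ℝ)⁻¹ ≤ n * (1 / mu) ^ 2 := by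
          rw [inv_le_iff_one_le_mul₀ hn']
          rw [one_div, show mu⁻¹ ^ 2 = (mu ^ 2)⁻¹ by rw [inv_pow]]
          have : 0 < mu ^ 2 := by positivity
          rw [show (n : ℝ) * (mu ^ 2)⁻¹ * n = n ^ 2 / mu ^ 2 by ring, le_div_iff₀ this]
          nlinarith
        have h2 := mul_le_mul_of_nonneg_left this (by positivity : 0 ≤ 2 * A ^ 2 * K ^ 2)
        have h3 : 0 ≤ (n : ℝ)⁻¹ := by positivity
        calc (5 * (n : ℝ))⁻¹ * (A * (A * K ^ 2) + (A * K) ^ 2)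
            = 5⁻¹ * (2 * A ^ 2 * K ^ 2 * (n : ℝ)⁻¹) := by rw [mul_inv]; ring
          _ ≤ 2 * A ^ 2 * K ^ 2 * (n : ℝ)⁻¹ := by
            have : 0 ≤ 2 * A ^ 2 * K ^ 2 * (n : ℝ)⁻¹ := by positivity
            linarith
          _ ≤ _ := h2
          _ = _ := by ring
      calc _ ≤ C * (2 * log mu) * (2 * A ^ 2 * (n * (K / mu) ^ 2)) := by gcongr
        _ ≤ _ := by
          have : 0 ≤ 4 * C * A ^ 2 * (n * (K / n)) := by positivity
          nlinarith
    · obtain ⟨C, hC, hb⟩ := H.high_pair_bound hψ (eucl_signedDir i) (eucl_signedDir i')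
        (eucl_signedDir_add hi)
      refine ⟨2 * C, by positivity, fun n mu K A β hn h10 hmun hK hA hβ x => ?_⟩
      have hn' : (0 : ℝ) < n := by exact_mod_cast hn
      have := hb (5 * n) mu A (A * K) (A * K ^ 2) A (A * K) (A * K ^ 2) (β i.1) (β i'.1)
        (signedFreq n i) (signedFreq n i') (by positivity) (by linarith) (hβ i.1) (hβ i'.1)
        (toVec_signedFreq n i) (toVec_signedFreq n i') x
      rw [if_neg hi, sub_zero, norm_mul, norm_character, one_mul]
      refine this.trans ?_
      have hlog0 : 0 ≤ log mu := Real.log_nonneg (by linarith)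
      have : 0 ≤ 2 * C * A ^ 2 * (n * (log mu * (K / mu) ^ 2)) := by positivity
      have e : (n : ℝ) * (K / n) = K := by field_simp
      calc C * (A * K * A + A * (A * K)) = 2 * C * A ^ 2 * (n * (K / n)) := by rw [e]; ring
        _ ≤ _ := by linarith
  choose Cp hCp hbp using hpair
  have Hd : ∀ j : Fin 2, HomSymbol 0 fun y => h y * dirSym (direction j) y := fun j =>
    (H.mul (homSymbol_dirSym _)).cast (zero_add 0)
  choose Cl hCl hbl using fun j => (Hd j).log_bound hψ
  refine ⟨∑ i, ∑ i', Cp i i' + 2 * ∑ j, Cl j, by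
      have := sum_nonneg fun j (_ : j ∈ univ) => hCl j
      have := sum_nonneg fun i (_ : i ∈ univ) =>
        sum_nonneg fun i' (_ : i' ∈ univ) => hCp i i'
      positivity,
    fun n mu K χ A C₀ q u β hn h10 hmun hK hKmu hχ hq hA hu hβ hβ2 x => ?_⟩
  have hn' : (0 : ℝ) < n := by exact_mod_cast hn
  have hlog0 : 0 ≤ log mu := Real.log_nonneg (by linarith)
  set a := √(χ / (5 * n)) with ha
  have ha2 : a ^ 2 = χ / (5 * n) := sq_sqrt (by positivity)
  rw [trig_pair_expand]
  set X : Fin 2 × Bool → Fin 2 × Bool → ℂ := fun i i' => character (signedFreq n i + signedFreq n i') x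
        * trig (disc mu ×ˢ disc mu) (fun p => h (toVec (signedFreq n i + p.1 + (signedFreq n i' + p.2)))
          * ((symmSym (toVec (signedFreq n i + p.1)) (toVec (signedFreq n i' + p.2)) : ℂ)
            * (fourierCoeff (β i.1) p.1 * fourierCoeff (β i'.1) p.2))) (fun p => p.1 + p.2) x with hX
  set Y : Fin 2 → ℂ := fun j => ((5 * n / 2 : ℝ) : ℂ) * trig (disc mu ×ˢ disc mu) (fun p =>
          (h (toVec (p.1 + p.2)) * dirSym (direction j) (toVec (p.1 + p.2)))
            * (fourierCoeff (β j) p.1 * fourierCoeff (β j) p.2)) (fun p => p.1 + p.2) x with hY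
  set Q := trig (disc K) (fun k => h (toVec k) * fourierCoeff q k) id x with hQ
  have hmain : ‖(a : ℂ) ^ 2 * ∑ i : Fin 2 × Bool, Y i.1 + Q‖
      ≤ 2 * (∑ j, Cl j) * A * χ * (log mu * (K / mu) ^ 2) := by
    have e1 : (a : ℂ) ^ 2 * ∑ i : Fin 2 × Bool, Y i.1 = χ * ∑ j : Fin 2,
        trig (disc (4 * mu)) (fun k => (h (toVec k) * dirSym (direction j) (toVec k))
          * fourierCoeff (fun x => β j x * β j x) k) id x := by
      have : (a : ℂ) ^ 2 = ((χ / (5 * n) : ℝ) : ℂ) := by rw [← ha2]; push_cast; rfl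
      rw [this, Fintype.sum_prod_type, mul_sum, mul_sum]
      refine sum_congr rfl fun j _ => ?_
      have h2 : IsTP (4 * mu) fun x => β j x * β j x :=
        ((hβ j).isTP.mul (hβ j).isTP).mono (by linarith)
      rw [← (Rep.mul (hβ j).isTP (hβ j).isTP).trig_mul_eq h2
        (fun k => h (toVec k) * dirSym (direction j) (toVec k))]
      simp only [hY, Fintype.sum_bool, id]
      have hnc : (n : ℂ) ≠ 0 := by exact_mod_cast hn.ne'
      push_cast
      field_simp
      ring
    have hq4 : IsTP (4 * mu) q := hq.mono hKmu
    have hu4 : ∀ j, IsTP (4 * mu) (u j) := fun j => by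
      rw [hu j]
      exact (hq4.rieszO j).const_mul _
    have e2 : Q = trig (disc (4 * mu)) (fun k => h (toVec k) * fourierCoeff q k) id x :=
      Rep.trig_mul_eq hq hq4 (fun k => h (toVec k)) x
    let F : Fin 2 → Field := fun j x => β j x * β j x - (C₀ + u j x)
    have hF : ∀ j, IsTP (4 * mu) (F j) := fun j =>
      (((hβ j).isTP.mul (hβ j).isTP).mono (by linarith)).sub
        ((isTP_const C₀ (by linarith)).add (hu4 j))
    have hχc : (χ : ℂ) ≠ 0 := by exact_mod_cast hχ.ne'
    have hFc : ∀ j k, k ≠ 0 → fourierCoeff (F j) k = fourierCoeff (fun x => β j x * β j x) k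
        - (χ : ℂ)⁻¹ * ((rieszOSymbol j k : ℂ) * fourierCoeff q k) := by
      intro j k hk
      have c1 := ((hβ j).isTP.mul (hβ j).isTP).continuous
      have c2 := (isTP_const C₀ (by linarith : 0 ≤ 4 * mu)).continuous
      have e5 : fourierCoeff (u j) k = (χ : ℂ)⁻¹ * ((rieszOSymbol j k : ℂ) * fourierCoeff q k) := by
        rw [hu j, fourierCoeff_const_mul, rieszO, hq.fourierCoeff_fourierMul (rieszOSymbol_even j)]
        push_cast
        rfl
      have e6 := fourierCoeff_sub c1 (c2.add (hu4 j).continuous) k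
      refine e6.trans ?_
      have e7 := fourierCoeff_add c2 (hu4 j).continuous k
      rw [fourierCoeff_const C₀ hk, zero_add, e5] at e7
      congr 1
    have e3 : (a : ℂ) ^ 2 * ∑ i : Fin 2 × Bool, Y i.1 + Q = χ * ∑ j : Fin 2,
        trig (disc (4 * mu)) (fun k => (h (toVec k) * dirSym (direction j) (toVec k))
          * fourierCoeff (F j) k) id x := by
      rw [e1, e2]
      simp only [trig, mul_sum]
      rw [sum_comm, ← sum_add_distrib, sum_comm]
      refine sum_congr rfl fun k _ => ?_
      by_cases hk : k = 0
      · rw [hk, toVec_eq_zero.2 rfl, H.zero]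
        simp
      · have := sum_dirSym_rieszSym hk
        rw [Fin.sum_univ_two] at this ⊢
        rw [Fin.sum_univ_two, hFc 0 k hk, hFc 1 k hk]
        have hχi : (χ : ℂ) * (χ : ℂ)⁻¹ = 1 := mul_inv_cancel₀ hχc
        linear_combination (h (toVec k) * fourierCoeff q k * character (id k) x) * this
          + (h (toVec k) * fourierCoeff q k * character (id k) x
            * (dirSym (direction 0) (toVec k) * (rieszOSymbol 0 k : ℂ)
              + dirSym (direction 1) (toVec k) * (rieszOSymbol 1 k : ℂ))) * hχi
    rw [e3, norm_mul, norm_real, Real.norm_of_nonneg hχ.le]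
    have e4 : ∀ j, ‖trig (disc (4 * mu)) (fun k => (h (toVec k) * dirSym (direction j) (toVec k))
          * fourierCoeff (F j) k) id x‖ ≤ Cl j * log (4 * mu) * (A * (K / mu) ^ 2) := by
      intro j
      refine hbl j (4 * mu) (by linarith) _ _ _ _ _ (fun p hp => mem_disc.1 hp) ?_ x
      refine norm_trig_of_rep (hF j) fun x => ?_
      have := hβ2 j x
      rwa [sq] at this
    have hlog : log (4 * mu) ≤ 2 * log mu := by
      have e5 : 2 * log mu = log (mu ^ 2) := by
        rw [Real.log_pow]
        norm_num
      rw [e5]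
      exact Real.log_le_log (by linarith) (by nlinarith)
    calc χ * ‖∑ j : Fin 2, trig (disc (4 * mu)) (fun k => (h (toVec k) * dirSym (direction j) (toVec k))
          * fourierCoeff (F j) k) id x‖
        ≤ χ * ∑ j, Cl j * log (4 * mu) * (A * (K / mu) ^ 2) :=
          mul_le_mul_of_nonneg_left ((norm_sum_le _ _).trans (sum_le_sum fun j _ => e4 j)) hχ.le
      _ = χ * ((∑ j, Cl j) * log (4 * mu) * (A * (K / mu) ^ 2)) := by
          rw [sum_mul, sum_mul]
      _ ≤ χ * ((∑ j, Cl j) * (2 * log mu) * (A * (K / mu) ^ 2)) := by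
          have := sum_nonneg fun j (_ : j ∈ univ) => hCl j
          gcongr
      _ = _ := by ring
  have herr : ‖∑ i, ∑ i', (X i i' - if i' = oppIndex i then Y i.1 else 0)‖
      ≤ (∑ i, ∑ i', Cp i i') * A ^ 2 * (n * (log mu * (K / mu) ^ 2 + K / n)) := by
    rw [sum_mul, sum_mul]
    refine (norm_sum_le _ _).trans (sum_le_sum fun i _ => ?_)
    rw [sum_mul, sum_mul]
    refine (norm_sum_le _ _).trans (sum_le_sum fun i' _ => ?_)
    exact hbp i i' n mu K A β hn h10 hmun hK hA hβ x
  have hsplit : ∑ i, ∑ i', (a : ℂ) ^ 2 * X i i' + Q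
      = (a : ℂ) ^ 2 * ∑ i, ∑ i', (X i i' - if i' = oppIndex i then Y i.1 else 0)
        + ((a : ℂ) ^ 2 * ∑ i : Fin 2 × Bool, Y i.1 + Q) := by
    simp only [sum_sub_distrib, Finset.sum_ite_eq', mem_univ, if_true, ← mul_sum]
    ring
  rw [hsplit]
  refine (norm_add_le _ _).trans ?_
  have h3 : ‖(a : ℂ) ^ 2‖ = χ / (5 * n) := by
    rw [← ha2, norm_pow, norm_real, norm_eq_abs, sq_abs]
  rw [norm_mul, h3]
  have P0 : 0 ≤ ∑ i, ∑ i', Cp i i' := sum_nonneg fun i _ => sum_nonneg fun i' _ => hCp i i'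
  have P1 : 0 ≤ ∑ j, Cl j := sum_nonneg fun j _ => hCl j
  set P := ∑ i, ∑ i', Cp i i'
  set P' := ∑ j, Cl j
  set Z := log mu * (K / mu) ^ 2 with hZ
  have hZ0 : 0 ≤ Z := by positivity
  have hW0 : 0 ≤ K / n := by positivity
  calc _ ≤ χ / (5 * n) * (P * A ^ 2 * (n * (Z + K / n))) + 2 * P' * A * χ * Z :=
        add_le_add (mul_le_mul_of_nonneg_left herr (by positivity)) hmain
    _ = 5⁻¹ * (P * A ^ 2 * χ * (Z + K / n)) + 2 * P' * A * χ * Z := by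
        field_simp
    _ ≤ P * A ^ 2 * χ * (Z + K / n) + 2 * P' * A * χ * (Z + K / n) := by
        have t1 : 0 ≤ P * A ^ 2 * χ * (Z + K / n) := by positivity
        have t2 : 0 ≤ 2 * P' * A * χ * (K / n) := by positivity
        nlinarith
    _ ≤ _ := by
        have t1 : 0 ≤ P * A * χ * (Z + K / n) := by positivity
        have t2 : 0 ≤ 2 * P' * A ^ 2 * χ * (Z + K / n) := by positivity
        nlinarith

theorem xBound_of_homSymbols {F : Field}
    (h : Rep F T c κ) {K A : ℝ} (hK : IsTP K F) (h0 : fourierCoeff F 0 = 0)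
    (hA : ∀ x, ‖trig T (fun p => (absPow 0 (toVec (κ p)) : ℂ) * c p) κ x‖ ≤ A)
    (hj : ∀ j x, ‖trig T (fun p => rieszSym j (toVec (κ p)) * c p) κ x‖ ≤ A) : XBound F A := by
  refine ⟨fun x => ?_, fun j => abs_le_of_rep (h.rieszO j) (hj j)⟩
  have := hA x
  rw [h.trig_mul_eq hK (fun k => (absPow 0 (toVec k) : ℂ))] at this
  have e : ∀ k ∈ disc K, (absPow 0 (toVec k) : ℂ) * fourierCoeff F k = fourierCoeff F k := by
    intro k _
    by_cases hk : k = 0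
    · rw [hk, h0, mul_zero]
    · rw [absPow_toVec, if_neg hk]
      simp
  rw [trig_congr e, ← hK x, norm_real] at this
  exact this

theorem fourierCoeff_bilin_zero {K K' : ℝ} {f g : Field} (hf : IsTP K f) (hg : IsTP K' g) :
    fourierCoeff (bilin f g) 0 = 0 := by
  have h1 : IsTP (K + K') fun x => (-dx₂ f x) * lambdaPow 1 g x :=
    hf.dx₂.neg.mul (hg.fourierMul (lambdaPow_even 1))
  have h2 : IsTP (K + K') fun x => dx₁ f x * lambdaPow 1 g x :=
    hf.dx₁.mul (hg.fourierMul (lambdaPow_even 1))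
  have := (h1.dx₁.add h2.dx₂).fourierCoeff_fourierMul
    (σ := fun k => if k = 0 then 0 else -(freqAbs k ^ 2)⁻¹) invLaplacian_even 0
  rw [if_pos rfl, Complex.ofReal_zero, zero_mul] at this
  exact this

/-- The oscillating perturbation built on a residual at a fixed time. -/
def wave (ψ : ℝ² → ℝ) (C₀ lam mu χ : ℝ) (q : Field) : Field := fun x =>
  ∑ j : Fin 2, amplitude ψ C₀ lam mu χ q j x
    * Real.cos (5 * lam * ((direction j).1 * x.1 + (direction j).2 * x.2))

/-- The square-root profile of the amplitudes. -/
def profile (ψ : ℝ² → ℝ) (C₀ mu χ : ℝ) (q : Field) (j : Fin 2) : Field :=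
  freqTrunc ψ mu fun x => √(C₀ + χ⁻¹ * rieszO j q x)

theorem wave_eq {q : Field} (hq : IsTP K q) (ψ : ℝ² → ℝ) (C₀ lam mu χ : ℝ) :
    wave ψ C₀ lam mu χ q = fun x => ∑ j : Fin 2, (2 * √(χ / (5 * lam)) * profile ψ C₀ mu χ q j x)
        * Real.cos (5 * lam * ((direction j).1 * x.1 + (direction j).2 * x.2)) := by
  have e : ∀ j, rieszO j (fun w => q w / χ) = fun x => χ⁻¹ * rieszO j q x := by
    intro j
    simp only [div_eq_inv_mul]
    exact hq.fourierMul_const_mul χ⁻¹ (rieszOSymbol_even j)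
  funext x
  simp only [wave, amplitude, profile, e]

theorem wave_rep (hψ : IsFreqCutoff ψ) {q : Field} (hq : IsTP K q) (C₀ χ : ℝ)
    {mu : ℝ} (hmu : 0 < mu) (n : ℕ) :
    Rep (wave ψ C₀ n mu χ q) ((univ : Finset (Fin 2 × Bool)) ×ˢ disc mu)
      (fun p => ((√(χ / (5 * n)) : ℝ) : ℂ) * fourierCoeff (profile ψ C₀ mu χ q p.1.1) p.2)
      (fun p => signedFreq n p.1 + p.2) := by
  rw [wave_eq hq]
  exact rep_wave fun j => isTP_freqTrunc hψ hmu _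

theorem exists_mismatch_xBound (hψ : IsFreqCutoff ψ) {C₀ : ℝ} (hC₀ : 2 ≤ C₀) :
    ∃ C, 0 ≤ C ∧ ∀ (n : ℕ) (mu K χ : ℝ) (q : Field), 0 < n → 10 ≤ mu → mu ≤ n → 0 < K → K ≤ 4 * mu →
      0 < χ → IsTP K q → fourierCoeff q 0 = 0 → (∀ j x, |rieszO j q x| ≤ χ) →
      XBound (fun x => bilin (wave ψ C₀ n mu χ q) (wave ψ C₀ n mu χ q) x + q x)
        (C * χ * (log mu * (K / mu) ^ 2 + K / n)) := by
  obtain ⟨A, hA, hamp⟩ := exists_amp_bounds hψ hC₀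
  obtain ⟨C₁, hC₁, hb₁⟩ := (homSymbol_absPow 0).mismatch_bound hψ
  choose C₂ hC₂ hb₂ using fun j => (homSymbol_rieszSym j).mismatch_bound hψ
  have hC20 : 0 ≤ ∑ j, C₂ j := sum_nonneg fun j _ => hC₂ j
  refine ⟨(C₁ + ∑ j, C₂ j) * (A + A ^ 2), by positivity,
    fun n mu K χ q hn h10 hmun hK hKmu hχ hq hq0 hqχ => ?_⟩
  have hmu : 0 < mu := by linarith
  let u : Fin 2 → Field := fun j x => χ⁻¹ * rieszO j q x
  have hu : ∀ j, IsTP K (u j) := fun j => (hq.rieszO j).const_mul _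
  have hu1 : ∀ j x, |u j x| ≤ 1 := fun j x => by
    rw [abs_mul, abs_of_pos (inv_pos.2 hχ), inv_mul_le_iff₀ hχ, mul_one]
    exact hqχ j x
  have hwave := wave_rep hψ hq C₀ χ hmu n
  set g := wave ψ C₀ n mu χ q with hg
  have hβ : ∀ j, SmoothAmp mu A (A * K) (A * K ^ 2) (profile ψ C₀ mu χ q j) := fun j =>
    (hamp K mu (u j) hK hmu (hu j) (hu1 j)).1
  have hβ2 : ∀ j x, |profile ψ C₀ mu χ q j x ^ 2 - (C₀ + u j x)| ≤ A * (K / mu) ^ 2 := fun j =>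
    (hamp K mu (u j) hK hmu (hu j) (hu1 j)).2
  have hgTP : ∃ L, 0 ≤ L ∧ IsTP L g :=
    ⟨∑ p ∈ (univ : Finset (Fin 2 × Bool)) ×ˢ disc mu, freqAbs (signedFreq n p.1 + p.2),
      sum_nonneg fun p _ => freqAbs_nonneg _,
      hwave.isTP fun p hp => single_le_sum
        (f := fun p : (Fin 2 × Bool) × ℤ² => freqAbs (signedFreq n p.1 + p.2))
        (fun p _ => freqAbs_nonneg _) hp⟩
  obtain ⟨L, hL, hgL⟩ := hgTP
  have hB := isTP_bilin hgL hgL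
  have hrep := (Rep.bilin_self hwave).add hq
  have hTP : IsTP (L + L + K) fun x => bilin g g x + q x :=
    (hB.mono (by linarith)).add (hq.mono (by linarith))
  have h0 : fourierCoeff (fun x => bilin g g x + q x) 0 = 0 := by
    rw [fourierCoeff_add hB.continuous hq.continuous, fourierCoeff_bilin_zero hgL hgL, hq0, add_zero]
  set Z := log mu * (K / mu) ^ 2 + K / n with hZ
  have hn' : (0 : ℝ) < n := by exact_mod_cast hn
  have hZ0 : 0 ≤ Z := by
    have : 0 ≤ log mu := Real.log_nonneg (by linarith)
    positivity
  have hW : 0 ≤ (A + A ^ 2) * χ * Z := by positivity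
  refine xBound_of_homSymbols hrep hTP h0 (fun x => ?_) fun j x => ?_
  · have := hb₁ n mu K χ A C₀ q u _ hn h10 hmun hK hKmu hχ hq hA (fun j => rfl) hβ hβ2 x
    refine le_trans (le_of_eq ?_) (this.trans ?_)
    · congr 1
      rw [trig, Finset.sum_disjSum]
      rfl
    · nlinarith [mul_nonneg hC20 hW]
  · have := hb₂ j n mu K χ A C₀ q u _ hn h10 hmun hK hKmu hχ hq hA (fun j => rfl) hβ hβ2 x
    refine le_trans (le_of_eq ?_) (this.trans ?_)
    · congr 1
      rw [trig, Finset.sum_disjSum]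
      rfl
    · have h3 : C₂ j ≤ ∑ j, C₂ j := single_le_sum (f := C₂) (fun j _ => hC₂ j) (mem_univ j)
      nlinarith [mul_nonneg hC₁ hW, mul_le_mul_of_nonneg_right h3 hW]

/-! ### Continuous families of trigonometric polynomials -/

/-- A family of trigonometric polynomials of frequency at most `K` that depends continuously on a
parameter. -/
structure TCont {E : Type*} [TopologicalSpace E] (K : ℝ) (u : E → Field) : Prop where
  isTP : ∀ e, IsTP K (u e)
  cont : ∀ k, Continuous fun e => fourierCoeff (u e) k

section TCont

variable {E : Type*} [TopologicalSpace E] {K K' : ℝ} {u v : E → Field}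

theorem TCont.mono (hu : TCont K u) (h : K ≤ K') : TCont K' u :=
  ⟨fun e => (hu.isTP e).mono h, hu.cont⟩

theorem TCont.joint (hu : TCont K u) : Continuous fun p : E × ℝ² => u p.1 p.2 := by
  have e : (fun p : E × ℝ² => u p.1 p.2) = fun p =>
      (∑ k ∈ disc K, fourierCoeff (u p.1) k * character k p.2).re := by
    funext p
    have := hu.isTP p.1 p.2
    simp only [trig, id] at this
    rw [← this, Complex.ofReal_re]
  rw [e]
  exact Complex.continuous_re.comp (continuous_finsetSum _ fun k _ =>
    ((hu.cont k).comp continuous_fst).mul ((continuous_character k).comp continuous_snd))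

theorem TCont.eval (hu : TCont K u) (x : ℝ²) : Continuous fun e => u e x :=
  hu.joint.comp (continuous_id.prodMk continuous_const)

theorem continuous_fourierCoeff [FirstCountableTopology E]
    (h : Continuous fun p : E × ℝ² => u p.1 p.2) (k : ℤ²) :
    Continuous fun e => fourierCoeff (u e) k := by
  unfold fourierCoeff
  refine continuous_const.mul ?_
  refine intervalIntegral.continuous_parametric_intervalIntegral_of_continuous' ?_ _ _
  have h1 : Continuous fun q : (E × ℝ) × ℝ =>
      (u q.1.1 (q.1.2, q.2) : ℂ) * character (-k) (q.1.2, q.2) :=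
    (continuous_ofReal.comp (h.comp (by fun_prop :
      Continuous fun q : (E × ℝ) × ℝ => (q.1.1, (q.1.2, q.2))))).mul
      ((continuous_character _).comp (by fun_prop))
  exact intervalIntegral.continuous_parametric_intervalIntegral_of_continuous'
    (f := fun (q : E × ℝ) b => (u q.1 (q.2, b) : ℂ) * character (-k) (q.2, b)) h1 _ _

theorem TCont.comp {E' : Type*} [TopologicalSpace E'] (hu : TCont K u) {φ : E' → E}
    (hφ : Continuous φ) : TCont K fun e => u (φ e) :=
  ⟨fun _ => hu.isTP _, fun k => (hu.cont k).comp hφ⟩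

theorem TCont.add (hu : TCont K u) (hv : TCont K v) : TCont K fun e x => u e x + v e x := by
  refine ⟨fun e => (hu.isTP e).add (hv.isTP e), fun k => ?_⟩
  simp only [fun e => fourierCoeff_add (hu.isTP e).continuous (hv.isTP e).continuous k]
  exact (hu.cont k).add (hv.cont k)

theorem TCont.const_mul (hu : TCont K u) {a : E → ℝ} (ha : Continuous a) :
    TCont K fun e x => a e * u e x := by
  refine ⟨fun e => (hu.isTP e).const_mul _, fun k => ?_⟩
  simp only [fourierCoeff_const_mul]
  exact (continuous_ofReal.comp ha).mul (hu.cont k)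

theorem TCont.sub (hu : TCont K u) (hv : TCont K v) : TCont K fun e x => u e x - v e x := by
  have := hu.add (hv.const_mul (a := fun _ => -1) continuous_const)
  simpa [sub_eq_add_neg] using this

theorem TCont.fourierMul (hu : TCont K u) {σ : ℤ² → ℝ} (hσ : ∀ k, σ (-k) = σ k) :
    TCont K fun e => fourierMul σ (u e) := by
  refine ⟨fun e => (hu.isTP e).fourierMul hσ, fun k => ?_⟩
  simp only [fun e => (hu.isTP e).fourierCoeff_fourierMul hσ k]
  exact continuous_const.mul (hu.cont k)

theorem TCont.lambdaPow (hu : TCont K u) (s : ℝ) : TCont K fun e => lambdaPow s (u e) :=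
  hu.fourierMul (lambdaPow_even s)

theorem TCont.rieszO (hu : TCont K u) (j : Fin 2) : TCont K fun e => rieszO j (u e) :=
  hu.fourierMul (rieszOSymbol_even j)

theorem TCont.dx₁ (hu : TCont K u) : TCont K fun e => dx₁ (u e) := by
  refine ⟨fun e => (hu.isTP e).dx₁, fun k => ?_⟩
  simp only [fun e => (hu.isTP e).fourierCoeff_dx₁ k]
  exact continuous_const.mul (hu.cont k)

theorem TCont.dx₂ (hu : TCont K u) : TCont K fun e => dx₂ (u e) := by
  refine ⟨fun e => (hu.isTP e).dx₂, fun k => ?_⟩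
  simp only [fun e => (hu.isTP e).fourierCoeff_dx₂ k]
  exact continuous_const.mul (hu.cont k)

theorem TCont.mul (hu : TCont K u) (hv : TCont K' v) : TCont (K + K') fun e x => u e x * v e x := by
  refine ⟨fun e => (hu.isTP e).mul (hv.isTP e), fun k => ?_⟩
  simp only [fun e => (Rep.mul (hu.isTP e) (hv.isTP e)).fourierCoeff k]
  refine continuous_finsetSum _ fun p _ => ?_
  split_ifs
  · exact (hu.cont _).mul (hv.cont _)
  · exact continuous_const

theorem TCont.bilin (hu : TCont K u) (hv : TCont K' v) : TCont (K + K') fun e => bilin (u e) (v e) := by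
  have h1 := (hu.dx₂.const_mul (a := fun _ => -1) continuous_const).mul (hv.lambdaPow 1)
  simp only [neg_one_mul] at h1
  exact (h1.dx₁.add (hu.dx₁.mul (hv.lambdaPow 1)).dx₂).fourierMul invLaplacian_even

theorem IsTP.abs_sub_le_coeff {f g : Field} (hf : IsTP K f) (hg : IsTP K g) (x : ℝ²) :
    |f x - g x| ≤ ∑ k ∈ disc K, ‖SQG.fourierCoeff f k - SQG.fourierCoeff g k‖ := by
  rw [← norm_eq_abs, ← norm_real, Complex.ofReal_sub, hf x, hg x, trig, trig,
    ← sum_sub_distrib]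
  refine (norm_sum_le _ _).trans (sum_le_sum fun k _ => ?_)
  rw [← sub_mul, norm_mul, norm_character, mul_one]

theorem supNorm_eq_ofReal {B : ℝ} (h : ∀ x, |f x| ≤ B) : supNorm f = ofReal (⨆ x, |f x|) := by
  have hbdd : BddAbove (Set.range fun x => |f x|) := ⟨B, by rintro _ ⟨x, rfl⟩; exact h x⟩
  refine le_antisymm (supNorm_le fun x => le_ciSup hbdd x) ?_
  have h0 : supNorm f ≠ ∞ := ne_top_of_le_ne_top ofReal_ne_top (supNorm_le h)
  rw [ENNReal.ofReal_le_iff_le_toReal h0]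
  refine ciSup_le fun x => abs_le_of_supNorm toReal_nonneg ?_ x
  rw [ofReal_toReal h0]

theorem IsTP.exists_bound (hf : IsTP K f) : ∃ B, ∀ x, |f x| ≤ B :=
  exists_bound_of_periodic hf.continuous hf.periodic

theorem TCont.continuous_supNorm (hu : TCont K u) : Continuous fun e => supNorm (u e) := by
  have h1 : ∀ e, supNorm (u e) = ofReal (⨆ x, |u e x|) := fun e => by
    obtain ⟨B, hB⟩ := (hu.isTP e).exists_bound
    exact supNorm_eq_ofReal hB
  simp only [h1]
  refine ENNReal.continuous_ofReal.comp ?_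
  have hb : ∀ e, BddAbove (Set.range fun x => |u e x|) := fun e => by
    obtain ⟨B, hB⟩ := (hu.isTP e).exists_bound
    exact ⟨B, by rintro _ ⟨x, rfl⟩; exact hB x⟩
  have h2 : ∀ e e', (⨆ x, |u e x|) ≤ (⨆ x, |u e' x|)
      + ∑ k ∈ disc K, ‖fourierCoeff (u e) k - fourierCoeff (u e') k‖ := fun e e' =>
    ciSup_le fun x => by
      have t1 := (hu.isTP e).abs_sub_le_coeff (hu.isTP e') x
      have t2 := le_ciSup (hb e') x
      have t3 := abs_sub_abs_le_abs_sub (u e x) (u e' x)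
      linarith
  rw [continuous_iff_continuousAt]
  intro e₀
  have h3 : Tendsto (fun e => ∑ k ∈ disc K, ‖fourierCoeff (u e) k - fourierCoeff (u e₀) k‖) (𝓝 e₀)
      (𝓝 0) := by
    have : Continuous fun e => ∑ k ∈ disc K, ‖fourierCoeff (u e) k - fourierCoeff (u e₀) k‖ :=
      continuous_finsetSum _ fun k _ => ((hu.cont k).sub continuous_const).norm
    simpa using this.tendsto e₀
  refine tendsto_iff_norm_sub_tendsto_zero.2 (squeeze_zero (fun _ => norm_nonneg _) (fun e => ?_) h3)
  rw [norm_eq_abs, abs_le]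
  have t1 := h2 e e₀
  have t2 := h2 e₀ e
  simp only [fun k => norm_sub_rev (fourierCoeff (u e₀) k)] at t2
  constructor <;> linarith

theorem TCont.continuous_xNorm (hu : TCont K u) : Continuous fun e => xNorm (u e) := by
  unfold xNorm
  exact hu.continuous_supNorm.add (continuous_finsetSum _ fun j _ => (hu.rieszO j).continuous_supNorm)

theorem IsTP.supNorm_ne_top (hf : IsTP K f) : supNorm f ≠ ∞ := by
  obtain ⟨B, hB⟩ := hf.exists_bound
  exact ne_top_of_le_ne_top ofReal_ne_top (supNorm_le hB)

theorem IsTP.xNorm_ne_top (hf : IsTP K f) : xNorm f ≠ ∞ :=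
  ENNReal.add_ne_top.2 ⟨hf.supNorm_ne_top,
    (ENNReal.sum_lt_top.2 fun j _ => (hf.rieszO j).supNorm_ne_top.lt_top).ne⟩

theorem TCont.continuous_toReal_xNorm (hu : TCont K u) : Continuous fun e => (xNorm (u e)).toReal :=
  ENNReal.continuousOn_toReal.comp_continuous hu.continuous_xNorm fun e => (hu.isTP e).xNorm_ne_top

end TCont

/-! ### Differentiable paths of trigonometric polynomials -/

/-- A path of trigonometric polynomials that is continuously differentiable in time. -/
structure TDiff (K : ℝ) (u : Path) : Prop where
  isTP : ∀ t, IsTP K (u t)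
  diff : ∀ k, Differentiable ℝ fun t => fourierCoeff (u t) k
  cont : ∀ k, Continuous (deriv fun t => fourierCoeff (u t) k)

theorem TDiff.tCont {u : Path} (hu : TDiff K u) : TCont K u :=
  ⟨hu.isTP, fun k => (hu.diff k).continuous⟩

theorem TDiff.hasDerivAt {u : Path} (hu : TDiff K u) (t : ℝ) (x : ℝ²) :
    HasDerivAt (fun s => u s x) (∑ k ∈ disc K,
      deriv (fun s => fourierCoeff (u s) k) t * character k x).re t := by
  have h1 := HasDerivAt.fun_sum (u := disc K) fun k _ =>
    ((hu.diff k t).hasDerivAt).mul_const (character k x)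
  have h2 := hasDerivAt_re h1
  refine h2.congr_of_eventuallyEq (of_forall fun s => ?_)
  have := hu.isTP s x
  simp only [trig, id] at this
  simp only [← this, Complex.ofReal_re]

theorem TDiff.timeDeriv_rep {u : Path} (hu : TDiff K u) (t : ℝ) :
    Rep (timeDeriv u t) (disc K) (fun k => deriv (fun s => fourierCoeff (u s) k) t) id := by
  intro x
  have h1 := HasDerivAt.fun_sum (u := disc K) fun k _ =>
    ((hu.diff k t).hasDerivAt).mul_const (character k x)
  have h2 : HasDerivAt (fun s => (u s x : ℂ)) (∑ k ∈ disc K,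
      deriv (fun s => fourierCoeff (u s) k) t * character k x) t := by
    refine h1.congr_of_eventuallyEq (of_forall fun s => ?_)
    have := hu.isTP s x
    simpa only [trig, id] using this
  have h3 := (hu.hasDerivAt t x).ofReal_comp
  have h4 := h2.unique h3
  rw [timeDeriv, (hu.hasDerivAt t x).deriv, ← h4]
  rfl

theorem TDiff.fourierCoeff_timeDeriv {u : Path} (hu : TDiff K u) (t : ℝ) (k : ℤ²) :
    fourierCoeff (timeDeriv u t) k = deriv (fun s => fourierCoeff (u s) k) t := by
  rw [(hu.timeDeriv_rep t).fourierCoeff]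
  simp only [id, Finset.sum_ite_eq']
  split_ifs with hk
  · rfl
  · rw [mem_disc, not_le] at hk
    simp only [fun s => (hu.isTP s).fourierCoeff_eq_zero hk, deriv_const]

theorem TDiff.timeDeriv {u : Path} (hu : TDiff K u) : TCont K (timeDeriv u) := by
  refine ⟨fun t => (hu.timeDeriv_rep t).isTP fun _ hp => mem_disc.1 hp, fun k => ?_⟩
  simp only [hu.fourierCoeff_timeDeriv]
  exact hu.cont k

theorem TDiff.mono {K K' : ℝ} {u : Path} (hu : TDiff K u) (h : K ≤ K') : TDiff K' u :=
  ⟨fun e => (hu.isTP e).mono h, hu.diff, hu.cont⟩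

theorem tDiff_of_hasDerivAt {u : Path} (hTP : ∀ t, IsTP K (u t)) {a' : ℤ² → ℝ → ℂ}
    (h : ∀ k t, HasDerivAt (fun s => fourierCoeff (u s) k) (a' k t) t) (hc : ∀ k, Continuous (a' k)) :
    TDiff K u :=
  ⟨hTP, fun k t => (h k t).differentiableAt, fun k => by
    rw [funext fun t => (h k t).deriv]
    exact hc k⟩

theorem TDiff.add {u v : Path} (hu : TDiff K u) (hv : TDiff K v) :
    TDiff K fun t x => u t x + v t x := by
  refine tDiff_of_hasDerivAt (fun t => (hu.isTP t).add (hv.isTP t))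
    (a' := fun k t => deriv (fun s => fourierCoeff (u s) k) t + deriv (fun s => fourierCoeff (v s) k) t)
    (fun k t => ?_) fun k => (hu.cont k).add (hv.cont k)
  simp only [fun e => fourierCoeff_add (hu.isTP e).continuous (hv.isTP e).continuous k]
  exact ((hu.diff k t).hasDerivAt).add ((hv.diff k t).hasDerivAt)

theorem TDiff.timeDeriv_add {u v : Path} (hu : TDiff K u) (hv : TDiff K v) (t : ℝ) :
    SQG.timeDeriv (fun t x => u t x + v t x) t
      = fun x => SQG.timeDeriv u t x + SQG.timeDeriv v t x := by
  funext x
  have h1 := hu.hasDerivAt t x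
  have h2 := hv.hasDerivAt t x
  have h3 : HasDerivAt (fun s => u s x + v s x) _ t := h1.add h2
  simp only [SQG.timeDeriv]
  rw [h1.deriv, h2.deriv, h3.deriv]

theorem TDiff.timeDeriv_of_coeff {u v : Path} (hu : TDiff K u) (hv : ∀ t, IsTP K (v t))
    {σ : ℤ² → ℂ} (h : ∀ t k, fourierCoeff (v t) k = σ k * fourierCoeff (u t) k) :
    TDiff K v ∧ ∀ t k, fourierCoeff (SQG.timeDeriv v t) k = σ k * fourierCoeff (SQG.timeDeriv u t) k := by
  have hd : ∀ k t, HasDerivAt (fun s => fourierCoeff (v s) k)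
      (σ k * deriv (fun s => fourierCoeff (u s) k) t) t := fun k t => by
    simp only [h]
    exact ((hu.diff k t).hasDerivAt).const_mul _
  have hv' := tDiff_of_hasDerivAt hv hd fun k => continuous_const.mul (hu.cont k)
  refine ⟨hv', fun t k => ?_⟩
  rw [hv'.fourierCoeff_timeDeriv, hu.fourierCoeff_timeDeriv, (hd k t).deriv]

/-! ### Convolution in time -/

theorem timeConv_eq_interval {f ρ : ℝ → ℝ} {H : ℝ} (hH : 0 ≤ H)
    (hs : ∀ t, t ∉ Icc 0 H → ρ t = 0) (s : ℝ) :
    timeConv f ρ s = ∫ t in (0 : ℝ)..H, f (s - t) * ρ t := by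
  rw [timeConv, intervalIntegral.integral_of_le hH, ← integral_Icc_eq_integral_Ioc]
  refine (setIntegral_eq_integral_of_forall_compl_eq_zero fun t ht => ?_).symm
  rw [hs t ht, mul_zero]

theorem timeConv_rep {K H : ℝ} {u : Path} (hu : TCont K u) {ρ : ℝ → ℝ} (hρ : Continuous ρ)
    (hH : 0 ≤ H) (hs : ∀ t, t ∉ Icc 0 H → ρ t = 0) (s : ℝ) : Rep (timeConvField u ρ s) (disc K)
      (fun k => ∫ t in (0 : ℝ)..H, fourierCoeff (u (s - t)) k * (ρ t : ℂ)) id := by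
  intro x
  rw [timeConvField, timeConv_eq_interval hH hs, ← intervalIntegral.integral_ofReal]
  have e : ∀ t, ((u (s - t) x * ρ t : ℝ) : ℂ)
      = ∑ k ∈ disc K, (fourierCoeff (u (s - t)) k * (ρ t : ℂ)) * character k x := by
    intro t
    push_cast
    rw [hu.isTP (s - t) x, trig, sum_mul]
    exact sum_congr rfl fun k _ => by simp only [id]; ring
  simp only [e]
  rw [intervalIntegral.integral_finsetSum]
  · simp only [intervalIntegral.integral_mul_const]
    rfl
  · intro k _
    have : Continuous fun t => (fourierCoeff (u (s - t)) k * (ρ t : ℂ)) * character k x :=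
      (((hu.cont k).comp (by fun_prop)).mul (continuous_ofReal.comp hρ)).mul continuous_const
    exact this.intervalIntegrable _ _

theorem fourierCoeff_timeConv {K H : ℝ} {u : Path} (hu : TCont K u) {ρ : ℝ → ℝ} (hρ : Continuous ρ)
    (hH : 0 ≤ H) (hs : ∀ t, t ∉ Icc 0 H → ρ t = 0) (s : ℝ) (k : ℤ²) :
    fourierCoeff (timeConvField u ρ s) k
      = ∫ t in (0 : ℝ)..H, fourierCoeff (u (s - t)) k * (ρ t : ℂ) := by
  rw [(timeConv_rep hu hρ hH hs s).fourierCoeff]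
  simp only [id, Finset.sum_ite_eq']
  split_ifs with hk
  · rfl
  · rw [mem_disc, not_le] at hk
    simp only [fun s => (hu.isTP s).fourierCoeff_eq_zero hk, zero_mul, intervalIntegral.integral_zero]

theorem TCont.timeConv {K H : ℝ} {u : Path} (hu : TCont K u) {ρ : ℝ → ℝ} (hρ : Continuous ρ)
    (hH : 0 ≤ H) (hs : ∀ t, t ∉ Icc 0 H → ρ t = 0) : TCont K (timeConvField u ρ) := by
  refine ⟨fun s => (timeConv_rep hu hρ hH hs s).isTP fun _ hp => mem_disc.1 hp, fun k => ?_⟩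
  simp only [fourierCoeff_timeConv hu hρ hH hs]
  refine intervalIntegral.continuous_parametric_intervalIntegral_of_continuous' ?_ _ _
  exact ((hu.cont k).comp (by fun_prop : Continuous fun p : ℝ² => p.1 - p.2)).mul
    (continuous_ofReal.comp (hρ.comp continuous_snd))

theorem timeConv_of_coeff {K H : ℝ} {u v : Path} (hu : TCont K u) (hv : TCont K v) {ρ : ℝ → ℝ}
    (hρ : Continuous ρ) (hH : 0 ≤ H) (hs : ∀ t, t ∉ Icc 0 H → ρ t = 0) {σ : ℤ² → ℂ}
    (h : ∀ t k, fourierCoeff (v t) k = σ k * fourierCoeff (u t) k) (s : ℝ) (k : ℤ²) :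
    fourierCoeff (timeConvField v ρ s) k = σ k * fourierCoeff (timeConvField u ρ s) k := by
  rw [fourierCoeff_timeConv hu hρ hH hs, fourierCoeff_timeConv hv hρ hH hs,
    ← intervalIntegral.integral_const_mul]
  simp only [h, mul_assoc]

theorem TCont.timeConv_fourierMul {K H : ℝ} {u : Path} (hu : TCont K u) {ρ : ℝ → ℝ}
    (hρ : Continuous ρ) (hH : 0 ≤ H) (hs : ∀ t, t ∉ Icc 0 H → ρ t = 0) {σ : ℤ² → ℝ}
    (hσ : ∀ k, σ (-k) = σ k) (s : ℝ) :
    SQG.fourierMul σ (timeConvField u ρ s) = timeConvField (fun t => SQG.fourierMul σ (u t)) ρ s := by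
  have hc := hu.timeConv hρ hH hs
  refine ((hc.isTP s).fourierMul hσ).ext (((hu.fourierMul hσ).timeConv hρ hH hs).isTP s) fun k => ?_
  rw [(hc.isTP s).fourierCoeff_fourierMul hσ, timeConv_of_coeff hu (hu.fourierMul hσ) hρ hH hs
    (σ := fun k => (σ k : ℂ)) fun t k => (hu.isTP t).fourierCoeff_fourierMul hσ k]

theorem TDiff.timeConv {K H : ℝ} {u : Path} (hu : TDiff K u) {ρ : ℝ → ℝ} (hρ : Continuous ρ)
    (hH : 0 ≤ H) (hs : ∀ t, t ∉ Icc 0 H → ρ t = 0) : TDiff K (timeConvField u ρ) ∧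
      ∀ s, SQG.timeDeriv (timeConvField u ρ) s = timeConvField (SQG.timeDeriv u) ρ s := by
  have hc := hu.tCont.timeConv hρ hH hs
  have hc' := hu.timeDeriv.timeConv hρ hH hs
  have hd : ∀ k s, HasDerivAt (fun s => fourierCoeff (timeConvField u ρ s) k)
      (fourierCoeff (timeConvField (SQG.timeDeriv u) ρ s) k) s := by
    intro k s
    simp only [fourierCoeff_timeConv hu.tCont hρ hH hs, fourierCoeff_timeConv hu.timeDeriv hρ hH hs,
      hu.fourierCoeff_timeDeriv]
    have hsub : Continuous fun p : ℝ² => p.1 - p.2 := by fun_prop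
    refine hasDerivAt_parametric_integral
      (F := fun s t => fourierCoeff (u (s - t)) k * (ρ t : ℂ))
      (F' := fun s t => deriv (fun s => fourierCoeff (u s) k) (s - t) * (ρ t : ℂ)) ?_ ?_ ?_ 0 H s
    · exact ((hu.tCont.cont k).comp hsub).mul (continuous_ofReal.comp (hρ.comp continuous_snd))
    · exact ((hu.cont k).comp hsub).mul (continuous_ofReal.comp (hρ.comp continuous_snd))
    · intro a b
      exact (((hu.diff k (a - b)).hasDerivAt).comp_sub_const a b).mul_const _
  have hD := tDiff_of_hasDerivAt hc.isTP hd fun k => hc'.cont k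
  refine ⟨hD, fun s => (hD.timeDeriv.isTP s).ext (hc'.isTP s) fun k => ?_⟩
  rw [hD.fourierCoeff_timeDeriv, (hd k s).deriv]

theorem abs_timeConv_le {f ρ : ℝ → ℝ} {H B s : ℝ} (hf : Continuous f) (hρ : Continuous ρ)
    (hρ0 : ∀ t, 0 ≤ ρ t) (hH : 0 ≤ H) (hs : ∀ t, t ∉ Icc 0 H → ρ t = 0) (h1 : ∫ t, ρ t = 1)
    (c : ℝ) (hB : ∀ t ∈ Icc 0 H, |f (s - t) - c| ≤ B) : |timeConv f ρ s - c| ≤ B := by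
  have i1 : ∫ t in (0 : ℝ)..H, ρ t = 1 := by
    have := timeConv_eq_interval (f := fun _ => 1) hH hs s
    simp only [one_mul, timeConv] at this
    rw [← this, h1]
  have c1 : Continuous fun t => f (s - t) * ρ t := (hf.comp (by fun_prop)).mul hρ
  have c2 : Continuous fun t => c * ρ t := continuous_const.mul hρ
  have e : timeConv f ρ s - c = ∫ t in (0 : ℝ)..H, (f (s - t) - c) * ρ t := by
    simp only [sub_mul]
    rw [timeConv_eq_interval hH hs, intervalIntegral.integral_sub (c1.intervalIntegrable _ _)
      (c2.intervalIntegrable _ _), intervalIntegral.integral_const_mul, i1, mul_one]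
  have c3 : Continuous fun t => (f (s - t) - c) * ρ t := ((hf.comp (by fun_prop)).sub continuous_const).mul hρ
  rw [e]
  have hBρ : Continuous fun t => B * ρ t := continuous_const.mul hρ
  calc _ ≤ ∫ t in (0 : ℝ)..H, |(f (s - t) - c) * ρ t| := intervalIntegral.abs_integral_le_integral_abs hH
    _ ≤ ∫ t in (0 : ℝ)..H, B * ρ t := by
        refine intervalIntegral.integral_mono_on hH (c3.abs.intervalIntegrable _ _)
          (hBρ.intervalIntegrable _ _) fun t ht => ?_
        rw [abs_mul, abs_of_nonneg (hρ0 t)]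
        exact mul_le_mul_of_nonneg_right (hB t ht) (hρ0 t)
    _ = B := by rw [intervalIntegral.integral_const_mul, i1, mul_one]

/-! ### The mollifier -/

theorem IsOneSidedMollifier.exists_support (h : IsOneSidedMollifier ψ₀) :
    ∃ M : ℕ, 1 ≤ M ∧ ∀ t, t ∉ Icc (0 : ℝ) M → ψ₀ t = 0 := by
  obtain ⟨R, hR⟩ := h.compact.isCompact.isBounded.subset_closedBall 0
  obtain ⟨M, hM⟩ := exists_nat_ge (max R 1)
  refine ⟨M, by exact_mod_cast (le_max_right R 1).trans hM, fun t ht => ?_⟩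
  by_contra h0
  have h1 := hR (subset_tsupport _ h0)
  rw [mem_closedBall_zero_iff, norm_eq_abs] at h1
  refine ht ⟨?_, (le_abs_self t).trans (h1.trans ((le_max_left R 1).trans hM))⟩
  by_contra h2
  exact h0 (h.one_sided t (not_le.1 h2))

/-- A nonnegative smooth function of compact support has `|f'| ≤ C √f`. -/
theorem exists_abs_deriv_le_sqrt {f : ℝ → ℝ} (hf : ContDiff ℝ (⊤ : ℕ∞) f) (hc : HasCompactSupport f)
    (h0 : ∀ t, 0 ≤ f t) : ∃ C, 0 ≤ C ∧ ∀ t, |deriv f t| ≤ C * √(f t) := by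
  have hf' : ContDiff ℝ 1 (deriv f) :=
    (contDiff_succ_iff_deriv.1 (hf.of_le (by norm_cast) : ContDiff ℝ (1 + 1) f)).2.2
  obtain ⟨L, hL⟩ := hf'.lipschitzWith_of_hasCompactSupport hc.deriv one_ne_zero
  set K : ℝ := L + 1 with hK
  have hKpos : 0 < K := by positivity
  have hlip : ∀ s t, |deriv f s - deriv f t| ≤ K * |s - t| := fun s t => by
    have := hL.dist_le_mul s t
    rw [Real.dist_eq, Real.dist_eq] at this
    exact this.trans (mul_le_mul_of_nonneg_right (by simp [hK]) (abs_nonneg _))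
  have hd : Differentiable ℝ f := hf.differentiable (by simp)
  have key : ∀ t h, f (t + h) ≤ f t + deriv f t * h + K * h ^ 2 := fun t h => by
    have := (convex_uIcc t (t + h)).norm_image_sub_le_of_norm_hasDerivWithin_le
      (f := fun s => f s - deriv f t * s) (f' := fun s => deriv f s - deriv f t * 1) (C := K * |h|)
      (fun s _ => ((hd s).hasDerivAt.sub ((hasDerivAt_id s).const_mul _)).hasDerivWithinAt)
      (fun s hs => by
        rw [norm_eq_abs, mul_one]
        refine (hlip s t).trans (mul_le_mul_of_nonneg_left ?_ hKpos.le)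
        have := Set.abs_sub_left_of_mem_uIcc hs
        simpa using this)
      Set.left_mem_uIcc Set.right_mem_uIcc
    simp only [norm_eq_abs, add_sub_cancel_left] at this
    rw [mul_assoc, abs_mul_abs_self] at this
    have := (abs_le.1 this).2
    nlinarith
  refine ⟨√(4 * K), Real.sqrt_nonneg _, fun t => ?_⟩
  rw [← sqrt_mul (by positivity)]
  refine Real.abs_le_sqrt ?_
  have h1 := (h0 _).trans (key t (-(deriv f t) / (2 * K)))
  have h2 : f t + deriv f t * (-(deriv f t) / (2 * K)) + K * (-(deriv f t) / (2 * K)) ^ 2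
      = f t - deriv f t ^ 2 / (4 * K) := by field_simp; ring
  rw [h2, sub_nonneg, div_le_iff₀ (by positivity)] at h1
  linarith

theorem IsOneSidedMollifier.contDiff_rescale (h : IsOneSidedMollifier ψ₀) (l : ℝ) : ContDiff ℝ (⊤ : ℕ∞) (rescale ψ₀ l) :=
  contDiff_const.mul (h.smooth.comp (contDiff_const.mul contDiff_id))

theorem IsOneSidedMollifier.rescale_nonneg (h : IsOneSidedMollifier ψ₀) {l : ℝ}
    (hl : 0 < l) (t : ℝ) : 0 ≤ rescale ψ₀ l t :=
  mul_nonneg (inv_pos.2 hl).le (h.nonneg _)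

theorem IsOneSidedMollifier.integral_rescale (h : IsOneSidedMollifier ψ₀) {l : ℝ}
    (hl : 0 < l) : ∫ t, rescale ψ₀ l t = 1 := by
  simp only [rescale]
  rw [integral_const_mul, Measure.integral_comp_mul_left, h.integral_eq_one, inv_inv,
    abs_of_pos hl, smul_eq_mul, mul_one, inv_mul_cancel₀ hl.ne']

theorem rescale_support {l M : ℝ} (hM : ∀ t, t ∉ Icc (0 : ℝ) M → ψ₀ t = 0) (hl : 0 < l) (t : ℝ)
    (ht : t ∉ Icc 0 (M * l)) : rescale ψ₀ l t = 0 := by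
  rw [rescale, hM, mul_zero]
  intro h1
  have e : t = l * (l⁻¹ * t) := by field_simp
  exact ht ⟨by rw [e]; exact mul_nonneg hl.le h1.1, by
    rw [e, mul_comm M]; exact mul_le_mul_of_nonneg_left h1.2 hl.le⟩

theorem deriv_rescale {l : ℝ} (hd : Differentiable ℝ ψ₀) (t : ℝ) :
    deriv (rescale ψ₀ l) t = l⁻¹ * (l⁻¹ * deriv ψ₀ (l⁻¹ * t)) := by
  have h1 : HasDerivAt (fun t => l⁻¹ * ψ₀ (l⁻¹ * t)) (l⁻¹ * (deriv ψ₀ (l⁻¹ * t) * (l⁻¹ * 1))) t :=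
    ((hd _).hasDerivAt.comp t ((hasDerivAt_id t).const_mul l⁻¹)).const_mul _
  exact h1.deriv.trans (by ring)

theorem hasDerivAt_timeConv {f ρ : ℝ → ℝ} (hf : Continuous f) (hρ : ContDiff ℝ (⊤ : ℕ∞) ρ)
    (hc : HasCompactSupport ρ) (s : ℝ) : HasDerivAt (timeConv f ρ) (timeConv f (deriv ρ) s) s := by
  have := hc.hasDerivAt_convolution_left (ContinuousLinearMap.mul ℝ ℝ)
    (hρ.of_le (by exact_mod_cast le_top)) (hf.locallyIntegrable (μ := volume)) s
  simp only [MeasureTheory.convolution, ContinuousLinearMap.mul_apply'] at this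
  simp only [timeConv, mul_comm (f _)]
  refine this.congr_of_eventuallyEq (of_forall fun t => ?_)
  simp only [timeConv, mul_comm (f _)]
  rfl

/-- The main gain from the one-sided mollifier: `‖f * ρ'‖ ≤ C ℓ⁻¹ (f * ρ + r)^{1/2} Q^{1/2}`. -/
theorem exists_abs_timeConv_deriv_le (h : IsOneSidedMollifier ψ₀) {M : ℝ} (hM1 : 1 ≤ M)
    (hM : ∀ t, t ∉ Icc (0 : ℝ) M → ψ₀ t = 0) :
    ∃ C, 0 ≤ C ∧ ∀ (l r Q s : ℝ) (f w : ℝ → ℝ), 0 < l → 0 < r → 0 ≤ Q → Continuous f → Continuous w →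
      (∀ t, |w t| ≤ f t) → (∀ t ∈ Icc (s - M * l) s, f t ≤ Q) →
      |timeConv w (deriv (rescale ψ₀ l)) s| ≤ C * l⁻¹ * √(timeConv f (rescale ψ₀ l) s + r) * √Q := by
  obtain ⟨C, hC, hb⟩ := exists_abs_deriv_le_sqrt h.smooth h.compact h.nonneg
  refine ⟨C * (1 + M), by positivity, fun l r Q s f w hl hr hQ hf hw hwf hfQ => ?_⟩
  set ρ := rescale ψ₀ l with hρ
  have hcρ : Continuous ρ := (h.contDiff_rescale l).continuous
  have hρ0 := h.rescale_nonneg hl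
  have hs := rescale_support hM hl
  have hH : 0 ≤ M * l := by positivity
  have hdiff : Differentiable ℝ ψ₀ := h.smooth.differentiable (by simp)
  have hcd : Continuous (deriv ρ) := (h.contDiff_rescale l).continuous_deriv (by exact_mod_cast le_top)
  have hf0 : ∀ t, 0 ≤ f t := fun t => (abs_nonneg _).trans (hwf t)
  have hs' : ∀ t, t ∉ Icc 0 (M * l) → deriv ρ t = 0 := fun t ht => by
    have hn : (Icc 0 (M * l))ᶜ ∈ 𝓝 t := isClosed_Icc.isOpen_compl.mem_nhds ht
    have : ρ =ᶠ[𝓝 t] fun _ => 0 := by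
      filter_upwards [hn] with y hy using hs y hy
    rw [this.deriv_eq]
    simp
  set χ := timeConv f ρ s + r with hχ
  have hconv : timeConv f ρ s = ∫ t in (0 : ℝ)..(M * l), f (s - t) * ρ t := timeConv_eq_interval hH hs s
  have hconv0 : 0 ≤ timeConv f ρ s := integral_nonneg fun t => mul_nonneg (hf0 _) (hρ0 t)
  have hχ0 : 0 < χ := by positivity
  -- the pointwise bound on the derivative of the mollifier
  have hder : ∀ t, |deriv ρ t| ≤ C * l⁻¹ * √l⁻¹ * √(ρ t) := fun t => by
    rw [hρ, deriv_rescale hdiff, abs_mul, abs_mul, abs_of_pos (inv_pos.2 hl), rescale,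
      sqrt_mul (inv_pos.2 hl).le]
    have e : √l⁻¹ * √l⁻¹ = l⁻¹ := Real.mul_self_sqrt (inv_pos.2 hl).le
    calc l⁻¹ * (l⁻¹ * |deriv ψ₀ (l⁻¹ * t)|) ≤ l⁻¹ * (l⁻¹ * (C * √(ψ₀ (l⁻¹ * t)))) := by
          gcongr
          exact hb _
      _ = l⁻¹ * ((√l⁻¹ * √l⁻¹) * (C * √(ψ₀ (l⁻¹ * t)))) := by rw [e]
      _ = _ := by ring
  set θ := √(l / χ) with hθ
  have hθ0 : 0 < θ := sqrt_pos.2 (by positivity)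
  set A := C * l⁻¹ * √l⁻¹ * √Q with hA
  have hA0 : 0 ≤ A := by positivity
  have c1 : Continuous fun t => w (s - t) * deriv ρ t := (hw.comp (by fun_prop)).mul hcd
  have c0 : Continuous fun t => f (s - t) * ρ t := (hf.comp (by fun_prop)).mul hcρ
  have c2 : Continuous fun t => A * (θ * (f (s - t) * ρ t) + θ⁻¹) :=
    continuous_const.mul ((continuous_const.mul c0).add continuous_const)
  have hpt : ∀ t ∈ Icc 0 (M * l), |w (s - t) * deriv ρ t| ≤ A * (θ * (f (s - t) * ρ t) + θ⁻¹) := by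
    intro t ht
    have hq := hfQ (s - t) ⟨by linarith [ht.2], by linarith [ht.1]⟩
    have e1 : f (s - t) = √(f (s - t)) * √(f (s - t)) := (Real.mul_self_sqrt (hf0 _)).symm
    have am : √(f (s - t) * ρ t) ≤ θ * (f (s - t) * ρ t) + θ⁻¹ := by
      have hy : 0 ≤ f (s - t) * ρ t := mul_nonneg (hf0 _) (hρ0 t)
      have hy2 := Real.mul_self_sqrt hy
      set y := √(f (s - t) * ρ t)
      have hy0 : 0 ≤ y := Real.sqrt_nonneg _
      rw [← hy2, ← sub_nonneg]
      have : θ * (y * y) + θ⁻¹ - y = θ⁻¹ * ((θ * y - 1 / 2) ^ 2 + 3 / 4) := by field_simp; ring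
      rw [this]
      positivity
    rw [abs_mul]
    calc |w (s - t)| * |deriv ρ t|
        ≤ (√Q * √(f (s - t))) * (C * l⁻¹ * √l⁻¹ * √(ρ t)) := by
          refine mul_le_mul ((hwf _).trans ?_) (hder t) (abs_nonneg _) (by positivity)
          nth_rewrite 1 [e1]
          gcongr
      _ = A * √(f (s - t) * ρ t) := by rw [hA, sqrt_mul (hf0 _)]; ring
      _ ≤ _ := by gcongr
  have hθχ : θ * χ = √l * √χ := by
    rw [hθ, Real.sqrt_div hl.le]
    have := Real.mul_self_sqrt hχ0.le
    have h2 : √χ ≠ 0 := (sqrt_pos.2 hχ0).ne'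
    nth_rewrite 2 [← this]
    field_simp
  have hθi : θ⁻¹ * l = √l * √χ := by
    rw [hθ, Real.sqrt_div hl.le, inv_div]
    have := Real.mul_self_sqrt hl.le
    have h2 : √l ≠ 0 := (sqrt_pos.2 hl).ne'
    nth_rewrite 2 [← this]
    field_simp
  rw [timeConv_eq_interval hH hs']
  calc |∫ t in (0 : ℝ)..(M * l), w (s - t) * deriv ρ t|
      ≤ ∫ t in (0 : ℝ)..(M * l), |w (s - t) * deriv ρ t| := intervalIntegral.abs_integral_le_integral_abs hH
    _ ≤ ∫ t in (0 : ℝ)..(M * l), A * (θ * (f (s - t) * ρ t) + θ⁻¹) :=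
        intervalIntegral.integral_mono_on hH (c1.abs.intervalIntegrable _ _)
          (c2.intervalIntegrable _ _) hpt
    _ = A * (θ * timeConv f ρ s + M * (θ⁻¹ * l)) := by
        have c3 : Continuous fun t => θ * (f (s - t) * ρ t) := continuous_const.mul c0
        rw [intervalIntegral.integral_const_mul, intervalIntegral.integral_add
          (c3.intervalIntegrable _ _) (continuous_const.intervalIntegrable _ _),
          intervalIntegral.integral_const_mul, hconv]
        simp only [intervalIntegral.integral_const, smul_eq_mul]
        ring
    _ ≤ A * (θ * χ + M * (θ⁻¹ * l)) := by
        gcongr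
        rw [hχ]; linarith
    _ = C * (1 + M) * l⁻¹ * √χ * √Q := by
        rw [hθχ, hθi, hA]
        have e : √l⁻¹ * √l = 1 := by
          rw [← sqrt_mul (inv_pos.2 hl).le, inv_mul_cancel₀ hl.ne', Real.sqrt_one]
        linear_combination (C * l⁻¹ * √Q * √χ * (1 + M)) * e

/-! ### Oscillating sums -/

theorem freqTrunc_sub (hψ : IsFreqCutoff ψ) {lam : ℝ} (hl : 0 < lam) {f g : Field}
    (hf : Continuous f) (hg : Continuous g) :
    freqTrunc ψ lam (fun x => f x - g x) = fun x => freqTrunc ψ lam f x - freqTrunc ψ lam g x := by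
  have h1 := isTP_freqTrunc hψ hl f
  have h2 := isTP_freqTrunc hψ hl g
  refine (isTP_freqTrunc hψ hl _).ext (h1.sub h2) fun k => ?_
  rw [fourierCoeff_sub h1.continuous h2.continuous, fourierCoeff_freqTrunc hψ hl,
    fourierCoeff_freqTrunc hψ hl, fourierCoeff_freqTrunc hψ hl, fourierCoeff_sub hf hg]
  ring

theorem freqTrunc_const_mul (hψ : IsFreqCutoff ψ) {lam : ℝ} (hl : 0 < lam) (f : Field)
    (a : ℝ) : freqTrunc ψ lam (fun x => a * f x) = fun x => a * freqTrunc ψ lam f x := by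
  refine (isTP_freqTrunc hψ hl _).ext ((isTP_freqTrunc hψ hl f).const_mul a) fun k => ?_
  rw [fourierCoeff_const_mul, fourierCoeff_freqTrunc hψ hl, fourierCoeff_freqTrunc hψ hl,
    fourierCoeff_const_mul]
  ring

/-- The oscillating sum `∑_j P_{≤ μ} F_j cos (5 λ l_j · x)`. -/
def osc (ψ : ℝ² → ℝ) (lam mu : ℝ) (F : Fin 2 → Field) : Field := fun x =>
  ∑ j : Fin 2, freqTrunc ψ mu (F j) x
    * Real.cos (5 * lam * ((direction j).1 * x.1 + (direction j).2 * x.2))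

section osc

variable {ψ : ℝ² → ℝ} {n : ℕ} {mu : ℝ}

theorem osc_rep (hψ : IsFreqCutoff ψ) (hmu : 0 < mu) (n : ℕ) (F : Fin 2 → Field) :
    Rep (osc ψ n mu F) ((univ : Finset (Fin 2 × Bool)) ×ˢ disc mu)
      (fun p => ((1 / 2 : ℝ) : ℂ) * ((ψ (mu⁻¹ • toVec p.2) : ℂ) * fourierCoeff (F p.1.1) p.2))
      (fun p => signedFreq n p.1 + p.2) := by
  have h := rep_wave (n := n) (a := 1 / 2) (β := fun j => freqTrunc ψ mu (F j))
    fun j => isTP_freqTrunc hψ hmu (F j)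
  have e : (2 * (1 / 2 : ℝ)) = 1 := by norm_num
  simp only [e, one_mul, fourierCoeff_freqTrunc hψ hmu] at h
  exact h

theorem freqAbs_signedFreq_add {p : (Fin 2 × Bool) × ℤ²} (hmun : mu ≤ n)
    (hp : p ∈ (univ : Finset (Fin 2 × Bool)) ×ˢ disc mu) :
    4 * (n : ℝ) ≤ freqAbs (signedFreq n p.1 + p.2) ∧ freqAbs (signedFreq n p.1 + p.2) ≤ 6 * n := by
  have h1 : freqAbs (signedFreq n p.1) = 5 * n := by
    rw [freqAbs_eq, toVec_signedFreq, eucl_smul, eucl_signedDir, mul_one, abs_of_nonneg (by positivity)]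
  have h2 := mem_disc.1 (mem_product.1 hp).2
  have h3 := freqAbs_add_le (signedFreq n p.1) p.2
  have h4 := freqAbs_add_le (signedFreq n p.1 + p.2) (-p.2)
  rw [add_neg_cancel_right, freqAbs_neg] at h4
  exact ⟨by linarith, by linarith⟩

theorem osc_freqIn (hψ : IsFreqCutoff ψ) (hmu : 0 < mu) (hmun : mu ≤ n) (F : Fin 2 → Field) :
    FreqIn (4 * n) (6 * n) (osc ψ n mu F) :=
  (osc_rep hψ hmu n F).freqIn fun _ hp => freqAbs_signedFreq_add hmun hp

theorem osc_sub (hψ : IsFreqCutoff ψ) (hmu : 0 < mu) {F G : Fin 2 → Field} (hF : ∀ j, Continuous (F j))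
    (hG : ∀ j, Continuous (G j)) (x : ℝ²) :
    osc ψ n mu (fun j x => F j x - G j x) x = osc ψ n mu F x - osc ψ n mu G x := by
  simp only [osc, freqTrunc_sub hψ hmu (hF _) (hG _), sub_mul, sum_sub_distrib]

theorem exists_osc_bound (hψ : IsFreqCutoff ψ) :
    ∃ C, 0 ≤ C ∧ ∀ (n : ℕ) (mu B : ℝ) (F : Fin 2 → Field), 0 < n → 0 < mu → mu ≤ n →
      (∀ j, Continuous (F j)) → (∀ j, IsPeriodic (F j)) → (∀ j x, |F j x| ≤ B) →
      (∀ x, |osc ψ n mu F x| ≤ C * B) ∧ WBound (osc ψ n mu F) (C * (n * B)) := by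
  obtain ⟨C₁, hC₁, hb₁⟩ := exists_freqTrunc_comb_le hψ
  choose C₂ hC₂ hb₂ using fun i =>
    (homSymbol_gradSym i).annulus_bound hψ (c₁ := 4) (c₂ := 6) (by norm_num) (by norm_num)
  have hS : 0 ≤ ∑ i, C₂ i := sum_nonneg fun i _ => hC₂ i
  refine ⟨2 * C₁ * (1 + ∑ i, C₂ i), by positivity, fun n mu B F hn hmu hmun hF hp hB => ?_⟩
  have hB0 : 0 ≤ B := (abs_nonneg _).trans (hB 0 0)
  have hsup : ∀ x, |osc ψ n mu F x| ≤ 2 * C₁ * B := by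
    intro x
    have h1 : ∀ j, |freqTrunc ψ mu (F j) x| ≤ C₁ * B := fun j => by
      have := hb₁ mu hmu (F j) (hF j) (hp j) 1 0 0 B x 0 0 (fun h => by simpa using hB j (x + h))
      simpa using this
    rw [osc, Fin.sum_univ_two]
    have h2 : ∀ (a θ : ℝ), |a * Real.cos θ| ≤ |a| := fun a θ => by
      rw [abs_mul]
      exact mul_le_of_le_one_right (abs_nonneg _) (Real.abs_cos_le_one _)
    refine (abs_add_le _ _).trans ((add_le_add ((h2 _ _).trans (h1 0)) ((h2 _ _).trans (h1 1))).trans ?_)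
    linarith
  have hR := osc_rep hψ hmu n F
  refine ⟨fun x => (hsup x).trans ?_, wBound_of_rep hR fun i x => ?_⟩
  · nlinarith [mul_nonneg (mul_nonneg hC₁ hB0) hS]
  · refine (hb₂ i n (by exact_mod_cast hn) _ _ _ _ _ (fun p hp => freqAbs_signedFreq_add hmun hp)
      (norm_trig_of_rep hR hsup) x).trans ?_
    rw [Real.rpow_one]
    have h3 : C₂ i ≤ 1 + ∑ i, C₂ i :=
      (single_le_sum (fun i _ => hC₂ i) (mem_univ i)).trans (by linarith)
    calc C₂ i * n * (2 * C₁ * B) ≤ (1 + ∑ i, C₂ i) * n * (2 * C₁ * B) := by gcongr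
      _ = _ := by ring

theorem exists_lambdaPow_osc_xBound (hψ : IsFreqCutoff ψ) (s : ℝ) :
    ∃ C, 0 ≤ C ∧ ∀ (n : ℕ) (mu B : ℝ) (F : Fin 2 → Field), 0 < n → 0 < mu → mu ≤ n →
      (∀ j, Continuous (F j)) → (∀ j, IsPeriodic (F j)) → (∀ j x, |F j x| ≤ B) →
      XBound (lambdaPow s (osc ψ n mu F)) (C * ((n : ℝ) ^ s * B)) := by
  obtain ⟨C₁, hC₁, hb₁⟩ := exists_osc_bound hψ
  obtain ⟨C₂, hC₂, hb₂⟩ :=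
    (homSymbol_absPow s).xBound_annulus hψ (c₁ := 4) (c₂ := 6) (by norm_num) (by norm_num)
  refine ⟨C₂ * C₁, by positivity, fun n mu B F hn hmu hmun hF hp hB => ?_⟩
  have hR := osc_rep hψ hmu n F
  have h1 := hb₂ n (by exact_mod_cast hn) _ _ _ _ (C₁ * B) (lambdaPow s (osc ψ n mu F))
    (fun p hp => freqAbs_signedFreq_add hmun hp)
    (norm_trig_of_rep hR (hb₁ n mu B F hn hmu hmun hF hp hB).1) (fun x => by
      rw [lambdaPow, hR.fourierMul (lambdaPow_even s) x]
      simp only [absPow_toVec])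
  exact h1.mono (le_of_eq (by ring))

end osc

theorem hasDerivAt_fourierCoeff {Φ Φ' : Path} (hΦ : Continuous fun p : ℝ × ℝ² => Φ p.1 p.2)
    (hΦ' : Continuous fun p : ℝ × ℝ² => Φ' p.1 p.2)
    (hd : ∀ t x, HasDerivAt (fun s => Φ s x) (Φ' t x) t) (k : ℤ²) (t : ℝ) :
    HasDerivAt (fun s => fourierCoeff (Φ s) k) (fourierCoeff (Φ' t) k) t := by
  unfold fourierCoeff
  refine HasDerivAt.const_mul _ ?_
  have h1 : ∀ {u : Path}, (Continuous fun p : ℝ × ℝ² => u p.1 p.2) →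
      Continuous fun q : ℝ² × ℝ => (u q.1.1 (q.1.2, q.2) : ℂ) * character (-k) (q.1.2, q.2) :=
    fun hu => (continuous_ofReal.comp (hu.comp (by fun_prop :
      Continuous fun q : ℝ² × ℝ => (q.1.1, (q.1.2, q.2))))).mul
      ((continuous_character _).comp (by fun_prop))
  have h2 : ∀ {u : Path}, (Continuous fun p : ℝ × ℝ² => u p.1 p.2) →
      Continuous fun q : ℝ² => ∫ b in (0 : ℝ)..(2 * π),
        (u q.1 (q.2, b) : ℂ) * character (-k) (q.2, b) := fun {u} hu =>
    intervalIntegral.continuous_parametric_intervalIntegral_of_continuous'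
      (f := fun (q : ℝ²) b => (u q.1 (q.2, b) : ℂ) * character (-k) (q.2, b)) (h1 hu) _ _
  refine hasDerivAt_parametric_integral
    (F := fun s a => ∫ b in (0 : ℝ)..(2 * π), (Φ s (a, b) : ℂ) * character (-k) (a, b))
    (F' := fun s a => ∫ b in (0 : ℝ)..(2 * π), (Φ' s (a, b) : ℂ) * character (-k) (a, b))
    (h2 hΦ) (h2 hΦ') (fun s a => ?_) _ _ t
  refine hasDerivAt_parametric_integral
    (F := fun s b => (Φ s (a, b) : ℂ) * character (-k) (a, b))
    (F' := fun s b => (Φ' s (a, b) : ℂ) * character (-k) (a, b))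
    ((h1 hΦ).comp (by fun_prop : Continuous fun q : ℝ² => ((q.1, a), q.2)))
    ((h1 hΦ').comp (by fun_prop : Continuous fun q : ℝ² => ((q.1, a), q.2))) (fun s b => ?_) _ _ s
  exact ((hd s (a, b)).ofReal_comp).mul_const _

theorem osc_tDiff (hψ : IsFreqCutoff ψ) {n : ℕ} {mu : ℝ} (hmu : 0 < mu) (hmun : mu ≤ n)
    {Φ Φ' : Fin 2 → Path} (hΦ : ∀ j, Continuous fun p : ℝ × ℝ² => Φ j p.1 p.2)
    (hΦ' : ∀ j, Continuous fun p : ℝ × ℝ² => Φ' j p.1 p.2)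
    (hd : ∀ j t x, HasDerivAt (fun s => Φ j s x) (Φ' j t x) t) :
    TDiff (6 * n) (fun t => osc ψ n mu fun j => Φ j t) ∧
      ∀ t, timeDeriv (fun t => osc ψ n mu fun j => Φ j t) t = osc ψ n mu fun j => Φ' j t := by
  have hco : ∀ (F : Fin 2 → Field) k, fourierCoeff (osc ψ n mu F) k
      = ∑ p ∈ (univ : Finset (Fin 2 × Bool)) ×ˢ disc mu,
        (if signedFreq n p.1 + p.2 = k then ((1 / 2 : ℝ) : ℂ) * (ψ (mu⁻¹ • toVec p.2) : ℂ) else 0)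
          * fourierCoeff (F p.1.1) p.2 := fun F k => by
    rw [(osc_rep hψ hmu n F).fourierCoeff]
    refine sum_congr rfl fun p _ => ?_
    split_ifs <;> ring
  have hder : ∀ k t, HasDerivAt (fun s => fourierCoeff (osc ψ n mu fun j => Φ j s) k)
      (fourierCoeff (osc ψ n mu fun j => Φ' j t) k) t := fun k t => by
    simp only [hco]
    exact HasDerivAt.fun_sum fun p _ =>
      (hasDerivAt_fourierCoeff (hΦ p.1.1) (hΦ' p.1.1) (hd p.1.1) p.2 t).const_mul _
  have hTP : ∀ F : Fin 2 → Field, IsTP (6 * n) (osc ψ n mu F) := fun F => (osc_freqIn hψ hmu hmun F).isTP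
  have hD := tDiff_of_hasDerivAt (fun t => hTP fun j => Φ j t) hder fun k => by
    simp only [hco]
    exact continuous_finsetSum _ fun p _ => continuous_const.mul (continuous_fourierCoeff (hΦ' p.1.1) p.2)
  refine ⟨hD, fun t => (hD.timeDeriv.isTP t).ext (hTP _) fun k => ?_⟩
  rw [hD.fourierCoeff_timeDeriv, (hder k t).deriv]

/-! ### The building block -/

theorem abs_timeConv_le_timeConv {f w ρ : ℝ → ℝ} {H : ℝ} (hf : Continuous f) (hw : Continuous w)
    (hρ : Continuous ρ) (hρ0 : ∀ t, 0 ≤ ρ t) (hH : 0 ≤ H) (hs : ∀ t, t ∉ Icc 0 H → ρ t = 0)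
    (hwf : ∀ t, |w t| ≤ f t) (s : ℝ) : |timeConv w ρ s| ≤ timeConv f ρ s := by
  have c1 : Continuous fun t => w (s - t) * ρ t := (hw.comp (by fun_prop)).mul hρ
  have c2 : Continuous fun t => f (s - t) * ρ t := (hf.comp (by fun_prop)).mul hρ
  rw [timeConv_eq_interval hH hs, timeConv_eq_interval hH hs]
  refine (intervalIntegral.abs_integral_le_integral_abs hH).trans
    (intervalIntegral.integral_mono_on hH (c1.abs.intervalIntegrable _ _) (c2.intervalIntegrable _ _)
      fun t _ => ?_)
  rw [abs_mul, abs_of_nonneg (hρ0 t)]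
  exact mul_le_mul_of_nonneg_right (hwf _) (hρ0 t)

theorem IsTP.abs_rieszO_le {q : Field} (hq : IsTP K q) (j : Fin 2) (x : ℝ²) :
    |SQG.rieszO j q x| ≤ (xNorm q).toReal :=
  (xBound_of_xNorm toReal_nonneg (ofReal_toReal hq.xNorm_ne_top).ge).2 j x

theorem min_one_le_rpow {y α : ℝ} (hy : 0 ≤ y) (h0 : 0 < α) (h1 : α < 1) : min 1 y ≤ y ^ α := by
  rcases le_total 1 y with h | h
  · exact (min_le_left _ _).trans (Real.one_le_rpow h h0.le)
  · refine (min_le_right _ _).trans ?_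
    rcases hy.eq_or_lt with rfl | hy
    · exact Real.rpow_nonneg le_rfl _
    · nth_rewrite 1 [← Real.rpow_one y]
      exact Real.rpow_le_rpow_of_exponent_ge hy h h1.le

theorem exists_profile (hψ : IsFreqCutoff ψ)
    (h : IsOneSidedMollifier ψ₀) {C₀ : ℝ} (hC₀ : 2 ≤ C₀) {M : ℝ} (hM1 : 1 ≤ M)
    (hM : ∀ t, t ∉ Icc (0 : ℝ) M → ψ₀ t = 0) :
    ∃ D, 0 ≤ D ∧ ∀ (n : ℕ) (mu l r K : ℝ) (q : Path), 0 < n → 0 < mu → 0 < l → 0 < r → TCont K q →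
      (∀ t, r ≤ chi q (rescale ψ₀ l) r t) ∧
      (∀ j t x, |rieszO j (timeConvField q (rescale ψ₀ l) t) x| ≤ chi q (rescale ψ₀ l) r t) ∧
      ∃ Φ Φ' : Fin 2 → Path, (∀ j, Continuous fun p : ℝ × ℝ² => Φ j p.1 p.2) ∧
        (∀ j, Continuous fun p : ℝ × ℝ² => Φ' j p.1 p.2) ∧
        (∀ j t x, HasDerivAt (fun s => Φ j s x) (Φ' j t x) t) ∧
        (∀ j t, IsPeriodic (Φ j t)) ∧ (∀ j t, IsPeriodic (Φ' j t)) ∧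
        (block ψ C₀ n mu r (rescale ψ₀ l) q = fun t => osc ψ n mu fun j => Φ j t) ∧
        ∀ Q a b : ℝ, 0 ≤ Q → (∀ s ∈ Icc (a - M * l) b, xNorm (q s) ≤ ofReal Q) →
          ∀ t ∈ Icc a b, chi q (rescale ψ₀ l) r t ≤ Q + r ∧ ∀ j x,
            |Φ j t x| ≤ D * ((√n)⁻¹ * √(Q + r)) ∧ |Φ' j t x| ≤ D * ((√n)⁻¹ * l⁻¹ * √(Q + r)) := by
  obtain ⟨C₁, hC₁, hb₁⟩ := exists_abs_timeConv_deriv_le h hM1 hM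
  set D := 2 * (C₀ + 1) * (1 + C₁) with hD
  have hD0 : 0 ≤ D := by positivity
  refine ⟨D, hD0, fun n mu l r K q hn hmu hl hr hq => ?_⟩
  have hn' : (0 : ℝ) < n := by exact_mod_cast hn
  set ρ := rescale ψ₀ l with hρ
  have hρs : ContDiff ℝ (⊤ : ℕ∞) ρ := h.contDiff_rescale l
  have hρc : Continuous ρ := hρs.continuous
  have hρ0 := h.rescale_nonneg hl
  have hs := rescale_support hM hl
  have hH : 0 ≤ M * l := by positivity
  have hcs : HasCompactSupport ρ := HasCompactSupport.intro isCompact_Icc hs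
  have hcd : Continuous (deriv ρ) := hρs.continuous_deriv (by exact_mod_cast le_top)
  have hs' : ∀ t, t ∉ Icc 0 (M * l) → deriv ρ t = 0 := fun t ht => by
    have hn : (Icc 0 (M * l))ᶜ ∈ 𝓝 t := isClosed_Icc.isOpen_compl.mem_nhds ht
    have : ρ =ᶠ[𝓝 t] fun _ => 0 := by
      filter_upwards [hn] with y hy using hs y hy
    rw [this.deriv_eq]
    simp
  set xN : ℝ → ℝ := fun t => (xNorm (q t)).toReal with hxN
  have hxNc : Continuous xN := hq.continuous_toReal_xNorm
  have hxN0 : ∀ t, 0 ≤ xN t := fun t => toReal_nonneg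
  set χ := chi q ρ r with hχ
  have hχe : ∀ t, χ t = timeConv xN ρ t + r := fun t => rfl
  have hconv0 : ∀ t, 0 ≤ timeConv xN ρ t := fun t => integral_nonneg fun s => mul_nonneg (hxN0 _) (hρ0 s)
  have hrχ : ∀ t, r ≤ χ t := fun t => by rw [hχe]; linarith [hconv0 t]
  have hχ0 : ∀ t, 0 < χ t := fun t => hr.trans_le (hrχ t)
  let w : Fin 2 → Path := fun j t => rieszO j (q t)
  have hwT : ∀ j, TCont K (w j) := fun j => hq.rieszO j
  have hwx : ∀ j t x, |w j t x| ≤ xN t := fun j t x => (hq.isTP t).abs_rieszO_le j x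
  have hRe : ∀ j t, rieszO j (timeConvField q ρ t) = timeConvField (w j) ρ t := fun j t =>
    hq.timeConv_fourierMul hρc hH hs (rieszOSymbol_even j) t
  have hR1 : ∀ j t x, |timeConvField (w j) ρ t x| ≤ timeConv xN ρ t := fun j t x =>
    abs_timeConv_le_timeConv hxNc ((hwT j).eval x) hρc hρ0 hH hs (fun s => hwx j s x) t
  let A : Fin 2 → Path := fun j t x => C₀ * χ t + timeConvField (w j) ρ t x
  let A' : Fin 2 → Path := fun j t x => C₀ * timeConv xN (deriv ρ) t + timeConvField (w j) (deriv ρ) t x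
  have hAlow : ∀ j t x, χ t ≤ A j t x := fun j t x => by
    have h1 := (abs_le.1 (hR1 j t x)).1
    have h2 := hχe t
    simp only [A]
    nlinarith [hχ0 t]
  have hAup : ∀ j t x, A j t x ≤ (C₀ + 1) * χ t := fun j t x => by
    have h1 := (abs_le.1 (hR1 j t x)).2
    have h2 := hχe t
    simp only [A]
    nlinarith [hχ0 t]
  have hder : ∀ j t x, HasDerivAt (fun s => A j s x) (A' j t x) t := fun j t x => by
    have h1 : HasDerivAt χ (timeConv xN (deriv ρ) t) t :=
      (hasDerivAt_timeConv hxNc hρs hcs t).add_const r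
    exact (h1.const_mul C₀).add (hasDerivAt_timeConv ((hwT j).eval x) hρs hcs t)
  have hcconv : Continuous (timeConv xN (deriv ρ)) := by
    have : timeConv xN (deriv ρ) = fun s => ∫ t in (0 : ℝ)..(M * l), xN (s - t) * deriv ρ t :=
      funext fun s => timeConv_eq_interval hH hs' s
    rw [this]
    exact intervalIntegral.continuous_parametric_intervalIntegral_of_continuous'
      (f := fun s t => xN (s - t) * deriv ρ t)
      ((hxNc.comp (by fun_prop : Continuous fun p : ℝ² => p.1 - p.2)).mul (hcd.comp continuous_snd)) _ _
  have hχc : Continuous χ := continuous_iff_continuousAt.2 fun t =>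
    ((hasDerivAt_timeConv hxNc hρs hcs t).add_const r).continuousAt
  have hAc : ∀ j, Continuous fun p : ℝ × ℝ² => A j p.1 p.2 := fun j =>
    (continuous_const.mul (hχc.comp continuous_fst)).add ((hwT j).timeConv hρc hH hs).joint
  have hA'c : ∀ j, Continuous fun p : ℝ × ℝ² => A' j p.1 p.2 := fun j =>
    (continuous_const.mul (hcconv.comp continuous_fst)).add ((hwT j).timeConv hcd hH hs').joint
  have hA0 : ∀ j t x, 0 < A j t x := fun j t x => (hχ0 t).trans_le (hAlow j t x)
  let Φ : Fin 2 → Path := fun j t x => 2 * √(A j t x / (5 * n))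
  let Φ' : Fin 2 → Path := fun j t x => 2 * (A' j t x / (5 * n) / (2 * √(A j t x / (5 * n))))
  have hΦc : ∀ j, Continuous fun p : ℝ × ℝ² => Φ j p.1 p.2 := fun j =>
    continuous_const.mul ((hAc j).div_const _).sqrt
  have hne : ∀ j t x, √(A j t x / (5 * n)) ≠ 0 := fun j t x =>
    (sqrt_pos.2 (div_pos (hA0 j t x) (by positivity))).ne'
  have hΦ'c : ∀ j, Continuous fun p : ℝ × ℝ² => Φ' j p.1 p.2 := fun j =>
    continuous_const.mul (((hA'c j).div_const _).div (continuous_const.mul ((hAc j).div_const _).sqrt)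
      fun p => mul_ne_zero two_ne_zero (hne j p.1 p.2))
  have hΦd : ∀ j t x, HasDerivAt (fun s => Φ j s x) (Φ' j t x) t := fun j t x =>
    (((hder j t x).div_const (5 * (n : ℝ))).sqrt (div_pos (hA0 j t x) (by positivity)).ne').const_mul 2
  have hper : ∀ j t, IsPeriodic (timeConvField (w j) ρ t) := fun j t =>
    (((hwT j).timeConv hρc hH hs).isTP t).periodic
  have hper' : ∀ j t, IsPeriodic (timeConvField (w j) (deriv ρ) t) := fun j t =>
    (((hwT j).timeConv hcd hH hs').isTP t).periodic
  have hΦp : ∀ j t, IsPeriodic (Φ j t) := fun j t x => by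
    simp only [Φ, A, (hper j t x).1, (hper j t x).2, and_self]
  have hΦ'p : ∀ j t, IsPeriodic (Φ' j t) := fun j t x => by
    simp only [Φ', A, A', (hper j t x).1, (hper j t x).2, (hper' j t x).1, (hper' j t x).2, and_self]
  have hgosc : block ψ C₀ n mu r ρ q = fun t => osc ψ n mu fun j => Φ j t := by
    funext t x
    simp only [block, amplitude, osc]
    refine sum_congr rfl fun j _ => ?_
    have e1 : rieszO j (fun w => timeConvField q ρ t w / χ t)
        = fun x => (χ t)⁻¹ * timeConvField (w j) ρ t x := by
      simp only [div_eq_inv_mul]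
      rw [← hRe]
      exact ((hq.timeConv hρc hH hs).isTP t).fourierMul_const_mul _ (rieszOSymbol_even j)
    have e2 : Φ j t = fun y => 2 * √(χ t / (5 * n))
        * √(C₀ + (χ t)⁻¹ * timeConvField (w j) ρ t y) := by
      funext y
      simp only [Φ, A]
      rw [mul_assoc, ← sqrt_mul (div_pos (hχ0 t) (by positivity)).le]
      congr 2
      have := (hχ0 t).ne'
      field_simp
    rw [e1, e2, freqTrunc_const_mul hψ hmu]
  refine ⟨hrχ, fun j t x => by rw [hRe]; exact (hR1 j t x).trans (by rw [hχe]; linarith),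
    Φ, Φ', hΦc, hΦ'c, hΦd, hΦp, hΦ'p, hgosc, ?_⟩
  intro Q a b hQ hqQ
  set X := Q + r with hX
  have hX0 : 0 < X := by positivity
  have hxQ : ∀ s ∈ Icc (a - M * l) b, xN s ≤ Q := fun s hs' =>
    ENNReal.toReal_le_of_le_ofReal hQ (hqQ s hs')
  have hχX : ∀ t ∈ Icc a b, χ t ≤ X := fun t ht => by
    have := abs_timeConv_le (s := t) (B := Q) hxNc hρc hρ0 hH hs (h.integral_rescale hl) 0 fun s hs' => by
      rw [sub_zero, abs_of_nonneg (hxN0 _)]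
      exact hxQ _ ⟨by linarith [ht.1, hs'.2], by linarith [ht.2, hs'.1]⟩
    rw [sub_zero] at this
    rw [hχe, hX]
    linarith [le_abs_self (timeConv xN ρ t)]
  have hsn : (0 : ℝ) < √n := sqrt_pos.2 hn'
  have hΦb : ∀ j, ∀ t ∈ Icc a b, ∀ x, |Φ j t x| ≤ D * ((√n)⁻¹ * √X) := by
    intro j t ht x
    have h1 : A j t x / (5 * n) ≤ (C₀ + 1) ^ 2 * (X / n) := by
      rw [div_le_iff₀ (by positivity)]
      have e : (C₀ + 1) ^ 2 * (X / n) * (5 * n) = 5 * (C₀ + 1) ^ 2 * X := by field_simp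
      rw [e]
      refine (hAup j t x).trans ?_
      have i1 := mul_le_mul_of_nonneg_left (hχX t ht) (by linarith : 0 ≤ C₀ + 1)
      have i2 : 0 ≤ (C₀ + 1) * X := by positivity
      nlinarith
    have h2 : √(A j t x / (5 * n)) ≤ (C₀ + 1) * ((√n)⁻¹ * √X) := by
      refine (Real.sqrt_le_sqrt h1).trans (le_of_eq ?_)
      rw [sqrt_mul (by positivity), Real.sqrt_sq (by linarith), Real.sqrt_div hX0.le]
      ring
    simp only [Φ]
    rw [abs_of_nonneg (by positivity)]
    have hy : 0 ≤ (√n)⁻¹ * √X := by positivity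
    have : 2 * (C₀ + 1) ≤ D := by rw [hD]; nlinarith
    calc 2 * √(A j t x / (5 * n)) ≤ 2 * ((C₀ + 1) * ((√n)⁻¹ * √X)) := by gcongr
      _ = 2 * (C₀ + 1) * ((√n)⁻¹ * √X) := by ring
      _ ≤ _ := mul_le_mul_of_nonneg_right this hy
  have hΦ'b : ∀ j, ∀ t ∈ Icc a b, ∀ x, |Φ' j t x| ≤ D * ((√n)⁻¹ * l⁻¹ * √X) := by
    intro j t ht x
    have hsub : ∀ s ∈ Icc (t - M * l) t, xN s ≤ Q := fun s hs' =>
      hxQ s ⟨by linarith [ht.1, hs'.1], by linarith [ht.2, hs'.2]⟩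
    have d1 := hb₁ l r Q t xN xN hl hr hQ hxNc hxNc (fun s => (abs_of_nonneg (hxN0 s)).le) hsub
    have d2 := hb₁ l r Q t xN (fun s => w j s x) hl hr hQ hxNc ((hwT j).eval x) (fun s => hwx j s x) hsub
    rw [← hρ, ← hχe] at d1 d2
    set Y := C₁ * l⁻¹ * √(χ t) * √Q with hY
    have h1 : |A' j t x| ≤ (C₀ + 1) * Y := by
      refine (abs_add_le _ _).trans ?_
      rw [abs_mul, abs_of_nonneg (by linarith : 0 ≤ C₀), add_mul, one_mul]
      exact add_le_add (mul_le_mul_of_nonneg_left d1 (by linarith)) d2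
    have hsχ : 0 < √(χ t) := sqrt_pos.2 (hχ0 t)
    have h5 : (0 : ℝ) < 5 * n := by positivity
    have hs5 : 0 < √(5 * n) := sqrt_pos.2 h5
    have h2 : √(χ t) / √(5 * n) ≤ √(A j t x / (5 * n)) := by
      rw [← Real.sqrt_div (hχ0 t).le]
      refine Real.sqrt_le_sqrt ?_
      have := hAlow j t x
      gcongr
    have e3 : Φ' j t x = A' j t x / (5 * n) / √(A j t x / (5 * n)) := by
      simp only [Φ']
      have := hne j t x
      field_simp
    rw [e3, abs_div, abs_div, abs_of_pos h5, abs_of_nonneg (Real.sqrt_nonneg _)]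
    have hsq := Real.mul_self_sqrt h5.le
    have hY0 : 0 ≤ Y := by positivity
    calc |A' j t x| / (5 * n) / √(A j t x / (5 * n))
        ≤ ((C₀ + 1) * Y) / (5 * n) / (√(χ t) / √(5 * n)) := by gcongr
      _ = (C₀ + 1) * C₁ * ((√(5 * n))⁻¹ * l⁻¹ * √Q) := by
          rw [show (C₀ + 1) * Y / (5 * n) = (C₀ + 1) * Y / (√(5 * n) * √(5 * n)) by
            rw [hsq], hY]
          field_simp
      _ ≤ D * ((√n)⁻¹ * l⁻¹ * √X) := by
          have i1 : (C₀ + 1) * C₁ ≤ D := by rw [hD]; nlinarith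
          have i2 : (√(5 * n))⁻¹ ≤ (√n)⁻¹ :=
            inv_anti₀ hsn (Real.sqrt_le_sqrt (by linarith))
          have i3 : √Q ≤ √X := Real.sqrt_le_sqrt (by rw [hX]; linarith)
          gcongr
  exact fun t ht => ⟨hχX t ht, fun j x => ⟨hΦb j t ht x, hΦ'b j t ht x⟩⟩

theorem exists_block_bounds (hψ : IsFreqCutoff ψ)
    (h : IsOneSidedMollifier ψ₀) {C₀ : ℝ} (hC₀ : 2 ≤ C₀) {M : ℝ} (hM1 : 1 ≤ M)
    (hM : ∀ t, t ∉ Icc (0 : ℝ) M → ψ₀ t = 0) {α : ℝ} (hα0 : 0 < α) (hα1 : α < 1) (γ : ℝ) :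
    ∃ C, 0 ≤ C ∧ ∀ (n : ℕ) (mu l r K : ℝ) (q g : Path), 0 < n → 0 < mu → mu ≤ n → 0 < l → 0 < r →
      TCont K q → g = block ψ C₀ n mu r (rescale ψ₀ l) q →
      TDiff (6 * n) g ∧ (∀ t, FreqIn (4 * n) (6 * n) (g t)) ∧ (∀ t, r ≤ chi q (rescale ψ₀ l) r t) ∧
      (∀ j t x, |rieszO j (timeConvField q (rescale ψ₀ l) t) x| ≤ chi q (rescale ψ₀ l) r t) ∧
      ∀ Q a b : ℝ, 0 ≤ Q → (∀ s ∈ Icc (a - M * l) b, xNorm (q s) ≤ ofReal Q) →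
        ∀ t ∈ Icc a b, chi q (rescale ψ₀ l) r t ≤ Q + r ∧ WBound (g t) (C * (√n * √(Q + r))) ∧
          (∀ x, |g t x| ≤ C * ((√n)⁻¹ * √(Q + r))) ∧ XBound (lambdaPow (-1) (timeDeriv g t))
            (C * ((n : ℝ) ^ (-(3 / 2) : ℝ) * l⁻¹ * √(Q + r))) ∧
          XBound (lambdaPow (γ - 1) (g t)) (C * ((n : ℝ) ^ (γ - 3 / 2) * √(Q + r))) ∧
          ∀ t' ∈ Icc a b, WBound (fun x => g t x - g t' x)
            (C * (√n * l ^ (-α) * √(Q + r) * |t - t'| ^ α)) := by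
  obtain ⟨D, hD0, hprof⟩ := exists_profile hψ h hC₀ hM1 hM
  obtain ⟨C₂, hC₂, hb₂⟩ := exists_osc_bound hψ
  obtain ⟨C₃, hC₃, hb₃⟩ := exists_lambdaPow_osc_xBound hψ (-1)
  obtain ⟨C₄, hC₄, hb₄⟩ := exists_lambdaPow_osc_xBound hψ (γ - 1)
  set E := C₂ + C₃ + C₄ with hE
  have hE0 : 0 ≤ E := by positivity
  refine ⟨E * (2 * D), by positivity, fun n mu l r K q g hn hmu hmun hl hr hq hg => ?_⟩
  have hn' : (0 : ℝ) < n := by exact_mod_cast hn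
  obtain ⟨hrχ, hRχ, Φ, Φ', hΦc, hΦ'c, hΦd, hΦp, hΦ'p, hgosc, hloc⟩ := hprof n mu l r K q hn hmu hl hr hq
  rw [← hg] at hgosc
  have hΦcx : ∀ j t, Continuous (Φ j t) := fun j t => (hΦc j).comp (continuous_const.prodMk continuous_id)
  have hΦ'cx : ∀ j t, Continuous (Φ' j t) := fun j t =>
    (hΦ'c j).comp (continuous_const.prodMk continuous_id)
  obtain ⟨hT, hTd⟩ := osc_tDiff hψ hmu hmun hΦc hΦ'c hΦd
  rw [← hgosc] at hT hTd
  refine ⟨hT, fun t => by rw [hgosc]; exact osc_freqIn hψ hmu hmun _, hrχ, hRχ, ?_⟩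
  intro Q a b hQ hqQ
  replace hloc := hloc Q a b hQ hqQ
  set X := Q + r with hX
  have hX0 : 0 < X := by positivity
  have hsn : (0 : ℝ) < √n := sqrt_pos.2 hn'
  have hχX := fun t ht => (hloc t ht).1
  have hΦb := fun j t ht x => ((hloc t ht).2 j x).1
  have hΦ'b := fun j t ht x => ((hloc t ht).2 j x).2
  have hnn : (n : ℝ) * (√n)⁻¹ = √n := by
    rw [mul_inv_eq_iff_eq_mul₀ hsn.ne', Real.mul_self_sqrt hn'.le]
  have hpow : ∀ s : ℝ, (n : ℝ) ^ s * (√n)⁻¹ = (n : ℝ) ^ (s - 1 / 2) := fun s => by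
    rw [Real.sqrt_eq_rpow, Real.rpow_sub hn', div_eq_mul_inv ((n : ℝ) ^ s)]
  have hE2 : ∀ {y C : ℝ}, 0 ≤ y → C ≤ E → C * (D * y) ≤ E * (2 * D) * y := fun {y C} hy hC => by
    have h1 : C * (D * y) ≤ E * (D * y) := mul_le_mul_of_nonneg_right hC (by positivity)
    have h2 : 0 ≤ E * (D * y) := by positivity
    linarith
  intro t ht
  have o2 := hb₂ n mu _ (fun j => Φ j t) hn hmu hmun (fun j => hΦcx j t) (fun j => hΦp j t)
    (fun j x => hΦb j t ht x)
  have o3 := hb₃ n mu _ (fun j => Φ' j t) hn hmu hmun (fun j => hΦ'cx j t) (fun j => hΦ'p j t)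
    (fun j x => hΦ'b j t ht x)
  have o4 := hb₄ n mu _ (fun j => Φ j t) hn hmu hmun (fun j => hΦcx j t) (fun j => hΦp j t)
    (fun j x => hΦb j t ht x)
  have hgt : ∀ t, g t = osc ψ n mu fun j => Φ j t := fun t => by rw [hgosc]
  refine ⟨hχX t ht, ?_, fun x => ?_, ?_, ?_, fun t' ht' => ?_⟩
  · rw [hgt]
    refine o2.2.mono ?_
    have e : (n : ℝ) * (D * ((√n)⁻¹ * √X)) = D * (√n * √X) := by
      linear_combination (D * √X) * hnn
    rw [e]
    exact hE2 (by positivity) (by rw [hE]; linarith)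
  · rw [hgt]
    exact (o2.1 x).trans (hE2 (by positivity) (by rw [hE]; linarith))
  · rw [hTd]
    refine o3.mono ?_
    have e : (n : ℝ) ^ (-1 : ℝ) * (D * ((√n)⁻¹ * l⁻¹ * √X))
        = D * ((n : ℝ) ^ (-(3 / 2) : ℝ) * l⁻¹ * √X) := by
      have := hpow (-1)
      rw [show (-1 : ℝ) - 1 / 2 = -(3 / 2) by norm_num] at this
      linear_combination (D * l⁻¹ * √X) * this
    rw [e]
    exact hE2 (by positivity) (by rw [hE]; linarith)
  · rw [hgt]
    refine o4.mono ?_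
    have e : (n : ℝ) ^ (γ - 1) * (D * ((√n)⁻¹ * √X))
        = D * ((n : ℝ) ^ (γ - 3 / 2) * √X) := by
      have := hpow (γ - 1)
      rw [show γ - 1 - 1 / 2 = γ - 3 / 2 by ring] at this
      linear_combination (D * √X) * this
    rw [e]
    exact hE2 (by positivity) (by rw [hE]; linarith)
  · set B := D * ((√n)⁻¹ * √X) with hB
    have hB0 : 0 ≤ B := by positivity
    have hdiff : ∀ j x, |Φ j t x - Φ j t' x| ≤ 2 * B * (l⁻¹ * |t - t'|) ^ α := by
      intro j x
      have m1 : |Φ j t x - Φ j t' x| ≤ 2 * B := by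
        refine (abs_sub _ _).trans ?_
        linarith [hΦb j t ht x, hΦb j t' ht' x]
      have m2 : |Φ j t x - Φ j t' x| ≤ B * (l⁻¹ * |t - t'|) := by
        have := (convex_Icc a b).norm_image_sub_le_of_norm_hasDerivWithin_le
          (fun s _ => (hΦd j s x).hasDerivWithinAt) (fun s hs' => hΦ'b j s hs' x) ht' ht
        simp only [norm_eq_abs] at this
        refine this.trans (le_of_eq ?_)
        rw [hB]
        ring
      have hy : 0 ≤ l⁻¹ * |t - t'| := by positivity
      refine le_trans ?_ (mul_le_mul_of_nonneg_left (min_one_le_rpow hy hα0 hα1) (by positivity))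
      rw [mul_min_of_nonneg _ _ (by positivity)]
      refine le_min (by rwa [mul_one]) (m2.trans ?_)
      nlinarith [mul_nonneg hB0 hy]
    have o5 := (hb₂ n mu _ (fun j x => Φ j t x - Φ j t' x) hn hmu hmun
      (fun j => (hΦcx j t).sub (hΦcx j t'))
      (fun j x => by simp only [(hΦp j t x).1, (hΦp j t x).2, (hΦp j t' x).1, (hΦp j t' x).2, and_self])
      hdiff).2
    have e0 : (fun x => g t x - g t' x) = osc ψ n mu fun j x => Φ j t x - Φ j t' x := by
      funext x
      rw [osc_sub hψ hmu (fun j => hΦcx j t) (fun j => hΦcx j t'), hgt, hgt]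
    rw [e0]
    refine o5.mono ?_
    have e : (n : ℝ) * (2 * B * (l⁻¹ * |t - t'|) ^ α)
        = D * (2 * (√n * l ^ (-α) * √X * |t - t'| ^ α)) := by
      rw [Real.mul_rpow (inv_pos.2 hl).le (abs_nonneg _), Real.inv_rpow hl.le, ← Real.rpow_neg hl.le, hB]
      linear_combination (2 * D * √X * l ^ (-α) * |t - t'| ^ α) * hnn
    rw [e]
    have hy : 0 ≤ √n * l ^ (-α) * √X * |t - t'| ^ α := by positivity
    have h1 : C₂ * (D * (2 * (√n * l ^ (-α) * √X * |t - t'| ^ α)))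
        ≤ E * (D * (2 * (√n * l ^ (-α) * √X * |t - t'| ^ α))) :=
      mul_le_mul_of_nonneg_right (by rw [hE]; linarith) (by positivity)
    exact h1.trans (le_of_eq (by ring))

/-! ### Operators acting on Fourier coefficients -/

/-- `T` acts on trigonometric polynomials by multiplying the Fourier coefficients with `σ`. -/
def IsFourierOp (T : Field → Field) (σ : ℤ² → ℂ) : Prop :=
  ∀ K f, IsTP K f → IsTP K (T f) ∧ ∀ k, fourierCoeff (T f) k = σ k * fourierCoeff f k

theorem isFourierOp_id : IsFourierOp (fun f => f) fun _ => 1 := fun _ _ hf =>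
  ⟨hf, fun _ => (one_mul _).symm⟩

theorem isFourierOp_dx₁ : IsFourierOp dx₁ fun k => I * k.1 := fun _ _ hf =>
  ⟨hf.dx₁, hf.fourierCoeff_dx₁⟩

theorem isFourierOp_dx₂ : IsFourierOp dx₂ fun k => I * k.2 := fun _ _ hf =>
  ⟨hf.dx₂, hf.fourierCoeff_dx₂⟩

theorem isFourierOp_fourierMul {σ : ℤ² → ℝ} (hσ : ∀ k, σ (-k) = σ k) :
    IsFourierOp (fourierMul σ) fun k => (σ k : ℂ) := fun _ _ hf =>
  ⟨hf.fourierMul hσ, hf.fourierCoeff_fourierMul hσ⟩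

theorem isFourierOp_lambdaPow (s : ℝ) :
    IsFourierOp (lambdaPow s) fun k => ((if k = 0 then 0 else freqAbs k ^ s : ℝ) : ℂ) :=
  isFourierOp_fourierMul (lambdaPow_even s)

theorem IsTP.lambdaPow (hf : IsTP K f) (s : ℝ) : IsTP K (lambdaPow s f) :=
  hf.fourierMul (lambdaPow_even s)

theorem FreqIn.lambdaPow {lo hi : ℝ} (hf : FreqIn lo hi f) (s : ℝ) :
    FreqIn lo hi (lambdaPow s f) := hf.fourierMul (lambdaPow_even s)

theorem isFourierOp_rieszO (j : Fin 2) : IsFourierOp (rieszO j) fun k => (rieszOSymbol j k : ℂ) :=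
  isFourierOp_fourierMul (rieszOSymbol_even j)

theorem isFourierOp_invLaplacian :
    IsFourierOp invLaplacian fun k => ((if k = 0 then 0 else -(freqAbs k ^ 2)⁻¹ : ℝ) : ℂ) :=
  isFourierOp_fourierMul invLaplacian_even

section IsFourierOp

variable {T T' : Field → Field} {σ σ' : ℤ² → ℂ} {K : ℝ} {f g : Field}

theorem IsFourierOp.comp (hT : IsFourierOp T σ) (hT' : IsFourierOp T' σ') :
    IsFourierOp (fun f => T (T' f)) fun k => σ k * σ' k := fun K f hf => by
  obtain ⟨h1, h2⟩ := hT' K f hf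
  obtain ⟨h3, h4⟩ := hT K _ h1
  exact ⟨h3, fun k => by rw [h4, h2, mul_assoc]⟩

theorem IsFourierOp.add (hT : IsFourierOp T σ) (hf : IsTP K f) (hg : IsTP K g) :
    T (fun x => f x + g x) = fun x => T f x + T g x := by
  obtain ⟨a1, a2⟩ := hT K f hf
  obtain ⟨b1, b2⟩ := hT K g hg
  obtain ⟨c1, c2⟩ := hT K _ (hf.add hg)
  refine c1.ext (a1.add b1) fun k => ?_
  rw [c2, fourierCoeff_add hf.continuous hg.continuous, fourierCoeff_add a1.continuous b1.continuous,
    a2, b2]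
  ring

theorem IsFourierOp.sub (hT : IsFourierOp T σ) (hf : IsTP K f) (hg : IsTP K g) :
    T (fun x => f x - g x) = fun x => T f x - T g x := by
  obtain ⟨a1, a2⟩ := hT K f hf
  obtain ⟨b1, b2⟩ := hT K g hg
  obtain ⟨c1, c2⟩ := hT K _ (hf.sub hg)
  refine c1.ext (a1.sub b1) fun k => ?_
  rw [c2, fourierCoeff_sub hf.continuous hg.continuous, fourierCoeff_sub a1.continuous b1.continuous,
    a2, b2]
  ring

theorem IsFourierOp.tCont (hT : IsFourierOp T σ) {E : Type*} [TopologicalSpace E] {u : E → Field}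
    (hu : TCont K u) : TCont K fun e => T (u e) := by
  refine ⟨fun e => (hT K _ (hu.isTP e)).1, fun k => ?_⟩
  simp only [fun e => (hT K _ (hu.isTP e)).2 k]
  exact continuous_const.mul (hu.cont k)

theorem IsFourierOp.timeConv (hT : IsFourierOp T σ) {H : ℝ} {u : Path} (hu : TCont K u) {ρ : ℝ → ℝ}
    (hρ : Continuous ρ) (hH : 0 ≤ H) (hs : ∀ t, t ∉ Icc 0 H → ρ t = 0) (s : ℝ) :
    T (timeConvField u ρ s) = timeConvField (fun t => T (u t)) ρ s := by
  have hc := (hu.timeConv hρ hH hs).isTP s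
  refine (hT K _ hc).1.ext (((hT.tCont hu).timeConv hρ hH hs).isTP s) fun k => ?_
  rw [(hT K _ hc).2, timeConv_of_coeff hu (hT.tCont hu) hρ hH hs
    fun t k => (hT K _ (hu.isTP t)).2 k]

theorem IsFourierOp.abs_timeConv_sub_le (hT : IsFourierOp T σ) {H B s : ℝ} {u : Path} {v : Field}
    (hu : TCont K u) (hv : IsTP K v) {ρ : ℝ → ℝ} (hρ : Continuous ρ) (hρ0 : ∀ t, 0 ≤ ρ t) (hH : 0 ≤ H)
    (hs : ∀ t, t ∉ Icc 0 H → ρ t = 0) (h1 : ∫ t, ρ t = 1) (x : ℝ²)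
    (hB : ∀ t ∈ Icc 0 H, |T (fun y => u (s - t) y - v y) x| ≤ B) :
    |T (fun y => timeConvField u ρ s y - v y) x| ≤ B := by
  rw [hT.sub ((hu.timeConv hρ hH hs).isTP s) hv, hT.timeConv hu hρ hH hs]
  refine abs_timeConv_le ((hT.tCont hu).eval x) hρ hρ0 hH hs h1 _ fun t ht => ?_
  have := hB t ht
  rwa [hT.sub (hu.isTP _) hv] at this

theorem IsFourierOp.timeDeriv (hT : IsFourierOp T σ) {u : Path} (hu : TDiff K u) :
    TDiff K (fun t => T (u t)) ∧ ∀ t, SQG.timeDeriv (fun t => T (u t)) t = T (SQG.timeDeriv u t) := by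
  obtain ⟨h1, h2⟩ := hu.timeDeriv_of_coeff (fun t => (hT K _ (hu.isTP t)).1)
    fun t k => (hT K _ (hu.isTP t)).2 k
  refine ⟨h1, fun t => (h1.timeDeriv.isTP t).ext (hT K _ (hu.timeDeriv.isTP t)).1 fun k => ?_⟩
  rw [h2, (hT K _ (hu.timeDeriv.isTP t)).2]

end IsFourierOp

theorem WBound.add {K A B : ℝ} {f g : Field} (hf : IsTP K f) (hg : IsTP K g) (h : WBound f A)
    (h' : WBound g B) : WBound (fun x => f x + g x) (A + B) := by
  refine ⟨fun x => ?_, fun x => ?_, fun x => ?_⟩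
  · rw [isFourierOp_dx₁.add hf hg]
    exact (abs_add_le _ _).trans (add_le_add (h.1 x) (h'.1 x))
  · rw [isFourierOp_dx₂.add hf hg]
    exact (abs_add_le _ _).trans (add_le_add (h.2.1 x) (h'.2.1 x))
  · rw [(isFourierOp_lambdaPow 1).add hf hg]
    exact (abs_add_le _ _).trans (add_le_add (h.2.2 x) (h'.2.2 x))

theorem WBound.timeConv {K H A s : ℝ} {u : Path} {v : Field} (hu : TCont K u) (hv : IsTP K v)
    {ρ : ℝ → ℝ} (hρ : Continuous ρ) (hρ0 : ∀ t, 0 ≤ ρ t) (hH : 0 ≤ H)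
    (hs : ∀ t, t ∉ Icc 0 H → ρ t = 0) (h1 : ∫ t, ρ t = 1)
    (hA : ∀ t ∈ Icc 0 H, WBound (fun y => u (s - t) y - v y) A) :
    WBound (fun y => timeConvField u ρ s y - v y) A :=
  ⟨fun x => isFourierOp_dx₁.abs_timeConv_sub_le hu hv hρ hρ0 hH hs h1 x fun t ht => (hA t ht).1 x,
    fun x => isFourierOp_dx₂.abs_timeConv_sub_le hu hv hρ hρ0 hH hs h1 x fun t ht => (hA t ht).2.1 x,
    fun x => (isFourierOp_lambdaPow 1).abs_timeConv_sub_le hu hv hρ hρ0 hH hs h1 x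
      fun t ht => (hA t ht).2.2 x⟩

theorem XBound.timeConv {K H A s : ℝ} {u : Path} {v : Field} (hu : TCont K u) (hv : IsTP K v)
    {ρ : ℝ → ℝ} (hρ : Continuous ρ) (hρ0 : ∀ t, 0 ≤ ρ t) (hH : 0 ≤ H)
    (hs : ∀ t, t ∉ Icc 0 H → ρ t = 0) (h1 : ∫ t, ρ t = 1)
    (hA : ∀ t ∈ Icc 0 H, XBound (fun y => u (s - t) y - v y) A) :
    XBound (fun y => timeConvField u ρ s y - v y) A :=
  ⟨fun x => isFourierOp_id.abs_timeConv_sub_le hu hv hρ hρ0 hH hs h1 x fun t ht => (hA t ht).1 x,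
    fun j x => (isFourierOp_rieszO j).abs_timeConv_sub_le hu hv hρ hρ0 hH hs h1 x
      fun t ht => (hA t ht).2 j x⟩

/-! ### The bilinear form -/

theorem bilin_eq {v w : Field} (hv : IsTP K v) (hw : IsTP K w) :
    bilin v w = fun x => invLaplacian (dx₁ fun y => (-dx₂ v y) * lambdaPow 1 w y) x
      + invLaplacian (dx₂ fun y => dx₁ v y * lambdaPow 1 w y) x := by
  have h := hw.lambdaPow 1
  exact IsTP.invGrad_eq (F := (fun x => (-dx₂ v x) * lambdaPow 1 w x, fun x => dx₁ v x * lambdaPow 1 w x))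
    (hv.dx₂.neg.mul h) (hv.dx₁.mul h)

theorem bilin_add_left {v v' w : Field} (hv : IsTP K v) (hv' : IsTP K v') (hw : IsTP K w) :
    bilin (fun x => v x + v' x) w = fun x => bilin v w x + bilin v' w x := by
  have h := hw.lambdaPow 1
  have T1 := isFourierOp_invLaplacian.comp isFourierOp_dx₁
  have T2 := isFourierOp_invLaplacian.comp isFourierOp_dx₂
  have e1 : (fun y => (-dx₂ (fun x => v x + v' x) y) * lambdaPow 1 w y)
      = fun y => (-dx₂ v y) * lambdaPow 1 w y + (-dx₂ v' y) * lambdaPow 1 w y := by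
    rw [isFourierOp_dx₂.add hv hv']
    funext y
    ring
  have e2 : (fun y => dx₁ (fun x => v x + v' x) y * lambdaPow 1 w y)
      = fun y => dx₁ v y * lambdaPow 1 w y + dx₁ v' y * lambdaPow 1 w y := by
    rw [isFourierOp_dx₁.add hv hv']
    funext y
    ring
  rw [bilin_eq (hv.add hv') hw, bilin_eq hv hw, bilin_eq hv' hw, e1, e2,
    T1.add (hv.dx₂.neg.mul h) (hv'.dx₂.neg.mul h), T2.add (hv.dx₁.mul h) (hv'.dx₁.mul h)]
  funext x
  ring

theorem bilin_add_right {v w w' : Field} (hv : IsTP K v) (hw : IsTP K w) (hw' : IsTP K w') :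
    bilin v (fun x => w x + w' x) = fun x => bilin v w x + bilin v w' x := by
  have h := hw.lambdaPow 1
  have h' := hw'.lambdaPow 1
  have T1 := isFourierOp_invLaplacian.comp isFourierOp_dx₁
  have T2 := isFourierOp_invLaplacian.comp isFourierOp_dx₂
  have e1 : (fun y => (-dx₂ v y) * lambdaPow 1 (fun x => w x + w' x) y)
      = fun y => (-dx₂ v y) * lambdaPow 1 w y + (-dx₂ v y) * lambdaPow 1 w' y := by
    rw [(isFourierOp_lambdaPow 1).add hw hw']
    funext y
    ring
  have e2 : (fun y => dx₁ v y * lambdaPow 1 (fun x => w x + w' x) y)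
      = fun y => dx₁ v y * lambdaPow 1 w y + dx₁ v y * lambdaPow 1 w' y := by
    rw [(isFourierOp_lambdaPow 1).add hw hw']
    funext y
    ring
  rw [bilin_eq hv (hw.add hw'), bilin_eq hv hw, bilin_eq hv hw', e1, e2,
    T1.add (hv.dx₂.neg.mul h) (hv.dx₂.neg.mul h'), T2.add (hv.dx₁.mul h) (hv.dx₁.mul h')]
  funext x
  ring

theorem exists_bilin_xBound (hψ : IsFreqCutoff ψ) :
    ∃ C, 0 ≤ C ∧ ∀ (K A B : ℝ) (v w : Field), IsTP K v → IsTP K w → WBound v A → WBound w B →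
      XBound (bilin v w) (C * (A * B)) := by
  obtain ⟨C, hC, hb⟩ := exists_invGrad_xBound hψ
  refine ⟨C, hC, fun K A B v w hv hw hA hB => ?_⟩
  have h := hw.lambdaPow 1
  refine hb (K + K) _ _ (hv.dx₂.neg.mul h) (hv.dx₁.mul h) (fun x => ?_) fun x => ?_
  · simp only [abs_mul, abs_neg]
    exact mul_le_mul (hA.2.1 x) (hB.2.2 x) (abs_nonneg _) hA.nonneg
  · simp only [abs_mul]
    exact mul_le_mul (hA.1 x) (hB.2.2 x) (abs_nonneg _) hA.nonneg

theorem exists_bilin_transport_xBound (hψ : IsFreqCutoff ψ) :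
    ∃ C, 0 ≤ C ∧ ∀ (R A B : ℝ) (g v : Field), 0 < R → FreqIn (4 * R) (6 * R) g → IsTP R v →
      WBound g A → WBound v B → XBound (bilin g v) (C * (R⁻¹ * (A * B)))
        ∧ XBound (bilin v g) (C * (R⁻¹ * (A * B))) := by
  obtain ⟨C, hC, hb⟩ := exists_invGrad_xBound_annulus hψ (c₁ := 3) (c₂ := 7) (by norm_num) (by norm_num)
  refine ⟨C, hC, fun R A B g v hR hg hv hA hB => ?_⟩
  have hL := hv.lambdaPow 1
  have hL' := hg.lambdaPow 1
  have lo : 3 * R ≤ 4 * R - R := by linarith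
  have hi : 6 * R + R ≤ 7 * R := by linarith
  have key : ∀ {x y : ℝ}, |x| ≤ A → |y| ≤ B → |x * y| ≤ A * B := fun {x y} hx hy => by
    rw [abs_mul]
    exact mul_le_mul hx hy (abs_nonneg _) hA.nonneg
  rw [← mul_assoc]
  constructor
  · refine hb R hR _ _ ((hg.dx₂.neg.mul hL).mono lo hi) ((hg.dx₁.mul hL).mono lo hi) (fun x => ?_)
      fun x => ?_
    · exact key (by rw [abs_neg]; exact hA.2.1 x) (hB.2.2 x)
    · exact key (hA.1 x) (hB.2.2 x)
  · refine hb R hR _ _ ((hL'.mul_left hv.dx₂.neg).mono lo hi) ((hL'.mul_left hv.dx₁).mono lo hi)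
      (fun x => ?_) fun x => ?_
    · simp only
      rw [mul_comm]
      exact key (hA.2.2 x) (by rw [abs_neg]; exact hB.2.1 x)
    · simp only
      rw [mul_comm]
      exact key (hA.2.2 x) (hB.1 x)

/-! ### The residual -/

theorem residual_eq {K ν γ : ℝ} {g z : Path} (hg : TDiff K g) (hz : ∀ t, IsTP K (z t)) (t : ℝ) :
    residual ν γ g z t = fun x => bilin (fun x => g t x + z t x) (fun x => g t x + z t x) x
      + (-1 * lambdaPow (-1) (timeDeriv g t) x + -ν * lambdaPow (γ - 1) (g t) x) := by
  have hgt := hg.isTP t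
  have hgd := hg.timeDeriv.isTP t
  have hL := isFourierOp_lambdaPow (-1)
  have hv : IsTP K fun x => g t x + z t x := hgt.add (hz t)
  have hb := hv.lambdaPow 1
  have T1 := (isFourierOp_dx₁.comp hL).timeDeriv hg
  have T2 := (isFourierOp_dx₂.comp hL).timeDeriv hg
  have L1 := ((isFourierOp_dx₁.comp hL) K _ hgd)
  have L2 := ((isFourierOp_dx₂.comp hL) K _ hgd)
  have G1 := (((isFourierOp_lambdaPow (γ - 1)).comp isFourierOp_dx₁) K _ hgt)
  have G2 := (((isFourierOp_lambdaPow (γ - 1)).comp isFourierOp_dx₂) K _ hgt)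
  have I1 := isFourierOp_invLaplacian.comp isFourierOp_dx₁
  have I2 := isFourierOp_invLaplacian.comp isFourierOp_dx₂
  set K' := max K (K + K)
  have m : K ≤ K' := le_max_left _ _
  have m' : K + K ≤ K' := le_max_right _ _
  set B₁ : Field := fun x => (-dx₂ (fun x => g t x + z t x) x) * lambdaPow 1 (fun x => g t x + z t x) x
  set B₂ : Field := fun x => dx₁ (fun x => g t x + z t x) x * lambdaPow 1 (fun x => g t x + z t x) x
  have hB₁ : IsTP K' B₁ := (hv.dx₂.neg.mul hb).mono m'
  have hB₂ : IsTP K' B₂ := (hv.dx₁.mul hb).mono m'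
  set D₁ : Field := fun x => -1 * dx₁ (lambdaPow (-1) (timeDeriv g t)) x
    + -ν * lambdaPow (γ - 1) (dx₁ (g t)) x
  set D₂ : Field := fun x => -1 * dx₂ (lambdaPow (-1) (timeDeriv g t)) x
    + -ν * lambdaPow (γ - 1) (dx₂ (g t)) x
  have hD₁ : IsTP K' D₁ := ((L1.1.const_mul _).add (G1.1.const_mul _)).mono m
  have hD₂ : IsTP K' D₂ := ((L2.1.const_mul _).add (G2.1.const_mul _)).mono m
  have e1 : (residualField ν γ g z t).1 = fun x => B₁ x + D₁ x := by
    funext x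
    simp only [residualField, T1.2, B₁, D₁]
    change -_ + -dx₂ (fun x => g t x + z t x) x * lambdaPow 1 (fun x => g t x + z t x) x - _ = _
    ring
  have e2 : (residualField ν γ g z t).2 = fun x => B₂ x + D₂ x := by
    funext x
    simp only [residualField, T2.2, B₂, D₂]
    change -_ + dx₁ (fun x => g t x + z t x) x * lambdaPow 1 (fun x => g t x + z t x) x - _ = _
    ring
  have e3 : residual ν γ g z t = fun x => invLaplacian (dx₁ (fun x => B₁ x + D₁ x)) x
      + invLaplacian (dx₂ (fun x => B₂ x + D₂ x)) x := by
    rw [residual, IsTP.invGrad_eq (K := K') (by rw [e1]; exact hB₁.add hD₁)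
      (by rw [e2]; exact hB₂.add hD₂), e1, e2]
  have e4 : (fun x => invLaplacian (dx₁ D₁) x + invLaplacian (dx₂ D₂) x)
      = fun x => -1 * lambdaPow (-1) (timeDeriv g t) x + -ν * lambdaPow (γ - 1) (g t) x := by
    have a1 := I1 K' _ hD₁
    have a2 := I2 K' _ hD₂
    have c1 := hL K _ hgd
    have c2 := isFourierOp_lambdaPow (γ - 1) K _ hgt
    refine (a1.1.add a2.1).ext ((c1.1.const_mul _).add (c2.1.const_mul _)) fun k => ?_
    rw [fourierCoeff_add a1.1.continuous a2.1.continuous, a1.2, a2.2,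
      fourierCoeff_add (L1.1.const_mul _).continuous (G1.1.const_mul _).continuous,
      fourierCoeff_add (L2.1.const_mul _).continuous (G2.1.const_mul _).continuous,
      fourierCoeff_add (c1.1.const_mul _).continuous (c2.1.const_mul _).continuous]
    simp only [fourierCoeff_const_mul, L1.2, L2.2, G1.2, G2.2, c1.2, c2.2]
    by_cases hk : k = 0
    · simp [hk]
    · simp only [if_neg hk]
      have h1 : (freqAbs k : ℂ) ^ 2 = (k.1 : ℂ) ^ 2 + (k.2 : ℂ) ^ 2 := by
        exact_mod_cast congrArg Complex.ofReal (freqAbs_sq k)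
      have h2 : (freqAbs k : ℂ) ≠ 0 := by exact_mod_cast (freqAbs_pos hk).ne'
      have h3 : ((-(freqAbs k ^ 2)⁻¹ : ℝ) : ℂ) * ((I * k.1) ^ 2 + (I * k.2) ^ 2) = 1 := by
        push_cast
        rw [mul_pow, mul_pow, Complex.I_sq, ← mul_add, ← h1]
        field_simp
      linear_combination (((-1 : ℝ) : ℂ) * (((freqAbs k ^ (-1 : ℝ) : ℝ) : ℂ) * fourierCoeff (timeDeriv g t) k)
        + ((-ν : ℝ) : ℂ) * (((freqAbs k ^ (γ - 1) : ℝ) : ℂ) * fourierCoeff (g t) k)) * h3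
  rw [e3, I1.add hB₁ hD₁, I2.add hB₂ hD₂, bilin_eq hv hv]
  funext x
  rw [← congrFun e4 x]
  ring

theorem residual_tCont {K K' ν γ : ℝ} {g z : Path} (hg : TDiff K g) (hz : TCont K z)
    (hK : K + K ≤ K') (hK' : K ≤ K') :
    TCont K' (residual ν γ g z) ∧ ∀ t, fourierCoeff (residual ν γ g z t) 0 = 0 := by
  have h1 := hg.tCont.add hz
  have e : residual ν γ g z = fun t x => bilin (fun x => g t x + z t x) (fun x => g t x + z t x) x
      + (-1 * lambdaPow (-1) (timeDeriv g t) x + -ν * lambdaPow (γ - 1) (g t) x) :=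
    funext fun t => residual_eq hg hz.isTP t
  have a1 := (h1.bilin h1).mono hK
  have a2 := (hg.timeDeriv.lambdaPow (-1)).const_mul (a := fun _ => (-1 : ℝ)) continuous_const
  have a3 := (hg.tCont.lambdaPow (γ - 1)).const_mul (a := fun _ => -ν) continuous_const
  have a4 := (a2.add a3).mono hK'
  refine ⟨by rw [e]; exact a1.add a4, fun t => ?_⟩
  have z1 := isFourierOp_lambdaPow (-1) K _ (hg.timeDeriv.isTP t)
  have z2 := isFourierOp_lambdaPow (γ - 1) K _ (hg.isTP t)
  rw [residual_eq hg hz.isTP t, fourierCoeff_add (a1.isTP t).continuous (a4.isTP t).continuous,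
    fourierCoeff_add (a2.isTP t).continuous (a3.isTP t).continuous, fourierCoeff_bilin_zero (h1.isTP t) (h1.isTP t),
    fourierCoeff_const_mul, fourierCoeff_const_mul, z1.2, z2.2]
  simp

/-! ### Regularity of the iteration -/

/-- Continuous paths with values in `C^s_x`. -/
structure HolderPath (s : ℝ) (z : Path) : Prop where
  mem : ∀ t, MemHolder s (z t)
  cont : ∀ t, Tendsto (fun s' => holderNorm s (z s' - z t)) (𝓝 t) (𝓝 0)

theorem supNorm_le_holderNorm (s : ℝ) (f : Field) : supNorm f ≤ holderNorm s f := by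
  unfold holderNorm
  refine le_trans ?_ le_self_add
  refine le_trans ?_ (single_le_sum (f := fun i => ∑ k ∈ antidiagonal i,
    supNorm (multiDeriv k f)) (fun _ _ => zero_le) (mem_range.2 (Nat.succ_pos _)))
  simp [multiDeriv]

theorem HolderPath.tendsto_fourierCoeff {s : ℝ} {z : Path} (hz : HolderPath s z) (k : ℤ²) :
    Continuous fun t => fourierCoeff (z t) k := by
  have hc : ∀ t, Continuous (z t) := fun t => (hz.mem t).contDiff.continuous
  rw [continuous_iff_continuousAt]
  intro t
  have h1 : Tendsto (fun s' => supNorm (z s' - z t)) (𝓝 t) (𝓝 0) :=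
    tendsto_of_tendsto_of_tendsto_of_le_of_le tendsto_const_nhds (hz.cont t) (fun _ => zero_le)
      fun s' => supNorm_le_holderNorm s _
  refine tendsto_iff_norm_sub_tendsto_zero.2 ?_
  have h2 : Tendsto (fun s' => (supNorm (z s' - z t)).toReal) (𝓝 t) (𝓝 0) := by
    exact (ENNReal.tendsto_toReal (by simp : (0 : ℝ≥0∞) ≠ ∞)).comp h1
  refine squeeze_zero' (of_forall fun _ => norm_nonneg _) ?_ h2
  filter_upwards [h1.eventually_lt_const (by simp : (0 : ℝ≥0∞) < 1)] with s' hs'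
  rw [← fourierCoeff_sub (hc s') (hc t)]
  refine norm_fourierCoeff_le (abs_le_of_supNorm toReal_nonneg ?_) k
  rw [ofReal_toReal (hs'.trans ENNReal.one_lt_top).ne]
  rfl

theorem HolderPath.tCont (hψ : IsFreqCutoff ψ) {s lam : ℝ} (hl : 0 < lam) {z : Path}
    (hz : HolderPath s z) : TCont lam fun t => freqTrunc ψ lam (z t) := by
  refine ⟨fun t => isTP_freqTrunc hψ hl _, fun k => ?_⟩
  simp only [fourierCoeff_freqTrunc hψ hl]
  exact continuous_const.mul (hz.tendsto_fourierCoeff k)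

/-- The one-sided mollifiers at scale `l`, with all the properties used. -/
structure MollifierAt (ρ : ℝ → ℝ) (H : ℝ) : Prop where
  cont : Continuous ρ
  nonneg : ∀ t, 0 ≤ ρ t
  pos : 0 ≤ H
  supp : ∀ t, t ∉ Icc 0 H → ρ t = 0
  integral : ∫ t, ρ t = 1

theorem IsOneSidedMollifier.mollifierAt (h : IsOneSidedMollifier ψ₀) {l M : ℝ} (hl : 0 < l)
    (hM1 : 1 ≤ M) (hM : ∀ t, t ∉ Icc (0 : ℝ) M → ψ₀ t = 0) : MollifierAt (rescale ψ₀ l) (M * l) :=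
  ⟨(h.contDiff_rescale l).continuous, h.rescale_nonneg hl, by positivity, rescale_support hM hl,
    h.integral_rescale hl⟩

theorem tDiff_zero (K : ℝ) : TDiff K (0 : Path) :=
  tDiff_of_hasDerivAt (a' := fun _ _ => 0) (fun _ => isTP_zero K)
    (fun k t => hasDerivAt_const t (fourierCoeff (0 : Field) k)) fun _ => continuous_const

/-- The data of one step of the iteration. -/
structure StepRegular (lam : ℝ) (g q : Path) : Prop where
  tDiff : TDiff (6 * lam) g
  tCont : TCont (12 * lam) q
  zero : ∀ t, fourierCoeff (q t) 0 = 0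

theorem iteration_regular (hψ : IsFreqCutoff ψ)
    (h : IsOneSidedMollifier ψ₀) {C₀ : ℝ} (hC₀ : 2 ≤ C₀) (ν γ : ℝ) {c : Controls} (hc : c.Positive)
    {N : ℕ} (hN : c.Admissible N) {σ : ℝ} {z : Path} (hz : HolderPath σ z) (n : ℕ) (hn : n ≤ N + 1) :
    StepRegular (c.lam n) (iteration ψ ψ₀ C₀ ν γ c z n).1 (iteration ψ ψ₀ C₀ ν γ c z n).2 := by
  obtain ⟨M, hM1, hM⟩ := h.exists_support
  have hM1' : (1 : ℝ) ≤ M := by exact_mod_cast hM1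
  obtain ⟨C, -, hb⟩ := exists_block_bounds hψ h hC₀ hM1' hM (α := 1 / 2) (by norm_num) (by norm_num) γ
  have key : ∀ n g, TDiff (6 * c.lam n) g → StepRegular (c.lam n) g
      (residual ν γ g fun t => freqTrunc ψ (c.lam n) (z t)) := fun n g hg => by
    have h0 := hc.lam n
    have := residual_tCont (ν := ν) (γ := γ) (K' := 12 * c.lam n) hg
      ((hz.tCont hψ h0).mono (by linarith : c.lam n ≤ 6 * c.lam n)) (by linarith) (by linarith)
    exact ⟨hg, this.1, this.2⟩
  induction n with
  | zero => exact key 0 _ (tDiff_zero _)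
  | succ n ih =>
    have ih := ih (by omega)
    obtain ⟨k, hk⟩ := hN.lam_nat (n + 1) hn
    have h0 := hc.lam (n + 1)
    have hgrow := hN.lam_growth n (by omega)
    have m := h.mollifierAt (hc.ell (n + 1)) hM1' hM
    have b := (hb k (c.mu (n + 1)) (c.ell (n + 1)) (c.r n) _ _ _ (by rw [hk] at h0; exact_mod_cast h0)
      (hc.mu _) (hk ▸ hN.mu_le_lam (n + 1) (by omega) hn) (hc.ell _) (hc.r n) ih.tCont rfl).1
    rw [← hk] at b
    exact key (n + 1) _ (((ih.tDiff.timeConv m.cont m.pos m.supp).1.mono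
      (by linarith [hc.lam n])).add b)

/-! ### The decomposition of the residual -/

theorem residual_step {K ν γ H s : ℝ} {ρ : ℝ → ℝ} (hρ : MollifierAt ρ H) {g b z z' : Path}
    (hg : TDiff K g) (hb : TDiff K b) (hz : TCont K z) (hz' : ∀ t, IsTP K (z' t)) {v : Field}
    (hv : v = fun x => timeConvField g ρ s x + z' s x) :
    residual ν γ (timeConvField g ρ + b) z' s = fun x =>
      (bilin (b s) (b s) x + timeConvField (residual ν γ g z) ρ s x)
      + (-1 * (timeConvField (fun t => bilin (fun x => g t x + z t x) (fun x => g t x + z t x)) ρ s x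
          - bilin v v x) + ((bilin (b s) v x + bilin v (b s) x)
          + (-1 * lambdaPow (-1) (timeDeriv b s) x + -ν * lambdaPow (γ - 1) (b s) x))) := by
  obtain ⟨hG, hG'⟩ := hg.timeConv hρ.cont hρ.pos hρ.supp
  have hGs := hG.isTP s
  have hbs := hb.isTP s
  have hvTP : IsTP K v := by rw [hv]; exact hGs.add (hz' s)
  have e0 := residual_eq (ν := ν) (γ := γ) (hG.add hb) hz' s
  have e1 : (fun x => (timeConvField g ρ s x + b s x) + z' s x) = fun x => v x + b s x := by
    rw [hv]; funext x; ring
  have h1 := (hg.tCont.add hz).bilin (hg.tCont.add hz)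
  have hL := isFourierOp_lambdaPow (-1)
  have hL' := isFourierOp_lambdaPow (γ - 1)
  have e2 : timeConvField (residual ν γ g z) ρ s = fun x =>
      timeConvField (fun t => bilin (fun x => g t x + z t x) (fun x => g t x + z t x)) ρ s x
      + (-1 * lambdaPow (-1) (timeDeriv (timeConvField g ρ) s) x
        + -ν * lambdaPow (γ - 1) (timeConvField g ρ s) x) := by
    rw [hG', hL.timeConv hg.timeDeriv hρ.cont hρ.pos hρ.supp,
      hL'.timeConv hg.tCont hρ.cont hρ.pos hρ.supp]
    have c1 := hL.tCont hg.timeDeriv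
    have c2 := hL'.tCont hg.tCont
    funext x
    have ee : ∀ t, residual ν γ g z t x = _ := fun t => congrFun (residual_eq hg hz.isTP t) x
    simp only [timeConvField, timeConv_eq_interval hρ.pos hρ.supp, ee]
    have i : ∀ {u : ℝ → ℝ}, Continuous u →
        IntervalIntegrable (fun t => u (s - t) * ρ t) volume 0 H := fun hu =>
      ((hu.comp (by fun_prop)).mul hρ.cont).intervalIntegrable _ _
    have i1 := i (h1.eval x)
    have i2 := (i (c1.eval x)).const_mul (-1)
    have i3 := (i (c2.eval x)).const_mul (-ν)
    rw [← intervalIntegral.integral_const_mul, ← intervalIntegral.integral_const_mul,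
      ← intervalIntegral.integral_add i2 i3, ← intervalIntegral.integral_add i1 (i2.add i3)]
    exact intervalIntegral.integral_congr fun t _ => by ring
  have e3 : timeConvField g ρ + b = fun t x => timeConvField g ρ t x + b t x := rfl
  rw [e3, e0, e1, bilin_add_left hvTP hbs (hvTP.add hbs), bilin_add_right hvTP hvTP hbs,
    bilin_add_right hbs hvTP hbs, hG.timeDeriv_add hb, hL.add (hG.timeDeriv.isTP s) (hb.timeDeriv.isTP s),
    hL'.add hGs hbs, e2]
  funext x
  ring

/-! ### Pathwise bounds -/

theorem wBound_zero : WBound (fun _ => 0) 0 := by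
  have h : ∀ {T : Field → Field} {σ : ℤ² → ℂ}, IsFourierOp T σ → ∀ x, |T (fun _ => 0) x| ≤ 0 :=
    fun {T σ} hT x => by
      have := congrFun (hT.sub (isTP_zero 0) (isTP_zero 0)) x
      simp only [Pi.zero_apply, sub_self] at this
      rw [this, abs_zero]
  exact ⟨h isFourierOp_dx₁, h isFourierOp_dx₂, h (isFourierOp_lambdaPow 1)⟩

theorem WBound.sub_comm {K A : ℝ} {f g : Field} (hf : IsTP K f) (hg : IsTP K g)
    (h : WBound (fun x => f x - g x) A) : WBound (fun x => g x - f x) A := by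
  have key : ∀ {T : Field → Field} {σ : ℤ² → ℂ}, IsFourierOp T σ →
      (∀ x, |T (fun x => f x - g x) x| ≤ A) → ∀ x, |T (fun x => g x - f x) x| ≤ A :=
    fun {T σ} hT hA x => by
      have := hA x
      rw [hT.sub hf hg] at this
      rw [hT.sub hg hf]
      simpa only [abs_sub_comm] using this
  exact ⟨key isFourierOp_dx₁ h.1, key isFourierOp_dx₂ h.2.1, key (isFourierOp_lambdaPow 1) h.2.2⟩

theorem timeConvField_sub_shift {K H : ℝ} {u : Path} (hu : TCont K u) {ρ : ℝ → ℝ} (hρ : MollifierAt ρ H)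
    (s s' : ℝ) (x : ℝ²) : timeConvField (fun t x => u t x - u (t + (s' - s)) x) ρ s x
      = timeConvField u ρ s x - timeConvField u ρ s' x := by
  have i : ∀ {f : ℝ → ℝ}, Continuous f → ∀ s,
      IntervalIntegrable (fun t => f (s - t) * ρ t) volume 0 H := fun hf s =>
    ((hf.comp (by fun_prop)).mul hρ.cont).intervalIntegrable _ _
  simp only [timeConvField, timeConv_eq_interval hρ.pos hρ.supp]
  rw [← intervalIntegral.integral_sub (i (hu.eval x) s) (i (hu.eval x) s')]
  refine intervalIntegral.integral_congr fun t _ => ?_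
  have e : s - t + (s' - s) = s' - t := by ring
  simp only [e]
  ring

theorem wBound_accumulate {N : ℕ} {g b : ℕ → Path} {ρ : ℕ → ℝ → ℝ} {K : ℕ → ℝ} {M α t₀ T : ℝ}
    {A B : ℕ → ℝ} (h0 : g 0 = 0) (hg : ∀ n < N, g (n + 1) = timeConvField (g n) (ρ n) + b n)
    (hT : ∀ n ≤ N, TCont (K n) (g n)) (hb : ∀ n < N, TCont (K (n + 1)) (b n))
    (hK : ∀ n < N, K n ≤ K (n + 1)) (hρ : ∀ n < N, ∃ H ≤ M, MollifierAt (ρ n) H)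
    (hB : ∀ n < N, ∀ s ∈ Icc (t₀ - M * (N - n)) T, WBound (b n s) (B n))
    (hA : ∀ n < N, ∀ s ∈ Icc (t₀ - M * (N - n)) T, ∀ s' ∈ Icc (t₀ - M * (N - n)) T,
      WBound (fun x => b n s x - b n s' x) (A n * |s - s'| ^ α)) (n : ℕ) (hn : n ≤ N) :
    (∀ s ∈ Icc (t₀ - M * (N + 1 - n)) T, WBound (g n s) (∑ i ∈ range n, B i)) ∧
    ∀ s ∈ Icc (t₀ - M * (N + 1 - n)) T, ∀ s' ∈ Icc (t₀ - M * (N + 1 - n)) T,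
      WBound (fun x => g n s x - g n s' x) ((∑ i ∈ range n, A i) * |s - s'| ^ α) := by
  induction n with
  | zero =>
    simp only [h0, Finset.range_zero, Finset.sum_empty, Pi.zero_apply, sub_zero, zero_mul]
    exact ⟨fun _ _ => wBound_zero, fun _ _ _ _ => wBound_zero⟩
  | succ n ih =>
    have hnN : n < N := by omega
    obtain ⟨ih1, ih2⟩ := ih (by omega)
    obtain ⟨H, hHM, m⟩ := hρ n hnN
    have hTn := (hT n hnN.le).mono (hK n hnN)
    have hconv := hTn.timeConv m.cont m.pos m.supp
    have ew : t₀ - M * (N + 1 - ((n + 1 : ℕ) : ℝ)) = t₀ - M * (N - n) := by push_cast; ring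
    have ew' : t₀ - M * (N + 1 - n) = t₀ - M * (N - n) - M := by ring
    rw [ew'] at ih1 ih2
    rw [ew]
    have hw : ∀ s ∈ Icc (t₀ - M * (N - n)) T, ∀ t ∈ Icc 0 H,
        s - t ∈ Icc (t₀ - M * (N - n) - M) T := fun s hs t ht =>
      ⟨by linarith [hs.1, ht.2], by linarith [hs.2, ht.1]⟩
    simp only [hg n hnN, Pi.add_apply, Finset.sum_range_succ]
    refine ⟨fun s hs => ?_, fun s hs s' hs' => ?_⟩
    · have h1 := WBound.timeConv (s := s) (A := ∑ i ∈ range n, B i) hTn (isTP_zero _) m.cont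
        m.nonneg m.pos m.supp m.integral fun t ht => by
          simp only [Pi.zero_apply, sub_zero]
          exact ih1 _ (hw s hs t ht)
      simp only [Pi.zero_apply, sub_zero] at h1
      exact h1.add (hconv.isTP s) ((hb n hnN).isTP s) (hB n hnN s hs)
    · have hsub := hTn.sub (hTn.comp (by fun_prop : Continuous fun t : ℝ => t + (s' - s)))
      have h1 := WBound.timeConv (s := s) (A := (∑ i ∈ range n, A i) * |s - s'| ^ α) hsub
        (isTP_zero _) m.cont m.nonneg m.pos m.supp m.integral fun t ht => by
          simp only [Pi.zero_apply, sub_zero]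
          have e : s - t + (s' - s) = s' - t := by ring
          have := ih2 _ (hw s hs t ht) _ (hw s' hs' t ht)
          rw [e]
          simpa only [sub_sub_sub_cancel_right] using this
      simp only [Pi.zero_apply, sub_zero, timeConvField_sub_shift hTn m] at h1
      have h2 := h1.add ((hconv.isTP s).sub (hconv.isTP s')) (((hb n hnN).isTP s).sub ((hb n hnN).isTP s'))
        (hA n hnN s hs s' hs')
      rw [add_mul]
      convert h2 using 2
      ring

theorem exists_commutator_xBound (hψ : IsFreqCutoff ψ) :
    ∃ C, 0 ≤ C ∧ ∀ (K H V D s : ℝ) (ρ : ℝ → ℝ) (u : Path) (v : Field), MollifierAt ρ H → TCont K u →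
      IsTP K v → WBound v V → (∀ t ∈ Icc 0 H, WBound (u (s - t)) V) →
      (∀ t ∈ Icc 0 H, WBound (fun x => u (s - t) x - v x) D) →
      XBound (fun x => timeConvField (fun t => bilin (u t) (u t)) ρ s x - bilin v v x) (C * (D * V)) := by
  obtain ⟨C, hC, hb⟩ := exists_bilin_xBound hψ
  refine ⟨2 * C, by positivity, fun K H V D s ρ u v m hu hv hV huV hD => ?_⟩
  refine XBound.timeConv (hu.bilin hu) (isTP_bilin hv hv) m.cont m.nonneg m.pos m.supp m.integral
    fun t ht => ?_
  have hut := hu.isTP (s - t)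
  have hw : IsTP K fun x => u (s - t) x - v x := hut.sub hv
  have e1 : u (s - t) = fun x => (fun x => u (s - t) x - v x) x + v x := by funext x; simp
  have e2 : ∀ x, bilin (u (s - t)) (u (s - t)) x
      = bilin (fun x => u (s - t) x - v x) (u (s - t)) x
        + (bilin v (fun x => u (s - t) x - v x) x + bilin v v x) := fun x => by
    have a1 := congrFun (bilin_add_left hw hv hut) x
    have a2 := congrFun (bilin_add_right hv hw hv) x
    rw [← e1] at a1 a2
    rw [a1, a2]
  have e3 : (fun x => bilin (u (s - t)) (u (s - t)) x - bilin v v x) = fun x =>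
      bilin (fun x => u (s - t) x - v x) (u (s - t)) x + bilin v (fun x => u (s - t) x - v x) x := by
    funext x
    rw [e2]
    ring
  rw [e3]
  have := (hb K D V _ _ hw hut (hD t ht) (huV t ht)).add (isTP_bilin hw hut) (isTP_bilin hv hw)
    (hb K V D _ _ hv hw hV (hD t ht))
  exact this.mono (le_of_eq (by ring))

/-- The bound for the residual in terms of bounds along one path. -/
def pathBound (c : Controls) (N : ℕ) (ν γ X D V : ℝ) : ℝ :=
  (log (c.mu (N + 1)) * (c.lam N / c.mu (N + 1)) ^ 2 + c.lam N / c.lam (N + 1)) * X + D * V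
    + (c.lam (N + 1) ^ (-(3 / 2) : ℝ) * (c.ell (N + 1))⁻¹ * √X
      + |ν| * (c.lam (N + 1) ^ (γ - 3 / 2) * √X)
      + (√(c.lam (N + 1)))⁻¹ * √X * V)

theorem exists_step_xBound (hψ : IsFreqCutoff ψ)
    (h : IsOneSidedMollifier ψ₀) {C₀ : ℝ} (hC₀ : 2 ≤ C₀) {M : ℝ} (hM1 : 1 ≤ M)
    (hM : ∀ t, t ∉ Icc (0 : ℝ) M → ψ₀ t = 0) {α : ℝ} (hα0 : 0 < α) (hα1 : α < 1) (γ : ℝ) :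
    ∃ C, 1 ≤ C ∧ ∀ (ν : ℝ) (c : Controls), c.Positive → ∀ N, c.Admissible N →
      ∀ (σ s Q D V : ℝ) (z : Path), HolderPath σ z → 0 ≤ Q → ∀ g q : Path,
      StepRegular (c.lam N) g q → q = residual ν γ g (fun t => freqTrunc ψ (c.lam N) (z t)) →
      (∀ t ∈ Icc (s - M * c.ell (N + 1)) s, xNorm (q t) ≤ ofReal Q) →
      WBound (fun x => timeConvField g (rescale ψ₀ (c.ell (N + 1))) s x
        + freqTrunc ψ (c.lam (N + 1)) (z s) x) V → (∀ t ∈ Icc 0 (M * c.ell (N + 1)),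
        WBound (fun x => g (s - t) x + freqTrunc ψ (c.lam N) (z (s - t)) x) V) →
      (∀ t ∈ Icc 0 (M * c.ell (N + 1)),
        WBound (fun x => (g (s - t) x + freqTrunc ψ (c.lam N) (z (s - t)) x)
          - (timeConvField g (rescale ψ₀ (c.ell (N + 1))) s x + freqTrunc ψ (c.lam (N + 1)) (z s) x)) D) →
      XBound (residual ν γ (timeConvField g (rescale ψ₀ (c.ell (N + 1)))
          + block ψ C₀ (c.lam (N + 1)) (c.mu (N + 1)) (c.r N) (rescale ψ₀ (c.ell (N + 1))) q)
          (fun t => freqTrunc ψ (c.lam (N + 1)) (z t)) s)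
        (C * pathBound c N ν γ (Q + c.r N) D V) := by
  obtain ⟨C₁, hC₁, hb₁⟩ := exists_block_bounds hψ h hC₀ hM1 hM hα0 hα1 γ
  obtain ⟨C₂, hC₂, hb₂⟩ := exists_mismatch_xBound hψ hC₀
  obtain ⟨C₃, hC₃, hb₃⟩ := exists_commutator_xBound hψ
  obtain ⟨C₄, hC₄, hb₄⟩ := exists_bilin_transport_xBound hψ
  set C := 1 + 144 * C₂ + C₃ + 2 * C₄ * C₁ + C₁ with hC
  have hCC : 0 ≤ C₄ * C₁ := by positivity
  refine ⟨C, by rw [hC]; linarith, fun ν c hc N hN σ s Q D V z hz hQ g q hreg hq hqQ hv hu hD => ?_⟩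
  set lam := c.lam (N + 1) with hlam
  set mu := c.mu (N + 1) with hmu
  set l := c.ell (N + 1) with hl
  set ρ := rescale ψ₀ l with hρ
  set r := c.r N
  have hlam0 : 0 < lam := hc.lam _
  have hlamN : 0 < c.lam N := hc.lam _
  have hgrow : 48 * c.lam N ≤ lam := hN.lam_growth N le_rfl
  have h10 : 10 ≤ mu := hN.ten_le_mu (N + 1) (by omega) le_rfl
  have hl0 : 0 < l := hc.ell _
  have m := h.mollifierAt hl0 hM1 hM
  obtain ⟨n, hn⟩ := hN.lam_nat (N + 1) le_rfl
  rw [← hlam] at hn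
  have hn0 : 0 < n := by rw [hn] at hlam0; exact_mod_cast hlam0
  have hmun : mu ≤ n := hn ▸ hN.mu_le_lam (N + 1) (by omega) le_rfl
  obtain ⟨hbT, hbF, hrχ, hRχ, hbl⟩ := hb₁ n mu l r _ q _ hn0 (hc.mu _) hmun hl0 (hc.r N) hreg.tCont rfl
  rw [← hn] at hbT hbF hbl
  set b := block ψ C₀ lam mu r ρ q with hb
  obtain ⟨hχX, hbW, -, hbt, hbg, -⟩ := hbl Q s s hQ hqQ s ⟨le_rfl, le_rfl⟩
  set X := Q + r with hX
  have hX0 : 0 < X := add_pos_of_nonneg_of_pos hQ (hc.r N)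
  have hg6 : TDiff lam g := hreg.tDiff.mono (by linarith)
  have hzN : TCont lam fun t => freqTrunc ψ (c.lam N) (z t) := (hz.tCont hψ hlamN).mono (by linarith)
  have hz1 : TCont lam fun t => freqTrunc ψ lam (z t) := hz.tCont hψ hlam0
  have h6 : lam ≤ 6 * lam := by linarith
  have hGT : IsTP lam (timeConvField g ρ s) :=
    (hg6.tCont.timeConv m.cont m.pos m.supp).isTP s
  set v : Field := fun x => timeConvField g ρ s x + freqTrunc ψ lam (z s) x with hvdef
  have hvTP : IsTP lam v := hGT.add (hz1.isTP s)
  have e := residual_step (ν := ν) (γ := γ) (s := s) m (hg6.mono h6) hbT (hzN.mono h6)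
    (fun t => (hz1.isTP t).mono h6) hvdef
  rw [← hq] at e
  rw [e]
  have hqℓ := (hreg.tCont.timeConv m.cont m.pos m.supp).isTP s
  -- the mismatch
  have x1 := hb₂ n mu (12 * c.lam N) (chi q ρ r s) (timeConvField q ρ s) hn0 h10 hmun (by positivity)
    (hN.lam_le_mu N le_rfl) ((hc.r N).trans_le (hrχ s)) hqℓ (by
      rw [fourierCoeff_timeConv hreg.tCont m.cont m.pos m.supp]
      simp [hreg.zero]) (fun j x => hRχ j s x)
  rw [← hn] at x1
  have eb : wave ψ C₀ lam mu (chi q ρ r s) (timeConvField q ρ s) = b s := rfl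
  rw [eb] at x1
  -- the commutator
  have hu6 := (hg6.tCont.add hzN)
  have x2 := hb₃ lam _ V D s ρ _ v m hu6 hvTP hv hu hD
  -- the transport terms
  have x3 := hb₄ lam _ V (b s) v hlam0 (hbF s) hvTP hbW hv
  set K := 12 * lam with hK
  have k2 : lam + lam ≤ K := by linarith
  have k6 : 6 * lam ≤ K := by linarith
  have k7 : 6 * lam + lam ≤ K := by linarith
  have hbs := hbT.isTP s
  have tp1 : IsTP K fun x => bilin (b s) (b s) x + timeConvField q ρ s x :=
    ((isTP_bilin hbs hbs).mono (by linarith)).add (hqℓ.mono (by linarith))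
  have tp2 : IsTP K fun x => timeConvField (fun t => bilin (fun x => g t x + freqTrunc ψ (c.lam N) (z t) x)
      (fun x => g t x + freqTrunc ψ (c.lam N) (z t) x)) ρ s x - bilin v v x :=
    ((((hu6.bilin hu6).timeConv m.cont m.pos m.supp).isTP s).sub (isTP_bilin hvTP hvTP)).mono k2
  have tp3 : IsTP K (bilin (b s) v) := (isTP_bilin hbs hvTP).mono k7
  have tp3' : IsTP K (bilin v (b s)) := (isTP_bilin hvTP hbs).mono (by linarith)
  have tp4 : IsTP K (lambdaPow (-1) (timeDeriv b s)) := ((hbT.timeDeriv.isTP s).lambdaPow _).mono k6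
  have tp5 : IsTP K (lambdaPow (γ - 1) (b s)) := (hbs.lambdaPow _).mono k6
  have y45 := (hbt.const_mul tp4 (-1)).add (tp4.const_mul _) (tp5.const_mul _) (hbg.const_mul tp5 (-ν))
  have y3 := x3.1.add tp3 tp3' x3.2
  have y345 := y3.add (tp3.add tp3') ((tp4.const_mul _).add (tp5.const_mul _)) y45
  have y2 := (x2.const_mul tp2 (-1)).add (tp2.const_mul _)
    ((tp3.add tp3').add ((tp4.const_mul _).add (tp5.const_mul _))) y345
  have y1 := x1.add tp1 ((tp2.const_mul _).add ((tp3.add tp3').add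
    ((tp4.const_mul _).add (tp5.const_mul _)))) y2
  refine y1.mono ?_
  simp only [abs_neg, abs_one, one_mul]
  have hV0 := hv.nonneg
  have hD0 : 0 ≤ D := (hD 0 ⟨le_rfl, m.pos⟩).nonneg
  have hlog : 0 ≤ log mu := Real.log_nonneg (by linarith)
  have hmu0 : 0 < mu := by linarith
  have hsl : 0 < √lam := sqrt_pos.2 hlam0
  have b1 : C₂ * chi q ρ r s * (log mu * (12 * c.lam N / mu) ^ 2 + 12 * c.lam N / lam)
      ≤ C * ((log mu * (c.lam N / mu) ^ 2 + c.lam N / lam) * X) := by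
    have i1 : log mu * (12 * c.lam N / mu) ^ 2 + 12 * c.lam N / lam
        ≤ 144 * (log mu * (c.lam N / mu) ^ 2 + c.lam N / lam) := by
      have : 0 ≤ c.lam N / lam := by positivity
      have e1 : (12 * c.lam N / mu) ^ 2 = 144 * (c.lam N / mu) ^ 2 := by ring
      have e2 : 12 * c.lam N / lam = 12 * (c.lam N / lam) := by ring
      rw [e1, e2]
      linarith
    calc _ ≤ C₂ * X * (144 * (log mu * (c.lam N / mu) ^ 2 + c.lam N / lam)) := by
          gcongr
      _ = 144 * C₂ * ((log mu * (c.lam N / mu) ^ 2 + c.lam N / lam) * X) := by ring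
      _ ≤ _ := mul_le_mul_of_nonneg_right (by rw [hC]; linarith) (by positivity)
  have b2 : C₃ * (D * V) ≤ C * (D * V) := mul_le_mul_of_nonneg_right (by rw [hC]; linarith) (by positivity)
  have b3 : C₄ * (lam⁻¹ * (C₁ * (√lam * √X) * V))
      + C₄ * (lam⁻¹ * (C₁ * (√lam * √X) * V))
      ≤ C * ((√lam)⁻¹ * √X * V) := by
    have e1 : lam⁻¹ * √lam = (√lam)⁻¹ := by
      rw [inv_mul_eq_iff_eq_mul₀ hlam0.ne', eq_mul_inv_iff_mul_eq₀ hsl.ne', Real.mul_self_sqrt hlam0.le]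
    calc _ = 2 * C₄ * C₁ * (lam⁻¹ * √lam * √X * V) := by ring
      _ = 2 * C₄ * C₁ * ((√lam)⁻¹ * √X * V) := by rw [e1]
      _ ≤ _ := mul_le_mul_of_nonneg_right (by rw [hC]; linarith) (by positivity)
  have b4 : C₁ * (lam ^ (-(3 / 2) : ℝ) * l⁻¹ * √X)
      ≤ C * (lam ^ (-(3 / 2) : ℝ) * l⁻¹ * √X) :=
    mul_le_mul_of_nonneg_right (by rw [hC]; linarith) (by positivity)
  have b5 : |ν| * (C₁ * (lam ^ (γ - 3 / 2) * √X))
      ≤ C * (|ν| * (lam ^ (γ - 3 / 2) * √X)) := by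
    rw [mul_left_comm]
    exact mul_le_mul_of_nonneg_right (by rw [hC]; linarith) (by positivity)
  rw [pathBound]
  simp only [← hlam, ← hmu, ← hl]
  linarith

theorem pathBound_scale {c : Controls} (hc : c.Positive) {N : ℕ} (hN : c.Admissible N) (γ ν : ℝ)
    {F X D V : ℝ} (hF1 : 1 ≤ F) (hX0 : 0 ≤ X) (hV0 : 0 ≤ V) :
    pathBound c N ν γ X (F * D) (F * V) ≤ F ^ 2 * pathBound c N ν γ X D V := by
  have hF2 : 1 ≤ F ^ 2 := one_le_pow₀ hF1
  have hFF : F ≤ F ^ 2 := by nlinarith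
  have hlog : 0 ≤ log (c.mu (N + 1)) := Real.log_nonneg (by
    linarith [hN.ten_le_mu (N + 1) (by omega) le_rfl])
  have hlam0 := hc.lam (N + 1)
  have hlamN := hc.lam N
  have hmu0 := hc.mu (N + 1)
  have hl0 := hc.ell (N + 1)
  have u1 : ∀ {y : ℝ}, 0 ≤ y → y ≤ F ^ 2 * y := fun hy => le_mul_of_one_le_left hy hF2
  have t1 := u1 (y := (log (c.mu (N + 1)) * (c.lam N / c.mu (N + 1)) ^ 2
    + c.lam N / c.lam (N + 1)) * X) (by positivity)
  have t2 := u1 (y := c.lam (N + 1) ^ (-(3 / 2) : ℝ) * (c.ell (N + 1))⁻¹ * √X)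
    (by positivity)
  have t3 := u1 (y := |ν| * (c.lam (N + 1) ^ (γ - 3 / 2) * √X)) (by positivity)
  have t4 : (√(c.lam (N + 1)))⁻¹ * √X * (F * V)
      ≤ F ^ 2 * ((√(c.lam (N + 1)))⁻¹ * √X * V) := by
    have : 0 ≤ (√(c.lam (N + 1)))⁻¹ * √X * V := by positivity
    nlinarith [mul_le_mul_of_nonneg_right hFF this]
  simp only [pathBound]
  have t5 : F * D * (F * V) = F ^ 2 * (D * V) := by ring
  rw [t5]
  linarith

set_option maxHeartbeats 800000 in
theorem exists_path_xBound (hψ : IsFreqCutoff ψ)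
    (h : IsOneSidedMollifier ψ₀) {C₀ : ℝ} (hC₀ : 2 ≤ C₀) {M : ℝ} (hM1 : 1 ≤ M)
    (hM : ∀ t, t ∉ Icc (0 : ℝ) M → ψ₀ t = 0) {α : ℝ} (hα0 : 0 < α) (hα1 : α < 1) (γ : ℝ) :
    ∃ C, 1 ≤ C ∧ ∀ (ν : ℝ) (c : Controls), c.Positive → ∀ N, c.Admissible N →
      ∀ (σ t₀ Zs Zd Za : ℝ) (Q : ℕ → ℝ) (z : Path), HolderPath σ z → (∀ i, 0 ≤ Q i) →
      (∀ i ≤ N, ∀ s ∈ Icc (t₀ - M * (N + 1 - i)) (t₀ + 1),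
        xNorm ((iteration ψ ψ₀ C₀ ν γ c z i).2 s) ≤ ofReal (Q i)) →
      (∀ s ∈ Icc (t₀ - M) (t₀ + 1), WBound (freqTrunc ψ (c.lam N) (z s)) Zs) →
      (∀ s ∈ Icc t₀ (t₀ + 1), WBound (fun x => freqTrunc ψ (c.lam (N + 1)) (z s) x
        - freqTrunc ψ (c.lam N) (z s) x) Zd) →
      (∀ s ∈ Icc t₀ (t₀ + 1), ∀ t ∈ Icc 0 (M * c.ell (N + 1)),
        WBound (fun x => freqTrunc ψ (c.lam N) (z (s - t)) x - freqTrunc ψ (c.lam N) (z s) x)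
          (c.ell (N + 1) ^ α * Za)) →
      ∀ s ∈ Icc t₀ (t₀ + 1), XBound ((iteration ψ ψ₀ C₀ ν γ c z (N + 1)).2 s)
        (C * pathBound c N ν γ (Q N + c.r N)
          (c.ell (N + 1) ^ α * (∑ i ∈ range N, √(c.lam (i + 1)) * c.ell (i + 1) ^ (-α)
            * √(Q i + c.r i)) + c.ell (N + 1) ^ α * Za + Zd)
          ((∑ i ∈ range N, √(c.lam (i + 1)) * √(Q i + c.r i)) + Zs + Zd)) := by
  obtain ⟨C₁, hC₁, hb₁⟩ := exists_block_bounds hψ h hC₀ hM1 hM hα0 hα1 γ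
  obtain ⟨C₂, hC₂, hb₂⟩ := exists_step_xBound hψ h hC₀ hM1 hM hα0 hα1 γ
  set F := 1 + M * C₁ with hF
  have hM0 : 0 ≤ M := by linarith
  have hMC : 0 ≤ M * C₁ := by positivity
  have hF1 : 1 ≤ F := by rw [hF]; linarith
  refine ⟨C₂ * F ^ 2, one_le_mul_of_one_le_of_one_le hC₂ (one_le_pow₀ hF1),
    fun ν c hc N hN σ t₀ Zs Zd Za Q z hz hQ hqQ hZs hZd hZa s hs => ?_⟩
  have hreg := fun n hn => iteration_regular hψ h hC₀ ν γ hc hN hz n hn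
  set g : ℕ → Path := fun n => (iteration ψ ψ₀ C₀ ν γ c z n).1 with hgdef
  set q : ℕ → Path := fun n => (iteration ψ ψ₀ C₀ ν γ c z n).2 with hqdef
  set b : ℕ → Path := fun n => block ψ C₀ (c.lam (n + 1)) (c.mu (n + 1)) (c.r n)
    (rescale ψ₀ (c.ell (n + 1))) (q n) with hbdef
  set l := c.ell (N + 1) with hl
  have hl0 : 0 < l := hc.ell _
  have hl1 : l ≤ 1 := hN.ell_le_one (N + 1) (by omega) le_rfl
  have hMl : M * l ≤ M := mul_le_of_le_one_right hM0 hl1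
  have hw0 : ∀ i : ℕ, i ≤ N → 0 ≤ M * (N - i : ℝ) := fun i hi =>
    mul_nonneg hM0 (sub_nonneg.2 (by exact_mod_cast hi))
  have hblk : ∀ n < N, TCont (6 * c.lam (n + 1)) (b n) ∧ ∀ s ∈ Icc (t₀ - M * (N - n)) (t₀ + 1),
      WBound (b n s) (C₁ * (√(c.lam (n + 1)) * √(Q n + c.r n))) ∧
      ∀ s' ∈ Icc (t₀ - M * (N - n)) (t₀ + 1), WBound (fun x => b n s x - b n s' x)
        (C₁ * (√(c.lam (n + 1)) * c.ell (n + 1) ^ (-α) * √(Q n + c.r n))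
          * |s - s'| ^ α) := by
    intro n hn
    obtain ⟨k, hk⟩ := hN.lam_nat (n + 1) (by omega)
    have h0 := hc.lam (n + 1)
    obtain ⟨b1, -, -, -, b2⟩ := hb₁ k (c.mu (n + 1)) (c.ell (n + 1)) (c.r n) _ _ _
      (by rw [hk] at h0; exact_mod_cast h0) (hc.mu _) (hk ▸ hN.mu_le_lam (n + 1) (by omega) (by omega))
      (hc.ell _) (hc.r n) (hreg n (by omega)).tCont rfl
    rw [← hk] at b1 b2
    have hln := hN.ell_le_one (n + 1) (by omega) (by omega)
    have b3 := b2 (Q n) (t₀ - M * (N - n)) (t₀ + 1) (hQ n) fun s' hs' => hqQ n hn.le s'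
      ⟨by
        have : M * c.ell (n + 1) ≤ M := mul_le_of_le_one_right hM0 hln
        have e : t₀ - M * (N + 1 - n) = t₀ - M * (N - n) - M := by ring
        rw [e]
        linarith [hs'.1], hs'.2⟩
    refine ⟨b1.tCont, fun s hs => ⟨(b3 s hs).2.1, fun s' hs' => ?_⟩⟩
    exact ((b3 s hs).2.2.2.2.2 s' hs').mono (le_of_eq (by ring))
  have hK : ∀ n < N, 6 * c.lam n ≤ 6 * c.lam (n + 1) := fun n hn => by
    linarith [hN.lam_growth n (by omega), hc.lam n]
  obtain ⟨ac1, ac2⟩ := wBound_accumulate (N := N) (g := g) (b := b)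
    (ρ := fun n => rescale ψ₀ (c.ell (n + 1))) (K := fun n => 6 * c.lam n) (M := M) (α := α) (t₀ := t₀)
    (T := t₀ + 1) rfl (fun n _ => rfl) (fun n hn => (hreg n (by omega)).tDiff.tCont)
    (fun n hn => (hblk n hn).1) hK
    (fun n hn => ⟨_, mul_le_of_le_one_right hM0 (hN.ell_le_one (n + 1) (by omega) (by omega)),
      h.mollifierAt (hc.ell _) hM1 hM⟩) (fun n hn s hs => ((hblk n hn).2 s hs).1)
    (fun n hn s hs s' hs' => ((hblk n hn).2 s hs).2 s' hs') N le_rfl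
  rw [← mul_sum] at ac1 ac2
  set Gs := ∑ i ∈ range N, √(c.lam (i + 1)) * √(Q i + c.r i) with hGs
  set Ga := ∑ i ∈ range N, √(c.lam (i + 1)) * c.ell (i + 1) ^ (-α)
    * √(Q i + c.r i) with hGa
  have hGs0 : 0 ≤ Gs := sum_nonneg fun i _ => by positivity
  have hGa0 : 0 ≤ Ga := sum_nonneg fun i _ => by
    have := (hc.ell (i + 1)).le
    positivity
  have ew : t₀ - M * ((N : ℝ) + 1 - N) = t₀ - M := by ring
  rw [ew] at ac1 ac2
  have hqN := hqQ N le_rfl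
  rw [ew] at hqN
  have hlamN := hc.lam N
  have hgrow := hN.lam_growth N le_rfl
  have hregN := hreg N (by omega)
  have m := h.mollifierAt hl0 hM1 hM
  set lam := c.lam (N + 1)
  have hgT : TCont lam (g N) := hregN.tDiff.tCont.mono (by linarith)
  have hGT := hgT.timeConv m.cont m.pos m.supp
  have hzN : TCont lam fun t => freqTrunc ψ (c.lam N) (z t) := (hz.tCont hψ hlamN).mono (by linarith)
  have hz1 : TCont lam fun t => freqTrunc ψ lam (z t) := hz.tCont hψ (hc.lam _)
  have hsw : ∀ t ∈ Icc 0 (M * l), s - t ∈ Icc (t₀ - M) (t₀ + 1) := fun t ht =>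
    ⟨by linarith [hs.1, ht.2], by linarith [hs.2, ht.1]⟩
  have hsM : s ∈ Icc (t₀ - M) (t₀ + 1) := ⟨by linarith [hs.1], hs.2⟩
  have hZs0 := (hZs s hsM).nonneg
  have hZd0 := (hZd s hs).nonneg
  have hZa0 := (hZa s hs 0 ⟨le_rfl, m.pos⟩).nonneg
  have hlα : 0 < l ^ α := rpow_pos_of_pos hl0 _
  set V := Gs + Zs + Zd with hV
  set D := l ^ α * Ga + l ^ α * Za + Zd with hD
  have hV0 : 0 ≤ V := by positivity
  have hD0 : 0 ≤ D := by positivity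
  have hC1F : C₁ ≤ F := by
    rw [hF]
    nlinarith
  have hFV : C₁ * Gs + Zs + Zd ≤ F * V := by
    rw [hV]
    nlinarith [mul_le_mul_of_nonneg_right hC1F hGs0, mul_nonneg (sub_nonneg.2 hF1) hZs0,
      mul_nonneg (sub_nonneg.2 hF1) hZd0]
  have hGW : WBound (timeConvField (g N) (rescale ψ₀ l) s) (C₁ * Gs) := by
    have h1 := WBound.timeConv (s := s) (A := C₁ * Gs) hgT (isTP_zero _) m.cont
      m.nonneg m.pos m.supp m.integral fun t ht => by
        simp only [Pi.zero_apply, sub_zero]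
        exact ac1 _ (hsw t ht)
    simpa only [Pi.zero_apply, sub_zero] using h1
  have hv : WBound (fun x => timeConvField (g N) (rescale ψ₀ l) s x + freqTrunc ψ lam (z s) x) (F * V) := by
    have h1 := (hZs s hsM).add (hzN.isTP s) ((hz1.isTP s).sub (hzN.isTP s)) (hZd s hs)
    simp only [add_sub_cancel] at h1
    exact (hGW.add (hGT.isTP s) (hz1.isTP s) h1).mono (by linarith)
  have hu : ∀ t ∈ Icc 0 (M * l),
      WBound (fun x => g N (s - t) x + freqTrunc ψ (c.lam N) (z (s - t)) x) (F * V) := fun t ht =>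
    ((ac1 _ (hsw t ht)).add (hgT.isTP _) (hzN.isTP _) (hZs _ (hsw t ht))).mono (by linarith)
  have hMα : (M * l) ^ α ≤ M * l ^ α := by
    rw [Real.mul_rpow hM0 hl0.le]
    refine mul_le_mul_of_nonneg_right ?_ hlα.le
    nth_rewrite 2 [← Real.rpow_one M]
    exact Real.rpow_le_rpow_of_exponent_le hM1 hα1.le
  have hdiff : ∀ t ∈ Icc 0 (M * l), WBound (fun x => (g N (s - t) x
      + freqTrunc ψ (c.lam N) (z (s - t)) x) - (timeConvField (g N) (rescale ψ₀ l) s x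
        + freqTrunc ψ lam (z s) x)) (F * D) := by
    intro t ht
    have h1 : WBound (fun x => timeConvField (g N) (rescale ψ₀ l) s x - g N (s - t) x)
        (C₁ * Ga * (M * l ^ α)) := by
      refine WBound.timeConv hgT (hgT.isTP _) m.cont m.nonneg m.pos m.supp m.integral fun t' ht' => ?_
      refine (ac2 _ (hsw t' ht') _ (hsw t ht)).mono ?_
      refine mul_le_mul_of_nonneg_left ?_ (by positivity)
      refine le_trans (Real.rpow_le_rpow (abs_nonneg _) ?_ hα0.le) hMα
      rw [abs_le]
      exact ⟨by linarith [ht.1, ht'.2], by linarith [ht.2, ht'.1]⟩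
    have h2 := h1.sub_comm (hGT.isTP s) (hgT.isTP _)
    have h3 := (hZd s hs).sub_comm (hz1.isTP s) (hzN.isTP s)
    have h4 := (hZa s hs t ht).add ((hzN.isTP _).sub (hzN.isTP _)) ((hzN.isTP _).sub (hz1.isTP _)) h3
    have h5 := h2.add ((hgT.isTP _).sub (hGT.isTP s))
      (((hzN.isTP (s - t)).sub (hzN.isTP s)).add ((hzN.isTP s).sub (hz1.isTP s))) h4
    have e : (fun x => (g N (s - t) x + freqTrunc ψ (c.lam N) (z (s - t)) x)
        - (timeConvField (g N) (rescale ψ₀ l) s x + freqTrunc ψ lam (z s) x)) = fun x =>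
        (g N (s - t) x - timeConvField (g N) (rescale ψ₀ l) s x)
        + ((freqTrunc ψ (c.lam N) (z (s - t)) x - freqTrunc ψ (c.lam N) (z s) x)
          + (freqTrunc ψ (c.lam N) (z s) x - freqTrunc ψ lam (z s) x)) := by
      funext x
      ring
    rw [e]
    refine h5.mono ?_
    have p1 : 0 ≤ l ^ α * Ga := by positivity
    rw [hD, hF]
    linarith [mul_nonneg hMC hZa0, mul_nonneg hMC hZd0]
  have key := hb₂ ν c hc N hN σ s (Q N) (F * D) (F * V) z hz (hQ N) (g N) (q N) hregN
    (by simp only [hqdef, hgdef]; cases N <;> rfl)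
    (fun t ht => hqN t ⟨by linarith [ht.1, hs.1], by linarith [ht.2, hs.2]⟩) hv hu hdiff
  refine XBound.mono (q := (iteration ψ ψ₀ C₀ ν γ c z (N + 1)).2 s) key ?_
  rw [mul_assoc]
  refine mul_le_mul_of_nonneg_left ?_ (by linarith)
  exact pathBound_scale hc hN γ ν hF1 (add_nonneg (hQ N) (hc.r N).le) hV0

/-! ### Measurability -/

section measurability

variable {Ω : Type*} [MeasurableSpace Ω]

theorem measurable_iSup_of_continuous {X : Type*} [TopologicalSpace X]
    [TopologicalSpace.SeparableSpace X] [Nonempty X] {f : Ω → X → ℝ≥0∞}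
    (hc : ∀ ω, Continuous (f ω)) (hm : ∀ x, Measurable fun ω => f ω x) :
    Measurable fun ω => ⨆ x, f ω x := by
  have e : (fun ω => ⨆ x, f ω x) = fun ω => ⨆ n, f ω (TopologicalSpace.denseSeq X n) := by
    funext ω
    refine le_antisymm (iSup_le fun x => ?_) (iSup_le fun n => le_iSup (f ω) _)
    exact (TopologicalSpace.denseRange_denseSeq X).induction_on
      (p := fun x => f ω x ≤ ⨆ n, f ω (TopologicalSpace.denseSeq X n)) x
      (isClosed_le (hc ω) continuous_const) fun n => le_iSup (fun n => f ω (TopologicalSpace.denseSeq X n)) n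
  rw [e]
  exact Measurable.iSup fun n => hm _

theorem measurable_intervalIntegral {E : Type*} [NormedAddCommGroup E] [NormedSpace ℝ E]
    [SecondCountableTopology E] [MeasurableSpace E] [BorelSpace E] {F : Ω → ℝ → E}
    (hc : ∀ ω, Continuous (F ω)) (hm : ∀ t, Measurable fun ω => F ω t) (a b : ℝ) :
    Measurable fun ω => ∫ t in a..b, F ω t := by
  have h1 : Measurable (Function.uncurry fun t ω => F ω t) :=
    measurable_uncurry_of_continuous_of_measurable hc hm
  have h2 := h1.stronglyMeasurable
  simp only [intervalIntegral]
  exact (StronglyMeasurable.integral_prod_left (μ := volume.restrict (Set.Ioc a b)) h2).measurable.sub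
    (StronglyMeasurable.integral_prod_left (μ := volume.restrict (Set.Ioc b a)) h2).measurable

theorem measurable_fourierCoeff {f : Ω → Field} (hc : ∀ ω, Continuous (f ω))
    (hm : ∀ x, Measurable fun ω => f ω x) (k : ℤ²) : Measurable fun ω => fourierCoeff (f ω) k := by
  have h1 : ∀ ω, Continuous fun p : ℝ² => (f ω p : ℂ) * character (-k) p := fun ω =>
    (continuous_ofReal.comp (hc ω)).mul (continuous_character _)
  unfold fourierCoeff
  refine measurable_const.mul (measurable_intervalIntegral (fun ω => ?_) (fun a => ?_) _ _)
  · exact intervalIntegral.continuous_parametric_intervalIntegral_of_continuous'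
      (f := fun a b => (f ω (a, b) : ℂ) * character (-k) (a, b)) (h1 ω) _ _
  · refine measurable_intervalIntegral (fun ω => (h1 ω).comp (by fun_prop)) (fun b => ?_) _ _
    exact (Complex.measurable_ofReal.comp (hm (a, b))).mul measurable_const

theorem measurable_deriv_of_measurable {f : Ω → ℝ → ℂ} (hd : ∀ ω, Differentiable ℝ (f ω))
    (hm : ∀ t, Measurable fun ω => f ω t) (t : ℝ) : Measurable fun ω => deriv (f ω) t := by
  refine measurable_of_tendsto_metrizable
    (f := fun (n : ℕ) ω => ((n : ℝ) + 1) • (f ω (t + ((n : ℝ) + 1)⁻¹) - f ω t))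
    (fun n => by have := (hm (t + ((n : ℝ) + 1)⁻¹)).sub (hm t); fun_prop) (tendsto_pi_nhds.2 fun ω => ?_)
  have h1 : Tendsto (fun n : ℕ => ((n : ℝ) + 1)⁻¹) atTop (𝓝[≠] 0) := by
    refine tendsto_nhdsWithin_iff.2 ⟨?_, of_forall fun n => ?_⟩
    · simpa [one_div] using tendsto_one_div_add_atTop_nhds_zero_nat (𝕜 := ℝ)
    · exact inv_ne_zero (by positivity)
  have := ((hd ω t).hasDerivAt.tendsto_slope_zero).comp h1
  simpa [Function.comp_def] using this

/-- A random trigonometric polynomial. -/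
structure RandTP (K : ℝ) (u : Ω → Field) : Prop where
  isTP : ∀ ω, IsTP K (u ω)
  meas : ∀ k, Measurable fun ω => fourierCoeff (u ω) k

variable {K K' : ℝ} {u v : Ω → Field}

theorem randTP_of_eval (hTP : ∀ ω, IsTP K (u ω)) (hm : ∀ x, Measurable fun ω => u ω x) : RandTP K u :=
  ⟨hTP, measurable_fourierCoeff (fun ω => (hTP ω).continuous) hm⟩

theorem RandTP.eval (hu : RandTP K u) (x : ℝ²) : Measurable fun ω => u ω x := by
  have e : (fun ω => u ω x) = fun ω => (∑ k ∈ disc K, fourierCoeff (u ω) k * character k x).re := by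
    funext ω
    have := hu.isTP ω x
    simp only [trig, id] at this
    rw [← this, Complex.ofReal_re]
  rw [e]
  exact Complex.measurable_re.comp (measurable_fun_sum _ fun k _ => (hu.meas k).mul measurable_const)

theorem RandTP.mono (hu : RandTP K u) (h : K ≤ K') : RandTP K' u :=
  ⟨fun ω => (hu.isTP ω).mono h, hu.meas⟩

theorem RandTP.op (hu : RandTP K u) {T : Field → Field} {σ : ℤ² → ℂ} (hT : IsFourierOp T σ) :
    RandTP K fun ω => T (u ω) := by
  refine ⟨fun ω => (hT K _ (hu.isTP ω)).1, fun k => ?_⟩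
  simp only [fun ω => (hT K _ (hu.isTP ω)).2 k]
  exact measurable_const.mul (hu.meas k)

theorem RandTP.add (hu : RandTP K u) (hv : RandTP K v) : RandTP K fun ω x => u ω x + v ω x :=
  randTP_of_eval (fun ω => (hu.isTP ω).add (hv.isTP ω)) fun x => (hu.eval x).add (hv.eval x)

theorem RandTP.sub (hu : RandTP K u) (hv : RandTP K v) : RandTP K fun ω x => u ω x - v ω x :=
  randTP_of_eval (fun ω => (hu.isTP ω).sub (hv.isTP ω)) fun x => (hu.eval x).sub (hv.eval x)

theorem RandTP.const_mul (hu : RandTP K u) {a : Ω → ℝ} (ha : Measurable a) :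
    RandTP K fun ω x => a ω * u ω x :=
  randTP_of_eval (fun ω => (hu.isTP ω).const_mul _) fun x => ha.mul (hu.eval x)

theorem RandTP.mul (hu : RandTP K u) (hv : RandTP K' v) : RandTP (K + K') fun ω x => u ω x * v ω x :=
  randTP_of_eval (fun ω => (hu.isTP ω).mul (hv.isTP ω)) fun x => (hu.eval x).mul (hv.eval x)

theorem RandTP.bilin (hu : RandTP K u) (hv : RandTP K' v) :
    RandTP (K + K') fun ω => bilin (u ω) (v ω) := by
  have h := hv.op (isFourierOp_lambdaPow 1)
  have h1 := ((hu.op isFourierOp_dx₂).const_mul (a := fun _ => -1) measurable_const).mul h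
  simp only [neg_one_mul] at h1
  exact ((h1.op isFourierOp_dx₁).add (((hu.op isFourierOp_dx₁).mul h).op isFourierOp_dx₂)).op
    isFourierOp_invLaplacian

theorem RandTP.measurable_supNorm (hu : RandTP K u) : Measurable fun ω => supNorm (u ω) :=
  measurable_iSup_of_continuous (fun ω => (hu.isTP ω).continuous.enorm) fun x => (hu.eval x).enorm

theorem RandTP.measurable_xNorm (hu : RandTP K u) : Measurable fun ω => xNorm (u ω) :=
  hu.measurable_supNorm.add (measurable_fun_sum _ fun j _ =>
    (hu.op (isFourierOp_rieszO j)).measurable_supNorm)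

variable {U : Ω → Path}

theorem RandTP.timeConv (hU : ∀ ω, TCont K (U ω)) (hm : ∀ t, RandTP K fun ω => U ω t) {ρ : ℝ → ℝ} {H : ℝ}
    (hρ : MollifierAt ρ H) (s : ℝ) : RandTP K fun ω => timeConvField (U ω) ρ s := by
  refine ⟨fun ω => ((hU ω).timeConv hρ.cont hρ.pos hρ.supp).isTP s, fun k => ?_⟩
  simp only [fun ω => fourierCoeff_timeConv (hU ω) hρ.cont hρ.pos hρ.supp s k]
  refine measurable_intervalIntegral (fun ω => ?_) (fun t => ((hm _).meas k).mul measurable_const) _ _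
  exact (((hU ω).cont k).comp (by fun_prop)).mul (continuous_ofReal.comp hρ.cont)

theorem RandTP.timeDeriv (hU : ∀ ω, TDiff K (U ω)) (hm : ∀ t, RandTP K fun ω => U ω t) (t : ℝ) :
    RandTP K fun ω => timeDeriv (U ω) t := by
  refine ⟨fun ω => (hU ω).timeDeriv.isTP t, fun k => ?_⟩
  simp only [fun ω => (hU ω).fourierCoeff_timeDeriv t k]
  exact measurable_deriv_of_measurable (fun ω => (hU ω).diff k) (fun s => (hm s).meas k) t

theorem RandTP.residual {Z : Ω → Path} (hU : ∀ ω, TDiff K (U ω)) (hm : ∀ t, RandTP K fun ω => U ω t)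
    (hZ : ∀ t, RandTP K fun ω => Z ω t) (ν γ : ℝ) (t : ℝ) {K' : ℝ} (h1 : K + K ≤ K') (h2 : K ≤ K') :
    RandTP K' fun ω => residual ν γ (U ω) (Z ω) t := by
  have e : (fun ω => SQG.residual ν γ (U ω) (Z ω) t) = _ :=
    funext fun ω => residual_eq (hU ω) (fun t => (hZ t).isTP ω) t
  rw [e]
  have a := (hm t).add (hZ t)
  exact ((a.bilin a).mono h1).add (((((RandTP.timeDeriv hU hm t).op (isFourierOp_lambdaPow (-1))).const_mul
    (a := fun _ => -1) measurable_const).add (((hm t).op (isFourierOp_lambdaPow (γ - 1))).const_mul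
      (a := fun _ => -ν) measurable_const)).mono h2)

theorem RandTP.block (hψ : IsFreqCutoff ψ) {mu : ℝ} (hmu : 0 < mu) {C₀ lam r : ℝ}
    {ρ : ℝ → ℝ} {H : ℝ} (hρ : MollifierAt ρ H) (hU : ∀ ω, TCont K (U ω))
    (hm : ∀ t, RandTP K fun ω => U ω t) (t : ℝ) (hb : ∀ ω, IsTP K' (block ψ C₀ lam mu r ρ (U ω) t)) :
    RandTP K' fun ω => block ψ C₀ lam mu r ρ (U ω) t := by
  refine randTP_of_eval hb fun x => ?_
  have hχ : Measurable fun ω => chi (U ω) ρ r t := by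
    simp only [chi, timeConv_eq_interval hρ.pos hρ.supp]
    refine (measurable_intervalIntegral (fun ω => ?_) (fun s =>
      (hm _).measurable_xNorm.ennreal_toReal.mul measurable_const) _ _).add measurable_const
    exact ((hU ω).continuous_toReal_xNorm.comp (by fun_prop)).mul hρ.cont
  have hR : ∀ j, RandTP K fun ω => rieszO j fun w => timeConvField (U ω) ρ t w / chi (U ω) ρ r t := by
    intro j
    have := ((RandTP.timeConv hU hm hρ t).const_mul hχ.inv).op (isFourierOp_rieszO j)
    simpa only [Pi.inv_apply, ← div_eq_inv_mul] using this
  have hA : ∀ j, Measurable fun ω => amplitude ψ C₀ lam mu (chi (U ω) ρ r t) (timeConvField (U ω) ρ t) j x := by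
    intro j
    simp only [amplitude]
    refine (measurable_const.mul (hχ.div_const _).sqrt).mul ?_
    refine RandTP.eval (K := mu) ⟨fun ω => isTP_freqTrunc hψ hmu _, fun k => ?_⟩ x
    simp only [fourierCoeff_freqTrunc hψ hmu]
    refine measurable_const.mul (measurable_fourierCoeff (fun ω => ?_) (fun y => ?_) k)
    · exact (continuous_const.add ((hR j).isTP ω).continuous).sqrt
    · exact (measurable_const.add ((hR j).eval y)).sqrt
  exact measurable_fun_sum _ fun j _ => (hA j).mul measurable_const

theorem randTP_freqTrunc (hψ : IsFreqCutoff ψ) {lam : ℝ} (hl : 0 < lam) {σ : ℝ}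
    {z : Ω → Path} (hz : ∀ ω, HolderPath σ (z ω)) (hzm : ∀ t x, Measurable fun ω => z ω t x) (t : ℝ) :
    RandTP lam fun ω => freqTrunc ψ lam (z ω t) := by
  refine ⟨fun ω => isTP_freqTrunc hψ hl _, fun k => ?_⟩
  simp only [fourierCoeff_freqTrunc hψ hl]
  exact measurable_const.mul (measurable_fourierCoeff (fun ω => ((hz ω).mem t).contDiff.continuous) (hzm t) k)

theorem iteration_measurable (hψ : IsFreqCutoff ψ)
    (h : IsOneSidedMollifier ψ₀) {C₀ : ℝ} (hC₀ : 2 ≤ C₀) (ν γ : ℝ) {c : Controls} (hc : c.Positive)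
    {N : ℕ} (hN : c.Admissible N) {σ : ℝ} {z : Ω → Path} (hz : ∀ ω, HolderPath σ (z ω))
    (hzm : ∀ t x, Measurable fun ω => z ω t x) (n : ℕ) (hn : n ≤ N + 1) (t : ℝ) :
    RandTP (6 * c.lam n) (fun ω => (iteration ψ ψ₀ C₀ ν γ c (z ω) n).1 t) ∧
    RandTP (12 * c.lam n) (fun ω => (iteration ψ ψ₀ C₀ ν γ c (z ω) n).2 t) := by
  obtain ⟨M, hM1, hM⟩ := h.exists_support
  have hM1' : (1 : ℝ) ≤ M := by exact_mod_cast hM1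
  have hreg := fun n hn ω => iteration_regular hψ h hC₀ ν γ hc hN (hz ω) n hn
  have hZ : ∀ n t, RandTP (6 * c.lam n) fun ω => freqTrunc ψ (c.lam n) (z ω t) := fun n t =>
    (randTP_freqTrunc hψ (hc.lam n) hz hzm t).mono (by linarith [hc.lam n])
  have key : ∀ n, n ≤ N + 1 → (∀ t, RandTP (6 * c.lam n) fun ω => (iteration ψ ψ₀ C₀ ν γ c (z ω) n).1 t) →
      ∀ t, RandTP (12 * c.lam n) fun ω => (iteration ψ ψ₀ C₀ ν γ c (z ω) n).2 t := fun n hn hg t => by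
    have := RandTP.residual (fun ω => (hreg n hn ω).tDiff) hg (hZ n) ν γ t (K' := 12 * c.lam n)
      (by linarith [hc.lam n]) (by linarith [hc.lam n])
    cases n <;> exact this
  induction n generalizing t with
  | zero =>
    have h0 : ∀ t, RandTP (6 * c.lam 0) fun ω => (iteration ψ ψ₀ C₀ ν γ c (z ω) 0).1 t := fun t =>
      randTP_of_eval (fun _ => isTP_zero _) fun _ => measurable_const
    exact ⟨h0 t, key 0 hn h0 t⟩
  | succ n ih =>
    have ih := ih (by omega)
    have m := h.mollifierAt (hc.ell (n + 1)) hM1' hM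
    have hgrow := hN.lam_growth n (by omega)
    have h0 := hc.lam n
    have hconv : ∀ t, RandTP (6 * c.lam (n + 1)) fun ω =>
        timeConvField (iteration ψ ψ₀ C₀ ν γ c (z ω) n).1 (rescale ψ₀ (c.ell (n + 1))) t := fun t =>
      (RandTP.timeConv (fun ω => (hreg n (by omega) ω).tDiff.tCont) (fun t => (ih t).1) m t).mono
        (by linarith)
    have hblk : ∀ t, RandTP (6 * c.lam (n + 1)) fun ω => SQG.block ψ C₀ (c.lam (n + 1)) (c.mu (n + 1)) (c.r n)
        (rescale ψ₀ (c.ell (n + 1))) (iteration ψ ψ₀ C₀ ν γ c (z ω) n).2 t := fun t =>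
      RandTP.block hψ (hc.mu _) m (fun ω => (hreg n (by omega) ω).tCont) (fun t => (ih t).2) t fun ω => by
        have e : SQG.block ψ C₀ (c.lam (n + 1)) (c.mu (n + 1)) (c.r n) (rescale ψ₀ (c.ell (n + 1)))
            (iteration ψ ψ₀ C₀ ν γ c (z ω) n).2 t = fun x =>
            (iteration ψ ψ₀ C₀ ν γ c (z ω) (n + 1)).1 t x
            - timeConvField (iteration ψ ψ₀ C₀ ν γ c (z ω) n).1 (rescale ψ₀ (c.ell (n + 1))) t x := by
          funext x
          simp only [iteration, Pi.add_apply, add_sub_cancel_left]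
        rw [e]
        exact ((hreg (n + 1) hn ω).tDiff.isTP t).sub ((hconv t).isTP ω)
    have hg : ∀ t, RandTP (6 * c.lam (n + 1)) fun ω => (iteration ψ ψ₀ C₀ ν γ c (z ω) (n + 1)).1 t :=
      fun t => (hconv t).add (hblk t)
    exact ⟨hg t, key (n + 1) hn hg t⟩

end measurability

/-! ### A regular version of the noise -/

theorem holderNorm_zero (s : ℝ) : holderNorm s 0 = 0 := by
  have h1 : dx₁ 0 = 0 := by funext x; simp [dx₁]
  have h2 : dx₂ 0 = 0 := by funext x; simp [dx₂]
  have h3 : ∀ k, multiDeriv k 0 = 0 := fun k => by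
    rw [multiDeriv, Function.iterate_fixed h2, Function.iterate_fixed h1]
  simp [holderNorm, h3, supNorm, holderSeminorm]

theorem holderPath_zero (s : ℝ) : HolderPath s 0 :=
  ⟨fun t => ⟨fun x => ⟨rfl, rfl⟩, contDiff_const, by
    rw [Pi.zero_apply, holderNorm_zero]; exact ENNReal.zero_lt_top⟩, fun t => by
      simp only [Pi.zero_apply, sub_self, holderNorm_zero]
      exact tendsto_const_nhds⟩

theorem HolderPath.continuous_eval {s : ℝ} {z : Path} (hz : HolderPath s z) (x : ℝ²) :
    Continuous fun t => z t x := by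
  rw [continuous_iff_continuousAt]
  intro t
  refine tendsto_iff_edist_tendsto_0.2 (tendsto_of_tendsto_of_tendsto_of_le_of_le tendsto_const_nhds
    (hz.cont t) (fun _ => zero_le) fun s' => ?_)
  refine le_trans ?_ (supNorm_le_holderNorm s _)
  rw [edist_eq_enorm_sub]
  exact le_iSup (fun x => ‖(z s' - z t) x‖ₑ) x

section probability

variable {Ω : Type*} [MeasurableSpace Ω]

theorem measurable_of_denseSeq {X : Type*} [TopologicalSpace X] [FirstCountableTopology X]
    [TopologicalSpace.SeparableSpace X] [Nonempty X] {f : Ω → X → ℝ} (hc : ∀ ω, Continuous (f ω))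
    (hm : ∀ n, Measurable fun ω => f ω (TopologicalSpace.denseSeq X n)) (x : X) :
    Measurable fun ω => f ω x := by
  obtain ⟨y, hy, hlim⟩ := mem_closure_iff_seq_limit.1 (TopologicalSpace.denseRange_denseSeq X x)
  choose k hk using hy
  refine measurable_of_tendsto_metrizable (f := fun n ω => f ω (y n)) (fun n => ?_)
    (tendsto_pi_nhds.2 fun ω => ((hc ω).tendsto x).comp hlim)
  rw [← hk n]
  exact hm _

theorem exists_regular_version {P : Measure Ω} {m α κ ε : ℝ} {z : Ω → Path}
    (hz : NoiseRegular P m α κ ε z) : ∃ z' : Ω → Path, (∀ ω, HolderPath (1 + κ) (z' ω)) ∧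
      (∀ t x, Measurable fun ω => z' ω t x) ∧ ∀ᵐ ω ∂P, z' ω = z ω := by
  classical
  let τ := TopologicalSpace.denseSeq ℝ
  let ξ := TopologicalSpace.denseSeq ℝ²
  have h1 : ∀ᵐ ω ∂P, HolderPath (1 + κ) (z ω) ∧
      ∀ i j, z ω (τ i) (ξ j) = (hz.measurable (τ i) (ξ j)).mk _ ω := by
    have h2 : ∀ᵐ ω ∂P, ∀ i j, z ω (τ i) (ξ j) = (hz.measurable (τ i) (ξ j)).mk _ ω :=
      ae_all_iff.2 fun i => ae_all_iff.2 fun j => (hz.measurable (τ i) (ξ j)).ae_eq_mk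
    filter_upwards [hz.mem_kappa, hz.continuous_kappa, h2] with ω a b c using ⟨⟨a, b⟩, c⟩
  obtain ⟨B, hB, hBm, hB0⟩ := exists_measurable_superset_of_null (ae_iff.1 h1)
  have hgood : ∀ ω, ω ∉ B → HolderPath (1 + κ) (z ω) ∧
      ∀ i j, z ω (τ i) (ξ j) = (hz.measurable (τ i) (ξ j)).mk _ ω := fun ω hω => by
    by_contra h
    exact hω (hB h)
  have hreg : ∀ ω, HolderPath (1 + κ) (if ω ∈ B then 0 else z ω) := fun ω => by
    split_ifs with h
    · exact holderPath_zero _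
    · exact (hgood ω h).1
  refine ⟨fun ω => if ω ∈ B then 0 else z ω, hreg, fun t x => ?_, ?_⟩
  · refine measurable_of_denseSeq (f := fun ω t => (if ω ∈ B then 0 else z ω : Path) t x)
      (fun ω => (hreg ω).continuous_eval x) (fun i => ?_) t
    refine measurable_of_denseSeq (f := fun ω x => (if ω ∈ B then 0 else z ω : Path) (τ i) x)
      (fun ω => ((hreg ω).mem _).contDiff.continuous) (fun j => ?_) x
    have e : (fun ω => (if ω ∈ B then 0 else z ω : Path) (τ i) (ξ j))
        = fun ω => if ω ∈ B then 0 else (hz.measurable (τ i) (ξ j)).mk _ ω := by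
      funext ω
      split_ifs with h
      · rfl
      · exact (hgood ω h).2 i j
    exact e ▸ Measurable.ite hBm measurable_const (hz.measurable _ _).measurable_mk
  · filter_upwards [measure_eq_zero_iff_ae_notMem.1 hB0] with ω hω
    exact if_neg hω

/-! ### The norm of the gradient -/

/-- The norm `‖∂₁ f‖ + ‖∂₂ f‖ + ‖Λ f‖` in `L^∞`. -/
def wNorm (f : Field) : ℝ≥0∞ := supNorm (dx₁ f) + supNorm (dx₂ f) + supNorm (lambdaPow 1 f)

theorem WBound.wNorm_le {A : ℝ} (h : WBound f A) : wNorm f ≤ ofReal (3 * A) := by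
  have hA := h.nonneg
  have e : 3 * A = A + A + A := by ring
  rw [e, ofReal_add (by linarith) hA, ofReal_add hA hA]
  exact add_le_add (add_le_add (supNorm_le h.1) (supNorm_le h.2.1)) (supNorm_le h.2.2)

theorem wBound_of_wNorm {B : ℝ≥0∞} (hB : B ≠ ∞) (h : wNorm f ≤ B) : WBound f B.toReal := by
  rw [← ofReal_toReal hB] at h
  have h0 : 0 ≤ B.toReal := toReal_nonneg
  exact ⟨abs_le_of_supNorm h0 ((le_self_add.trans le_self_add).trans h),
    abs_le_of_supNorm h0 ((le_add_self.trans le_self_add).trans h), abs_le_of_supNorm h0 (le_add_self.trans h)⟩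

theorem TCont.continuous_wNorm {E : Type*} [TopologicalSpace E] {u : E → Field} (hu : TCont K u) :
    Continuous fun e => wNorm (u e) :=
  (hu.dx₁.continuous_supNorm.add hu.dx₂.continuous_supNorm).add (hu.lambdaPow 1).continuous_supNorm

theorem RandTP.measurable_wNorm {u : Ω → Field} (hu : RandTP K u) :
    Measurable fun ω => wNorm (u ω) :=
  ((hu.op isFourierOp_dx₁).measurable_supNorm.add (hu.op isFourierOp_dx₂).measurable_supNorm).add
    (hu.op (isFourierOp_lambdaPow 1)).measurable_supNorm

theorem wNorm_le_of_wBound {C : ℝ} {b : ℝ≥0∞} (hC : 0 < C)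
    (h : ∀ B : ℝ, 0 ≤ B → b ≤ ofReal B → WBound f (C * B)) : wNorm f ≤ ofReal (3 * C) * b := by
  by_cases hb : b = ∞
  · rw [hb, ENNReal.mul_top (by simpa using hC)]
    exact le_top
  · have := (h b.toReal toReal_nonneg (ofReal_toReal hb).ge).wNorm_le
    rwa [← mul_assoc, ofReal_mul (by positivity), ofReal_toReal hb] at this

/-! ### Moments -/

/-- The `L^p` norm of a nonnegative random variable. -/
def lpn (P : Measure Ω) (p : ℝ) (f : Ω → ℝ≥0∞) : ℝ≥0∞ := (∫⁻ ω, f ω ^ p ∂P) ^ (1 / p)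

variable {P : Measure Ω} {p : ℝ}

theorem lpn_mono (hp : 0 < p) {f g : Ω → ℝ≥0∞} (h : ∀ᵐ ω ∂P, f ω ≤ g ω) : lpn P p f ≤ lpn P p g := by
  refine ENNReal.rpow_le_rpow (lintegral_mono_ae ?_) (by positivity)
  filter_upwards [h] with ω hω using ENNReal.rpow_le_rpow hω hp.le

theorem lpn_add_le (hp : 1 ≤ p) {f g : Ω → ℝ≥0∞} (hf : Measurable f) (hg : Measurable g) :
    lpn P p (fun ω => f ω + g ω) ≤ lpn P p f + lpn P p g :=
  ENNReal.lintegral_Lp_add_le hf.aemeasurable hg.aemeasurable hp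

theorem lpn_const_mul (hp : 0 < p) (c : ℝ) (f : Ω → ℝ≥0∞) :
    lpn P p (fun ω => ofReal c * f ω) = ofReal c * lpn P p f := by
  simp only [lpn, ENNReal.mul_rpow_of_nonneg _ _ hp.le]
  rw [lintegral_const_mul' _ _ (ENNReal.rpow_ne_top_of_nonneg hp.le ofReal_ne_top),
    ENNReal.mul_rpow_of_nonneg _ _ (by positivity), ← ENNReal.rpow_mul, mul_one_div_cancel hp.ne',
    ENNReal.rpow_one]

theorem lpn_const [IsProbabilityMeasure P] (hp : 0 < p) (c : ℝ≥0∞) : lpn P p (fun _ => c) = c := by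
  simp only [lpn, lintegral_const, measure_univ, mul_one]
  rw [← ENNReal.rpow_mul, mul_one_div_cancel hp.ne', ENNReal.rpow_one]

theorem lpn_sum_le (hp : 1 ≤ p) (s : Finset ι) {f : ι → Ω → ℝ≥0∞}
    (hf : ∀ i ∈ s, Measurable (f i)) : lpn P p (fun ω => ∑ i ∈ s, f i ω) ≤ ∑ i ∈ s, lpn P p (f i) := by
  classical
  induction s using Finset.induction_on with
  | empty =>
    have h0 : 0 < p := by linarith
    simp [lpn, ENNReal.zero_rpow_of_pos h0, h0]
  | insert a s ha ih =>
    simp only [Finset.sum_insert ha]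
    have hs := fun i hi => hf i (Finset.mem_insert_of_mem hi)
    exact (lpn_add_le hp (hf a (Finset.mem_insert_self a s)) (measurable_fun_sum _ hs)).trans
      (add_le_add le_rfl (ih hs))

theorem lpn_mul_le (hp : 0 < p) {f g : Ω → ℝ≥0∞} (hf : Measurable f) (hg : Measurable g) :
    lpn P p (fun ω => f ω * g ω) ≤ lpn P (2 * p) f * lpn P (2 * p) g :=
  ENNReal.lintegral_Lp_mul_le_Lq_mul_Lr hp (by linarith) (by field_simp; norm_num) P hf.aemeasurable
    hg.aemeasurable

theorem lpn_sqrt (hp : 0 < p) (f : Ω → ℝ≥0∞) :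
    lpn P (2 * p) (fun ω => f ω ^ (1 / 2 : ℝ)) = lpn P p f ^ (1 / 2 : ℝ) := by
  simp only [lpn, ← ENNReal.rpow_mul]
  congr 2
  · funext ω
    congr 1
    ring
  · field_simp

theorem lpn_le_normLpCloc (E : Field → ℝ≥0∞) (u : Ω → Path) (t : ℝ) (hp : 0 < p) :
    lpn P p (fun ω => normCt E t (u ω)) ≤ normLpCloc P p E u :=
  ENNReal.rpow_le_rpow (le_iSup (fun t => ∫⁻ ω, normCt E t (u ω) ^ p ∂P) t) (by positivity)

theorem lpn_le_seminormLpCloc (E : Field → ℝ≥0∞) (α : ℝ) (u : Ω → Path) (t : ℝ) (hp : 0 < p) :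
    lpn P p (fun ω => seminormCt E α t (u ω)) ≤ seminormLpCloc P p E α u :=
  ENNReal.rpow_le_rpow (le_iSup (fun t => ∫⁻ ω, seminormCt E α t (u ω) ^ p ∂P) t) (by positivity)

theorem normLpCloc_le {E : Field → ℝ≥0∞} {u : Ω → Path} (hp : 0 < p) {B : ℝ≥0∞}
    (h : ∀ t, lpn P p (fun ω => normCt E t (u ω)) ≤ B) : normLpCloc P p E u ≤ B := by
  have h1 : ∀ t, ∫⁻ ω, normCt E t (u ω) ^ p ∂P ≤ B ^ p := fun t => by
    have := ENNReal.rpow_le_rpow (h t) hp.le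
    rwa [lpn, ← ENNReal.rpow_mul, one_div_mul_cancel hp.ne', ENNReal.rpow_one] at this
  refine (ENNReal.rpow_le_rpow (iSup_le h1) (by positivity)).trans (le_of_eq ?_)
  rw [← ENNReal.rpow_mul, mul_one_div_cancel hp.ne', ENNReal.rpow_one]

theorem ae_ne_top_of_lpn (hp : 0 < p) {f : Ω → ℝ≥0∞} (hf : Measurable f) (h : lpn P p f ≠ ∞) :
    ∀ᵐ ω ∂P, f ω ≠ ∞ := by
  have h1 : ∫⁻ ω, f ω ^ p ∂P ≠ ∞ := fun h2 => h (by
    rw [lpn, h2, ENNReal.top_rpow_of_pos (by positivity)])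
  filter_upwards [ae_lt_top (hf.pow_const p) h1] with ω hω h2
  rw [h2, ENNReal.top_rpow_of_pos hp] at hω
  exact lt_irrefl _ hω

/-! ### Suprema over intervals -/

theorem measurable_iSup_Icc {a b : ℝ} (hab : a ≤ b) {f : Ω → ℝ → ℝ≥0∞} (hc : ∀ ω, Continuous (f ω))
    (hm : ∀ s, Measurable fun ω => f ω s) : Measurable fun ω => ⨆ s ∈ Icc a b, f ω s := by
  have : Nonempty (Icc a b) := ⟨⟨a, le_rfl, hab⟩⟩
  simp only [← iSup_subtype'']
  exact measurable_iSup_of_continuous (X := Icc a b) (f := fun ω s => f ω s)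
    (fun ω => (hc ω).comp continuous_subtype_val) fun s => hm s

theorem iSup_Icc_le_sum (a : ℝ) (n : ℕ) (f : ℝ → ℝ≥0∞) : ⨆ s ∈ Icc a (a + n + 1), f s
      ≤ ∑ j ∈ range (n + 1), ⨆ s ∈ Icc (a + j) (a + j + 1), f s := by
  refine iSup₂_le fun s hs => ?_
  have h0 : 0 ≤ s - a := by linarith [hs.1]
  set j := min n ⌊s - a⌋₊ with hj
  have hjn : j ∈ range (n + 1) := mem_range.2 (Nat.lt_succ_of_le (min_le_left _ _))
  have hmem : s ∈ Icc (a + j) (a + j + 1) := by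
    constructor
    · have h1 : (j : ℝ) ≤ ⌊s - a⌋₊ := by exact_mod_cast min_le_right _ _
      linarith [Nat.floor_le h0]
    · rcases le_total n ⌊s - a⌋₊ with h | h
      · rw [hj, min_eq_left h]
        exact hs.2
      · rw [hj, min_eq_right h]
        linarith [Nat.lt_floor_add_one (s - a)]
  exact (le_iSup₂ (f := fun s (_ : s ∈ Icc (a + j) (a + j + 1)) => f s) s hmem).trans
    (single_le_sum (f := fun j : ℕ => ⨆ s ∈ Icc (a + j) (a + j + 1), f s)
      (fun _ _ => zero_le) hjn)

theorem lpn_iSup_Icc_le (hp : 1 ≤ p) {f : Ω → ℝ → ℝ≥0∞} (hc : ∀ ω, Continuous (f ω))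
    (hm : ∀ s, Measurable fun ω => f ω s) (a : ℝ) (n : ℕ) {B : ℝ≥0∞}
    (hB : ∀ t, lpn P p (fun ω => ⨆ s ∈ Icc t (t + 1), f ω s) ≤ B) :
    lpn P p (fun ω => ⨆ s ∈ Icc a (a + n + 1), f ω s) ≤ (n + 1 : ℕ) * B := by
  refine (lpn_mono (by linarith) (of_forall fun ω => iSup_Icc_le_sum a n (f ω))).trans ?_
  refine (lpn_sum_le hp _ (f := fun (j : ℕ) ω => ⨆ s ∈ Icc (a + j) (a + j + 1), f ω s)
    fun j _ => measurable_iSup_Icc (by linarith) hc hm).trans ?_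
  refine (sum_le_sum fun (j : ℕ) _ => hB (a + j)).trans (le_of_eq ?_)
  rw [Finset.sum_const, Finset.card_range, nsmul_eq_mul]

end probability

/-! ### Moments of the truncated noise -/

theorem exists_noise_wNorm (hψ : IsFreqCutoff ψ) {κ ε : ℝ} (hε : 0 < ε) (hεκ : ε ≤ κ) :
    ∃ C : ℝ, 1 ≤ C ∧ ∀ z : Path, HolderPath (1 + κ) z → ∀ lam : ℝ, 0 < lam →
      (∀ s, wNorm (freqTrunc ψ lam (z s)) ≤ ofReal C * holderNorm (1 + κ) (z s)) ∧
      (∀ lam', lam ≤ lam' → ∀ s, wNorm (fun x => freqTrunc ψ lam' (z s) x - freqTrunc ψ lam (z s) x)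
        ≤ ofReal (C * lam ^ (-κ)) * holderNorm (1 + κ) (z s)) ∧
      ∀ s s', wNorm (fun x => freqTrunc ψ lam (z s) x - freqTrunc ψ lam (z s') x)
        ≤ ofReal C * holderNorm (1 + ε) (z s - z s') := by
  have hκ : 0 < κ := hε.trans_le hεκ
  obtain ⟨C₁, h1, hC1⟩ := exists_freqTrunc_wBound hψ hκ
  obtain ⟨C₂, h2, hC2⟩ := exists_freqTrunc_sub_wBound hψ hκ
  obtain ⟨C₃, h3, hC3⟩ := exists_freqTrunc_wBound hψ hε
  set C := C₁ + C₂ + C₃ + 1 with hC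
  have hCpos : 0 < C := by positivity
  refine ⟨3 * C, by linarith, fun z hz lam hl => ⟨fun s => ?_, fun lam' hl' s => ?_, fun s s' => ?_⟩⟩
  · refine wNorm_le_of_wBound hCpos fun B hB hb => ?_
    exact (hC1 lam hl _ (hz.mem s).periodic (hz.mem s).contDiff B hB hb).mono
      (mul_le_mul_of_nonneg_right (by linarith) hB)
  · rw [mul_assoc 3]
    refine wNorm_le_of_wBound (by positivity) fun B hB hb => ?_
    exact (hC2 lam lam' hl hl' _ (hz.mem s).periodic (hz.mem s).contDiff B hB hb).mono
      (mul_le_mul_of_nonneg_right (mul_le_mul_of_nonneg_right (by linarith) (by positivity)) hB)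
  · refine wNorm_le_of_wBound hCpos fun B hB hb => ?_
    have hp : IsPeriodic (z s - z s') := fun x =>
      ⟨congr_arg₂ (· - ·) ((hz.mem s).periodic x).1 ((hz.mem s').periodic x).1,
        congr_arg₂ (· - ·) ((hz.mem s).periodic x).2 ((hz.mem s').periodic x).2⟩
    have hd : ContDiff ℝ ⌊1 + ε⌋₊ (z s - z s') :=
      ((hz.mem s).contDiff.sub (hz.mem s').contDiff).of_le
        (by exact_mod_cast Nat.floor_mono (by linarith))
    have := hC3 lam hl _ hp hd B hB hb
    rw [show z s - z s' = fun x => z s x - z s' x from rfl,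
      freqTrunc_sub hψ hl (hz.mem s).contDiff.continuous (hz.mem s').contDiff.continuous] at this
    exact this.mono (mul_le_mul_of_nonneg_right (by linarith) hB)

/-- The pairs of distinct times in `[τ, τ + 1]`. -/
abbrev TimePairs (τ : ℝ) : Type :=
  {p : ℝ² // p.1 ∈ Icc τ (τ + 1) ∧ p.2 ∈ Icc τ (τ + 1) ∧ p.1 ≠ p.2}

/-- The time-Hölder seminorm of `u` over `[τ, τ + 1]` with respect to `wNorm`. -/
def wSeminorm (α τ : ℝ) (u : Path) : ℝ≥0∞ :=
  ⨆ p : TimePairs τ, ofReal ((|p.1.1 - p.1.2| ^ α)⁻¹) * wNorm fun x => u p.1.1 x - u p.1.2 x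

theorem wNorm_sub_le {α τ : ℝ} {u : Path} {s s' : ℝ} (hs : s ∈ Icc τ (τ + 1))
    (hs' : s' ∈ Icc τ (τ + 1)) (h : s ≠ s') :
    wNorm (fun x => u s x - u s' x) ≤ ofReal (|s - s'| ^ α) * wSeminorm α τ u := by
  have h0 : 0 < |s - s'| ^ α := rpow_pos_of_pos (abs_pos.2 (sub_ne_zero.2 h)) α
  have := le_iSup (fun p : TimePairs τ => ofReal ((|p.1.1 - p.1.2| ^ α)⁻¹) *
    wNorm fun x => u p.1.1 x - u p.1.2 x) ⟨(s, s'), hs, hs', h⟩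
  refine le_trans (le_of_eq ?_) (mul_le_mul_right this _)
  rw [← mul_assoc, ← ofReal_mul h0.le, mul_inv_cancel₀ h0.ne', ENNReal.ofReal_one, one_mul]

theorem wSeminorm_le {α τ C : ℝ} {u v : Path} {E : Field → ℝ≥0∞}
    (h : ∀ s s', wNorm (fun x => u s x - u s' x) ≤ ofReal C * E (v s - v s')) :
    wSeminorm α τ u ≤ ofReal C * seminormCt E α τ v := by
  refine iSup_le fun ⟨⟨s, s'⟩, hs, hs', hne⟩ => ?_
  have h0 : 0 < |s - s'| ^ α := rpow_pos_of_pos (abs_pos.2 (sub_ne_zero.2 hne)) α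
  have h1 : E (v s - v s') / ofReal (|s - s'| ^ α) ≤ seminormCt E α τ v :=
    le_iSup_of_le s (le_iSup_of_le hs (le_iSup_of_le s' (le_iSup_of_le hs' (le_iSup_of_le hne le_rfl))))
  refine (mul_le_mul_right (h s s') _).trans ?_
  rw [mul_left_comm, ENNReal.ofReal_inv_of_pos h0, mul_comm _ (E _), ← div_eq_mul_inv]
  exact mul_le_mul_right h1 _

section probability

variable {Ω : Type*} [MeasurableSpace Ω]

theorem measurable_wSeminorm {K α : ℝ} (τ : ℝ) {u : Ω → Path} (hc : ∀ ω, TCont K (u ω))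
    (hm : ∀ t, RandTP K fun ω => u ω t) : Measurable fun ω => wSeminorm α τ (u ω) := by
  have : Nonempty (TimePairs τ) :=
    ⟨⟨(τ, τ + 1), ⟨by simp, by simp⟩, ⟨by simp, by simp⟩, by simp⟩⟩
  refine measurable_iSup_of_continuous (fun ω => ?_) fun p => ?_
  · have hf : Continuous fun p : TimePairs τ => p.1.1 := continuous_fst.comp continuous_subtype_val
    have hg : Continuous fun p : TimePairs τ => p.1.2 := continuous_snd.comp continuous_subtype_val
    have hpos : ∀ p : TimePairs τ, 0 < |p.1.1 - p.1.2| := fun p => abs_pos.2 (sub_ne_zero.2 p.2.2.2)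
    have h1 : Continuous fun p : TimePairs τ => ofReal ((|p.1.1 - p.1.2| ^ α)⁻¹) :=
      ENNReal.continuous_ofReal.comp (((hf.sub hg).abs.rpow_const fun p => Or.inl (hpos p).ne').inv₀
        fun p => (rpow_pos_of_pos (hpos p) α).ne')
    have h2 := (((hc ω).comp hf).sub ((hc ω).comp hg)).continuous_wNorm
    refine continuous_iff_continuousAt.2 fun p => ENNReal.Tendsto.mul h1.continuousAt (Or.inl ?_)
      h2.continuousAt (Or.inr ofReal_ne_top)
    simpa using rpow_pos_of_pos (hpos p) α
  · exact measurable_const.mul ((hm _).sub (hm _)).measurable_wNorm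

end probability

theorem WBound.sub {K A B : ℝ} {f g : Field} (hf : IsTP K f) (hg : IsTP K g) (h : WBound f A)
    (h' : WBound g B) : WBound (fun x => f x - g x) (A + B) := by
  have key : ∀ {T : Field → Field} {σ : ℤ² → ℂ}, IsFourierOp T σ → (∀ x, |T f x| ≤ A) →
      (∀ x, |T g x| ≤ B) → ∀ x, |T (fun x => f x - g x) x| ≤ A + B := fun {T σ} hT hA hB x => by
    rw [hT.sub hf hg]
    exact (abs_sub _ _).trans (add_le_add (hA x) (hB x))
  exact ⟨key isFourierOp_dx₁ h.1 h'.1, key isFourierOp_dx₂ h.2.1 h'.2.1,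
    key (isFourierOp_lambdaPow 1) h.2.2 h'.2.2⟩

theorem wBound_shift {K α t₀ ell : ℝ} {M : ℕ} {u : Path} (hu : ∀ s, IsTP K (u s)) (hα0 : 0 < α) (hα1 : α ≤ 1)
    (hM : 1 ≤ M) (hl0 : 0 < ell) (hl1 : ell ≤ 1) {S Z : ℝ≥0∞} (hS : S ≠ ∞) (hZ : Z ≠ ∞)
    (hSj : ∀ j ∈ range (2 * M + 3), wSeminorm α (t₀ - M + j / 2) u ≤ S)
    (hZs : ∀ s ∈ Icc (t₀ - M) (t₀ + 1), wNorm (u s) ≤ Z) {s t : ℝ} (hs : s ∈ Icc t₀ (t₀ + 1))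
    (ht : t ∈ Icc 0 (M * ell)) : WBound (fun x => u (s - t) x - u s x)
      (ell ^ α * (ofReal M * S + ofReal (4 * M) * Z).toReal) := by
  have hM1 : (1 : ℝ) ≤ M := by exact_mod_cast hM
  have hS0 : 0 ≤ S.toReal := toReal_nonneg
  have hZ0 : 0 ≤ Z.toReal := toReal_nonneg
  have hla : 0 < ell ^ α := rpow_pos_of_pos hl0 α
  have htM : t ≤ M := ht.2.trans (mul_le_of_le_one_right (by linarith) hl1)
  rw [toReal_add (ENNReal.mul_ne_top ofReal_ne_top hS)
    (ENNReal.mul_ne_top ofReal_ne_top hZ), toReal_mul, toReal_mul,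
    toReal_ofReal (by linarith), toReal_ofReal (by linarith)]
  rcases ht.1.eq_or_lt with h0 | h0
  · subst h0
    simp only [sub_zero, sub_self]
    exact wBound_zero.mono (by positivity)
  rcases le_or_gt t (1 / 2) with h2 | h2
  · set y := s - t - (t₀ - M) with hy
    have hy0 : 0 ≤ y := by linarith [hs.1]
    have hj1 := Nat.floor_le (a := 2 * y) (by linarith)
    have hj2 := Nat.lt_floor_add_one (2 * y)
    set j := ⌊2 * y⌋₊
    have hj : j ∈ range (2 * M + 3) := by
      rw [mem_range]
      have : (j : ℝ) < (2 * M + 3 : ℕ) := by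
        push_cast
        linarith [hs.2]
      exact_mod_cast this
    have h3 := (wNorm_sub_le (α := α) (τ := t₀ - M + j / 2) (u := u) (s := s - t) (s' := s)
      ⟨by linarith, by linarith⟩ ⟨by linarith, by linarith⟩ (by linarith)).trans
      (mul_le_mul_right (hSj j hj) _)
    have e : |s - t - s| = t := by rw [show s - t - s = -t by ring, abs_neg, abs_of_pos h0]
    rw [e] at h3
    refine (wBound_of_wNorm (ENNReal.mul_ne_top ofReal_ne_top hS) h3).mono ?_
    rw [toReal_mul, toReal_ofReal (by positivity)]
    have h4 : t ^ α ≤ M * ell ^ α := by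
      refine (Real.rpow_le_rpow h0.le ht.2 hα0.le).trans ?_
      rw [Real.mul_rpow (by linarith) hl0.le]
      exact mul_le_mul_of_nonneg_right ((Real.rpow_le_rpow_of_exponent_le hM1 hα1).trans_eq
        (Real.rpow_one _)) hla.le
    have h5 := mul_le_mul_of_nonneg_right h4 hS0
    have h6 : 0 ≤ ell ^ α * (4 * M * Z.toReal) := by positivity
    linarith
  · have h3 := wBound_of_wNorm hZ (hZs (s - t) ⟨by linarith [hs.1], by linarith [hs.2]⟩)
    have h4 := wBound_of_wNorm hZ (hZs s ⟨by linarith [hs.1], hs.2⟩)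
    refine (WBound.sub (hu _) (hu _) h3 h4).mono ?_
    have h5 : ell ≤ ell ^ α := by
      simpa using Real.rpow_le_rpow_of_exponent_ge hl0 hl1 hα1
    have h6 : 1 / 2 ≤ M * ell ^ α := by
      linarith [ht.2, mul_le_mul_of_nonneg_left h5 (by linarith : (0 : ℝ) ≤ M)]
    have h7 := mul_le_mul_of_nonneg_right h6 hZ0
    have h8 : 0 ≤ ell ^ α * (M * S.toReal) := by positivity
    linarith

theorem exists_noise_moments (hψ : IsFreqCutoff ψ) {α κ ε : ℝ} (hα0 : 0 < α) (hα1 : α ≤ 1)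
    (hε : 0 < ε) (hεκ : ε ≤ κ) {M : ℕ} (hM : 1 ≤ M) :
    ∃ K : ℝ, 1 ≤ K ∧ ∀ (Ω : Type*) [MeasurableSpace Ω] (P : Measure Ω) (p : ℝ), 1 ≤ p → ∀ z : Ω → Path,
      (∀ ω, HolderPath (1 + κ) (z ω)) → (∀ t x, Measurable fun ω => z ω t x) → ∀ Cz : ℝ, 0 ≤ Cz →
      normLpCloc P p (holderNorm (1 + κ)) z ≤ ofReal Cz →
      seminormLpCloc P p (holderNorm (1 + ε)) α z ≤ ofReal Cz →
      ∀ lam lam' ell t₀ : ℝ, 0 < lam → lam ≤ lam' → 0 < ell → ell ≤ 1 →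
      ∃ Zs Zd Za : Ω → ℝ≥0∞, (Measurable Zs ∧ Measurable Zd ∧ Measurable Za) ∧
        (lpn P p Zs ≤ ofReal (K * Cz) ∧ lpn P p Zd ≤ ofReal (K * (lam ^ (-κ) * Cz)) ∧
          lpn P p Za ≤ ofReal (K * Cz)) ∧ ∀ ω, Zs ω ≠ ∞ → Zd ω ≠ ∞ → Za ω ≠ ∞ →
          (∀ s ∈ Icc (t₀ - M) (t₀ + 1), WBound (freqTrunc ψ lam (z ω s)) (Zs ω).toReal) ∧
          (∀ s ∈ Icc t₀ (t₀ + 1),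
            WBound (fun x => freqTrunc ψ lam' (z ω s) x - freqTrunc ψ lam (z ω s) x) (Zd ω).toReal) ∧
          ∀ s ∈ Icc t₀ (t₀ + 1), ∀ t ∈ Icc 0 (M * ell),
            WBound (fun x => freqTrunc ψ lam (z ω (s - t)) x - freqTrunc ψ lam (z ω s) x)
              (ell ^ α * (Za ω).toReal) := by
  obtain ⟨C, hC1, hC⟩ := exists_noise_wNorm hψ hε hεκ
  have hM1 : (1 : ℝ) ≤ M := by exact_mod_cast hM
  set K := M * ((2 * M + 3) * C) + 4 * M * ((M + 1) * C) with hK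
  have hCM : C ≤ M * C := le_mul_of_one_le_left (by linarith) hM1
  have hMM : M * C ≤ M * (M * C) := mul_le_mul_of_nonneg_left hCM (by linarith)
  have hKC : (M + 1) * C ≤ K := by nlinarith
  refine ⟨K, by linarith, fun Ω _ P p hp z hz hzm Cz hCz hH hG lam lam' ell t₀ hl hl' hl0 hl1 => ?_⟩
  have hp0 : 0 < p := by linarith
  have hlpos : ∀ L, 0 < L → ∀ s, RandTP L fun ω => freqTrunc ψ L (z ω s) := fun L hL s =>
    randTP_freqTrunc hψ hL hz hzm s
  have hcont : ∀ ω, TCont lam fun t => freqTrunc ψ lam (z ω t) := fun ω => (hz ω).tCont hψ hl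
  have hdc : ∀ ω, TCont lam' fun s x => freqTrunc ψ lam' (z ω s) x - freqTrunc ψ lam (z ω s) x :=
    fun ω => ((hz ω).tCont hψ (hl.trans_le hl')).sub ((hcont ω).mono hl')
  have hdm : ∀ s, RandTP lam' fun ω x => freqTrunc ψ lam' (z ω s) x - freqTrunc ψ lam (z ω s) x :=
    fun s => (hlpos lam' (hl.trans_le hl') s).sub ((hlpos lam hl s).mono hl')
  set Zs : Ω → ℝ≥0∞ := fun ω => ⨆ s ∈ Icc (t₀ - M) (t₀ - M + M + 1), wNorm (freqTrunc ψ lam (z ω s))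
  set Zd : Ω → ℝ≥0∞ := fun ω => ⨆ s ∈ Icc t₀ (t₀ + 1),
    wNorm fun x => freqTrunc ψ lam' (z ω s) x - freqTrunc ψ lam (z ω s) x
  set S : Ω → ℝ≥0∞ := fun ω => ∑ j ∈ range (2 * M + 3),
    wSeminorm α (t₀ - M + j / 2) fun t => freqTrunc ψ lam (z ω t)
  have mZs : Measurable Zs := measurable_iSup_Icc (by linarith) (fun ω => (hcont ω).continuous_wNorm)
    fun s => (hlpos lam hl s).measurable_wNorm
  have mZd : Measurable Zd := measurable_iSup_Icc (by linarith) (fun ω => (hdc ω).continuous_wNorm)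
    fun s => (hdm s).measurable_wNorm
  have mSj : ∀ j : ℕ, Measurable fun ω => wSeminorm α (t₀ - M + j / 2) fun t => freqTrunc ψ lam (z ω t) :=
    fun j => measurable_wSeminorm _ hcont (hlpos lam hl)
  have mS : Measurable S := measurable_fun_sum _ fun j _ => mSj j
  have lsup : ∀ {A : ℝ} {f : Ω → Path}, 0 ≤ A →
      (∀ ω s, wNorm (f ω s) ≤ ofReal A * holderNorm (1 + κ) (z ω s)) → ∀ t,
      lpn P p (fun ω => ⨆ s ∈ Icc t (t + 1), wNorm (f ω s)) ≤ ofReal (A * Cz) :=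
    fun {A f} hA hf t => by
      refine (lpn_mono hp0 (g := fun ω => ofReal A * normCt (holderNorm (1 + κ)) t (z ω))
        (of_forall fun ω => iSup₂_le fun s hs => (hf ω s).trans (mul_le_mul_right
          (le_iSup₂ (f := fun s (_ : s ∈ Icc t (t + 1)) => holderNorm (1 + κ) (z ω s)) s hs) _))).trans ?_
      rw [lpn_const_mul hp0, ofReal_mul hA]
      exact mul_le_mul_right ((lpn_le_normLpCloc _ z t hp0).trans hH) _
  have lZs : lpn P p Zs ≤ ofReal ((M + 1) * C * Cz) := by
    refine (lpn_iSup_Icc_le hp (fun ω => (hcont ω).continuous_wNorm)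
      (fun s => (hlpos lam hl s).measurable_wNorm) (t₀ - M) M
      (lsup (by linarith) fun ω s => (hC (z ω) (hz ω) lam hl).1 s)).trans (le_of_eq ?_)
    rw [mul_assoc, ofReal_mul (by positivity : (0 : ℝ) ≤ M + 1),
      show (M + 1 : ℝ) = ((M + 1 : ℕ) : ℝ) by push_cast; ring, ENNReal.ofReal_natCast]
  have lZd : lpn P p Zd ≤ ofReal (C * lam ^ (-κ) * Cz) :=
    lsup (by positivity) (fun ω s => (hC (z ω) (hz ω) lam hl).2.1 lam' hl' s) t₀
  have lS : lpn P p S ≤ ofReal ((2 * M + 3) * (C * Cz)) := by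
    refine (lpn_sum_le hp _ fun j _ => mSj j).trans ((sum_le_sum (g := fun _ => ofReal (C * Cz))
      fun j _ => ?_).trans (le_of_eq ?_))
    · refine (lpn_mono hp0 (of_forall fun ω =>
        wSeminorm_le (hC (z ω) (hz ω) lam hl).2.2)).trans ?_
      rw [lpn_const_mul hp0, ofReal_mul (by linarith)]
      exact mul_le_mul_right ((lpn_le_seminormLpCloc _ α z _ hp0).trans hG) _
    · rw [Finset.sum_const, Finset.card_range, nsmul_eq_mul,
        ofReal_mul (by positivity : (0 : ℝ) ≤ 2 * M + 3),
        show (2 * M + 3 : ℝ) = ((2 * M + 3 : ℕ) : ℝ) by push_cast; ring, ENNReal.ofReal_natCast]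
  refine ⟨Zs, Zd, fun ω => ofReal M * S ω + ofReal (4 * M) * Zs ω,
    ⟨mZs, mZd, (mS.const_mul _).add (mZs.const_mul _)⟩, ⟨lZs.trans ?_, lZd.trans ?_, ?_⟩, fun ω h1 h2 h3 => ?_⟩
  · exact ofReal_le_ofReal (mul_le_mul_of_nonneg_right hKC hCz)
  · rw [mul_assoc]
    exact ofReal_le_ofReal (mul_le_mul_of_nonneg_right (by linarith) (by positivity))
  · refine (lpn_add_le hp (mS.const_mul _) (mZs.const_mul _)).trans ?_
    rw [lpn_const_mul hp0, lpn_const_mul hp0]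
    refine (add_le_add (mul_le_mul_right lS _) (mul_le_mul_right lZs _)).trans (le_of_eq ?_)
    rw [← ofReal_mul (by positivity), ← ofReal_mul (by positivity),
      ← ofReal_add (by positivity) (by positivity), hK]
    congr 1
    ring
  · have hsup : ∀ s ∈ Icc (t₀ - M) (t₀ + 1), wNorm (freqTrunc ψ lam (z ω s)) ≤ Zs ω := fun s hs =>
      le_iSup₂ (f := fun s (_ : s ∈ Icc (t₀ - M) (t₀ - M + M + 1)) => wNorm (freqTrunc ψ lam (z ω s)))
        s ⟨hs.1, by linarith [hs.2]⟩
    refine ⟨fun s hs => wBound_of_wNorm h1 (hsup s hs), fun s hs => wBound_of_wNorm h2 ?_,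
      fun s hs t ht => wBound_shift (u := fun t => freqTrunc ψ lam (z ω t)) (fun s => (hlpos lam hl s).isTP ω)
        hα0 hα1 hM hl0 hl1 ?_ h1 (fun j hj => ?_) hsup hs ht⟩
    · exact le_iSup₂ (f := fun s (_ : s ∈ Icc t₀ (t₀ + 1)) =>
        wNorm fun x => freqTrunc ψ lam' (z ω s) x - freqTrunc ψ lam (z ω s) x) s hs
    · intro h
      exact h3 (by simp only [h]; rw [ENNReal.mul_top (ENNReal.ofReal_pos.2 (by linarith)).ne', top_add])
    · exact single_le_sum (f := fun j : ℕ => wSeminorm α (t₀ - M + j / 2)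
        fun t => freqTrunc ψ lam (z ω t)) (fun _ _ => zero_le) hj

/-! ### The iterative estimate -/

theorem sumDec_nonneg {c : Controls} (hc : c.Positive) (N : ℕ) (β : ℝ) : 0 ≤ sumDec c N β :=
  sum_nonneg fun n _ => by
    have := hc.ell n
    have := hc.r (n - 1)
    positivity

theorem sumDec_zero_le {c : Controls} (hc : c.Positive) {N : ℕ} (hN : c.Admissible N) {α : ℝ} (hα : 0 ≤ α) :
    sumDec c N 0 ≤ sumDec c N α := by
  refine sum_le_sum fun n hn => ?_
  obtain ⟨h1, h2⟩ := Finset.mem_Icc.1 hn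
  have := hc.r (n - 1)
  gcongr ?_ * _
  gcongr ?_ * ?_
  rw [neg_zero]
  exact Real.rpow_le_rpow_of_exponent_ge (hc.ell n) (hN.ell_le_one n h1 (by omega)) (by linarith)

theorem sumDec_eq (c : Controls) (N : ℕ) (β : ℝ) : sumDec c N β
    = ∑ i ∈ range N, 4 ^ (N - (i + 1)) * c.ell (i + 1) ^ (-β) * √(c.r i) := by
  have := Finset.sum_Ico_add' (fun n => 4 ^ (N - n) * c.ell n ^ (-β) * c.r (n - 1) ^ (1 / 2 : ℝ)) 0 N 1
  simp only [Real.sqrt_eq_rpow, Finset.range_eq_Ico]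
  exact this.symm

theorem pathBound_le_err {c : Controls} (hc : c.Positive) {N : ℕ} (hN : c.Admissible N) {α κ Cz K : ℝ}
    (hα : 0 ≤ α) (hCz : 0 ≤ Cz) (hK : 1 ≤ K) (ν γ : ℝ) :
    pathBound c N ν γ (K ^ 2 * c.r N) (c.ell (N + 1) ^ α * (√(c.lam N) * sumDec c N α)
        + (c.ell (N + 1) ^ α + c.lam N ^ (-κ)) * Cz) (√(c.lam N) * sumDec c N 0 + Cz)
      ≤ 2 * K ^ 2 * (errMiss c N + errCom c α κ Cz N + errTime c N + errDis c ν γ N + errTrans c N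
        + errSto c Cz N) := by
  have hmu10 := hN.ten_le_mu (N + 1) (by omega) le_rfl
  have hlam10 := hmu10.trans (hN.mu_le_lam (N + 1) (by omega) le_rfl)
  have hlogmu : 0 ≤ log (c.mu (N + 1)) := Real.log_nonneg (by linarith)
  have hL : 1 ≤ log (c.lam (N + 1)) := by
    rw [Real.le_log_iff_exp_le (by linarith)]
    linarith [Real.exp_one_lt_d9]
  have hr := hc.r N
  have hl := hc.lam N
  have hl' := hc.lam (N + 1)
  have hmu := hc.mu (N + 1)
  have hell := hc.ell (N + 1)
  have hS0 := sumDec_nonneg hc N 0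
  have hSα := sumDec_nonneg hc N α
  have hSS := sumDec_zero_le hc hN hα
  have hKK : K ≤ K ^ 2 := by nlinarith
  have hK0 : 0 < K := by linarith
  have e1 : √(K ^ 2 * c.r N) = K * c.r N ^ (1 / 2 : ℝ) := by
    rw [sqrt_mul (by positivity), Real.sqrt_sq hK0.le, Real.sqrt_eq_rpow]
  have e2 : (√(c.lam (N + 1)))⁻¹ = c.lam (N + 1) ^ (-(1 / 2) : ℝ) := by
    rw [Real.rpow_neg hl'.le, Real.sqrt_eq_rpow]
  have e3 : c.lam N = c.lam N ^ (1 / 2 : ℝ) * c.lam N ^ (1 / 2 : ℝ) := by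
    rw [← Real.rpow_add hl, add_halves, Real.rpow_one]
  rw [pathBound, errMiss, errCom, errTime, errDis, errTrans, errSto, e1, e2, Real.sqrt_eq_rpow]
  set L := log (c.lam (N + 1))
  have up : ∀ {y : ℝ}, 0 ≤ y → K * y ≤ 2 * K ^ 2 * (L * y) := fun {y} hy => by
    have h1 : y ≤ L * y := le_mul_of_one_le_left hy hL
    have h2 := mul_le_mul hKK h1 hy (by positivity)
    linarith [mul_nonneg (sq_nonneg K) (hy.trans h1)]
  have a1 : (log (c.mu (N + 1)) * (c.lam N / c.mu (N + 1)) ^ 2 + c.lam N / c.lam (N + 1)) * (K ^ 2 * c.r N)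
      ≤ 2 * K ^ 2 * ((log (c.mu (N + 1)) * (c.lam N / c.mu (N + 1) + c.mu (N + 1) / c.lam (N + 1)) ^ 2
        + c.lam N / c.lam (N + 1)) * c.r N) := by
    have h1 : (c.lam N / c.mu (N + 1)) ^ 2 ≤ (c.lam N / c.mu (N + 1) + c.mu (N + 1) / c.lam (N + 1)) ^ 2 :=
      pow_le_pow_left₀ (by positivity) (le_add_of_nonneg_right (by positivity)) 2
    have h2 := mul_le_mul_of_nonneg_right (add_le_add_left (mul_le_mul_of_nonneg_left h1 hlogmu)
      (c.lam N / c.lam (N + 1))) (by positivity : 0 ≤ K ^ 2 * c.r N)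
    have h3 : 0 ≤ (log (c.mu (N + 1)) * (c.lam N / c.mu (N + 1) + c.mu (N + 1) / c.lam (N + 1)) ^ 2
        + c.lam N / c.lam (N + 1)) * (K ^ 2 * c.r N) := by positivity
    linarith
  have a3 := up (y := c.lam (N + 1) ^ (-(3 / 2) : ℝ) * (c.ell (N + 1))⁻¹ * c.r N ^ (1 / 2 : ℝ)) (by positivity)
  have a4 := up (y := |ν| * (c.lam (N + 1) ^ (γ - 3 / 2) * c.r N ^ (1 / 2 : ℝ))) (by positivity)
  have a5 := up (y := c.lam (N + 1) ^ (-(1 / 2) : ℝ) * c.r N ^ (1 / 2 : ℝ)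
    * (c.lam N ^ (1 / 2 : ℝ) * sumDec c N 0 + Cz)) (by positivity)
  have a2 : (c.ell (N + 1) ^ α * (c.lam N ^ (1 / 2 : ℝ) * sumDec c N α)
      + (c.ell (N + 1) ^ α + c.lam N ^ (-κ)) * Cz) * (c.lam N ^ (1 / 2 : ℝ) * sumDec c N 0 + Cz)
      ≤ 2 * K ^ 2 * (L * c.lam N * c.ell (N + 1) ^ α * sumDec c N α * sumDec c N 0
      + L * c.lam N ^ (1 / 2 : ℝ)
        * (c.ell (N + 1) ^ α * sumDec c N α + c.lam N ^ (-κ) * sumDec c N 0) * Cz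
      + L * (c.ell (N + 1) ^ α + c.lam N ^ (-κ)) * Cz ^ 2) := by
    have hw : (0 : ℝ) ≤ c.lam N ^ (1 / 2 : ℝ) := by positivity
    have ha : (0 : ℝ) ≤ c.ell (N + 1) ^ α := by positivity
    have hk : (0 : ℝ) ≤ c.lam N ^ (-κ) := by positivity
    rw [show L * c.lam N = L * (c.lam N ^ (1 / 2 : ℝ) * c.lam N ^ (1 / 2 : ℝ)) by rw [← e3]]
    generalize c.lam N ^ (1 / 2 : ℝ) = w at *
    generalize c.ell (N + 1) ^ α = a at *
    generalize c.lam N ^ (-κ) = k at *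
    generalize sumDec c N α = Sα at *
    generalize sumDec c N 0 = S₀ at *
    have h1 : 0 ≤ w * w * a * Sα * S₀ + w * (a * Sα + k * S₀) * Cz + (a + k) * Cz ^ 2 := by positivity
    have h2 := mul_le_mul_of_nonneg_left hSS (by positivity : 0 ≤ w * a * Cz)
    have h3 := mul_le_mul_of_nonneg_right hL h1
    have h4 := mul_le_mul_of_nonneg_right (one_le_pow₀ hK : 1 ≤ K ^ 2) (h1.trans ((one_mul _).symm.trans_le h3))
    have h5 : 0 ≤ w * w * a * Sα * S₀ := by positivity
    have h6 : 0 ≤ w * k * S₀ * Cz := by positivity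
    have h7 : 0 ≤ (a + k) * Cz ^ 2 := by positivity
    linarith
  linarith

section probability

variable {Ω : Type*} [MeasurableSpace Ω] {P : Measure Ω}

theorem lpn_pathBound [IsProbabilityMeasure P] {p : ℝ} (hp : 1 ≤ p) {c : Controls} (hc : c.Positive) {N : ℕ}
    (hN : c.Admissible N) {ν γ C x d v : ℝ} (hC : 0 ≤ C) (hx : 0 ≤ x) (hd : 0 ≤ d) (hv : 0 ≤ v)
    {X D V f : Ω → ℝ≥0∞} (mX : Measurable X) (mD : Measurable D) (mV : Measurable V)
    (lX : lpn P p X ≤ ofReal x) (lD : lpn P (2 * p) D ≤ ofReal d) (lV : lpn P (2 * p) V ≤ ofReal v)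
    (hf : ∀ᵐ ω ∂P, X ω ≠ ∞ → D ω ≠ ∞ → V ω ≠ ∞ →
      f ω ≤ ofReal (C * pathBound c N ν γ (X ω).toReal (D ω).toReal (V ω).toReal)) :
    lpn P p f ≤ ofReal (C * pathBound c N ν γ x d v) := by
  have hp0 : 0 < p := by linarith
  have hlog : 0 ≤ log (c.mu (N + 1)) := Real.log_nonneg (by
    linarith [hN.ten_le_mu (N + 1) (by omega) le_rfl])
  have hl := hc.lam N
  have hl' := hc.lam (N + 1)
  have hmu := hc.mu (N + 1)
  have hell := hc.ell (N + 1)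
  obtain ⟨A, hA⟩ : ∃ A, A = log (c.mu (N + 1)) * (c.lam N / c.mu (N + 1)) ^ 2 + c.lam N / c.lam (N + 1) :=
    ⟨_, rfl⟩
  obtain ⟨a, ha⟩ : ∃ a, a = c.lam (N + 1) ^ (-(3 / 2) : ℝ) * (c.ell (N + 1))⁻¹
    + |ν| * c.lam (N + 1) ^ (γ - 3 / 2) := ⟨_, rfl⟩
  obtain ⟨b, hb⟩ : ∃ b, b = (√(c.lam (N + 1)))⁻¹ := ⟨_, rfl⟩
  have hA0 : 0 ≤ A := by rw [hA]; positivity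
  have ha0 : 0 ≤ a := by rw [ha]; positivity
  have hb0 : 0 ≤ b := by rw [hb]; positivity
  have e : ∀ {x d v : ℝ}, 0 ≤ x → 0 ≤ d → 0 ≤ v → ofReal (C * pathBound c N ν γ x d v)
      = ofReal C * (ofReal A * ofReal x + ofReal d * ofReal v
        + (ofReal a * ofReal x ^ (1 / 2 : ℝ)
        + ofReal b * (ofReal x ^ (1 / 2 : ℝ) * ofReal v))) := fun {x d v} hx hd hv => by
    have e1 : pathBound c N ν γ x d v = A * x + d * v + (a * √x + b * (√x * v)) := by
      rw [pathBound, hA, ha, hb]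
      ring
    rw [e1, ENNReal.ofReal_rpow_of_nonneg hx (by norm_num), ← Real.sqrt_eq_rpow, ofReal_mul hC,
      ofReal_add (by positivity) (by positivity), ofReal_add (by positivity) (by positivity),
      ofReal_add (by positivity) (by positivity), ofReal_mul hA0, ofReal_mul hd,
      ofReal_mul ha0, ofReal_mul hb0, ofReal_mul (by positivity)]
  set R : Ω → ℝ≥0∞ := fun ω => X ω ^ (1 / 2 : ℝ)
  have mR : Measurable R := mX.pow_const _
  have lR : lpn P (2 * p) R ≤ ofReal x ^ (1 / 2 : ℝ) := by
    rw [lpn_sqrt hp0]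
    exact ENNReal.rpow_le_rpow lX (by norm_num)
  have lR' : lpn P p R ≤ ofReal x ^ (1 / 2 : ℝ) := by
    have := lpn_mul_le (P := P) hp0 mR (measurable_const (a := (1 : ℝ≥0∞)))
    rw [lpn_const (by linarith)] at this
    simp only [mul_one] at this
    exact this.trans lR
  have hpp : (0 : ℝ) < 2 * p := by linarith
  have t1 := ae_ne_top_of_lpn hp0 mX (lX.trans_lt ofReal_lt_top).ne
  have t2 := ae_ne_top_of_lpn hpp mD (lD.trans_lt ofReal_lt_top).ne
  have t3 := ae_ne_top_of_lpn hpp mV (lV.trans_lt ofReal_lt_top).ne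
  refine (lpn_mono hp0 (g := fun ω => ofReal C * (ofReal A * X ω + D ω * V ω
    + (ofReal a * R ω + ofReal b * (R ω * V ω)))) ?_).trans ?_
  · filter_upwards [hf, t1, t2, t3] with ω h0 h1 h2 h3
    refine (h0 h1 h2 h3).trans (le_of_eq ?_)
    rw [e toReal_nonneg toReal_nonneg toReal_nonneg, ofReal_toReal h1,
      ofReal_toReal h2, ofReal_toReal h3]
  · rw [lpn_const_mul hp0, e hx hd hv]
    have mRV := mR.mul mV
    refine mul_le_mul_right ((lpn_add_le hp ((mX.const_mul _).add (mD.mul mV))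
      ((mR.const_mul _).add (mRV.const_mul _))).trans (add_le_add
      ((lpn_add_le hp (mX.const_mul _) (mD.mul mV)).trans (add_le_add ?_ ?_))
      ((lpn_add_le hp (mR.const_mul _) (mRV.const_mul _)).trans (add_le_add ?_ ?_)))) _
    · rw [lpn_const_mul hp0]
      exact mul_le_mul_right lX _
    · exact (lpn_mul_le hp0 mD mV).trans (mul_le_mul' lD lV)
    · rw [lpn_const_mul hp0]
      exact mul_le_mul_right lR' _
    · refine (lpn_const_mul hp0 b (fun ω => R ω * V ω)).trans_le ?_
      exact mul_le_mul_right ((lpn_mul_le hp0 mR mV).trans (mul_le_mul' lR lV)) _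

/-- The weighted sum of the sizes of the increments. -/
def incSum {Ω : Type*} (c : Controls) (N : ℕ) (β : ℝ) (R : ℕ → Ω → ℝ≥0∞) (ω : Ω) : ℝ≥0∞ :=
  ∑ i ∈ range N, ofReal (√(c.lam (i + 1)) * c.ell (i + 1) ^ (-β)) * R i ω

theorem Controls.Admissible.lam_le {c : Controls} (hc : c.Positive) {N : ℕ} (hN : c.Admissible N) {i : ℕ}
    (hi : i ≤ N) : c.lam i ≤ c.lam N := by
  have : ∀ j, i ≤ j → j ≤ N → c.lam i ≤ c.lam j := fun j hij => by
    induction j, hij using Nat.le_induction with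
    | base => exact fun _ => le_rfl
    | succ j hij ih =>
      intro hj
      linarith [ih (by omega), hN.lam_growth j (by omega), hc.lam j]
  exact this N hi le_rfl

theorem lpn_incSum_le {p : ℝ} (hp : 1 ≤ p) {c : Controls} (hc : c.Positive) {N : ℕ} (hN : c.Admissible N)
    (hK : 0 ≤ K) (β : ℝ) {R : ℕ → Ω → ℝ≥0∞} (mR : ∀ i < N, Measurable (R i))
    (lR : ∀ i < N, lpn P p (R i) ≤ ofReal (K * (4 ^ (N - (i + 1)) * √(c.r i)))) :
    lpn P p (incSum c N β R) ≤ ofReal (K * (√(c.lam N) * sumDec c N β)) := by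
  refine (lpn_sum_le hp _ fun i hi => (mR i (mem_range.1 hi)).const_mul _).trans ?_
  rw [sumDec_eq, mul_sum, mul_sum, ENNReal.ofReal_sum_of_nonneg fun i _ => by
    have := hc.ell (i + 1)
    positivity]
  refine sum_le_sum fun i hi => ?_
  have hi := mem_range.1 hi
  have hell := hc.ell (i + 1)
  rw [lpn_const_mul (by linarith)]
  refine (mul_le_mul_right (lR i hi) _).trans ?_
  rw [← ofReal_mul (by positivity)]
  refine ofReal_le_ofReal ?_
  have := mul_le_mul_of_nonneg_right (Real.sqrt_le_sqrt (hN.lam_le hc (i := i + 1) (by omega)))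
    (by positivity : 0 ≤ c.ell (i + 1) ^ (-β) * (K * (4 ^ (N - (i + 1)) * √(c.r i))))
  linarith

theorem toReal_incSum {Ω : Type*} (c : Controls) (hc : c.Positive) {N : ℕ} (β : ℝ) {R : ℕ → Ω → ℝ≥0∞} {ω : Ω}
    (h : ∀ i < N, R i ω ≠ ∞) : incSum c N β R ω ≠ ∞ ∧ (incSum c N β R ω).toReal
      = ∑ i ∈ range N, √(c.lam (i + 1)) * c.ell (i + 1) ^ (-β) * (R i ω).toReal := by
  have h1 : ∀ i ∈ range N,
      ofReal (√(c.lam (i + 1)) * c.ell (i + 1) ^ (-β)) * R i ω ≠ ∞ := fun i hi =>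
    ENNReal.mul_ne_top ofReal_ne_top (h i (mem_range.1 hi))
  refine ⟨ENNReal.sum_ne_top.2 h1, ?_⟩
  rw [incSum, ENNReal.toReal_sum h1]
  refine sum_congr rfl fun i _ => ?_
  have := hc.ell (i + 1)
  rw [toReal_mul, toReal_ofReal (by positivity)]

end probability

theorem normLpCloc_congr {Ω : Type*} [MeasurableSpace Ω] {P : Measure Ω} (p : ℝ) (E : Field → ℝ≥0∞)
    {u v : Ω → Path} (h : ∀ᵐ ω ∂P, u ω = v ω) : normLpCloc P p E u = normLpCloc P p E v := by
  unfold normLpCloc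
  congr 2
  funext t
  exact lintegral_congr_ae (h.mono fun ω hω => by simp only [hω])

theorem seminormLpCloc_congr {Ω : Type*} [MeasurableSpace Ω] {P : Measure Ω} (p : ℝ) (E : Field → ℝ≥0∞)
    (α : ℝ) {u v : Ω → Path} (h : ∀ᵐ ω ∂P, u ω = v ω) :
    seminormLpCloc P p E α u = seminormLpCloc P p E α v := by
  unfold seminormLpCloc
  congr 2
  funext t
  exact lintegral_congr_ae (h.mono fun ω hω => by simp only [hω])

theorem sqrt_toReal_add {q : ℝ≥0∞} (hq : q ≠ ∞) {r : ℝ} (hr : 0 ≤ r) :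
    √(q.toReal + r) = ((q + ofReal r) ^ (1 / 2 : ℝ)).toReal := by
  rw [← ENNReal.toReal_rpow, toReal_add hq ofReal_ne_top, toReal_ofReal hr,
    Real.sqrt_eq_rpow]

theorem sqrt_window_le {M N i : ℕ} (hi : i < N) (hK : 2 * M + 2 ≤ K) (r : ℝ) :
    √(((M * (N + 1 - i) : ℕ) + 2) * r) ≤ K * (4 ^ (N - (i + 1)) * √r) := by
  obtain ⟨j, rfl⟩ : ∃ j, N = i + 1 + j := ⟨N - (i + 1), by omega⟩
  rw [show i + 1 + j + 1 - i = j + 2 by omega, show i + 1 + j - (i + 1) = j by omega]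
  have h4 : (j : ℝ) + 1 ≤ 4 ^ j := by exact_mod_cast Nat.lt_pow_self (n := j) (a := 4) (by norm_num)
  have hM : (0 : ℝ) ≤ M := Nat.cast_nonneg M
  have hj : (0 : ℝ) ≤ j := Nat.cast_nonneg j
  have h1 : (2 * M + 2) * ((j : ℝ) + 1) ≤ K * 4 ^ j := mul_le_mul hK h4 (by linarith) (by linarith)
  have h2 : ((M * (j + 2) : ℕ) : ℝ) + 2 ≤ K * 4 ^ j := by
    push_cast
    linarith [mul_nonneg hM hj]
  have h3 : 1 ≤ K * 4 ^ j := le_trans (by linarith [Nat.cast_nonneg (α := ℝ) (M * (j + 2))]) h2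
  rw [sqrt_mul (by positivity), ← mul_assoc]
  refine mul_le_mul_of_nonneg_right ((Real.sqrt_le_left (by linarith)).2 (h2.trans ?_)) (Real.sqrt_nonneg _)
  exact le_self_pow₀ h3 two_ne_zero

set_option maxHeartbeats 1000000 in
theorem exists_residual_moment_bound (hψ : IsFreqCutoff ψ)
    (h : IsOneSidedMollifier ψ₀) {C₀ α κ ε : ℝ} (hC₀ : 2 ≤ C₀) (hα0 : 0 < α) (hα1 : α < 1) (hε : 0 < ε)
    (hεκ : ε ≤ κ) (γ : ℝ) :
    ∃ K : ℝ, 1 ≤ K ∧ ∀ (Ω : Type*) [MeasurableSpace Ω] (P : Measure Ω) [IsProbabilityMeasure P] (m : ℝ),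
      1 ≤ m → ∀ z : Ω → Path, (∀ ω, HolderPath (1 + κ) (z ω)) → (∀ t x, Measurable fun ω => z ω t x) →
      ∀ Cz : ℝ, 0 ≤ Cz → normLpCloc P (2 * m) (holderNorm (1 + κ)) z ≤ ofReal Cz →
      seminormLpCloc P (2 * m) (holderNorm (1 + ε)) α z ≤ ofReal Cz →
      ∀ (ν : ℝ) (c : Controls), c.Positive → ∀ N, c.Admissible N →
      (∀ n ≤ N, normLpCloc P m xNorm (residualSeq ψ ψ₀ C₀ ν γ c z n) ≤ ofReal (c.r n)) →
      normLpCloc P m xNorm (residualSeq ψ ψ₀ C₀ ν γ c z (N + 1)) ≤ ofReal (K *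
        (errMiss c N + errCom c α κ Cz N + errTime c N + errDis c ν γ N + errTrans c N + errSto c Cz N)) := by
  obtain ⟨M, hM1, hM⟩ := h.exists_support
  have hM1' : (1 : ℝ) ≤ M := by exact_mod_cast hM1
  obtain ⟨C, hC1, hC⟩ := exists_path_xBound hψ h hC₀ hM1' hM hα0 hα1 γ
  obtain ⟨K₀, hK₀, hnoise⟩ := exists_noise_moments hψ hα0 hα1.le hε hεκ hM1
  obtain ⟨K, hK⟩ : ∃ K : ℝ, K = 2 * M + 2 + 2 * K₀ := ⟨_, rfl⟩
  have hK1 : 1 ≤ K := by linarith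
  refine ⟨3 * C * K ^ 2 * (2 * K ^ 2), ?_, fun Ω _ P _ m hm z hz hzm Cz hCz hH hG ν c hc N hN hq => ?_⟩
  · have hK2 : 1 ≤ K ^ 2 := one_le_pow₀ hK1
    have h1 : 1 ≤ 3 * C * K ^ 2 := one_le_mul_of_one_le_of_one_le (by linarith) hK2
    exact one_le_mul_of_one_le_of_one_le h1 (by linarith)
  have hm0 : 0 < m := by linarith
  have hmm : 1 ≤ 2 * m := by linarith
  have hmm0 : 0 < 2 * m := by linarith
  refine normLpCloc_le hm0 fun t₀ => ?_
  have hlN := hc.lam N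
  have hl1 : 1 ≤ c.lam N := by
    obtain ⟨k, hk⟩ := hN.lam_nat N (by omega)
    rw [hk] at hlN ⊢
    exact_mod_cast hlN
  have hκ1 : c.lam N ^ (-κ) ≤ 1 := Real.rpow_le_one_of_one_le_of_nonpos hl1 (by linarith)
  have hκ0 : 0 ≤ c.lam N ^ (-κ) := by positivity
  have hell := hc.ell (N + 1)
  have hS0 := sumDec_nonneg hc N 0
  have hSα := sumDec_nonneg hc N α
  have hla : 0 ≤ c.ell (N + 1) ^ α := by positivity
  obtain ⟨Zs, Zd, Za, ⟨mZs, mZd, mZa⟩, ⟨lZs, lZd, lZa⟩, hZ⟩ := hnoise Ω P (2 * m) hmm z hz hzm Cz hCz hH hG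
    (c.lam N) (c.lam (N + 1)) (c.ell (N + 1)) t₀ hlN (by linarith [hN.lam_growth N le_rfl]) hell
    (hN.ell_le_one (N + 1) (by omega) le_rfl)
  set n : ℕ → ℕ := fun i => M * (N + 1 - i)
  set Q : ℕ → Ω → ℝ≥0∞ := fun i ω => ⨆ s ∈ Icc (t₀ - n i) (t₀ - n i + n i + 1),
    xNorm (residualSeq ψ ψ₀ C₀ ν γ c z i ω s)
  have cont : ∀ i ≤ N, ∀ ω, Continuous fun s => xNorm (residualSeq ψ ψ₀ C₀ ν γ c z i ω s) := fun i hi ω =>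
    (iteration_regular hψ h hC₀ ν γ hc hN (hz ω) i (by omega)).tCont.continuous_xNorm
  have meas : ∀ i ≤ N, ∀ s, Measurable fun ω => xNorm (residualSeq ψ ψ₀ C₀ ν γ c z i ω s) := fun i hi s =>
    (iteration_measurable hψ h hC₀ ν γ hc hN hz hzm i (by omega) s).2.measurable_xNorm
  have mQ : ∀ i ≤ N, Measurable (Q i) := fun i hi =>
    measurable_iSup_Icc (by linarith [Nat.cast_nonneg (α := ℝ) (n i)]) (cont i hi) (meas i hi)
  have lQ : ∀ i ≤ N, lpn P m (Q i) ≤ (n i + 1 : ℕ) * ofReal (c.r i) := fun i hi =>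
    lpn_iSup_Icc_le hm (cont i hi) (meas i hi) _ _ fun t => (lpn_le_normLpCloc _ _ t hm0).trans (hq i hi)
  set X : ℕ → Ω → ℝ≥0∞ := fun i ω => Q i ω + ofReal (c.r i)
  have mX : ∀ i ≤ N, Measurable (X i) := fun i hi => (mQ i hi).add measurable_const
  have lX : ∀ i ≤ N, lpn P m (X i) ≤ ofReal ((n i + 2) * c.r i) := fun i hi => by
    refine (lpn_add_le hm (mQ i hi) measurable_const).trans ?_
    rw [lpn_const hm0]
    refine (add_le_add (lQ i hi) le_rfl).trans (le_of_eq ?_)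
    rw [← ENNReal.ofReal_natCast, ← ofReal_mul (by positivity),
      ← ofReal_add (mul_nonneg (by positivity) (hc.r i).le) (hc.r i).le]
    push_cast
    ring_nf
  set R : ℕ → Ω → ℝ≥0∞ := fun i ω => X i ω ^ (1 / 2 : ℝ)
  have mR : ∀ i < N, Measurable (R i) := fun i hi => (mX i hi.le).pow_const _
  have lR : ∀ i < N, lpn P (2 * m) (R i) ≤ ofReal (K * (4 ^ (N - (i + 1)) * √(c.r i))) :=
    fun i hi => by
      rw [lpn_sqrt hm0]
      refine (ENNReal.rpow_le_rpow (lX i hi.le) (by norm_num)).trans ?_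
      rw [ENNReal.ofReal_rpow_of_nonneg (mul_nonneg (by positivity) (hc.r i).le) (by norm_num),
        ← Real.sqrt_eq_rpow]
      exact ofReal_le_ofReal (sqrt_window_le hi (by linarith) _)
  have mI : ∀ β, Measurable (incSum c N β R) := fun β =>
    measurable_fun_sum _ fun i hi => (mR i (mem_range.1 hi)).const_mul _
  have lI := fun β => lpn_incSum_le hmm hc hN (by linarith : 0 ≤ K) β mR lR
  set V : Ω → ℝ≥0∞ := fun ω => incSum c N 0 R ω + Zs ω + Zd ω
  set D : Ω → ℝ≥0∞ := fun ω => ofReal (c.ell (N + 1) ^ α) * (incSum c N α R ω + Za ω) + Zd ω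
  have hK₀' : K₀ * (c.lam N ^ (-κ) * Cz) ≤ K₀ * Cz :=
    mul_le_mul_of_nonneg_left (mul_le_of_le_one_left hCz hκ1) (by linarith)
  have hKM : 0 ≤ (M : ℝ) * Cz := by positivity
  have lV : lpn P (2 * m) V ≤ ofReal (K * (√(c.lam N) * sumDec c N 0 + Cz)) := by
    refine (lpn_add_le hmm ((mI 0).add mZs) mZd).trans ((add_le_add ((lpn_add_le hmm (mI 0) mZs).trans
      (add_le_add (lI 0) lZs)) lZd).trans ?_)
    rw [← ofReal_add (by positivity) (by positivity),
      ← ofReal_add (by positivity) (by positivity), mul_add K]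
    refine ofReal_le_ofReal ?_
    have : K * Cz = 2 * (M * Cz) + 2 * Cz + 2 * (K₀ * Cz) := by rw [hK]; ring
    linarith
  have lD : lpn P (2 * m) D ≤ ofReal (K * (c.ell (N + 1) ^ α * (√(c.lam N) * sumDec c N α)
      + (c.ell (N + 1) ^ α + c.lam N ^ (-κ)) * Cz)) := by
    refine (lpn_add_le hmm (((mI α).add mZa).const_mul _) mZd).trans ?_
    rw [lpn_const_mul hmm0]
    refine (add_le_add (mul_le_mul_right ((lpn_add_le hmm (mI α) mZa).trans (add_le_add (lI α) lZa)) _)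
      lZd).trans ?_
    rw [← ofReal_add (by positivity) (by positivity), ← ofReal_mul hla,
      ← ofReal_add (by positivity) (by positivity)]
    refine ofReal_le_ofReal ?_
    have h1 := mul_le_mul_of_nonneg_right (by linarith : K₀ ≤ K) (mul_nonneg hla hCz)
    have h2 := mul_le_mul_of_nonneg_right (by linarith : K₀ ≤ K) (mul_nonneg hκ0 hCz)
    linarith
  have lXN : lpn P m (X N) ≤ ofReal (K ^ 2 * c.r N) := by
    refine (lX N le_rfl).trans (ofReal_le_ofReal (mul_le_mul_of_nonneg_right ?_ (hc.r N).le))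
    have : (n N : ℝ) = M := by simp [n]
    nlinarith
  have key : ∀ᵐ ω ∂P, X N ω ≠ ∞ → D ω ≠ ∞ → V ω ≠ ∞ →
      normCt xNorm t₀ (residualSeq ψ ψ₀ C₀ ν γ c z (N + 1) ω) ≤ ofReal (3 * C *
        pathBound c N ν γ (X N ω).toReal (D ω).toReal (V ω).toReal) := by
    have aQ : ∀ᵐ ω ∂P, ∀ i, i ≤ N → Q i ω ≠ ∞ := ae_all_iff.2 fun i => by
      by_cases hi : i ≤ N
      · filter_upwards [ae_ne_top_of_lpn hm0 (mQ i hi) ((lQ i hi).trans_lt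
          (ENNReal.mul_lt_top (ENNReal.natCast_lt_top _) ofReal_lt_top)).ne] with ω hω _ using hω
      · exact of_forall fun ω h => absurd h hi
    filter_upwards [aQ, ae_ne_top_of_lpn hmm0 mZs (lZs.trans_lt ofReal_lt_top).ne,
      ae_ne_top_of_lpn hmm0 mZd (lZd.trans_lt ofReal_lt_top).ne,
      ae_ne_top_of_lpn hmm0 mZa (lZa.trans_lt ofReal_lt_top).ne] with ω hQ h1 h2 h3 _ _ _
    obtain ⟨w1, w2, w3⟩ := hZ ω h1 h2 h3
    have hR : ∀ i < N, R i ω ≠ ∞ := fun i hi => ENNReal.rpow_ne_top_of_nonneg (by norm_num)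
      (ENNReal.add_ne_top.2 ⟨hQ i hi.le, ofReal_ne_top⟩)
    have hI := fun β => toReal_incSum c hc β hR
    have eI : ∀ β, ∑ i ∈ range N, √(c.lam (i + 1)) * c.ell (i + 1) ^ (-β)
        * √((Q i ω).toReal + c.r i) = (incSum c N β R ω).toReal := fun β => by
      rw [(hI β).2]
      exact sum_congr rfl fun i hi => by
        rw [sqrt_toReal_add (hQ i (mem_range.1 hi).le) (hc.r i).le]
    have e0 := eI 0
    simp only [neg_zero, Real.rpow_zero, mul_one] at e0
    have b := hC ν c hc N hN (1 + κ) t₀ (Zs ω).toReal (Zd ω).toReal (Za ω).toReal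
      (fun i => (Q i ω).toReal) (z ω) (hz ω) (fun _ => toReal_nonneg) (fun i hi s hs => ?_) w1 w2 w3
    · rw [e0, eI α] at b
      have eX : (X N ω).toReal = (Q N ω).toReal + c.r N := by
        rw [toReal_add (hQ N le_rfl) ofReal_ne_top, toReal_ofReal (hc.r N).le]
      have eV : (V ω).toReal = (incSum c N 0 R ω).toReal + (Zs ω).toReal + (Zd ω).toReal := by
        rw [toReal_add (ENNReal.add_ne_top.2 ⟨(hI 0).1, h1⟩) h2, toReal_add (hI 0).1 h1]
      have eD : (D ω).toReal = c.ell (N + 1) ^ α * (incSum c N α R ω).toReal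
          + c.ell (N + 1) ^ α * (Za ω).toReal + (Zd ω).toReal := by
        rw [toReal_add (ENNReal.mul_ne_top ofReal_ne_top (ENNReal.add_ne_top.2
          ⟨(hI α).1, h3⟩)) h2, toReal_mul, toReal_add (hI α).1 h3, toReal_ofReal hla,
          mul_add]
      rw [eX, eV, eD, mul_assoc]
      exact iSup₂_le fun s hs => (b s hs).xNorm_le
    · rw [ofReal_toReal (hQ i hi)]
      have hn : (n i : ℝ) = M * (N + 1 - i) := by simp [n, Nat.cast_sub (by omega : i ≤ N + 1)]
      exact le_iSup₂ (f := fun s (_ : s ∈ Icc (t₀ - n i) (t₀ - n i + n i + 1)) =>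
        xNorm (residualSeq ψ ψ₀ C₀ ν γ c z i ω s)) s ⟨by rw [hn]; exact hs.1, by linarith [hs.2]⟩
  refine (lpn_pathBound hm hc hN (by linarith) (mul_nonneg (sq_nonneg K) (hc.r N).le) (by positivity)
    (by positivity) (mX N le_rfl) ((((mI α).add mZa).const_mul _).add mZd) (((mI 0).add mZs).add mZd)
    lXN lD lV key).trans (ofReal_le_ofReal ?_)
  have hX0 : 0 ≤ K ^ 2 * c.r N := mul_nonneg (sq_nonneg K) (hc.r N).le
  refine (mul_le_mul_of_nonneg_left ((pathBound_scale hc hN γ ν hK1 hX0 (by positivity)).trans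
    (mul_le_mul_of_nonneg_left (pathBound_le_err hc hN hα0.le hCz hK1 ν γ) (sq_nonneg K)))
    (by linarith)).trans (le_of_eq (by ring))

end SQG

end

theorem proposition3p1
    (ψ : ℝ × ℝ → ℝ) (hψ : SQG.IsFreqCutoff ψ)
    (ψ₀ : ℝ → ℝ) (hψ₀ : SQG.IsOneSidedMollifier ψ₀)
    (C₀ α κ ε γ : ℝ) (hC₀ : 2 ≤ C₀) (hα₀ : 0 < α) (hα₁ : α < 1) (hκ : 1 / 2 < κ) (hε₀ : 0 < ε)
    (hε₁ : ε ≤ κ) (hγ : γ < 3 / 2) :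
    ∃ Cit : ℝ, 1 ≤ Cit ∧
      ∀ (Ω : Type*) [MeasurableSpace Ω] (P : MeasureTheory.Measure Ω)
        [MeasureTheory.IsProbabilityMeasure P] (m : ℝ), 1 ≤ m →
      ∀ z : Ω → SQG.Path, SQG.NoiseRegular P m α κ ε z →
      ∀ (ν : ℝ) (c : SQG.Controls), c.Positive →
      ∀ N : ℕ, c.Admissible N →
        (∀ n ≤ N, SQG.normLpCloc P m SQG.xNorm (SQG.residualSeq ψ ψ₀ C₀ ν γ c z n)
          ≤ ENNReal.ofReal (c.r n)) →
        SQG.normLpCloc P m SQG.xNorm (SQG.residualSeq ψ ψ₀ C₀ ν γ c z (N + 1))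
          ≤ ENNReal.ofReal (Cit *
            (SQG.errMiss c N + SQG.errCom c α κ (SQG.noiseConst P m α κ ε z) N
              + SQG.errTime c N + SQG.errDis c ν γ N + SQG.errTrans c N
              + SQG.errSto c (SQG.noiseConst P m α κ ε z) N)) := by
  obtain ⟨K, hK, hb⟩ := SQG.exists_residual_moment_bound hψ hψ₀ hC₀ hα₀ hα₁ hε₀ hε₁ γ
  refine ⟨K, hK, fun Ω _ P _ m hm z hz ν c hc N hN hq => ?_⟩
  obtain ⟨z', hz', hzm, hae⟩ := SQG.exists_regular_version hz
  have eR := fun n => SQG.normLpCloc_congr m SQG.xNorm (u := SQG.residualSeq ψ ψ₀ C₀ ν γ c z' n)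
    (v := SQG.residualSeq ψ ψ₀ C₀ ν γ c z n) (hae.mono fun ω hω => by simp only [SQG.residualSeq, hω])
  have e : ENNReal.ofReal (SQG.noiseConst P m α κ ε z)
      = SQG.normLpCloc P (2 * m) (SQG.holderNorm (1 + κ)) z
        + SQG.seminormLpCloc P (2 * m) (SQG.holderNorm (1 + ε)) α z :=
    ENNReal.ofReal_toReal (ENNReal.add_ne_top.2 ⟨hz.norm_lt_top.ne, hz.seminorm_lt_top.ne⟩)
  rw [← eR]
  refine hb Ω P m hm z' hz' hzm (SQG.noiseConst P m α κ ε z) ENNReal.toReal_nonneg ?_ ?_ ν c hc N hN fun n hn => (eR n).trans_le (hq n hn)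
  · rw [SQG.normLpCloc_congr _ _ hae, e]
    exact le_self_add
  · rw [SQG.seminormLpCloc_congr _ _ α hae, e]
    exact le_add_self
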